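/- **Setting.** Let $D=n+2\ge 3$, let $U\subseteq\mathbb R^{n}$ be a non-empty open coordinate domain of the horizon cross-section with coordinates $\sigma^M$, and consider the region $t\in\mathbb R$, $0\le\rho<\varepsilon$, $\sigma\in U$ with horizon $\rho=0$, surfaces $\Sigma_t=\{t=\mathrm{const}\}$ and $\partial\Sigma_t=\{t=\mathrm{const},\rho=0\}$. Fields are smooth up to $\rho=0$; for them $O(\rho^k)$ means $\rho^k$ times a function smooth up to $\rho=0$. For currents, $O(\rho^k)$ means a bound by $C\rho^k$ as $\rho\to0^+$, locally uniformly in $(t,\sigma)$. Let $\bar g$ be a metric (non-degenerate for $\rho>0$) with $$\bar g_{tt}=-\kappa^2\rho^2+O(\rho^4),\quad \bar g_{t\rho}=O(\rho^4),\quad \bar g_{tM}=f_M\rho^2+O(\rho^4),\quad \bar g_{\rho\rho}=1+O(\rho^2),\quad \bar g_{\rho M}=O(\rho^3),\quad \bar g_{MN}=q_{MN}+O(\rho^2),$$ where $\kappa>0$ is constant, $f_M,q_{MN}$ are smooth functions of $\sigma$ and $q$ is positive definite, and suppose that for $\rho>0$ it solves the Einstein equations $R_{\mu\nu}-\tfrac12(R-2\Lambda)\bar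 g_{\mu\nu}=0$. (This includes the case in which one coordinate $\psi$ is singled out, $q=\mathrm{diag}(f_{\psi\psi},\Omega_{AB})$, and $f_M,q_{MN}$ do not depend on $\psi$.) Let $D_M$ be the covariant derivative of $q$. Let $\mathcal A'$ be the set of vector fields $$\xi^t=F+tG+O(\rho^2),\qquad \xi^\rho=\rho(H+tJ)+O(\rho^2),\qquad \xi^M=K^M+O(\rho^2)$$ with arbitrary smooth functions $F,G,H,J,K^M$ of $\sigma$, and $\mathcal A\subseteq\mathcal A'$ the subset with $D_MK^M=0$. For perturbations $\delta_1g,\delta_2g$ of a metric $g$ let $\Theta^\mu(g,\delta g)=\frac{\sqrt{-g}}{16\pi G_N}(g^{\mu\alpha}\nabla^\beta\delta g_{\alpha\beta}-g^{\alpha\beta}\nabla^\mu\delta g_{\alpha\beta})$, let $\omega^\mu(g,\delta_1g,\delta_2g)=\delta_1\Theta^\mu(g,\delta_2g)-\delta_2\Theta^\mu(g,\delta_1g)$ be the pre-symplectic current, and let $$S^{\mu\nu}(g,\delta g,\pounds_\xi g)=\delta Q^{\mu\nu}[\xi]+2\xi^{[\mu}\Theta^{\nu]}(g,\delta g),\qquad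 Q^{\mu\nu}[\xi]=-\tfrac{\sqrt{-g}}{8\pi G_N}\nabla^{[\mu}\xi^{\nu]},$$ where $G_N>0$ is Newton's constant and brackets antisymmetrise with unit weight. For antisymmetric $B^{\mu\nu}$, $\int_{\partial\Sigma_t}(d^{D-2}x)_{\mu\nu}B^{\mu\nu}$ denotes $\lim_{\rho\to0^+}\int B^{t\rho}\,d^{n}\sigma$ at fixed $t$. **Theorem.** 1. $\mathcal A'$ and $\mathcal A$ are real Lie algebras: linear spaces closed under the commutator. 2. For all $\eta,\xi\in\mathcal A'$ all components of $\omega(\bar g,\pounds_\eta\bar g,\pounds_\xi\bar g)$ are $O(1)$, but there are $\eta,\xi\in\mathcal A'$ for which $\omega^\rho$ is not $O(\rho)$. 3. For all $\eta,\xi\in\mathcal A$: $\omega^t=O(1)$, $\omega^\rho=O(\rho)$, $\omega^M=O(1)$ for $\omega(\bar g,\pounds_\eta\bar g,\pounds_\xi\bar g)$. 4. The charges of $\mathcal A$ are integrable: for every metric $g=\phi^*\bar g$, $\phi$ a finite composition of time-one flow maps of elements of $\mathcal A$ (defined near the horizon, up to and including $\rho=0$, on a relatively open set $W$ of the region), one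 has $$\int_{\partial\Sigma_t}(d^{D-2}x)_{\mu\nu}\,\xi^{[\mu}\omega^{\nu]}(g,\pounds_\eta g,\pounds_\chi g)=0\qquad\text{for all }\xi,\eta,\chi\in\mathcal A\text{ and all }t,$$ the integral being taken over an arbitrary compact portion of $\partial\Sigma_t$ that lies in $W$. 5. If $\xi,\eta\in\mathcal A$ (with coefficients indexed $1$ and $2$) vanish for $\sigma$ outside a compact subset of $U$, then for every $t$ the bracket at the background $\{H[\xi],H[\eta]\}|_{\bar g}=\int_{\partial\Sigma_t}(d^{D-2}x)_{\mu\nu}S^{\mu\nu}(\bar g,\pounds_\eta\bar g,\pounds_\xi\bar g)$ exists and equals $$\frac1{8\pi G_N}\int_U\frac{\sqrt{\det q}}{\kappa}\Big[\tfrac12(G_1J_2-J_1G_2)+(\partial_Mf_N-\partial_Nf_M)K_1^MK_2^N\Big]d^{n}\sigma .$$ 6. The charges are non-trivial: there are such $\xi,\eta\in\mathcal A$ whose bracket at the background is non-zero (and the same for all $t$). -/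

import Mathlib

open Set Filter Topology MeasureTheory
open scoped ContDiff

noncomputable section

namespace KillingHorizon

/-! ### Tensor calculus in one coordinate system

`ι` is the finite set of coordinate labels, a point is `x : ι → ℝ`, tensor fields are given by their
components.  `s` is the coordinate domain; partial derivatives are taken within `s`, so that they are
the ordinary ones at interior points and one-sided ones at boundary points of `s`. -/

section Calculus

variable {ι : Type} [Fintype ι] [DecidableEq ι]

/-- The partial derivative `∂_μ f` at `x`. -/
def pd (s : Set (ι → ℝ)) (μ : ι) (f : (ι → ℝ) → ℝ) (x : ι → ℝ) : ℝ :=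
  fderivWithin ℝ f s x (Pi.single μ 1)

/-- The determinant of the component matrix `g_{μν}`. -/
def metricDet (g : ι → ι → (ι → ℝ) → ℝ) (x : ι → ℝ) : ℝ :=
  (Matrix.of fun μ ν => g μ ν x).det

/-- The inverse metric `g^{μν}`. -/
def inv (g : ι → ι → (ι → ℝ) → ℝ) (μ ν : ι) (x : ι → ℝ) : ℝ :=
  (Matrix.of fun α β => g α β x)⁻¹ μ ν

/-- The Christoffel symbol `Γ^l_{μν}`. -/
def christoffel (s : Set (ι → ℝ)) (g : ι → ι → (ι → ℝ) → ℝ) (l μ ν : ι) (x : ι → ℝ) : ℝ :=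
  (1 / 2) * ∑ τ, inv g l τ x * (pd s μ (g τ ν) x + pd s ν (g τ μ) x - pd s τ (g μ ν) x)

/-- The Ricci tensor
`R_{μν} = ∂_α Γ^α_{μν} - ∂_ν Γ^α_{μα} + Γ^α_{αβ} Γ^β_{μν} - Γ^α_{νβ} Γ^β_{μα}`. -/
def ricci (s : Set (ι → ℝ)) (g : ι → ι → (ι → ℝ) → ℝ) (μ ν : ι) (x : ι → ℝ) : ℝ :=
  (∑ α, (pd s α (christoffel s g α μ ν) x - pd s ν (christoffel s g α μ α) x)) +
    ∑ α, ∑ β, (christoffel s g α α β x * christoffel s g β μ ν x -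
      christoffel s g α ν β x * christoffel s g β μ α x)

/-- The Ricci scalar. -/
def scalarCurv (s : Set (ι → ℝ)) (g : ι → ι → (ι → ℝ) → ℝ) (x : ι → ℝ) : ℝ :=
  ∑ μ, ∑ ν, inv g μ ν x * ricci s g μ ν x

/-- `G_{μν} = R_{μν} - (R - 2Λ) g_{μν} / 2`, the Einstein tensor including the cosmological
constant. -/
def einstein (s : Set (ι → ℝ)) (cosm : ℝ) (g : ι → ι → (ι → ℝ) → ℝ) (μ ν : ι) (x : ι → ℝ) : ℝ :=
  ricci s g μ ν x - (1 / 2) * (scalarCurv s g x - 2 * cosm) * g μ ν x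

/-- The Lie derivative `(£_ξ g)_{μν}`. -/
def lieDeriv (s : Set (ι → ℝ)) (ξ : (ι → ℝ) → (ι → ℝ)) (g : ι → ι → (ι → ℝ) → ℝ)
    (μ ν : ι) (x : ι → ℝ) : ℝ :=
  ∑ α, (ξ x α * pd s α (g μ ν) x + g α ν x * pd s μ (fun y => ξ y α) x +
    g μ α x * pd s ν (fun y => ξ y α) x)

/-- The covariant derivative `∇_γ h_{αβ}` of a covariant 2-tensor `h`. -/
def covT (s : Set (ι → ℝ)) (g h : ι → ι → (ι → ℝ) → ℝ) (γ α β : ι) (x : ι → ℝ) : ℝ :=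
  pd s γ (h α β) x -
    ∑ l, (christoffel s g l γ α x * h l β x + christoffel s g l γ β x * h α l x)

/-- The covariant derivative `∇_α ξ^ν` of a vector field `ξ`. -/
def covV (s : Set (ι → ℝ)) (g : ι → ι → (ι → ℝ) → ℝ) (ξ : (ι → ℝ) → (ι → ℝ))
    (α ν : ι) (x : ι → ℝ) : ℝ :=
  pd s α (fun y => ξ y ν) x + ∑ β, christoffel s g ν α β x * ξ x β

/-- The covariant divergence `D_M K^M` of a vector field `K` for the metric `q`. -/
def divergence (s : Set (ι → ℝ)) (q : ι → ι → (ι → ℝ) → ℝ) (K : (ι → ℝ) → (ι → ℝ))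
    (x : ι → ℝ) : ℝ :=
  ∑ M, covV s q K M M x

/-- The pre-symplectic current `ω^ν(g, δ₁g, δ₂g)` of general relativity with Newton constant `GN`
(a vector density),
`√(-g)/(16πG) (g^{να}(g^{ρσ} g^{βγ} - 2 g^{ρβ} g^{σγ}) + 2 g^{νγ} g^{ρ[α} g^{σ]β}
  + g^{νρ} g^{αβ} g^{σγ}) δ_{[1}g_{ρσ} ∇_γ δ_{2]}g_{αβ}`,
with unit-weight antisymmetrisation. It is `δ₁Θ^ν(g, δ₂g) - δ₂Θ^ν(g, δ₁g)` written out for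
`Θ^ν(g, δg) = √(-g)/(16πG) (g^{να} ∇^β δg_{αβ} - g^{αβ} ∇^ν δg_{αβ})`. -/
def omega (GN : ℝ) (s : Set (ι → ℝ)) (g h₁ h₂ : ι → ι → (ι → ℝ) → ℝ) (ν : ι) (x : ι → ℝ) : ℝ :=
  Real.sqrt (-metricDet g x) / (16 * Real.pi * GN) *
    ∑ ρ, ∑ σ, ∑ α, ∑ β, ∑ γ,
      (inv g ν α x * (inv g ρ σ x * inv g β γ x - 2 * (inv g ρ β x * inv g σ γ x)) +
        2 * inv g ν γ x *
          ((1 / 2) * (inv g ρ α x * inv g σ β x - inv g ρ σ x * inv g α β x)) +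
        inv g ν ρ x * inv g α β x * inv g σ γ x) *
      ((1 / 2) * (h₁ ρ σ x * covT s g h₂ γ α β x - h₂ ρ σ x * covT s g h₁ γ α β x))

/-- The expression
`- δg/2 ∇^μ ξ^ν + δg^{αμ} ∇_α ξ^ν - (∇^μ δg^{να}) ξ_α + ξ^μ ∇_α δg^{να} - ξ^μ ∇^ν δg`
(`δg` without indices is the trace), before antisymmetrisation in `μ, ν`. -/
def preS (s : Set (ι → ℝ)) (g h : ι → ι → (ι → ℝ) → ℝ) (ξ : (ι → ℝ) → (ι → ℝ))
    (μ ν : ι) (x : ι → ℝ) : ℝ :=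
  -(1 / 2) * (∑ α, ∑ β, inv g α β x * h α β x) * (∑ l, inv g μ l x * covV s g ξ l ν x) +
    (∑ α, ∑ β, ∑ γ, inv g α β x * inv g μ γ x * h β γ x * covV s g ξ α ν x) -
    (∑ l, ∑ β, ∑ α, inv g μ l x * inv g ν β x * covT s g h l β α x * ξ x α) +
    ξ x μ * (∑ α, ∑ β, ∑ γ, inv g ν β x * inv g α γ x * covT s g h α β γ x) -
    ξ x μ * (∑ l, ∑ α, ∑ β, inv g ν l x * inv g α β x * covT s g h l α β x)

/-- The antisymmetric tensor density `S^{μν}(g, δg, £_ξ g) = δQ^{μν}[ξ] + 2 ξ^{[μ} Θ^{ν]}(g, δg)`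
whose boundary integral is the variation of the charge of `ξ`;
`Q^{μν}[ξ] = - √(-g)/(8πG) ∇^{[μ} ξ^{ν]}`. -/
def chargeS (GN : ℝ) (s : Set (ι → ℝ)) (g h : ι → ι → (ι → ℝ) → ℝ) (ξ : (ι → ℝ) → (ι → ℝ))
    (μ ν : ι) (x : ι → ℝ) : ℝ :=
  Real.sqrt (-metricDet g x) / (8 * Real.pi * GN) *
    ((1 / 2) * (preS s g h ξ μ ν x - preS s g h ξ ν μ x))

/-- The pulled-back metric `(φ^* g)_{μν}`. -/
def pullback (s : Set (ι → ℝ)) (φ : (ι → ℝ) → (ι → ℝ)) (g : ι → ι → (ι → ℝ) → ℝ)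
    (μ ν : ι) (x : ι → ℝ) : ℝ :=
  ∑ α, ∑ β, g α β (φ x) * pd s μ (fun y => φ y α) x * pd s ν (fun y => φ y β) x

/-- A set `A` of vector fields on `s` is a real Lie algebra: a linear subspace closed under the
commutator `[ξ, η]^μ = ξ^ν ∂_ν η^μ - η^ν ∂_ν ξ^μ`. -/
structure IsLieClosed (s : Set (ι → ℝ)) (A : Set ((ι → ℝ) → (ι → ℝ))) : Prop where
  zero_mem : (0 : (ι → ℝ) → (ι → ℝ)) ∈ A
  add_mem : ∀ ξ ∈ A, ∀ η ∈ A, ξ + η ∈ A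
  smul_mem : ∀ c : ℝ, ∀ ξ ∈ A, c • ξ ∈ A
  bracket_mem : ∀ ξ ∈ A, ∀ η ∈ A, VectorField.lieBracketWithin ℝ ξ η s ∈ A

/-- `W` is relatively open in `s`. -/
def RelOpen (s W : Set (ι → ℝ)) : Prop := ∃ O : Set (ι → ℝ), IsOpen O ∧ W = O ∩ s

/-- `Φ` is the flow of the vector field `ξ` up to time `1`, for initial points in `W ⊆ s`. -/
structure IsFlow (s W : Set (ι → ℝ)) (ξ : (ι → ℝ) → (ι → ℝ)) (Φ : ℝ → (ι → ℝ) → (ι → ℝ)) :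
    Prop where
  smooth : ContDiffOn ℝ ∞ (fun p : ℝ × (ι → ℝ) => Φ p.1 p.2) (Icc 0 1 ×ˢ W)
  init : ∀ x ∈ W, Φ 0 x = x
  maps : ∀ r ∈ Icc (0 : ℝ) 1, ∀ x ∈ W, Φ r x ∈ s
  ode : ∀ r ∈ Icc (0 : ℝ) 1, ∀ x ∈ W,
    HasDerivWithinAt (fun r' => Φ r' x) (ξ (Φ r x)) (Icc 0 1) r

/-- `φ : W → s` is a diffeomorphism (onto its image) generated by `A`: a finite composition of
time-one flow maps of elements of `A`. The case `W = s` is that of globally defined maps. -/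
inductive Generated (s : Set (ι → ℝ)) (A : Set ((ι → ℝ) → (ι → ℝ))) :
    Set (ι → ℝ) → ((ι → ℝ) → (ι → ℝ)) → Prop
  | id (W : Set (ι → ℝ)) (hW : RelOpen s W) : Generated s A W (fun x => x)
  | comp (W W' : Set (ι → ℝ)) (φ : (ι → ℝ) → (ι → ℝ)) (ξ : (ι → ℝ) → (ι → ℝ))
      (Φ : ℝ → (ι → ℝ) → (ι → ℝ)) (hφ : Generated s A W φ) (hW' : RelOpen s W')
      (hmaps : MapsTo φ W W') (hξ : ξ ∈ A) (hΦ : IsFlow s W' ξ Φ) :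
      Generated s A W (fun x => Φ 1 (φ x))

end Calculus

/-! ### The neighbourhood of the horizon

Spacetime has dimension `D = n + 2`. A point is `x : Fin (n + 2) → ℝ` with `t = x 0`, `ρ = x 1` and
the remaining `n` coordinates `σ^M = x M.succ.succ` on the horizon cross-section. -/

/-- The cross-section coordinates `σ` of a point. -/
def ang {n : ℕ} (x : Fin (n + 2) → ℝ) : Fin n → ℝ := fun M => x M.succ.succ

/-- The point with coordinates `(t, ρ, σ)`. -/
def pt {n : ℕ} (t ρ : ℝ) (σ : Fin n → ℝ) : Fin (n + 2) → ℝ := Fin.cons t (Fin.cons ρ σ)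

/-- The coordinate region `t ∈ ℝ`, `0 ≤ ρ < ε`, `σ ∈ U`. The horizon is `ρ = 0`, and the Cauchy
surface `Σ_t` is `t = const` with boundary `∂Σ_t` at `ρ = 0`. -/
def region {n : ℕ} (ε : ℝ) (U : Set (Fin n → ℝ)) : Set (Fin (n + 2) → ℝ) :=
  {x | 0 ≤ x 1 ∧ x 1 < ε ∧ ang x ∈ U}

/-- `f = O(ρ^k)` for a function that is smooth up to the horizon: `f` is `ρ^k` times a function that
is smooth up to and including `ρ = 0`. -/
def SmoothO {n : ℕ} (s : Set (Fin (n + 2) → ℝ)) (k : ℕ) (f : (Fin (n + 2) → ℝ) → ℝ) : Prop :=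
  ∃ h : (Fin (n + 2) → ℝ) → ℝ, ContDiffOn ℝ ∞ h s ∧ ∀ x ∈ s, f x = x 1 ^ k * h x

/-- `f = O(ρ^k)` as `ρ → 0+`, locally uniformly in `t` and `σ ∈ U`. -/
def BigO {n : ℕ} (U : Set (Fin n → ℝ)) (k : ℕ) (f : (Fin (n + 2) → ℝ) → ℝ) : Prop :=
  ∀ (T : Set ℝ) (C : Set (Fin n → ℝ)), IsCompact T → IsCompact C → C ⊆ U →
    ∃ c δ : ℝ, 0 < δ ∧ ∀ t ∈ T, ∀ σ ∈ C, ∀ ρ : ℝ, 0 < ρ → ρ < δ → |f (pt t ρ σ)| ≤ c * ρ ^ k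

/-- A background metric of Killing-horizon form. The coordinates are `(t, ρ, σ^M)`; `f_M` and
`q_{MN}` are functions of `σ` only and `κ` is a constant. If one coordinate `ψ` among the `σ^M` is
singled out, `q_{ψA} = 0`, and `f_M`, `q_{MN}` are moreover independent of `ψ`, this is the form with
`q = diag(f_{ψψ}, Ω_{AB})`; neither that extra structure nor a better fall-off than `O(ρ³)` of
`g_{ρψ}` is required here. -/
structure IsHorizonBackground {n : ℕ} (ε : ℝ) (U : Set (Fin n → ℝ)) (κ : ℝ)
    (f : Fin n → (Fin n → ℝ) → ℝ) (q : Fin n → Fin n → (Fin n → ℝ) → ℝ)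
    (g : Fin (n + 2) → Fin (n + 2) → (Fin (n + 2) → ℝ) → ℝ) : Prop where
  smooth_f : ∀ M, ContDiffOn ℝ ∞ (f M) U
  smooth_q : ∀ M N, ContDiffOn ℝ ∞ (q M N) U
  posDef_q : ∀ σ ∈ U, (Matrix.of fun M N => q M N σ).PosDef
  symm : ∀ μ ν, ∀ x ∈ region ε U, g μ ν x = g ν μ x
  nondegenerate : ∀ x ∈ region ε U, 0 < x 1 → metricDet g x ≠ 0
  tt : SmoothO (region ε U) 4 (fun x => g 0 0 x + κ ^ 2 * x 1 ^ 2)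
  tρ : SmoothO (region ε U) 4 (g 0 1)
  tM : ∀ M : Fin n, SmoothO (region ε U) 4 (fun x => g 0 M.succ.succ x - f M (ang x) * x 1 ^ 2)
  ρρ : SmoothO (region ε U) 2 (fun x => g 1 1 x - 1)
  ρM : ∀ M : Fin n, SmoothO (region ε U) 3 (g 1 M.succ.succ)
  MN : ∀ M N : Fin n,
    SmoothO (region ε U) 2 (fun x => g M.succ.succ N.succ.succ x - q M N (ang x))

/-- The vector field `ξ` has the form `ξ^t = F + tG + O(ρ²)`, `ξ^ρ = ρ(H + tJ) + O(ρ²)`,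
`ξ^M = K^M + O(ρ²)` with smooth functions `F, G, H, J, K^M` of `σ`. -/
structure HasForm {n : ℕ} (ε : ℝ) (U : Set (Fin n → ℝ)) (F G H J : (Fin n → ℝ) → ℝ)
    (K : (Fin n → ℝ) → (Fin n → ℝ)) (ξ : (Fin (n + 2) → ℝ) → (Fin (n + 2) → ℝ)) : Prop where
  smooth_F : ContDiffOn ℝ ∞ F U
  smooth_G : ContDiffOn ℝ ∞ G U
  smooth_H : ContDiffOn ℝ ∞ H U
  smooth_J : ContDiffOn ℝ ∞ J U
  smooth_K : ContDiffOn ℝ ∞ K U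
  t : SmoothO (region ε U) 2 (fun x => ξ x 0 - (F (ang x) + x 0 * G (ang x)))
  ρ : SmoothO (region ε U) 2 (fun x => ξ x 1 - x 1 * (H (ang x) + x 0 * J (ang x)))
  M : ∀ M : Fin n, SmoothO (region ε U) 2 (fun x => ξ x M.succ.succ - K (ang x) M)

/-- The larger algebra `𝒜'`: no condition on `K`. -/
def algA' {n : ℕ} (ε : ℝ) (U : Set (Fin n → ℝ)) : Set ((Fin (n + 2) → ℝ) → (Fin (n + 2) → ℝ)) :=
  {ξ | ∃ F G H J K, HasForm ε U F G H J K ξ}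

/-- The algebra `𝒜`: the elements of `𝒜'` with `D_M K^M = 0`, where `D` is the covariant derivative
of the horizon metric `q`. -/
def algA {n : ℕ} (ε : ℝ) (U : Set (Fin n → ℝ)) (q : Fin n → Fin n → (Fin n → ℝ) → ℝ) :
    Set ((Fin (n + 2) → ℝ) → (Fin (n + 2) → ℝ)) :=
  {ξ | ∃ F G H J K, HasForm ε U F G H J K ξ ∧ ∀ σ ∈ U, divergence U q K σ = 0}

/-- The pre-symplectic current `ω^μ(ḡ, £_η ḡ, £_ξ ḡ)` at the background. -/
def bgCurrent {n : ℕ} (GN ε : ℝ) (U : Set (Fin n → ℝ))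
    (gbar : Fin (n + 2) → Fin (n + 2) → (Fin (n + 2) → ℝ) → ℝ)
    (η ξ : (Fin (n + 2) → ℝ) → (Fin (n + 2) → ℝ)) (μ : Fin (n + 2)) (x : Fin (n + 2) → ℝ) : ℝ :=
  omega GN (region ε U) gbar (lieDeriv (region ε U) η gbar) (lieDeriv (region ε U) ξ gbar) μ x

/-- The integral of the antisymmetric tensor density `B^{μν}` over the portion `C` of the horizon
cross-section `∂Σ_t` exists and equals `L`: on the surface with constant `t` and `ρ` one has
`(d^{D-2}x)_{μν} B^{μν} = B^{tρ} d^n σ`, and `∂Σ_t` is the limit `ρ → 0+`. The argument `b` is the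
component `B^{tρ}`. -/
def HasBoundaryIntegral {n : ℕ} (C : Set (Fin n → ℝ)) (t : ℝ) (b : (Fin (n + 2) → ℝ) → ℝ)
    (L : ℝ) : Prop :=
  (∀ᶠ ρ in 𝓝[>] (0 : ℝ), IntegrableOn (fun σ => b (pt t ρ σ)) C) ∧
    Tendsto (fun ρ => ∫ σ in C, b (pt t ρ σ)) (𝓝[>] (0 : ℝ)) (𝓝 L)

/-- The integrability condition for the charges of `A` on the set of all metrics `g = φ^* ḡ`, `φ`
a diffeomorphism generated by `A`:
`∫_{∂Σ} (d^{D-2}x)_{μν} ξ^{[μ} ω^{ν]}(g, £_η g, £_χ g) = 0` for all `ξ, η, χ ∈ A`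
and every such `g`, on every cross-section `∂Σ_t` and in fact on each compact portion `C` of it near
which `g` is defined. -/
def IntegrableCharges {n : ℕ} (GN ε : ℝ) (U : Set (Fin n → ℝ))
    (gbar : Fin (n + 2) → Fin (n + 2) → (Fin (n + 2) → ℝ) → ℝ)
    (A : Set ((Fin (n + 2) → ℝ) → (Fin (n + 2) → ℝ))) : Prop :=
  ∀ (W : Set (Fin (n + 2) → ℝ)) (φ : (Fin (n + 2) → ℝ) → (Fin (n + 2) → ℝ)),
    Generated (region ε U) A W φ →
    ∀ g : Fin (n + 2) → Fin (n + 2) → (Fin (n + 2) → ℝ) → ℝ, g = pullback (region ε U) φ gbar →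
    ∀ ξ ∈ A, ∀ η ∈ A, ∀ χ ∈ A, ∀ (t : ℝ) (C : Set (Fin n → ℝ)),
      IsCompact C → C ⊆ U → (∀ σ ∈ C, pt t 0 σ ∈ W) →
      HasBoundaryIntegral C t (fun x => (1 / 2) *
        (ξ x 0 * omega GN (region ε U) g (lieDeriv (region ε U) η g)
            (lieDeriv (region ε U) χ g) 1 x -
          ξ x 1 * omega GN (region ε U) g (lieDeriv (region ε U) η g)
            (lieDeriv (region ε U) χ g) 0 x)) 0

/-- `L` is the value at the background `ḡ` of the Poisson bracket
`{H[ξ], H[η]} = δ_η H[ξ] = ∫_{∂Σ_t} (d^{D-2}x)_{μν} S^{μν}(ḡ, £_η ḡ, £_ξ ḡ)`. -/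
def HasBracket {n : ℕ} (GN ε : ℝ) (U : Set (Fin n → ℝ))
    (gbar : Fin (n + 2) → Fin (n + 2) → (Fin (n + 2) → ℝ) → ℝ) (t : ℝ)
    (ξ η : (Fin (n + 2) → ℝ) → (Fin (n + 2) → ℝ)) (L : ℝ) : Prop :=
  HasBoundaryIntegral U t
    (chargeS GN (region ε U) gbar (lieDeriv (region ε U) η gbar) ξ 0 1) L

/-- `ξ` vanishes outside a compact part of the cross-section. -/
def CompactlySupported {n : ℕ} (ε : ℝ) (U : Set (Fin n → ℝ))
    (ξ : (Fin (n + 2) → ℝ) → (Fin (n + 2) → ℝ)) : Prop :=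
  ∃ C : Set (Fin n → ℝ), IsCompact C ∧ C ⊆ U ∧ ∀ x ∈ region ε U, ang x ∉ C → ξ x = 0

end KillingHorizon

end

open KillingHorizon

/-! The background is a Rindler wedge over the cross-section, and every singularity at ρ = 0 comes
from the degenerate t-direction. Put λ_t = ρ and λ_ρ = λ_M = 1, and strip one factor λ from each
covariant index. The rescaled metric (`Hat`, `BgHat`) is smooth and non-degenerate up to the
horizon, where it equals diag(-κ², 1, q), and Lie derivatives along 𝒜' are smooth after the same
rescaling (`Hat.lieDeriv`). The current is a contraction with one derivative, so the factors cancel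
index by index and ω^ν = λ_ν⁻¹ ω̂^ν with ω̂ smooth (`Hat.omega_eq`). Only ω^t can be singular, at
worst like 1/ρ, and the rest is an evaluation of ω̂ on the horizon.

There a rescaled derivative in a direction other than t carries a factor ρ, apart from the weight
produced by ∂_ρ λ_t = 1. Hence the Christoffel symbols and the covariant derivatives of the
perturbations have only t, ρ components, and the contraction is a two-dimensional one plus terms
with the trace of a perturbation over the cross-section (`omA_plane`). The two-dimensional part
vanishes. So ω̂^t = 0, and ω̂^ρ is proportional to γ₁ tr h₂ - γ₂ tr h₁, where at the background γ =
G and the trace of £_ξ ḡ is 2 D_M K^M. This bounds the current for 𝒜', shows how ω^ρ can survive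
there, and shows that D_M K^M = 0 kills it. Hadamard's lemma (`Nested.exists_div`) turns vanishing
on the horizon into a factor ρ.

For integrability the same evaluation is made for every metric in the orbit. On the horizon such a
metric has plane part E((dρ + Bρ dt)² - Mρ² dt²) with ∂_t E = 2BE and ∂_t B = ∂_t M = 0, and a
t-independent cross-section block whose determinant is det q (`OrbitMetric`). These facts are
statements about the jets at ρ = 0 of the diffeomorphism (`OrbitMap`). Along a flow they follow from
linear differential equations (`FlowData.orbitMap`), and they survive composition; the determinant
is preserved because D_M K^M = 0. Hence ω̂^t and ω̂^ρ vanish on the horizon for the whole orbit, and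
since ξ^ρ = O(ρ) balances the 1/ρ in ω^t, the integrand of the condition tends to zero
(`integrableCharges`).

For the bracket, ξ is split into its t, ρ part, which after rescaling carries an extra factor ρ, and
its cross-section part (`Hat.chargeS_eq`). The former contributes its horizon value (G₁J₂ -
J₁G₂)/κ². The latter vanishes on the horizon and contributes its ρ-derivative, in which the
undetermined O(ρ²) parts of the fields cancel and K₁ · (dJ₂ + 2κ² d(F₂ + tG₂) - 2 £_{K₂} f)/κ²
remains. Cartan's formula splits £_{K₂} f into the curl of f and an exact form. All exact terms are
derivatives along the divergence-free, compactly supported K₁ and integrate to zero, which also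
removes t. With G₁ = J₂ a bump function, and all other coefficients zero, the bracket is positive.
-/

noncomputable section

namespace KillingHorizon

/-! ### Relatively open subsets of a half space -/

/-- `V` is a relatively open subset of the half space `0 ≤ ρ`. -/
def HalfOpen {n : ℕ} (V : Set (Fin (n + 2) → ℝ)) : Prop :=
  ∃ O : Set (Fin (n + 2) → ℝ), IsOpen O ∧ V = O ∩ {x | 0 ≤ x 1}

/-- `V ⊆ s` are relatively open subsets of the half space. -/
structure Nested {n : ℕ} (s V : Set (Fin (n + 2) → ℝ)) : Prop where
  big : HalfOpen s
  small : HalfOpen V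
  sub : V ⊆ s

variable {n : ℕ} {s V : Set (Fin (n + 2) → ℝ)}

theorem continuous_ang : Continuous (ang : (Fin (n + 2) → ℝ) → Fin n → ℝ) := by
  unfold ang; fun_prop

theorem halfOpen_region {ε : ℝ} {U : Set (Fin n → ℝ)} (hU : IsOpen U) :
    HalfOpen (region ε U) := by
  refine ⟨{x | x 1 < ε} ∩ ang ⁻¹' U, ?_, ?_⟩
  · exact (isOpen_lt (continuous_apply 1) continuous_const).inter (hU.preimage continuous_ang)
  · ext x; simp only [region, mem_ofPred_eq, mem_inter_iff, mem_preimage]; tauto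

theorem HalfOpen.inter_open (hV : HalfOpen V) {O : Set (Fin (n + 2) → ℝ)} (hO : IsOpen O) :
    HalfOpen (V ∩ O) := by
  obtain ⟨P, hP, rfl⟩ := hV
  exact ⟨P ∩ O, hP.inter hO, by ext; simp; tauto⟩

theorem HalfOpen.of_relOpen (hs : HalfOpen s) (h : RelOpen s V) : HalfOpen V := by
  obtain ⟨O, hO, rfl⟩ := h
  rw [inter_comm]
  exact hs.inter_open hO

theorem HalfOpen.ne_zero (hV : HalfOpen V) {f : (Fin (n + 2) → ℝ) → ℝ} (hf : ContinuousOn f V) :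
    HalfOpen {x | x ∈ V ∧ f x ≠ 0} := by
  obtain ⟨O, hO, h⟩ := (continuousOn_iff'.1 hf) _ (isOpen_compl_singleton (x := (0 : ℝ)))
  have : {x | x ∈ V ∧ f x ≠ 0} = V ∩ O := by
    rw [inter_comm, ← h]; ext x; simp; tauto
  rw [this]
  exact hV.inter_open hO

/-- A convex set with non-empty interior has unique derivatives, and intersecting with an open set
preserves this. It makes the one-sided partial derivatives at ρ = 0 meaningful. -/
theorem HalfOpen.uniqueDiffOn (hV : HalfOpen V) : UniqueDiffOn ℝ V := by
  obtain ⟨O, hO, rfl⟩ := hV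
  rw [inter_comm]
  refine UniqueDiffOn.inter (uniqueDiffOn_convex ?_ ?_) hO
  · exact convex_halfSpace_ge (f := fun x : Fin (n + 2) → ℝ => x 1)
      (IsLinearMap.mk (fun _ _ => rfl) fun _ _ => rfl) 0
  · refine ⟨fun _ => 1, mem_interior.2 ⟨{x | 0 < x 1}, fun x (hx : 0 < x 1) => hx.le, ?_, ?_⟩⟩
    · exact isOpen_lt continuous_const (continuous_apply 1)
    · simp

/-- Pushing the point inwards along ρ reaches the interior. The symmetry of second derivatives at
boundary points rests on this. -/
theorem HalfOpen.closure_interior (hV : HalfOpen V) {x : Fin (n + 2) → ℝ} (hx : x ∈ V) :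
    x ∈ closure (interior V) := by
  obtain ⟨O, hO, rfl⟩ := hV
  have hsub : O ∩ {x | 0 < x 1} ⊆ interior (O ∩ {x : Fin (n + 2) → ℝ | 0 ≤ x 1}) := by
    refine interior_maximal (fun y hy => ⟨hy.1, (show (0 : ℝ) < y 1 from hy.2).le⟩) ?_
    exact hO.inter (isOpen_lt continuous_const (continuous_apply 1))
  refine closure_mono hsub ?_
  have hc : Tendsto (fun r : ℝ => x + r • (Pi.single 1 1 : Fin (n + 2) → ℝ)) (𝓝[>] 0) (𝓝 x) := by
    have : ContinuousAt (fun r : ℝ => x + r • (Pi.single 1 1 : Fin (n + 2) → ℝ)) 0 := by fun_prop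
    simpa using this.tendsto.mono_left nhdsWithin_le_nhds
  refine mem_closure_of_tendsto hc ?_
  filter_upwards [hc.eventually (hO.mem_nhds hx.1), self_mem_nhdsWithin] with r hr hr0
  refine ⟨hr, ?_⟩
  have := hx.2
  simp only [mem_ofPred_eq, Pi.add_apply, Pi.smul_apply, Pi.single_eq_same, smul_eq_mul, mul_one,
    mem_Ioi] at this hr0 ⊢
  linarith

theorem HalfOpen.mem_nhdsWithin (hV : HalfOpen V) {x : Fin (n + 2) → ℝ} (hx : x ∈ V) :
    V ∈ 𝓝[{x | 0 ≤ x 1}] x := by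
  obtain ⟨O, hO, rfl⟩ := hV
  exact inter_mem (mem_nhdsWithin_of_mem_nhds (hO.mem_nhds hx.1)) self_mem_nhdsWithin

theorem HalfOpen.subset (hV : HalfOpen V) : V ⊆ {x | 0 ≤ x 1} := by
  obtain ⟨O, hO, rfl⟩ := hV
  exact inter_subset_right

theorem HalfOpen.nested_self (hV : HalfOpen V) : Nested V V := ⟨hV, hV, subset_rfl⟩

namespace Nested

/-- Near a point of `V` both sets coincide with the half space. Hence derivatives within the full
region `s`, in which all the tensors are defined, may be computed within the smaller `V`, where
smoothness is known. -/
theorem mem_nhdsWithin (N : Nested s V) {x : Fin (n + 2) → ℝ} (hx : x ∈ V) : V ∈ 𝓝[s] x :=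
  nhdsWithin_mono _ N.big.subset (N.small.mem_nhdsWithin hx)

theorem uniq (N : Nested s V) {x : Fin (n + 2) → ℝ} (hx : x ∈ V) : UniqueDiffWithinAt ℝ s x :=
  N.big.uniqueDiffOn x (N.sub hx)

theorem diffAt (N : Nested s V) {F : Type*} [NormedAddCommGroup F] [NormedSpace ℝ F]
    {f : (Fin (n + 2) → ℝ) → F} (hf : ContDiffOn ℝ ∞ f V)
    {x : Fin (n + 2) → ℝ} (hx : x ∈ V) : DifferentiableWithinAt ℝ f s x :=
  ((hf.differentiableOn (by simp)) x hx).mono_of_mem_nhdsWithin (N.mem_nhdsWithin hx)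

theorem fderivWithin_eq (N : Nested s V) {F : Type*} [NormedAddCommGroup F] [NormedSpace ℝ F]
    {f : (Fin (n + 2) → ℝ) → F} (hf : ContDiffOn ℝ ∞ f V)
    {x : Fin (n + 2) → ℝ} (hx : x ∈ V) : fderivWithin ℝ f s x = fderivWithin ℝ f V x :=
  fderivWithin_of_mem_nhdsWithin (N.mem_nhdsWithin hx) (N.uniq hx)
    ((hf.differentiableOn (by simp)) x hx)

theorem contDiffOn_fderivWithin (N : Nested s V) {F : Type*} [NormedAddCommGroup F]
    [NormedSpace ℝ F] {f : (Fin (n + 2) → ℝ) → F} (hf : ContDiffOn ℝ ∞ f V) :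
    ContDiffOn ℝ ∞ (fderivWithin ℝ f s) V :=
  (hf.fderivWithin N.small.uniqueDiffOn (m := ∞) (by simp)).congr
    fun _ hx => N.fderivWithin_eq hf hx

theorem contDiffOn_pd (N : Nested s V) {f : (Fin (n + 2) → ℝ) → ℝ} (hf : ContDiffOn ℝ ∞ f V)
    (μ : Fin (n + 2)) : ContDiffOn ℝ ∞ (pd s μ f) V :=
  (N.contDiffOn_fderivWithin hf).clm_apply contDiffOn_const

theorem pd_eq (N : Nested s V) {f : (Fin (n + 2) → ℝ) → ℝ} (hf : ContDiffOn ℝ ∞ f V)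
    (μ : Fin (n + 2)) {x : Fin (n + 2) → ℝ} (hx : x ∈ V) : pd s μ f x = pd V μ f x := by
  rw [pd, pd, N.fderivWithin_eq hf hx]

theorem pd_congr (N : Nested s V) {f g : (Fin (n + 2) → ℝ) → ℝ} (h : ∀ x ∈ V, f x = g x)
    (μ : Fin (n + 2)) {x : Fin (n + 2) → ℝ} (hx : x ∈ V) : pd s μ f x = pd s μ g x := by
  have : f =ᶠ[𝓝[s] x] g := by filter_upwards [N.mem_nhdsWithin hx] using h
  rw [pd, pd, this.fderivWithin_eq (h x hx)]

theorem pd_mul (N : Nested s V) {f g : (Fin (n + 2) → ℝ) → ℝ} (hf : ContDiffOn ℝ ∞ f V)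
    (hg : ContDiffOn ℝ ∞ g V) (μ : Fin (n + 2)) {x : Fin (n + 2) → ℝ} (hx : x ∈ V) :
    pd s μ (fun y => f y * g y) x = pd s μ f x * g x + f x * pd s μ g x := by
  rw [pd, fderivWithin_fun_mul (N.uniq hx) (N.diffAt hf hx) (N.diffAt hg hx)]
  simp [pd]; ring

theorem pd_add (N : Nested s V) {f g : (Fin (n + 2) → ℝ) → ℝ} (hf : ContDiffOn ℝ ∞ f V)
    (hg : ContDiffOn ℝ ∞ g V) (μ : Fin (n + 2)) {x : Fin (n + 2) → ℝ} (hx : x ∈ V) :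
    pd s μ (fun y => f y + g y) x = pd s μ f x + pd s μ g x := by
  rw [pd, fderivWithin_fun_add (N.uniq hx) (N.diffAt hf hx) (N.diffAt hg hx)]
  simp [pd]

theorem pd_sub (N : Nested s V) {f g : (Fin (n + 2) → ℝ) → ℝ} (hf : ContDiffOn ℝ ∞ f V)
    (hg : ContDiffOn ℝ ∞ g V) (μ : Fin (n + 2)) {x : Fin (n + 2) → ℝ} (hx : x ∈ V) :
    pd s μ (fun y => f y - g y) x = pd s μ f x - pd s μ g x := by
  rw [pd, fderivWithin_fun_sub (N.uniq hx) (N.diffAt hf hx) (N.diffAt hg hx)]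
  simp [pd]

theorem pd_sum (N : Nested s V) {ι : Type*} (u : Finset ι) {f : ι → (Fin (n + 2) → ℝ) → ℝ}
    (hf : ∀ i ∈ u, ContDiffOn ℝ ∞ (f i) V) (μ : Fin (n + 2)) {x : Fin (n + 2) → ℝ} (hx : x ∈ V) :
    pd s μ (fun y => ∑ i ∈ u, f i y) x = ∑ i ∈ u, pd s μ (f i) x := by
  rw [pd, fderivWithin_fun_sum (N.uniq hx) fun i hi => N.diffAt (hf i hi) hx]
  simp [pd]

theorem pd_const_mul (N : Nested s V) {g : (Fin (n + 2) → ℝ) → ℝ} (c : ℝ)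
    (hg : ContDiffOn ℝ ∞ g V) (μ : Fin (n + 2)) {x : Fin (n + 2) → ℝ} (hx : x ∈ V) :
    pd s μ (fun y => c * g y) x = c * pd s μ g x := by
  rw [N.pd_mul contDiffOn_const hg μ hx]
  simp [pd]

theorem pd_inv (N : Nested s V) {g : (Fin (n + 2) → ℝ) → ℝ}
    (hg : ContDiffOn ℝ ∞ g V) (μ : Fin (n + 2)) {x : Fin (n + 2) → ℝ} (hx : x ∈ V)
    (h0 : g x ≠ 0) :
    pd s μ (fun y => (g y)⁻¹) x = -(pd s μ g x) / g x ^ 2 := by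
  have h := (hasDerivAt_inv h0).comp_hasFDerivWithinAt x (N.diffAt hg hx).hasFDerivWithinAt
  rw [pd, show (fun y => (g y)⁻¹) = Inv.inv ∘ g from rfl, h.fderivWithin (N.uniq hx)]
  simp [pd]; ring

theorem pd_coord (N : Nested s V) (μ ν : Fin (n + 2)) {x : Fin (n + 2) → ℝ} (hx : x ∈ V) :
    pd s μ (fun y => y ν) x = if ν = μ then 1 else 0 := by
  rw [pd, (hasFDerivWithinAt_apply ν x s).fderivWithin (N.uniq hx)]
  simp [Pi.single_apply]

theorem fderivWithin_apply (x v : Fin (n + 2) → ℝ) (f : (Fin (n + 2) → ℝ) → ℝ) :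
    fderivWithin ℝ f s x v = ∑ μ, v μ * pd s μ f x := by
  conv_lhs => rw [pi_eq_sum_univ' v]
  rw [map_sum]
  refine Finset.sum_congr rfl fun μ _ => ?_
  rw [pd, ← smul_eq_mul, ← map_smul]

/-- Partial derivatives commute up to the boundary. -/
theorem pd_comm (N : Nested s V) {f : (Fin (n + 2) → ℝ) → ℝ} (hf : ContDiffOn ℝ ∞ f V)
    (μ ν : Fin (n + 2)) {x : Fin (n + 2) → ℝ} (hx : x ∈ V) :
    pd s μ (pd s ν f) x = pd s ν (pd s μ f) x := by
  have NV := N.small.nested_self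
  have key : ∀ μ ν, pd s μ (pd s ν f) x =
      fderivWithin ℝ (fderivWithin ℝ f V) V x (Pi.single μ 1) (Pi.single ν 1) := by
    intro μ ν
    rw [N.pd_congr (fun y hy => N.pd_eq hf ν hy) μ hx, N.pd_eq (NV.contDiffOn_pd hf ν) μ hx, pd]
    have h1 : DifferentiableWithinAt ℝ (fderivWithin ℝ f V) V x :=
      NV.diffAt (NV.contDiffOn_fderivWithin hf) hx
    have h2 := h1.hasFDerivWithinAt.clm_apply
      (hasFDerivWithinAt_const (Pi.single ν (1 : ℝ) : Fin (n + 2) → ℝ) x V)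
    have h3 := h2.fderivWithin (NV.uniq hx)
    rw [show pd V ν f = fun y => fderivWithin ℝ f V y (Pi.single ν 1) from rfl, h3]
    simp
  rw [key, key]
  exact (ContDiffWithinAt.isSymmSndFDerivWithinAt (hf x hx) (by
      simp only [minSmoothness_of_isRCLikeNormedField]; exact WithTop.coe_le_coe.2 le_top)
    N.small.uniqueDiffOn (N.small.closure_interior hx) hx).eq _ _

/-- Derivatives tangential to the horizon only depend on the values on the horizon. -/
theorem pd_tangential (N : Nested s V) {f g : (Fin (n + 2) → ℝ) → ℝ} (hf : ContDiffOn ℝ ∞ f V)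
    (hg : ContDiffOn ℝ ∞ g V) (h : ∀ x ∈ V, x 1 = 0 → f x = g x) {μ : Fin (n + 2)} (hμ : μ ≠ 1)
    {x : Fin (n + 2) → ℝ} (hx : x ∈ V) (h0 : x 1 = 0) : pd s μ f x = pd s μ g x := by
  -- The coordinate line through x in a direction other than ρ stays in the horizon for both signs
  -- of the parameter, so the partial derivative is an ordinary two-sided derivative along it.
  let γ : ℝ → Fin (n + 2) → ℝ := fun r => x + r • Pi.single μ 1
  have hγ0 : γ 0 = x := by simp [γ]
  have hγ : HasDerivAt γ (Pi.single μ 1) 0 := by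
    simpa [γ, Function.comp_def] using
      ((hasDerivAt_id (0 : ℝ)).smul_const (Pi.single μ (1 : ℝ) : Fin (n + 2) → ℝ)).const_add x
  have h1 : ∀ r, γ r 1 = 0 := fun r => by simp [γ, h0, hμ.symm]
  have hV : ∀ᶠ r in 𝓝 (0 : ℝ), γ r ∈ V := by
    have hc : Tendsto γ (𝓝 0) (𝓝[{x | 0 ≤ x 1}] x) := by
      refine tendsto_nhdsWithin_iff.2 ⟨?_, ?_⟩
      · simpa [hγ0] using hγ.continuousAt.tendsto
      · exact Eventually.of_forall fun r => (h1 r).ge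
    exact hc.eventually (N.small.mem_nhdsWithin hx)
  have key : ∀ k : (Fin (n + 2) → ℝ) → ℝ, ContDiffOn ℝ ∞ k V →
      HasDerivAt (k ∘ γ) (pd s μ k x) 0 := by
    intro k hk
    have hk' : HasFDerivWithinAt k (fderivWithin ℝ k s x) V (γ 0) := by
      rw [hγ0]; exact (N.diffAt hk hx).hasFDerivWithinAt.mono N.sub
    have := hk'.comp_hasDerivWithinAt (s := γ ⁻¹' V) 0 hγ.hasDerivWithinAt (fun r hr => hr)
    exact this.hasDerivAt hV
  refine (key f hf).unique ((key g hg).congr_of_eventuallyEq ?_)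
  filter_upwards [hV] with r hr using h _ hr (h1 r)

end Nested

/-! ### Functions of the cross-section coordinates alone -/

theorem contDiff_ang : ContDiff ℝ ∞ (ang : (Fin (n + 2) → ℝ) → Fin n → ℝ) := by
  unfold ang; fun_prop

/-- `ang` as a continuous linear map. -/
def angL (n : ℕ) : (Fin (n + 2) → ℝ) →L[ℝ] (Fin n → ℝ) :=
  ContinuousLinearMap.pi fun M => ContinuousLinearMap.proj M.succ.succ

/-- A function of the cross-section coordinates as a function on spacetime. -/
def angPull (F : (Fin n → ℝ) → ℝ) (x : Fin (n + 2) → ℝ) : ℝ := F (ang x)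

theorem contDiffOn_comp_ang {U : Set (Fin n → ℝ)} {F : (Fin n → ℝ) → ℝ} (hF : ContDiffOn ℝ ∞ F U)
    (hV : ∀ x ∈ V, ang x ∈ U) : ContDiffOn ℝ ∞ (angPull F) V :=
  hF.comp contDiff_ang.contDiffOn hV

theorem Nested.pd_comp_ang (N : Nested s V) {U : Set (Fin n → ℝ)} (hU : IsOpen U)
    {F : (Fin n → ℝ) → ℝ} (hF : ContDiffOn ℝ ∞ F U) {x : Fin (n + 2) → ℝ} (hx : x ∈ V)
    (hxU : ang x ∈ U) (μ : Fin (n + 2)) :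
    pd s μ (angPull F) x = fderivWithin ℝ F U (ang x) (ang (Pi.single μ 1)) := by
  have h1 : HasFDerivAt F (fderivWithin ℝ F U (ang x)) (angL n x) :=
    ((hF.differentiableOn (by simp)) _ hxU).hasFDerivWithinAt.hasFDerivAt (hU.mem_nhds hxU)
  have h2 := (h1.comp x (angL n).hasFDerivAt).hasFDerivWithinAt (s := s)
  rw [pd, show angPull F = F ∘ (angL n) from rfl, h2.fderivWithin (N.uniq hx)]
  rfl

theorem ang_single_zero : ang (Pi.single 0 1 : Fin (n + 2) → ℝ) = 0 := by
  ext M; simp [ang, Fin.succ_ne_zero]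

theorem ang_single_one : ang (Pi.single 1 1 : Fin (n + 2) → ℝ) = 0 := by
  ext M
  have : M.succ.succ ≠ 1 := fun h => Fin.succ_ne_zero M (Fin.succ_injective _ (by simpa using h))
  simp [ang, this]

theorem ang_single_succ (M : Fin n) :
    ang (Pi.single M.succ.succ 1 : Fin (n + 2) → ℝ) = Pi.single M 1 := by
  ext N; simp [ang, Pi.single_apply]

section ang

variable {U : Set (Fin n → ℝ)} {F : (Fin n → ℝ) → ℝ} {x : Fin (n + 2) → ℝ}

theorem Nested.pd_zero_ang (N : Nested s V) (hU : IsOpen U) (hF : ContDiffOn ℝ ∞ F U) (hx : x ∈ V)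
    (hxU : ang x ∈ U) : pd s 0 (angPull F) x = 0 := by
  rw [N.pd_comp_ang hU hF hx hxU, ang_single_zero, map_zero]

theorem Nested.pd_one_ang (N : Nested s V) (hU : IsOpen U) (hF : ContDiffOn ℝ ∞ F U) (hx : x ∈ V)
    (hxU : ang x ∈ U) : pd s 1 (angPull F) x = 0 := by
  rw [N.pd_comp_ang hU hF hx hxU, ang_single_one, map_zero]

theorem Nested.pd_succ_ang (N : Nested s V) (hU : IsOpen U) (hF : ContDiffOn ℝ ∞ F U) (hx : x ∈ V)
    (hxU : ang x ∈ U) (M : Fin n) :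
    pd s M.succ.succ (angPull F) x = pd U M F (ang x) := by
  rw [N.pd_comp_ang hU hF hx hxU, ang_single_succ, pd]

end ang

variable {n : ℕ} {s V : Set (Fin (n + 2) → ℝ)}

/-! ### Division by the horizon coordinate -/

/-- The linear map that scales the coordinate `ρ` by `r`. -/
def rhoScale (n : ℕ) (r : ℝ) : (Fin (n + 2) → ℝ) →L[ℝ] (Fin (n + 2) → ℝ) :=
  ContinuousLinearMap.pi fun μ => (if μ = 1 then r else 1) • ContinuousLinearMap.proj μ

theorem rhoScale_apply (r : ℝ) (x : Fin (n + 2) → ℝ) (μ : Fin (n + 2)) :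
    rhoScale n r x μ = (if μ = 1 then r else 1) * x μ := by
  unfold rhoScale
  rw [ContinuousLinearMap.pi_apply]
  split_ifs <;> simp

theorem norm_rhoScale_le {r : ℝ} (hr : r ∈ Icc (0 : ℝ) 1) : ‖rhoScale n r‖ ≤ 1 := by
  refine ContinuousLinearMap.opNorm_le_bound _ zero_le_one fun x => ?_
  rw [one_mul]
  refine (pi_norm_le_iff_of_nonneg (norm_nonneg _)).2 fun μ => ?_
  rw [rhoScale_apply, norm_mul]
  have h1 : ‖(if μ = 1 then r else 1 : ℝ)‖ ≤ 1 := by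
    split_ifs
    · rw [Real.norm_of_nonneg hr.1]; exact hr.2
    · simp
  calc _ ≤ 1 * ‖x μ‖ := by gcongr
    _ ≤ ‖x‖ := by rw [one_mul]; exact norm_le_pi_norm x μ

theorem continuous_rhoScale :
    Continuous fun p : ℝ × (Fin (n + 2) → ℝ) => rhoScale n p.1 p.2 := by
  refine continuous_pi fun μ => ?_
  simp only [rhoScale_apply]
  split_ifs <;> fun_prop

theorem rhoScale_one (x : Fin (n + 2) → ℝ) : rhoScale n 1 x = x := by
  ext μ; simp [rhoScale_apply]

theorem rhoScale_of_horizon {x : Fin (n + 2) → ℝ} (h : x 1 = 0) (r : ℝ) : rhoScale n r x = x := by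
  ext μ; rw [rhoScale_apply]; split_ifs with hμ
  · rw [hμ, h, mul_zero]
  · rw [one_mul]

/-- The average `∫₀¹ r^j g(t, rρ, σ) dr`. -/
def rhoAvg (j : ℕ) (g : (Fin (n + 2) → ℝ) → ℝ) (x : Fin (n + 2) → ℝ) : ℝ :=
  ∫ r in (0 : ℝ)..1, r ^ j * g (rhoScale n r x)

/-- A convex relatively open subset of the half space that is mapped to itself by scaling `ρ`. -/
structure RhoBox (V : Set (Fin (n + 2) → ℝ)) : Prop where
  halfOpen : HalfOpen V
  conv : Convex ℝ V
  scale : ∀ x ∈ V, ∀ r ∈ Icc (0 : ℝ) 1, rhoScale n r x ∈ V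

theorem RhoBox.continuousOn (hV : RhoBox V) {g : (Fin (n + 2) → ℝ) → ℝ} (hg : ContinuousOn g V)
    (j : ℕ) {x : Fin (n + 2) → ℝ} (hx : x ∈ V) :
    ContinuousOn (fun r : ℝ => r ^ j * g (rhoScale n r x)) (Icc 0 1) := by
  refine ContinuousOn.mul (by fun_prop) (hg.comp ?_ fun r hr => hV.scale x hx r hr)
  exact (continuous_rhoScale.comp (by fun_prop : Continuous fun r : ℝ => (r, x))).continuousOn

theorem RhoBox.intervalIntegrable (hV : RhoBox V) {g : (Fin (n + 2) → ℝ) → ℝ}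
    (hg : ContinuousOn g V) (j : ℕ) {x : Fin (n + 2) → ℝ} (hx : x ∈ V) :
    IntervalIntegrable (fun r : ℝ => r ^ j * g (rhoScale n r x)) volume 0 1 := by
  refine ContinuousOn.intervalIntegrable ?_
  rw [uIcc_of_le zero_le_one]
  exact hV.continuousOn hg j hx

/-- Differentiation under the integral sign. A ρ-derivative of g(t, rρ, σ) brings down a factor r,
so the weight r^j becomes r^(j+1); allowing every j makes the family of averages closed under
differentiation. -/
theorem RhoBox.hasFDerivWithinAt_rhoAvg (hV : RhoBox V) {g : (Fin (n + 2) → ℝ) → ℝ}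
    (hg : ContDiffOn ℝ ∞ g V) (j : ℕ) {x : Fin (n + 2) → ℝ} (hx : x ∈ V) :
    HasFDerivWithinAt (rhoAvg j g)
      (∑ μ, rhoAvg (if μ = 1 then j + 1 else j) (pd V μ g) x •
        (ContinuousLinearMap.proj μ : (Fin (n + 2) → ℝ) →L[ℝ] ℝ)) V x := by
  have N := hV.halfOpen.nested_self
  have hpd : ∀ μ, ContinuousOn (pd V μ g) V := fun μ => (N.contDiffOn_pd hg μ).continuousOn
  refine HasFDerivWithinAt.of_isLittleO (Asymptotics.isLittleO_iff.2 fun c hc => ?_)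
  have hcont : ContinuousOn
      (Function.uncurry fun (y : Fin (n + 2) → ℝ) (r : ℝ) => fderivWithin ℝ g V (rhoScale n r y))
      (V ×ˢ Icc (0 : ℝ) 1) := by
    refine (N.contDiffOn_fderivWithin hg).continuousOn.comp ?_
      fun p hp => hV.scale p.1 hp.1 p.2 hp.2
    exact (continuous_rhoScale.comp continuous_swap).continuousOn
  -- Compactness of [0, 1] makes the derivative close to its value at x uniformly in r. The mean
  -- value inequality on the convex ball then bounds the remainder uniformly in r.
  obtain ⟨v, hv, hvc⟩ := isCompact_Icc.mem_uniformity_of_prod hcont hx (Metric.dist_mem_uniformity hc)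
  obtain ⟨δ, hδ, hball⟩ := Metric.mem_nhdsWithin_iff.1 hv
  filter_upwards [inter_mem (mem_nhdsWithin_of_mem_nhds (Metric.ball_mem_nhds x hδ))
    self_mem_nhdsWithin] with y hy
  have hmvt : ∀ r ∈ Icc (0 : ℝ) 1,
      ‖g (rhoScale n r y) - g (rhoScale n r x) -
        (fderivWithin ℝ g V (rhoScale n r x)).comp (rhoScale n r) (y - x)‖ ≤ c * ‖y - x‖ := by
    intro r hr
    refine Convex.norm_image_sub_le_of_norm_hasFDerivWithin_le' (𝕜 := ℝ)
      (f := fun z => g (rhoScale n r z)) (s := Metric.ball x δ ∩ V)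
      (f' := fun z => (fderivWithin ℝ g V (rhoScale n r z)).comp (rhoScale n r))
      (fun z hz => ?_) (fun z hz => ?_) ((convex_ball x δ).inter hV.conv)
      ⟨Metric.mem_ball_self hδ, hx⟩ hy
    · have h1 := (N.diffAt hg (hV.scale z hz.2 r hr)).hasFDerivWithinAt
      exact (h1.comp z (rhoScale n r).hasFDerivWithinAt fun w hw => hV.scale w hw r hr).mono
        inter_subset_right
    · rw [← ContinuousLinearMap.sub_comp]
      refine (ContinuousLinearMap.opNorm_comp_le _ _).trans ?_
      have h1 : ‖fderivWithin ℝ g V (rhoScale n r z) - fderivWithin ℝ g V (rhoScale n r x)‖ ≤ c := by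
        rw [← dist_eq_norm]; exact (hvc z (hball hz) r hr).le
      calc _ ≤ c * 1 := mul_le_mul h1 (norm_rhoScale_le hr) (norm_nonneg _) hc.le
        _ = c := mul_one c
  have hI : rhoAvg j g y - rhoAvg j g x - (∑ μ, rhoAvg (if μ = 1 then j + 1 else j) (pd V μ g) x •
        (ContinuousLinearMap.proj μ : (Fin (n + 2) → ℝ) →L[ℝ] ℝ)) (y - x) =
      ∫ r in (0 : ℝ)..1, r ^ j * (g (rhoScale n r y) - g (rhoScale n r x) -
        (fderivWithin ℝ g V (rhoScale n r x)).comp (rhoScale n r) (y - x)) := by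
    have h1 : ∀ r : ℝ, r ^ j * (g (rhoScale n r y) - g (rhoScale n r x) -
        (fderivWithin ℝ g V (rhoScale n r x)).comp (rhoScale n r) (y - x)) =
        r ^ j * g (rhoScale n r y) - r ^ j * g (rhoScale n r x) -
        ∑ μ, (y - x) μ * (r ^ (if μ = 1 then j + 1 else j) * pd V μ g (rhoScale n r x)) := by
      intro r
      rw [mul_sub, mul_sub, ContinuousLinearMap.comp_apply, Nested.fderivWithin_apply,
        Finset.mul_sum]
      congr 1
      refine Finset.sum_congr rfl fun μ _ => ?_
      rw [rhoScale_apply]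
      split_ifs <;> ring
    simp_rw [h1]
    rw [intervalIntegral.integral_sub, intervalIntegral.integral_sub,
      intervalIntegral.integral_finsetSum]
    · simp only [rhoAvg, intervalIntegral.integral_const_mul, _root_.sum_apply,
        _root_.smul_apply, ContinuousLinearMap.proj_apply, smul_eq_mul]
      congr 1
      exact Finset.sum_congr rfl fun μ _ => mul_comm _ _
    · exact fun μ _ => (hV.intervalIntegrable (hpd μ) _ hx).const_mul _
    · exact hV.intervalIntegrable hg.continuousOn j hy.2
    · exact hV.intervalIntegrable hg.continuousOn j hx
    · exact (hV.intervalIntegrable hg.continuousOn j hy.2).sub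
        (hV.intervalIntegrable hg.continuousOn j hx)
    · convert! IntervalIntegrable.sum Finset.univ fun μ _ =>
        (hV.intervalIntegrable (hpd μ) (if μ = 1 then j + 1 else j) hx).const_mul ((y - x) μ) using 1
      ext r; simp
  rw [hI]
  have hle := intervalIntegral.norm_integral_le_of_norm_le_const (a := (0 : ℝ)) (b := 1)
    (C := c * ‖y - x‖) (f := fun r => r ^ j * (g (rhoScale n r y) - g (rhoScale n r x) -
        (fderivWithin ℝ g V (rhoScale n r x)).comp (rhoScale n r) (y - x))) fun r hr => by
      rw [uIoc_of_le zero_le_one] at hr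
      rw [norm_mul, norm_pow]
      have h1 : ‖r‖ ^ j ≤ 1 := pow_le_one₀ (norm_nonneg _) (by
        rw [Real.norm_of_nonneg hr.1.le]; exact hr.2)
      calc _ ≤ 1 * (c * ‖y - x‖) :=
            mul_le_mul h1 (hmvt r ⟨hr.1.le, hr.2⟩) (norm_nonneg _) zero_le_one
        _ = c * ‖y - x‖ := one_mul _
  simpa using hle

/-- Induction on the order of differentiability, for all weights and integrands at once, because the
derivative of an average is a combination of averages of partial derivatives. -/
theorem RhoBox.contDiffOn_rhoAvg (hV : RhoBox V) {g : (Fin (n + 2) → ℝ) → ℝ}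
    (hg : ContDiffOn ℝ ∞ g V) (j : ℕ) : ContDiffOn ℝ ∞ (rhoAvg j g) V := by
  have N := hV.halfOpen.nested_self
  have key : ∀ k : ℕ, ∀ (j : ℕ) (g : (Fin (n + 2) → ℝ) → ℝ), ContDiffOn ℝ ∞ g V →
      ContDiffOn ℝ k (rhoAvg j g) V := by
    intro k
    induction k with
    | zero =>
      intro j g hg
      exact contDiffOn_zero.2 fun x hx => (hV.hasFDerivWithinAt_rhoAvg hg j hx).continuousWithinAt
    | succ k ih =>
      intro j g hg
      push_cast
      refine (contDiffOn_succ_iff_hasFDerivWithinAt_of_uniqueDiffOn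
        hV.halfOpen.uniqueDiffOn).2 ⟨by simp, _, ?_, fun x hx => hV.hasFDerivWithinAt_rhoAvg hg j hx⟩
      exact ContDiffOn.sum fun μ _ => (ih _ _ (N.contDiffOn_pd hg μ)).smul contDiffOn_const
  exact contDiffOn_infty.2 fun k => key k j g hg

/-- The fundamental theorem of calculus along the segment r ↦ (t, rρ, σ), which starts on the
horizon, where f vanishes. -/
theorem RhoBox.eq_mul_rhoAvg (hV : RhoBox V) {f : (Fin (n + 2) → ℝ) → ℝ}
    (hf : ContDiffOn ℝ ∞ f V) (h0 : ∀ x ∈ V, x 1 = 0 → f x = 0) {x : Fin (n + 2) → ℝ}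
    (hx : x ∈ V) : f x = x 1 * rhoAvg 0 (pd V 1 f) x := by
  have N := hV.halfOpen.nested_self
  have hpath : ∀ r, HasDerivAt (fun r => rhoScale n r x) (Pi.single 1 (x 1)) r := by
    intro r
    refine hasDerivAt_pi.2 fun μ => ?_
    simp only [rhoScale_apply]
    by_cases hμ : μ = 1
    · subst hμ; simpa using (hasDerivAt_id r).mul_const (x 1)
    · simpa [hμ] using hasDerivAt_const r (x μ)
  have hder : ∀ r ∈ Icc (0 : ℝ) 1, HasDerivWithinAt (fun r => f (rhoScale n r x))
      (x 1 * pd V 1 f (rhoScale n r x)) (Icc 0 1) r := by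
    intro r hr
    have h1 := (N.diffAt hf (hV.scale x hx r hr)).hasFDerivWithinAt
    have h2 := h1.comp_hasDerivWithinAt r (hpath r).hasDerivWithinAt fun r hr => hV.scale x hx r hr
    convert! h2 using 1
    rw [Nested.fderivWithin_apply, Finset.sum_eq_single 1] <;> simp +contextual
  have hftc := intervalIntegral.integral_eq_sub_of_hasDerivAt_of_le (a := 0) (b := 1)
    (f := fun r => f (rhoScale n r x)) (f' := fun r => x 1 * pd V 1 f (rhoScale n r x))
    zero_le_one (fun r hr => (hder r hr).continuousWithinAt)
    (fun r hr => (hder r (Ioo_subset_Icc_self hr)).hasDerivAt (Icc_mem_nhds hr.1 hr.2))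
    (by simpa using (hV.intervalIntegrable (N.contDiffOn_pd hf 1).continuousOn 0 hx).const_mul (x 1))
  have h00 : f (rhoScale n 0 x) = 0 :=
    h0 _ (hV.scale x hx 0 (by simp)) (by simp [rhoScale_apply])
  simp only [rhoScale_one, h00, sub_zero] at hftc
  rw [← hftc, rhoAvg]
  simp

/-- A ball centred at a horizon point works: scaling ρ fixes the centre and is linear of norm at
most 1. -/
theorem HalfOpen.exists_rhoBox (hV : HalfOpen V) {x : Fin (n + 2) → ℝ} (hx : x ∈ V)
    (h0 : x 1 = 0) : ∃ B, RhoBox B ∧ B ⊆ V ∧ x ∈ B := by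
  have hV' := hV
  obtain ⟨O, hO, rfl⟩ := hV
  obtain ⟨δ, hδ, hball⟩ := Metric.isOpen_iff.1 hO x hx.1
  refine ⟨Metric.ball x δ ∩ {x | 0 ≤ x 1}, ⟨⟨_, Metric.isOpen_ball, rfl⟩, ?_, ?_⟩,
    inter_subset_inter_left _ hball, ⟨Metric.mem_ball_self hδ, hx.2⟩⟩
  · exact (convex_ball x δ).inter (convex_halfSpace_ge (f := fun x : Fin (n + 2) → ℝ => x 1)
      (IsLinearMap.mk (fun _ _ => rfl) fun _ _ => rfl) 0)
  · rintro y ⟨hy, hy0⟩ r hr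
    refine ⟨?_, ?_⟩
    · rw [mem_ball_iff_norm] at hy ⊢
      have : rhoScale n r y - x = rhoScale n r (y - x) := by
        rw [map_sub, rhoScale_of_horizon h0]
      rw [this]
      calc _ ≤ ‖rhoScale n r‖ * ‖y - x‖ := (rhoScale n r).le_opNorm _
        _ ≤ 1 * ‖y - x‖ := by gcongr; exact norm_rhoScale_le hr
        _ < δ := by rwa [one_mul]
    · have h1 : (0 : ℝ) ≤ y 1 := hy0
      simpa [rhoScale_apply] using mul_nonneg hr.1 h1

/-- Hadamard's lemma: a smooth function that vanishes on the horizon is `ρ` times a function that is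
smooth up to the horizon. -/
theorem Nested.exists_div (N : Nested s V) {f : (Fin (n + 2) → ℝ) → ℝ} (hf : ContDiffOn ℝ ∞ f V)
    (h0 : ∀ x ∈ V, x 1 = 0 → f x = 0) :
    ∃ m, ContDiffOn ℝ ∞ m V ∧ (∀ x ∈ V, f x = x 1 * m x) ∧
      ∀ x ∈ V, x 1 = 0 → m x = pd s 1 f x := by
  classical
  -- The quotient is global, but smoothness is local: around a horizon point it agrees with the
  -- average of ∂_ρ f over a box, and elsewhere it is a quotient with non-vanishing denominator.
  set m : (Fin (n + 2) → ℝ) → ℝ := fun x => if x 1 = 0 then pd V 1 f x else f x / x 1 with hm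
  have NV := N.small.nested_self
  refine ⟨m, fun x hx => ?_, fun x hx => ?_, fun x hx hx0 => ?_⟩
  · by_cases hx0 : x 1 = 0
    · obtain ⟨B, hB, hBV, hxB⟩ := N.small.exists_rhoBox hx hx0
      have NB : Nested V B := ⟨N.small, hB.halfOpen, hBV⟩
      have heq : ∀ y ∈ B, m y = rhoAvg 0 (pd B 1 f) y := by
        intro y hy
        by_cases hy0 : y 1 = 0
        · simp [hm, hy0, rhoAvg, rhoScale_of_horizon hy0, NB.pd_eq (hf.mono hBV) 1 hy]
        · simp only [hm, hy0, if_false]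
          rw [div_eq_iff hy0, mul_comm]
          exact hB.eq_mul_rhoAvg (hf.mono hBV) (fun z hz => h0 z (hBV hz)) hy
      have hsm := hB.contDiffOn_rhoAvg
        (hB.halfOpen.nested_self.contDiffOn_pd (hf.mono hBV) 1) 0
      exact ((hsm.congr heq) x hxB).mono_of_mem_nhdsWithin (NB.mem_nhdsWithin hxB)
    · have h1 : ContDiffWithinAt ℝ ∞ (fun x => f x / x 1) V x :=
        (hf x hx).div (contDiff_apply ℝ ℝ (1 : Fin (n + 2))).contDiffWithinAt hx0
      refine h1.congr_of_eventuallyEq ?_ (by simp [hm, hx0])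
      have : ∀ᶠ y in 𝓝[V] x, y 1 ≠ 0 :=
        ((continuous_apply (1 : Fin (n + 2))).continuousAt.eventually_ne hx0).filter_mono
          nhdsWithin_le_nhds
      filter_upwards [this] with y hy
      simp [hm, hy]
  · by_cases hx0 : x 1 = 0
    · rw [hx0, zero_mul, h0 x hx hx0]
    · simp only [hm, hx0, if_false]; field_simp
  · simp only [hm, hx0, if_true]; exact (N.pd_eq hf 1 hx).symm

/-- A smooth function that vanishes to second order on the horizon is `O(ρ²)`. -/
theorem HalfOpen.smoothO_two (hs : HalfOpen s) {f : (Fin (n + 2) → ℝ) → ℝ}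
    (hf : ContDiffOn ℝ ∞ f s) (h0 : ∀ x ∈ s, x 1 = 0 → f x = 0)
    (h1 : ∀ x ∈ s, x 1 = 0 → pd s 1 f x = 0) : SmoothO s 2 f := by
  have N := hs.nested_self
  obtain ⟨m, hm, hfm, hm0⟩ := N.exists_div hf h0
  obtain ⟨k, hk, hmk, -⟩ := N.exists_div hm fun x hx hx0 => (hm0 x hx hx0).trans (h1 x hx hx0)
  exact ⟨k, hk, fun x hx => by rw [hfm x hx, hmk x hx]; ring⟩

/-! ### Determinants and inverses of matrices of functions -/

section Matrices

variable {ι : Type} [Fintype ι] [DecidableEq ι] {E : Type*} [NormedAddCommGroup E] [NormedSpace ℝ E]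

theorem contDiffOn_det {A : ι → ι → E → ℝ} {V : Set E} (hA : ∀ i j, ContDiffOn ℝ ∞ (A i j) V) :
    ContDiffOn ℝ ∞ (fun x => (Matrix.of fun i j => A i j x).det) V := by
  simp only [Matrix.det_apply, Matrix.of_apply]
  exact ContDiffOn.sum fun σ _ => ContDiffOn.const_smul _ (contDiffOn_prod fun i _ => hA _ _)

theorem contDiffOn_inverse {A : ι → ι → E → ℝ} {V : Set E} (hA : ∀ i j, ContDiffOn ℝ ∞ (A i j) V)
    (h0 : ∀ x ∈ V, (Matrix.of fun i j => A i j x).det ≠ 0) (i j : ι) :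
    ContDiffOn ℝ ∞ (fun x => (Matrix.of fun i j => A i j x)⁻¹ i j) V := by
  -- An entry of the adjugate is the determinant of the matrix with one row replaced by a unit
  -- vector, hence smooth by the lemma on determinants.
  have hadj : ContDiffOn ℝ ∞ (fun x => (Matrix.of fun i j => A i j x).adjugate i j) V := by
    have h1 := contDiffOn_det (V := V)
      (A := fun k l (x : E) => if k = j then (Pi.single i (1 : ℝ) : ι → ℝ) l else A k l x) (by
        intro k l; by_cases hk : k = j
        · simp only [hk, if_true]; exact contDiffOn_const
        · simp only [hk, if_false]; exact hA k l)
    refine h1.congr fun x _ => ?_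
    rw [Matrix.adjugate_apply]
    congr 1
    ext k l
    by_cases hk : k = j <;> simp [Matrix.updateRow_apply, hk]
  have h2 := ((contDiffOn_det hA).inv h0).mul hadj
  refine h2.congr fun x _ => ?_
  rw [Matrix.inv_def, Ring.inverse_eq_inv']; rfl

theorem adjugate_eq_det_mul_inv (A : Matrix ι ι ℝ) (h : A.det ≠ 0) (i j : ι) :
    A.adjugate i j = A.det * A⁻¹ i j := by
  rw [Matrix.inv_def, Ring.inverse_eq_inv', Matrix.smul_apply, smul_eq_mul, ← mul_assoc,
    mul_inv_cancel₀ h, one_mul]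

/-- Jacobi's formula for the derivative of a determinant. -/
theorem hasFDerivWithinAt_det {A : ι → ι → E → ℝ} {A' : ι → ι → E →L[ℝ] ℝ} {V : Set E} {x : E}
    (hA : ∀ i j, HasFDerivWithinAt (A i j) (A' i j) V x) :
    HasFDerivWithinAt (fun y => (Matrix.of fun i j => A i j y).det)
      (∑ i, ∑ j, (Matrix.of fun i j => A i j x).adjugate j i • A' i j) V x := by
  -- The determinant is multilinear in the rows, so its derivative is a sum of determinants with one
  -- row replaced by its variation; expanding each along that row produces the adjugate.
  let D : ContinuousMultilinearMap ℝ (fun _ : ι => ι → ℝ) ℝ :=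
    ⟨(Matrix.detRowAlternating (R := ℝ) (n := ι)).toMultilinearMap,
      (continuous_id (X := Matrix ι ι ℝ)).matrix_det⟩
  have h1 : HasFDerivWithinAt (fun y i j => A i j y)
      (ContinuousLinearMap.pi fun i => ContinuousLinearMap.pi fun j => A' i j) V x :=
    hasFDerivWithinAt_pi.2 fun i => hasFDerivWithinAt_pi.2 fun j => hA i j
  have h2 := (D.hasFDerivAt fun i j => A i j x).comp_hasFDerivWithinAt x h1
  convert! h2 using 1
  ext v
  simp only [_root_.sum_apply, _root_.smul_apply, smul_eq_mul, ContinuousLinearMap.comp_apply,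
    ContinuousMultilinearMap.linearDeriv_apply]
  refine Finset.sum_congr rfl fun i _ => ?_
  have h3 := Matrix.det_eq_sum_mul_adjugate_row
    ((Matrix.of fun i j => A i j x).updateRow i fun j => A' i j v) i
  have h4 : D (Function.update (fun i j => A i j x) i
      ((ContinuousLinearMap.pi fun i => ContinuousLinearMap.pi fun j => A' i j) v i)) =
      ((Matrix.of fun i j => A i j x).updateRow i fun j => A' i j v).det := rfl
  rw [h4, h3]
  refine Finset.sum_congr rfl fun j _ => ?_
  rw [Matrix.adjugate_apply, Matrix.adjugate_apply, Matrix.updateRow_idem,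
    Matrix.updateRow_self, mul_comm]

end Matrices

/-! ### The divergence on the cross-section -/

section Divergence

variable {n : ℕ} {U : Set (Fin n → ℝ)}

theorem contDiffOn_pd_of_isOpen (hU : IsOpen U) {F : (Fin n → ℝ) → ℝ} (hF : ContDiffOn ℝ ∞ F U)
    (M : Fin n) : ContDiffOn ℝ ∞ (pd U M F) U :=
  (hF.fderivWithin hU.uniqueDiffOn (m := ∞) (by simp)).clm_apply contDiffOn_const

theorem hasFDerivWithinAt_of_smooth {F : (Fin n → ℝ) → ℝ} (hF : ContDiffOn ℝ ∞ F U)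
    {σ : Fin n → ℝ} (hσ : σ ∈ U) : HasFDerivWithinAt F (fderivWithin ℝ F U σ) U σ :=
  ((hF.differentiableOn (by simp)) σ hσ).hasFDerivWithinAt

theorem pd_open_mul (hU : IsOpen U) {F G : (Fin n → ℝ) → ℝ} (hF : ContDiffOn ℝ ∞ F U)
    (hG : ContDiffOn ℝ ∞ G U) (M : Fin n) {σ : Fin n → ℝ} (hσ : σ ∈ U) :
    pd U M (fun y => F y * G y) σ = pd U M F σ * G σ + F σ * pd U M G σ := by
  have h := (hasFDerivWithinAt_of_smooth hF hσ).mul (hasFDerivWithinAt_of_smooth hG hσ)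
  rw [pd, show (fun y => F y * G y) = F * G from rfl, h.fderivWithin (hU.uniqueDiffOn σ hσ)]
  simp [pd]; ring

theorem pd_open_sub (hU : IsOpen U) {F G : (Fin n → ℝ) → ℝ} (hF : ContDiffOn ℝ ∞ F U)
    (hG : ContDiffOn ℝ ∞ G U) (M : Fin n) {σ : Fin n → ℝ} (hσ : σ ∈ U) :
    pd U M (fun y => F y - G y) σ = pd U M F σ - pd U M G σ := by
  have h := (hasFDerivWithinAt_of_smooth hF hσ).sub (hasFDerivWithinAt_of_smooth hG hσ)
  rw [pd, show (fun y => F y - G y) = F - G from rfl, h.fderivWithin (hU.uniqueDiffOn σ hσ)]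
  simp [pd]

theorem pd_open_add (hU : IsOpen U) {F G : (Fin n → ℝ) → ℝ} (hF : ContDiffOn ℝ ∞ F U)
    (hG : ContDiffOn ℝ ∞ G U) (M : Fin n) {σ : Fin n → ℝ} (hσ : σ ∈ U) :
    pd U M (fun y => F y + G y) σ = pd U M F σ + pd U M G σ := by
  have h := (hasFDerivWithinAt_of_smooth hF hσ).add (hasFDerivWithinAt_of_smooth hG hσ)
  rw [pd, show (fun y => F y + G y) = F + G from rfl, h.fderivWithin (hU.uniqueDiffOn σ hσ)]
  simp [pd]

theorem pd_open_sum (hU : IsOpen U) {ι : Type*} (u : Finset ι) {F : ι → (Fin n → ℝ) → ℝ}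
    (hF : ∀ i ∈ u, ContDiffOn ℝ ∞ (F i) U) (M : Fin n) {σ : Fin n → ℝ} (hσ : σ ∈ U) :
    pd U M (fun y => ∑ i ∈ u, F i y) σ = ∑ i ∈ u, pd U M (F i) σ := by
  rw [pd, fderivWithin_fun_sum (hU.uniqueDiffOn σ hσ) fun i hi =>
    (hasFDerivWithinAt_of_smooth (hF i hi) hσ).differentiableWithinAt]
  simp [pd]

theorem pd_open_congr {F G : (Fin n → ℝ) → ℝ} (h : ∀ σ ∈ U, F σ = G σ) (M : Fin n)
    {σ : Fin n → ℝ} (hσ : σ ∈ U) : pd U M F σ = pd U M G σ := by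
  rw [pd, pd, fderivWithin_congr h (h σ hσ)]

theorem pd_open_comm (hU : IsOpen U) {F : (Fin n → ℝ) → ℝ} (hF : ContDiffOn ℝ ∞ F U)
    (M N : Fin n) {σ : Fin n → ℝ} (hσ : σ ∈ U) : pd U M (pd U N F) σ = pd U N (pd U M F) σ := by
  have key : ∀ M N, pd U M (pd U N F) σ =
      fderivWithin ℝ (fderivWithin ℝ F U) U σ (Pi.single M 1) (Pi.single N 1) := by
    intro M N
    have h1 : DifferentiableWithinAt ℝ (fderivWithin ℝ F U) U σ :=
      ((hF.fderivWithin hU.uniqueDiffOn (m := ∞) (by simp)).differentiableOn (by simp)) σ hσ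
    have h2 := h1.hasFDerivWithinAt.clm_apply
      (hasFDerivWithinAt_const (Pi.single N (1 : ℝ) : Fin n → ℝ) σ U)
    have h3 := h2.fderivWithin (hU.uniqueDiffOn σ hσ)
    rw [pd, show pd U N F = fun y => fderivWithin ℝ F U y (Pi.single N 1) from rfl, h3]
    simp
  rw [key, key]
  exact (ContDiffWithinAt.isSymmSndFDerivWithinAt (hF σ hσ) (by
    simp only [minSmoothness_of_isRCLikeNormedField]; exact WithTop.coe_le_coe.2 le_top)
    hU.uniqueDiffOn (by rw [hU.interior_eq]; exact subset_closure hσ) hσ).eq _ _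

/-- A metric on the cross-section: smooth, symmetric and non-degenerate. -/
structure IsCrossMetric (U : Set (Fin n → ℝ)) (q : Fin n → Fin n → (Fin n → ℝ) → ℝ) : Prop where
  isOpen : IsOpen U
  smooth : ∀ M N, ContDiffOn ℝ ∞ (q M N) U
  symm : ∀ M N, ∀ σ ∈ U, q M N σ = q N M σ
  pos : ∀ σ ∈ U, 0 < metricDet q σ

variable {q : Fin n → Fin n → (Fin n → ℝ) → ℝ}

theorem IsCrossMetric.smooth_det (hq : IsCrossMetric U q) : ContDiffOn ℝ ∞ (metricDet q) U :=
  contDiffOn_det hq.smooth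

theorem IsCrossMetric.pd_det (hq : IsCrossMetric U q) (P : Fin n) {σ : Fin n → ℝ} (hσ : σ ∈ U) :
    pd U P (metricDet q) σ = metricDet q σ * ∑ M, ∑ N, inv q N M σ * pd U P (q M N) σ := by
  have h := hasFDerivWithinAt_det (A := q) (x := σ) (V := U)
    fun i j => hasFDerivWithinAt_of_smooth (hq.smooth i j) hσ
  rw [pd, show metricDet q = fun y => (Matrix.of fun i j => q i j y).det from rfl,
    h.fderivWithin (hq.isOpen.uniqueDiffOn σ hσ)]
  simp only [_root_.sum_apply, _root_.smul_apply, smul_eq_mul, Finset.mul_sum]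
  refine Finset.sum_congr rfl fun i _ => Finset.sum_congr rfl fun j _ => ?_
  rw [adjugate_eq_det_mul_inv _ (hq.pos σ hσ).ne', mul_assoc]; rfl

theorem IsCrossMetric.inv_symm (hq : IsCrossMetric U q) {σ : Fin n → ℝ} (hσ : σ ∈ U)
    (M N : Fin n) : inv q M N σ = inv q N M σ := by
  have h : (Matrix.of fun α β => q α β σ).transpose = Matrix.of fun α β => q α β σ := by
    ext i j; exact hq.symm j i σ hσ
  have h2 := Matrix.transpose_nonsing_inv (Matrix.of fun α β => q α β σ)
  rw [h] at h2
  exact congrFun (congrFun h2 N) M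

/-- In the contracted symbol Γ^M_{MP} two of the three derivative terms cancel by the symmetry of
the inverse metric, and half the trace of ∂_P q is left. -/
theorem IsCrossMetric.divergence_eq (hq : IsCrossMetric U q) {K : (Fin n → ℝ) → (Fin n → ℝ)}
    {σ : Fin n → ℝ} (hσ : σ ∈ U) : divergence U q K σ =
      ∑ M, pd U M (fun y => K y M) σ +
        (1 / 2) * ∑ P, K σ P * ∑ M, ∑ N, inv q M N σ * pd U P (q M N) σ := by
  have hs : ∀ P M N, pd U P (q M N) σ = pd U P (q N M) σ := fun P M N =>
    pd_open_congr (fun y hy => hq.symm M N y hy) P hσ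
  simp only [divergence, covV, Finset.sum_add_distrib, christoffel]
  congr 1
  rw [Finset.sum_comm, Finset.mul_sum]
  refine Finset.sum_congr rfl fun P _ => ?_
  have h1 : ∑ M, ∑ τ, inv q M τ σ * pd U M (q τ P) σ = ∑ M, ∑ τ, inv q M τ σ * pd U τ (q M P) σ := by
    rw [Finset.sum_comm]
    exact Finset.sum_congr rfl fun M _ => Finset.sum_congr rfl fun τ _ => by rw [hq.inv_symm hσ]
  have h2 : ∑ M, ∑ τ, inv q M τ σ * (pd U M (q τ P) σ + pd U P (q τ M) σ - pd U τ (q M P) σ) =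
      ∑ M, ∑ τ, inv q M τ σ * pd U P (q M τ) σ := by
    simp only [mul_add, mul_sub, Finset.sum_add_distrib, Finset.sum_sub_distrib, h1]
    rw [add_sub_cancel_left]
    exact Finset.sum_congr rfl fun M _ => Finset.sum_congr rfl fun τ _ => by rw [hs P τ M]
  rw [← h2, ← Finset.sum_mul, ← Finset.mul_sum]
  ring

/-- `2 det q D_M K^M = 2 det q ∂_M K^M + K^M ∂_M det q`. -/
theorem IsCrossMetric.det_mul_divergence (hq : IsCrossMetric U q)
    {K : (Fin n → ℝ) → (Fin n → ℝ)} {σ : Fin n → ℝ} (hσ : σ ∈ U) :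
    2 * metricDet q σ * divergence U q K σ =
      2 * metricDet q σ * ∑ M, pd U M (fun y => K y M) σ +
        ∑ P, K σ P * pd U P (metricDet q) σ := by
  rw [hq.divergence_eq hσ]
  have : ∑ P, K σ P * pd U P (metricDet q) σ =
      metricDet q σ * ∑ P, K σ P * ∑ M, ∑ N, inv q M N σ * pd U P (q M N) σ := by
    rw [Finset.mul_sum]
    refine Finset.sum_congr rfl fun P _ => ?_
    have e : ∑ M, ∑ N, inv q N M σ * pd U P (q M N) σ =
        ∑ M, ∑ N, inv q M N σ * pd U P (q M N) σ :=
      Finset.sum_congr rfl fun M _ => Finset.sum_congr rfl fun N _ => by rw [hq.inv_symm hσ]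
    rw [hq.pd_det P hσ, e]
    ring
  rw [this]; ring

theorem IsCrossMetric.divergence_add (hq : IsCrossMetric U q) {K L : (Fin n → ℝ) → (Fin n → ℝ)}
    (hK : ∀ M, ContDiffOn ℝ ∞ (fun y => K y M) U) (hL : ∀ M, ContDiffOn ℝ ∞ (fun y => L y M) U)
    {σ : Fin n → ℝ} (hσ : σ ∈ U) :
    divergence U q (fun y M => K y M + L y M) σ = divergence U q K σ + divergence U q L σ := by
  simp only [hq.divergence_eq hσ, pd_open_add hq.isOpen (hK _) (hL _) _ hσ, add_mul,
    Finset.sum_add_distrib]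
  ring

theorem IsCrossMetric.divergence_smul (hq : IsCrossMetric U q) {K : (Fin n → ℝ) → (Fin n → ℝ)}
    (hK : ∀ M, ContDiffOn ℝ ∞ (fun y => K y M) U) (c : ℝ)
    {σ : Fin n → ℝ} (hσ : σ ∈ U) :
    divergence U q (fun y M => c * K y M) σ = c * divergence U q K σ := by
  have h : ∀ M, pd U M (fun y => c * K y M) σ = c * pd U M (fun y => K y M) σ := fun M => by
    rw [pd_open_mul hq.isOpen contDiffOn_const (hK M) M hσ]; simp [pd]
  simp only [hq.divergence_eq hσ, h, ← Finset.mul_sum, mul_assoc]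
  ring

/-- The commutator of divergence-free vector fields is divergence-free. -/
theorem IsCrossMetric.divergence_bracket (hq : IsCrossMetric U q)
    {K L : (Fin n → ℝ) → (Fin n → ℝ)}
    (hK : ∀ M, ContDiffOn ℝ ∞ (fun y => K y M) U) (hL : ∀ M, ContDiffOn ℝ ∞ (fun y => L y M) U)
    (hK0 : ∀ σ ∈ U, divergence U q K σ = 0) (hL0 : ∀ σ ∈ U, divergence U q L σ = 0)
    {σ : Fin n → ℝ} (hσ : σ ∈ U) :
    divergence U q (fun y M => ∑ N, (K y N * pd U N (fun z => L z M) y -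
      L y N * pd U N (fun z => K z M) y)) σ = 0 := by
  have hU := hq.isOpen
  have hd := hq.smooth_det
  have hdet : ∀ y ∈ U, metricDet q y ≠ 0 := fun y hy => (hq.pos y hy).ne'
  have hlog : ContDiffOn ℝ ∞ (fun y => (1 / 2) * Real.log (metricDet q y)) U :=
    contDiffOn_const.mul (hd.log hdet)
  -- With w = log √(det q) the divergence of Z is ∂_M Z^M + Z^P ∂_P w. In this form the commutator
  -- needs no curvature, only the equality of mixed partial derivatives.
  set w := fun y => (1 / 2) * Real.log (metricDet q y) with hw
  have hpw : ∀ P, ∀ y ∈ U, pd U P w y = (1 / 2) * (pd U P (metricDet q) y / metricDet q y) := by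
    intro P y hy
    have h1 := ((hasFDerivWithinAt_of_smooth hd hy).log (hdet y hy)).const_mul (1 / 2 : ℝ)
    rw [pd, h1.fderivWithin (hU.uniqueDiffOn y hy)]
    simp [pd]; ring
  have hdiv : ∀ Z : (Fin n → ℝ) → (Fin n → ℝ), ∀ y ∈ U, divergence U q Z y =
      ∑ M, pd U M (fun y => Z y M) y + ∑ P, Z y P * pd U P w y := by
    intro Z y hy
    have h1 := hq.det_mul_divergence (K := Z) hy
    have h2 : ∑ P, Z y P * pd U P w y =
        (1 / 2) * (∑ P, Z y P * pd U P (metricDet q) y) / metricDet q y := by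
      rw [Finset.mul_sum, Finset.sum_div]
      exact Finset.sum_congr rfl fun P _ => by rw [hpw P y hy]; ring
    rw [h2]
    have := hdet y hy
    field_simp
    linarith
  have hpK : ∀ M N, ContDiffOn ℝ ∞ (pd U M fun z => K z N) U := fun M N =>
    contDiffOn_pd_of_isOpen hU (hK N) M
  have hpL : ∀ M N, ContDiffOn ℝ ∞ (pd U M fun z => L z N) U := fun M N =>
    contDiffOn_pd_of_isOpen hU (hL N) M
  have hppw : ∀ P, ContDiffOn ℝ ∞ (pd U P w) U := fun P => contDiffOn_pd_of_isOpen hU hlog P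
  -- the derivative of the divergence of `Z` in the direction of `Y`
  have hder : ∀ Y Z : (Fin n → ℝ) → (Fin n → ℝ), (∀ M, ContDiffOn ℝ ∞ (fun y => Z y M) U) →
      (∀ y ∈ U, divergence U q Z y = 0) →
      ∑ N, Y σ N * (∑ M, pd U N (pd U M fun y => Z y M) σ +
        ∑ P, (pd U N (fun y => Z y P) σ * pd U P w σ + Z σ P * pd U N (pd U P w) σ)) = 0 := by
    intro Y Z hZ hZ0
    refine Finset.sum_eq_zero fun N _ => ?_
    have hpZ : ∀ M N, ContDiffOn ℝ ∞ (pd U M fun z => Z z N) U := fun M N =>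
      contDiffOn_pd_of_isOpen hU (hZ N) M
    have h1 : pd U N (fun y => ∑ M, pd U M (fun y => Z y M) y + ∑ P, Z y P * pd U P w y) σ = 0 := by
      rw [pd_open_congr (G := fun _ => 0) (fun y hy => by rw [← hdiv Z y hy, hZ0 y hy]) N hσ]
      simp [pd]
    rw [pd_open_add hU (by fun_prop) (by fun_prop) N hσ, pd_open_sum hU _ (fun M _ => by fun_prop) N hσ,
      pd_open_sum hU _ (fun M _ => by fun_prop) N hσ] at h1
    simp only [pd_open_mul hU (hZ _) (hppw _) N hσ] at h1
    rw [h1, mul_zero]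
  have h1 := hder K L hL hL0
  have h2 := hder L K hK hK0
  rw [hdiv _ σ hσ]
  have h3 : ∀ M, pd U M (fun y => ∑ N, (K y N * pd U N (fun z => L z M) y -
      L y N * pd U N (fun z => K z M) y)) σ =
      ∑ N, ((pd U M (fun y => K y N) σ * pd U N (fun z => L z M) σ +
        K σ N * pd U N (pd U M (fun z => L z M)) σ) -
        (pd U M (fun y => L y N) σ * pd U N (fun z => K z M) σ +
        L σ N * pd U N (pd U M (fun z => K z M)) σ)) := by
    intro M
    rw [pd_open_sum hU _ (fun N _ => by fun_prop) M hσ]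
    refine Finset.sum_congr rfl fun N _ => ?_
    rw [pd_open_sub hU (by fun_prop) (by fun_prop) M hσ, pd_open_mul hU (hK N) (hpL N M) M hσ,
      pd_open_mul hU (hL N) (hpK N M) M hσ, pd_open_comm hU (hL M) M N hσ,
      pd_open_comm hU (hK M) M N hσ]
  simp only [h3]
  -- What remains, apart from the derivatives of the two divergences, is symmetric under exchange of
  -- K and L: the products of first derivatives here, and the Hessian of w in `e2`.
  have e1 : ∑ M, ∑ N, pd U M (fun y => K y N) σ * pd U N (fun z => L z M) σ =
      ∑ M, ∑ N, pd U M (fun y => L y N) σ * pd U N (fun z => K z M) σ := by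
    rw [Finset.sum_comm]
    exact Finset.sum_congr rfl fun M _ => Finset.sum_congr rfl fun N _ => mul_comm _ _
  have e2 : ∑ N, ∑ P, K σ N * (L σ P * pd U N (pd U P w) σ) =
      ∑ N, ∑ P, L σ N * (K σ P * pd U N (pd U P w) σ) := by
    rw [Finset.sum_comm]
    refine Finset.sum_congr rfl fun M _ => Finset.sum_congr rfl fun N _ => ?_
    rw [pd_open_comm hU hlog N M hσ]; ring
  have e3 : ∀ (Y Z : (Fin n → ℝ) → (Fin n → ℝ)),
      ∑ M, ∑ N, Y σ N * pd U N (pd U M fun z => Z z M) σ =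
      ∑ N, ∑ M, Y σ N * pd U N (pd U M fun z => Z z M) σ := fun Y Z => Finset.sum_comm
  have e4 : ∀ (Y Z : (Fin n → ℝ) → (Fin n → ℝ)),
      ∑ M, ∑ N, Y σ N * pd U N (fun z => Z z M) σ * pd U M w σ =
      ∑ N, ∑ M, Y σ N * (pd U N (fun z => Z z M) σ * pd U M w σ) := fun Y Z => by
    rw [Finset.sum_comm]
    exact Finset.sum_congr rfl fun M _ => Finset.sum_congr rfl fun N _ => mul_assoc _ _ _
  simp only [mul_add, Finset.mul_sum, Finset.sum_add_distrib] at h1 h2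
  simp only [Finset.sum_sub_distrib, Finset.sum_add_distrib, Finset.sum_mul, sub_mul, e1, e3, e4]
  linarith

end Divergence

/-! ### Vector fields near the horizon -/

section Forms

variable {n : ℕ} {ε : ℝ} {U : Set (Fin n → ℝ)}

theorem sum_split (F : Fin (n + 2) → ℝ) : ∑ μ, F μ = F 0 + F 1 + ∑ M : Fin n, F M.succ.succ := by
  rw [Fin.sum_univ_succ, Fin.sum_univ_succ, ← add_assoc]; rfl

theorem index_cases {P : Fin (n + 2) → Prop} (h0 : P 0) (h1 : P 1) (hM : ∀ M : Fin n, P M.succ.succ)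
    (μ : Fin (n + 2)) : P μ := by
  refine Fin.cases h0 (fun i => ?_) μ
  exact Fin.cases (motive := fun i : Fin (n + 1) => P i.succ) h1 hM i

theorem succ_succ_ne_one (M : Fin n) : M.succ.succ ≠ (1 : Fin (n + 2)) := fun h =>
  Fin.succ_ne_zero M (Fin.succ_injective _ (by simpa using h))

theorem succ_succ_ne_zero (M : Fin n) : M.succ.succ ≠ (0 : Fin (n + 2)) := Fin.succ_ne_zero _

theorem ang_mem {x : Fin (n + 2) → ℝ} (hx : x ∈ region ε U) : ang x ∈ U := hx.2.2

theorem Nested.pd_rho_mul {s V : Set (Fin (n + 2) → ℝ)} (N : Nested s V)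
    {k : (Fin (n + 2) → ℝ) → ℝ} (hk : ContDiffOn ℝ ∞ k V)
    {x : Fin (n + 2) → ℝ} (hx : x ∈ V) (h0 : x 1 = 0) :
    pd s 1 (fun y => y 1 * k y) x = k x := by
  rw [N.pd_mul (by fun_prop) hk 1 hx, N.pd_coord 1 1 hx, h0]; simp

theorem Nested.pd_rho_sq_mul {s V : Set (Fin (n + 2) → ℝ)} (N : Nested s V)
    {k : (Fin (n + 2) → ℝ) → ℝ} (hk : ContDiffOn ℝ ∞ k V)
    {x : Fin (n + 2) → ℝ} (hx : x ∈ V) (h0 : x 1 = 0) :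
    pd s 1 (fun y => y 1 ^ 2 * k y) x = 0 := by
  have h1 : (fun y : Fin (n + 2) → ℝ => y 1 ^ 2 * k y) = fun y => y 1 * (y 1 * k y) := by
    ext y; ring
  rw [h1, N.pd_rho_mul (by fun_prop) hx h0, h0, zero_mul]

/-- The form of a vector field of `𝒜'`, expressed by its first-order jet at the horizon. -/
structure JetForm (ε : ℝ) (U : Set (Fin n → ℝ)) (F G H J : (Fin n → ℝ) → ℝ)
    (K : (Fin n → ℝ) → (Fin n → ℝ)) (ξ : (Fin (n + 2) → ℝ) → (Fin (n + 2) → ℝ)) : Prop where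
  smooth_F : ContDiffOn ℝ ∞ F U
  smooth_G : ContDiffOn ℝ ∞ G U
  smooth_H : ContDiffOn ℝ ∞ H U
  smooth_J : ContDiffOn ℝ ∞ J U
  smooth_K : ∀ M, ContDiffOn ℝ ∞ (fun σ => K σ M) U
  smooth : ∀ μ, ContDiffOn ℝ ∞ (fun x => ξ x μ) (region ε U)
  val_t : ∀ x ∈ region ε U, x 1 = 0 → ξ x 0 = F (ang x) + x 0 * G (ang x)
  val_ρ : ∀ x ∈ region ε U, x 1 = 0 → ξ x 1 = 0
  val_M : ∀ x ∈ region ε U, x 1 = 0 → ∀ M : Fin n, ξ x M.succ.succ = K (ang x) M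
  der_t : ∀ x ∈ region ε U, x 1 = 0 → pd (region ε U) 1 (fun y => ξ y 0) x = 0
  der_ρ : ∀ x ∈ region ε U, x 1 = 0 →
    pd (region ε U) 1 (fun y => ξ y 1) x = H (ang x) + x 0 * J (ang x)
  der_M : ∀ x ∈ region ε U, x 1 = 0 → ∀ M : Fin n,
    pd (region ε U) 1 (fun y => ξ y M.succ.succ) x = 0

variable {F G H J : (Fin n → ℝ) → ℝ} {K : (Fin n → ℝ) → (Fin n → ℝ)}
  {ξ : (Fin (n + 2) → ℝ) → (Fin (n + 2) → ℝ)}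

/-- A remainder ρ² h contributes neither to the value nor to the ρ-derivative at ρ = 0. -/
theorem HasForm.jetForm (hU : IsOpen U) (h : HasForm ε U F G H J K ξ) :
    JetForm ε U F G H J K ξ := by
  have N := (halfOpen_region (ε := ε) hU).nested_self
  have hF := contDiffOn_comp_ang (V := region ε U) h.smooth_F fun x hx => ang_mem hx
  have hG := contDiffOn_comp_ang (V := region ε U) h.smooth_G fun x hx => ang_mem hx
  have hH := contDiffOn_comp_ang (V := region ε U) h.smooth_H fun x hx => ang_mem hx
  have hJ := contDiffOn_comp_ang (V := region ε U) h.smooth_J fun x hx => ang_mem hx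
  have hKM := contDiffOn_pi.1 h.smooth_K
  have hK := fun M => contDiffOn_comp_ang (V := region ε U) (hKM M) fun x hx => ang_mem hx
  obtain ⟨X, hX, hXe⟩ := h.t
  obtain ⟨Y, hY, hYe⟩ := h.ρ
  choose Z hZ hZe using h.M
  have e0 : ∀ x ∈ region ε U, ξ x 0 = angPull F x + x 0 * angPull G x + x 1 ^ 2 * X x :=
    fun x hx => by simp only [angPull]; linarith [hXe x hx]
  have e1 : ∀ x ∈ region ε U, ξ x 1 = x 1 * (angPull H x + x 0 * angPull J x + x 1 * Y x) :=
    fun x hx => by simp only [angPull]; linarith [hYe x hx]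
  have eM : ∀ M : Fin n, ∀ x ∈ region ε U, ξ x M.succ.succ = angPull (fun σ => K σ M) x + x 1 ^ 2 * Z M x :=
    fun M x hx => by simp only [angPull]; linarith [hZe M x hx]
  refine ⟨h.smooth_F, h.smooth_G, h.smooth_H, h.smooth_J, hKM, ?_, ?_, ?_, ?_, ?_, ?_, ?_⟩
  · refine index_cases ?_ ?_ fun M => ?_
    · exact ContDiffOn.congr (by fun_prop) e0
    · exact ContDiffOn.congr (by fun_prop) e1
    · exact ContDiffOn.congr (by fun_prop) (eM M)
  · intro x hx h0; rw [e0 x hx, h0]; simp only [angPull]; ring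
  · intro x hx h0; rw [e1 x hx, h0]; ring
  · intro x hx h0 M; rw [eM M x hx, h0]; simp only [angPull]; ring
  · intro x hx h0
    rw [N.pd_congr e0 1 hx, N.pd_add (by fun_prop) (by fun_prop) 1 hx, N.pd_rho_sq_mul hX hx h0,
      N.pd_add (by fun_prop) (by fun_prop) 1 hx, N.pd_mul (by fun_prop) (by fun_prop) 1 hx,
      N.pd_one_ang hU h.smooth_F hx hx.2.2, N.pd_one_ang hU h.smooth_G hx hx.2.2,
      N.pd_coord 1 0 hx]
    simp
  · intro x hx h0
    rw [N.pd_congr e1 1 hx, N.pd_rho_mul (by fun_prop) hx h0, h0]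
    simp only [angPull]; ring
  · intro x hx h0 M
    rw [N.pd_congr (eM M) 1 hx, N.pd_add (by fun_prop) (by fun_prop) 1 hx,
      N.pd_rho_sq_mul (hZ M) hx h0, N.pd_one_ang hU (hKM M) hx hx.2.2]
    simp

/-- By Hadamard's lemma applied twice, a smooth function with vanishing value and ρ-derivative on
the horizon is O(ρ²). Closure of the algebras can therefore be tested on jets, without following the
remainders. -/
theorem JetForm.hasForm (hU : IsOpen U) (h : JetForm ε U F G H J K ξ) :
    HasForm ε U F G H J K ξ := by
  have N := (halfOpen_region (ε := ε) hU).nested_self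
  have hF := contDiffOn_comp_ang (V := region ε U) h.smooth_F fun x hx => ang_mem hx
  have hG := contDiffOn_comp_ang (V := region ε U) h.smooth_G fun x hx => ang_mem hx
  have hH := contDiffOn_comp_ang (V := region ε U) h.smooth_H fun x hx => ang_mem hx
  have hJ := contDiffOn_comp_ang (V := region ε U) h.smooth_J fun x hx => ang_mem hx
  have hK := fun M => contDiffOn_comp_ang (V := region ε U) (h.smooth_K M) fun x hx => ang_mem hx
  have hξ := h.smooth
  refine ⟨h.smooth_F, h.smooth_G, h.smooth_H, h.smooth_J, contDiffOn_pi.2 h.smooth_K,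
    N.small.smoothO_two (f := fun x => ξ x 0 - (angPull F x + x 0 * angPull G x)) (by fun_prop) ?_ ?_,
    N.small.smoothO_two (f := fun x => ξ x 1 - x 1 * (angPull H x + x 0 * angPull J x))
      (by fun_prop) ?_ ?_,
    fun M => N.small.smoothO_two (f := fun x => ξ x M.succ.succ - angPull (fun σ => K σ M) x)
      (by fun_prop) ?_ ?_⟩
  · intro x hx h0; rw [h.val_t x hx h0]; simp only [angPull]; ring
  · intro x hx h0
    rw [N.pd_sub (by fun_prop) (by fun_prop) 1 hx,
      N.pd_add (by fun_prop) (by fun_prop) 1 hx, N.pd_mul (by fun_prop) (by fun_prop) 1 hx,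
      N.pd_one_ang hU h.smooth_F hx hx.2.2, N.pd_one_ang hU h.smooth_G hx hx.2.2,
      N.pd_coord 1 0 hx, h.der_t x hx h0]
    simp
  · intro x hx h0; rw [h.val_ρ x hx h0, h0]; ring
  · intro x hx h0
    rw [N.pd_sub (by fun_prop) (by fun_prop) 1 hx, N.pd_rho_mul (by fun_prop) hx h0,
      h.der_ρ x hx h0]; simp only [angPull, sub_self]
  · intro x hx h0; rw [h.val_M x hx h0, angPull, sub_self]
  · intro x hx h0
    rw [N.pd_sub (by fun_prop) (by fun_prop) 1 hx, h.der_M x hx h0,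
      N.pd_one_ang hU (h.smooth_K M) hx hx.2.2, sub_self]

namespace JetForm

variable (hU : IsOpen U) (h : JetForm ε U F G H J K ξ) {x : Fin (n + 2) → ℝ}
  (hx : x ∈ region ε U) (h0 : x 1 = 0)
include hU h hx h0

theorem pd_zero_t : pd (region ε U) 0 (fun y => ξ y 0) x = G (ang x) := by
  have N := (halfOpen_region (ε := ε) hU).nested_self
  have hF := contDiffOn_comp_ang (V := region ε U) h.smooth_F fun x hx => ang_mem hx
  have hG := contDiffOn_comp_ang (V := region ε U) h.smooth_G fun x hx => ang_mem hx
  rw [N.pd_tangential (h.smooth 0) (g := fun x => angPull F x + x 0 * angPull G x) (by fun_prop)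
    h.val_t (by simp) hx h0, N.pd_add (by fun_prop) (by fun_prop) 0 hx,
    N.pd_mul (by fun_prop) (by fun_prop) 0 hx, N.pd_zero_ang hU h.smooth_F hx hx.2.2,
    N.pd_zero_ang hU h.smooth_G hx hx.2.2, N.pd_coord 0 0 hx]
  simp [angPull]

theorem pd_succ_t (M : Fin n) : pd (region ε U) M.succ.succ (fun y => ξ y 0) x =
    pd U M F (ang x) + x 0 * pd U M G (ang x) := by
  have N := (halfOpen_region (ε := ε) hU).nested_self
  have hF := contDiffOn_comp_ang (V := region ε U) h.smooth_F fun x hx => ang_mem hx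
  have hG := contDiffOn_comp_ang (V := region ε U) h.smooth_G fun x hx => ang_mem hx
  rw [N.pd_tangential (h.smooth 0) (g := fun x => angPull F x + x 0 * angPull G x) (by fun_prop)
    h.val_t (succ_succ_ne_one M) hx h0, N.pd_add (by fun_prop) (by fun_prop) _ hx,
    N.pd_mul (by fun_prop) (by fun_prop) _ hx, N.pd_succ_ang hU h.smooth_F hx hx.2.2,
    N.pd_succ_ang hU h.smooth_G hx hx.2.2, N.pd_coord _ 0 hx]
  simp [(succ_succ_ne_zero M).symm]

theorem pd_tangential_ρ {μ : Fin (n + 2)} (hμ : μ ≠ 1) :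
    pd (region ε U) μ (fun y => ξ y 1) x = 0 := by
  have N := (halfOpen_region (ε := ε) hU).nested_self
  rw [N.pd_tangential (h.smooth 1) (g := fun _ => 0) (by fun_prop) h.val_ρ hμ hx h0]
  simp [pd]

theorem pd_zero_M (M : Fin n) : pd (region ε U) 0 (fun y => ξ y M.succ.succ) x = 0 := by
  have N := (halfOpen_region (ε := ε) hU).nested_self
  have hK := contDiffOn_comp_ang (V := region ε U) (h.smooth_K M) fun x hx => ang_mem hx
  rw [N.pd_tangential (h.smooth _) hK (fun y hy hy0 => h.val_M y hy hy0 M) (by simp) hx h0,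
    N.pd_zero_ang hU (h.smooth_K M) hx hx.2.2]

theorem pd_succ_M (M P : Fin n) : pd (region ε U) P.succ.succ (fun y => ξ y M.succ.succ) x =
    pd U P (fun σ => K σ M) (ang x) := by
  have N := (halfOpen_region (ε := ε) hU).nested_self
  have hK := contDiffOn_comp_ang (V := region ε U) (h.smooth_K M) fun x hx => ang_mem hx
  rw [N.pd_tangential (h.smooth _) hK (fun y hy hy0 => h.val_M y hy hy0 M) (succ_succ_ne_one P) hx h0,
    N.pd_succ_ang hU (h.smooth_K M) hx hx.2.2]

/-- The ρ-derivative commutes with tangential ones, so mixed second derivatives on the horizon are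
tangential derivatives of the known ρ-derivatives. The next three lemmas work in the same way. -/
theorem pd_pd_t {μ : Fin (n + 2)} (hμ : μ ≠ 1) :
    pd (region ε U) 1 (pd (region ε U) μ fun y => ξ y 0) x = 0 := by
  have N := (halfOpen_region (ε := ε) hU).nested_self
  rw [N.pd_comm (h.smooth 0) 1 μ hx, N.pd_tangential (N.contDiffOn_pd (h.smooth 0) 1)
    (g := fun _ => 0) (by fun_prop) h.der_t hμ hx h0]
  simp [pd]

theorem pd_pd_M (M : Fin n) {μ : Fin (n + 2)} (hμ : μ ≠ 1) :
    pd (region ε U) 1 (pd (region ε U) μ fun y => ξ y M.succ.succ) x = 0 := by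
  have N := (halfOpen_region (ε := ε) hU).nested_self
  rw [N.pd_comm (h.smooth _) 1 μ hx, N.pd_tangential (N.contDiffOn_pd (h.smooth _) 1)
    (g := fun _ => 0) (by fun_prop) (fun y hy hy0 => h.der_M y hy hy0 M) hμ hx h0]
  simp [pd]

theorem pd_pd_zero_ρ :
    pd (region ε U) 1 (pd (region ε U) 0 fun y => ξ y 1) x = J (ang x) := by
  have N := (halfOpen_region (ε := ε) hU).nested_self
  have hH := contDiffOn_comp_ang (V := region ε U) h.smooth_H fun x hx => ang_mem hx
  have hJ := contDiffOn_comp_ang (V := region ε U) h.smooth_J fun x hx => ang_mem hx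
  rw [N.pd_comm (h.smooth 1) 1 0 hx, N.pd_tangential (N.contDiffOn_pd (h.smooth 1) 1)
    (g := fun x => angPull H x + x 0 * angPull J x) (by fun_prop) h.der_ρ (by simp) hx h0,
    N.pd_add (by fun_prop) (by fun_prop) 0 hx,
    N.pd_mul (by fun_prop) (by fun_prop) 0 hx, N.pd_zero_ang hU h.smooth_H hx hx.2.2,
    N.pd_zero_ang hU h.smooth_J hx hx.2.2, N.pd_coord 0 0 hx]
  simp [angPull]

theorem pd_pd_succ_ρ (M : Fin n) :
    pd (region ε U) 1 (pd (region ε U) M.succ.succ fun y => ξ y 1) x =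
      pd U M H (ang x) + x 0 * pd U M J (ang x) := by
  have N := (halfOpen_region (ε := ε) hU).nested_self
  have hH := contDiffOn_comp_ang (V := region ε U) h.smooth_H fun x hx => ang_mem hx
  have hJ := contDiffOn_comp_ang (V := region ε U) h.smooth_J fun x hx => ang_mem hx
  rw [N.pd_comm (h.smooth 1) 1 _ hx, N.pd_tangential (N.contDiffOn_pd (h.smooth 1) 1)
    (g := fun x => angPull H x + x 0 * angPull J x) (by fun_prop) h.der_ρ (succ_succ_ne_one M) hx h0,
    N.pd_add (by fun_prop) (by fun_prop) _ hx,
    N.pd_mul (by fun_prop) (by fun_prop) _ hx, N.pd_succ_ang hU h.smooth_H hx hx.2.2,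
    N.pd_succ_ang hU h.smooth_J hx hx.2.2, N.pd_coord _ 0 hx]
  simp [(succ_succ_ne_zero M).symm]

end JetForm

/-! ### The Lie algebras -/

theorem JetForm.zero : JetForm ε U 0 0 0 0 0 0 := by
  refine ⟨contDiffOn_const, contDiffOn_const, contDiffOn_const, contDiffOn_const,
    fun _ => contDiffOn_const, fun _ => contDiffOn_const, ?_, ?_, ?_, ?_, ?_, ?_⟩ <;>
  simp [pd]

variable {F₁ G₁ H₁ J₁ F₂ G₂ H₂ J₂ : (Fin n → ℝ) → ℝ} {K₁ K₂ : (Fin n → ℝ) → (Fin n → ℝ)}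
  {ξ η : (Fin (n + 2) → ℝ) → (Fin (n + 2) → ℝ)}

theorem JetForm.add (hU : IsOpen U) (h₁ : JetForm ε U F₁ G₁ H₁ J₁ K₁ ξ)
    (h₂ : JetForm ε U F₂ G₂ H₂ J₂ K₂ η) :
    JetForm ε U (fun σ => F₁ σ + F₂ σ) (fun σ => G₁ σ + G₂ σ) (fun σ => H₁ σ + H₂ σ)
      (fun σ => J₁ σ + J₂ σ) (fun σ M => K₁ σ M + K₂ σ M) (ξ + η) := by
  have N := (halfOpen_region (ε := ε) hU).nested_self
  have hs₁ := h₁.smooth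
  have hs₂ := h₂.smooth
  refine ⟨h₁.smooth_F.add h₂.smooth_F, h₁.smooth_G.add h₂.smooth_G, h₁.smooth_H.add h₂.smooth_H,
    h₁.smooth_J.add h₂.smooth_J, fun M => (h₁.smooth_K M).add (h₂.smooth_K M),
    fun μ => (hs₁ μ).add (hs₂ μ), ?_, ?_, ?_, ?_, ?_, ?_⟩ <;> intro x hx h0
  · simp only [Pi.add_apply, h₁.val_t x hx h0, h₂.val_t x hx h0]; ring
  · simp only [Pi.add_apply, h₁.val_ρ x hx h0, h₂.val_ρ x hx h0]; ring
  · intro M; simp only [Pi.add_apply, h₁.val_M x hx h0, h₂.val_M x hx h0]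
  · simp only [Pi.add_apply]
    rw [N.pd_add (hs₁ _) (hs₂ _) 1 hx, h₁.der_t x hx h0, h₂.der_t x hx h0, add_zero]
  · simp only [Pi.add_apply]
    rw [N.pd_add (hs₁ _) (hs₂ _) 1 hx, h₁.der_ρ x hx h0, h₂.der_ρ x hx h0]; ring
  · intro M; simp only [Pi.add_apply]
    rw [N.pd_add (hs₁ _) (hs₂ _) 1 hx, h₁.der_M x hx h0, h₂.der_M x hx h0, add_zero]

theorem JetForm.smul (hU : IsOpen U) (h₁ : JetForm ε U F₁ G₁ H₁ J₁ K₁ ξ) (c : ℝ) :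
    JetForm ε U (fun σ => c * F₁ σ) (fun σ => c * G₁ σ) (fun σ => c * H₁ σ)
      (fun σ => c * J₁ σ) (fun σ M => c * K₁ σ M) (c • ξ) := by
  have N := (halfOpen_region (ε := ε) hU).nested_self
  have hs₁ := h₁.smooth
  refine ⟨contDiffOn_const.mul h₁.smooth_F, contDiffOn_const.mul h₁.smooth_G,
    contDiffOn_const.mul h₁.smooth_H, contDiffOn_const.mul h₁.smooth_J,
    fun M => contDiffOn_const.mul (h₁.smooth_K M),
    fun μ => contDiffOn_const.mul (hs₁ μ), ?_, ?_, ?_, ?_, ?_, ?_⟩ <;> intro x hx h0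
  · simp only [Pi.smul_apply, smul_eq_mul, h₁.val_t x hx h0]; ring
  · simp only [Pi.smul_apply, smul_eq_mul, h₁.val_ρ x hx h0]; ring
  · intro M; simp only [Pi.smul_apply, smul_eq_mul, h₁.val_M x hx h0]
  · simp only [Pi.smul_apply, smul_eq_mul]
    rw [N.pd_const_mul c (hs₁ _) 1 hx, h₁.der_t x hx h0, mul_zero]
  · simp only [Pi.smul_apply, smul_eq_mul]
    rw [N.pd_const_mul c (hs₁ _) 1 hx, h₁.der_ρ x hx h0]; ring
  · intro M; simp only [Pi.smul_apply, smul_eq_mul]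
    rw [N.pd_const_mul c (hs₁ _) 1 hx, h₁.der_M x hx h0, mul_zero]

theorem Nested.fderivWithin_comp {s V : Set (Fin (n + 2) → ℝ)} (N : Nested s V)
    {η : (Fin (n + 2) → ℝ) → (Fin (n + 2) → ℝ)} (hη : ∀ μ, ContDiffOn ℝ ∞ (fun x => η x μ) V)
    {x : Fin (n + 2) → ℝ} (hx : x ∈ V) (v : Fin (n + 2) → ℝ) (μ : Fin (n + 2)) :
    fderivWithin ℝ η s x v μ = ∑ α, v α * pd s α (fun y => η y μ) x := by
  have h1 : HasFDerivWithinAt η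
      (ContinuousLinearMap.pi fun μ => fderivWithin ℝ (fun y => η y μ) s x) s x :=
    hasFDerivWithinAt_pi.2 fun μ => (N.diffAt (hη μ) hx).hasFDerivWithinAt
  rw [h1.fderivWithin (N.uniq hx), ContinuousLinearMap.pi_apply, fderivWithin_apply]

theorem lieBracketWithin_apply (hU : IsOpen U)
    (hξ : ∀ μ, ContDiffOn ℝ ∞ (fun x => ξ x μ) (region ε U))
    (hη : ∀ μ, ContDiffOn ℝ ∞ (fun x => η x μ) (region ε U)) {x : Fin (n + 2) → ℝ}
    (hx : x ∈ region ε U) (μ : Fin (n + 2)) :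
    VectorField.lieBracketWithin ℝ ξ η (region ε U) x μ =
      ∑ α, (ξ x α * pd (region ε U) α (fun y => η y μ) x -
        η x α * pd (region ε U) α (fun y => ξ y μ) x) := by
  have N := (halfOpen_region (ε := ε) hU).nested_self
  rw [VectorField.lieBracketWithin]
  rw [Pi.sub_apply, N.fderivWithin_comp hη hx,
    N.fderivWithin_comp hξ hx, Finset.sum_sub_distrib]

/-- The coefficients are read off from the value and the ρ-derivative of the commutator on the
horizon. No t² arises: the derivative along t turns the affine coefficients F + tG and H + tJ into
the constants G and J, and K does not depend on t. The t-terms of ξ^t ∂_t η^t - η^t ∂_t ξ^t cancel.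
-/
theorem JetForm.bracket (hU : IsOpen U) (h₁ : JetForm ε U F₁ G₁ H₁ J₁ K₁ ξ)
    (h₂ : JetForm ε U F₂ G₂ H₂ J₂ K₂ η) :
    JetForm ε U
      (fun σ => F₁ σ * G₂ σ - F₂ σ * G₁ σ + ∑ M, (K₁ σ M * pd U M F₂ σ - K₂ σ M * pd U M F₁ σ))
      (fun σ => ∑ M, (K₁ σ M * pd U M G₂ σ - K₂ σ M * pd U M G₁ σ))
      (fun σ => F₁ σ * J₂ σ - F₂ σ * J₁ σ + ∑ M, (K₁ σ M * pd U M H₂ σ - K₂ σ M * pd U M H₁ σ))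
      (fun σ => G₁ σ * J₂ σ - G₂ σ * J₁ σ + ∑ M, (K₁ σ M * pd U M J₂ σ - K₂ σ M * pd U M J₁ σ))
      (fun σ M => ∑ P, (K₁ σ P * pd U P (fun τ => K₂ τ M) σ -
        K₂ σ P * pd U P (fun τ => K₁ τ M) σ))
      (VectorField.lieBracketWithin ℝ ξ η (region ε U)) := by
  have N := (halfOpen_region (ε := ε) hU).nested_self
  have hs₁ := h₁.smooth
  have hs₂ := h₂.smooth
  have hb := fun μ x hx => lieBracketWithin_apply (ε := ε) hU hs₁ hs₂ (x := x) hx μ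
  have hp₁ : ∀ α μ, ContDiffOn ℝ ∞ (pd (region ε U) α fun y => ξ y μ) (region ε U) :=
    fun α μ => N.contDiffOn_pd (hs₁ μ) α
  have hp₂ : ∀ α μ, ContDiffOn ℝ ∞ (pd (region ε U) α fun y => η y μ) (region ε U) :=
    fun α μ => N.contDiffOn_pd (hs₂ μ) α
  have c : ∀ {F : (Fin n → ℝ) → ℝ}, ContDiffOn ℝ ∞ F U → ∀ M, ContDiffOn ℝ ∞ (pd U M F) U :=
    fun hF M => contDiffOn_pd_of_isOpen hU hF M
  have kF₁ := h₁.smooth_F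
  have kG₁ := h₁.smooth_G
  have kH₁ := h₁.smooth_H
  have kJ₁ := h₁.smooth_J
  have kK₁ := h₁.smooth_K
  have kF₂ := h₂.smooth_F
  have kG₂ := h₂.smooth_G
  have kH₂ := h₂.smooth_H
  have kJ₂ := h₂.smooth_J
  have kK₂ := h₂.smooth_K
  have lF₁ := c kF₁
  have lG₁ := c kG₁
  have lH₁ := c kH₁
  have lJ₁ := c kJ₁
  have lK₁ := fun M => c (kK₁ M)
  have lF₂ := c kF₂
  have lG₂ := c kG₂
  have lH₂ := c kH₂
  have lJ₂ := c kJ₂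
  have lK₂ := fun M => c (kK₂ M)
  have hder : ∀ μ, ∀ x ∈ region ε U,
      pd (region ε U) 1 (fun y => VectorField.lieBracketWithin ℝ ξ η (region ε U) y μ) x =
      ∑ α, ((pd (region ε U) 1 (fun y => ξ y α) x * pd (region ε U) α (fun y => η y μ) x +
        ξ x α * pd (region ε U) 1 (pd (region ε U) α fun y => η y μ) x) -
        (pd (region ε U) 1 (fun y => η y α) x * pd (region ε U) α (fun y => ξ y μ) x +
        η x α * pd (region ε U) 1 (pd (region ε U) α fun y => ξ y μ) x)) := by
    intro μ x hx
    rw [N.pd_congr (hb μ) 1 hx, N.pd_sum _ (fun α _ => by fun_prop) 1 hx]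
    refine Finset.sum_congr rfl fun α _ => ?_
    rw [N.pd_sub (by fun_prop) (by fun_prop) 1 hx, N.pd_mul (hs₁ _) (hp₂ _ _) 1 hx,
      N.pd_mul (hs₂ _) (hp₁ _ _) 1 hx]
  refine ⟨by fun_prop, by fun_prop, by fun_prop, by fun_prop, fun M => by fun_prop,
    fun μ => ContDiffOn.congr (by fun_prop) (hb μ), ?_, ?_, ?_, ?_, ?_, ?_⟩ <;> intro x hx h0
  · rw [hb 0 x hx, sum_split]
    simp only [h₁.val_ρ x hx h0, h₂.val_ρ x hx h0, h₁.val_t x hx h0, h₂.val_t x hx h0,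
      h₁.val_M x hx h0, h₂.val_M x hx h0, h₁.pd_zero_t hU hx h0, h₂.pd_zero_t hU hx h0,
      h₁.pd_succ_t hU hx h0, h₂.pd_succ_t hU hx h0, mul_add, Finset.sum_sub_distrib,
      Finset.sum_add_distrib, Finset.mul_sum, mul_sub, mul_left_comm (x 0)]
    ring
  · rw [hb 1 x hx, sum_split]
    simp only [h₁.val_ρ x hx h0, h₂.val_ρ x hx h0,
      h₁.pd_tangential_ρ hU hx h0 (μ := 0) (by simp), h₂.pd_tangential_ρ hU hx h0 (μ := 0) (by simp),
      fun M => h₁.pd_tangential_ρ hU hx h0 (succ_succ_ne_one M),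
      fun M => h₂.pd_tangential_ρ hU hx h0 (succ_succ_ne_one M)]
    simp
  · intro M
    rw [hb _ x hx, sum_split]
    simp only [h₁.val_ρ x hx h0, h₂.val_ρ x hx h0, h₁.val_M x hx h0, h₂.val_M x hx h0,
      h₁.pd_zero_M hU hx h0, h₂.pd_zero_M hU hx h0, h₁.pd_succ_M hU hx h0, h₂.pd_succ_M hU hx h0]
    ring
  · rw [hder 0 x hx, sum_split]
    simp only [h₁.val_ρ x hx h0, h₂.val_ρ x hx h0, h₁.der_t x hx h0, h₂.der_t x hx h0,
      h₁.der_M x hx h0, h₂.der_M x hx h0, h₁.pd_pd_t hU hx h0 (μ := 0) (by simp),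
      h₂.pd_pd_t hU hx h0 (μ := 0) (by simp), fun M => h₁.pd_pd_t hU hx h0 (succ_succ_ne_one M),
      fun M => h₂.pd_pd_t hU hx h0 (succ_succ_ne_one M)]
    simp
  · rw [hder 1 x hx, sum_split]
    simp only [h₁.val_ρ x hx h0, h₂.val_ρ x hx h0, h₁.der_t x hx h0, h₂.der_t x hx h0,
      h₁.der_M x hx h0, h₂.der_M x hx h0, h₁.pd_pd_zero_ρ hU hx h0, h₂.pd_pd_zero_ρ hU hx h0,
      h₁.val_t x hx h0, h₂.val_t x hx h0,
      h₁.val_M x hx h0, h₂.val_M x hx h0, h₁.pd_pd_succ_ρ hU hx h0, h₂.pd_pd_succ_ρ hU hx h0,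
      zero_mul, zero_add, mul_add, Finset.sum_sub_distrib,
      Finset.sum_add_distrib, Finset.mul_sum, mul_sub, mul_left_comm (x 0)]
    ring
  · intro M
    rw [hder _ x hx, sum_split]
    simp only [h₁.val_ρ x hx h0, h₂.val_ρ x hx h0, h₁.der_t x hx h0, h₂.der_t x hx h0,
      h₁.der_M x hx h0, h₂.der_M x hx h0, h₁.pd_pd_M hU hx h0 M (μ := 0) (by simp),
      h₂.pd_pd_M hU hx h0 M (μ := 0) (by simp), h₁.pd_zero_M hU hx h0 M, h₂.pd_zero_M hU hx h0 M,
      fun P : Fin n => h₁.pd_pd_M hU hx h0 M (succ_succ_ne_one P),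
      fun P : Fin n => h₂.pd_pd_M hU hx h0 M (succ_succ_ne_one P)]
    simp

theorem isLieClosed_algA' (hU : IsOpen U) : IsLieClosed (region ε U) (algA' ε U) where
  zero_mem := ⟨_, _, _, _, _, JetForm.zero.hasForm hU⟩
  add_mem := by
    rintro ξ ⟨_, _, _, _, _, h₁⟩ η ⟨_, _, _, _, _, h₂⟩
    exact ⟨_, _, _, _, _, ((h₁.jetForm hU).add hU (h₂.jetForm hU)).hasForm hU⟩
  smul_mem := by
    rintro c ξ ⟨_, _, _, _, _, h₁⟩
    exact ⟨_, _, _, _, _, ((h₁.jetForm hU).smul hU c).hasForm hU⟩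
  bracket_mem := by
    rintro ξ ⟨_, _, _, _, _, h₁⟩ η ⟨_, _, _, _, _, h₂⟩
    exact ⟨_, _, _, _, _, ((h₁.jetForm hU).bracket hU (h₂.jetForm hU)).hasForm hU⟩

theorem isLieClosed_algA {q : Fin n → Fin n → (Fin n → ℝ) → ℝ} (hq : IsCrossMetric U q) :
    IsLieClosed (region ε U) (algA ε U q) where
  zero_mem := ⟨_, _, _, _, _, JetForm.zero.hasForm hq.isOpen, fun σ _ => by
    simp [divergence, covV, pd]⟩
  add_mem := by
    rintro ξ ⟨_, _, _, _, _, h₁, d₁⟩ η ⟨_, _, _, _, _, h₂, d₂⟩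
    have k₁ := h₁.jetForm hq.isOpen
    have k₂ := h₂.jetForm hq.isOpen
    exact ⟨_, _, _, _, _, (k₁.add hq.isOpen k₂).hasForm hq.isOpen, fun σ hσ => by
      rw [hq.divergence_add k₁.smooth_K k₂.smooth_K hσ, d₁ σ hσ, d₂ σ hσ, add_zero]⟩
  smul_mem := by
    rintro c ξ ⟨_, _, _, _, _, h₁, d₁⟩
    have k₁ := h₁.jetForm hq.isOpen
    exact ⟨_, _, _, _, _, (k₁.smul hq.isOpen c).hasForm hq.isOpen, fun σ hσ => by
      rw [hq.divergence_smul k₁.smooth_K c hσ, d₁ σ hσ, mul_zero]⟩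
  bracket_mem := by
    rintro ξ ⟨_, _, _, _, _, h₁, d₁⟩ η ⟨_, _, _, _, _, h₂, d₂⟩
    have k₁ := h₁.jetForm hq.isOpen
    have k₂ := h₂.jetForm hq.isOpen
    exact ⟨_, _, _, _, _, (k₁.bracket hq.isOpen k₂).hasForm hq.isOpen, fun σ hσ =>
      hq.divergence_bracket k₁.smooth_K k₂.smooth_K d₁ d₂ hσ⟩

end Forms

set_option linter.unusedSectionVars false

/-! ### Pointwise tensor algebra -/

section Algebra

variable {ι : Type} [Fintype ι] [DecidableEq ι]

/-- Christoffel symbols from the inverse metric and the first derivatives of the metric. -/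
def chrA (I : ι → ι → ℝ) (dg : ι → ι → ι → ℝ) (l μ ν : ι) : ℝ :=
  (1 / 2) * ∑ τ, I l τ * (dg μ τ ν + dg ν τ μ - dg τ μ ν)

/-- The covariant derivative of a 2-tensor from its first derivatives. -/
def covA (Γ : ι → ι → ι → ℝ) (h : ι → ι → ℝ) (dh : ι → ι → ι → ℝ) (γ α β : ι) : ℝ :=
  dh γ α β - ∑ l, (Γ l γ α * h l β + Γ l γ β * h α l)

/-- The contraction that defines the pre-symplectic current. -/
def omA (I h₁ h₂ : ι → ι → ℝ) (c₁ c₂ : ι → ι → ι → ℝ) (ν : ι) : ℝ :=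
  ∑ ρ, ∑ σ, ∑ α, ∑ β, ∑ γ,
    (I ν α * (I ρ σ * I β γ - 2 * (I ρ β * I σ γ)) +
      2 * I ν γ * ((1 / 2) * (I ρ α * I σ β - I ρ σ * I α β)) + I ν ρ * I α β * I σ γ) *
    ((1 / 2) * (h₁ ρ σ * c₂ γ α β - h₂ ρ σ * c₁ γ α β))

/-- The contraction that defines `preS`. -/
def preA (I h : ι → ι → ℝ) (c : ι → ι → ι → ℝ) (v : ι → ι → ℝ) (ξ : ι → ℝ) (μ ν : ι) : ℝ :=
  -(1 / 2) * (∑ α, ∑ β, I α β * h α β) * (∑ l, I μ l * v l ν) +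
    (∑ α, ∑ β, ∑ γ, I α β * I μ γ * h β γ * v α ν) -
    (∑ l, ∑ β, ∑ α, I μ l * I ν β * c l β α * ξ α) +
    ξ μ * (∑ α, ∑ β, ∑ γ, I ν β * I α γ * c α β γ) -
    ξ μ * (∑ l, ∑ α, ∑ β, I ν l * I α β * c l α β)

theorem christoffel_eq (s : Set (ι → ℝ)) (g : ι → ι → (ι → ℝ) → ℝ) (x : ι → ℝ) (l μ ν : ι) :
    christoffel s g l μ ν x =
      chrA (fun α β => inv g α β x) (fun γ α β => pd s γ (g α β) x) l μ ν := rfl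

theorem covT_eq (s : Set (ι → ℝ)) (g h : ι → ι → (ι → ℝ) → ℝ) (x : ι → ℝ) (γ α β : ι) :
    covT s g h γ α β x =
      covA (fun l μ ν => christoffel s g l μ ν x) (fun α β => h α β x)
        (fun γ α β => pd s γ (h α β) x) γ α β := rfl

theorem omega_eq (GN : ℝ) (s : Set (ι → ℝ)) (g h₁ h₂ : ι → ι → (ι → ℝ) → ℝ) (x : ι → ℝ) (ν : ι) :
    omega GN s g h₁ h₂ ν x = Real.sqrt (-metricDet g x) / (16 * Real.pi * GN) *
      omA (fun α β => inv g α β x) (fun α β => h₁ α β x) (fun α β => h₂ α β x)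
        (fun γ α β => covT s g h₁ γ α β x) (fun γ α β => covT s g h₂ γ α β x) ν := rfl

theorem preS_eq (s : Set (ι → ℝ)) (g h : ι → ι → (ι → ℝ) → ℝ) (ξ : (ι → ℝ) → (ι → ℝ))
    (x : ι → ℝ) (μ ν : ι) :
    preS s g h ξ μ ν x = preA (fun α β => inv g α β x) (fun α β => h α β x)
      (fun γ α β => covT s g h γ α β x) (fun α ν => covV s g ξ α ν x) (ξ x) μ ν := rfl

variable {I h h₁ h₂ : ι → ι → ℝ} {c c₁ c₂ dg dh Γ : ι → ι → ι → ℝ} {lam : ι → ℝ} {r : ℝ}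

/-- Each contracted pair of indices contributes λ⁻¹λ = 1, each free index keeps its own factor, and
r⁻¹ counts the single derivative. The scaling lemmas below count in the same way. -/
theorem chrA_scale (hl : ∀ μ, lam μ ≠ 0) (l μ ν : ι) :
    chrA (fun α β => (lam α)⁻¹ * (lam β)⁻¹ * I α β)
      (fun γ α β => r⁻¹ * (lam γ * lam α * lam β) * dg γ α β) l μ ν =
      r⁻¹ * ((lam l)⁻¹ * lam μ * lam ν) * chrA I dg l μ ν := by
  simp only [chrA, Finset.mul_sum]
  refine Finset.sum_congr rfl fun τ _ => ?_
  have := hl τ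
  field_simp

theorem covA_scale (hl : ∀ μ, lam μ ≠ 0) (γ α β : ι) :
    covA (fun l μ ν => r⁻¹ * ((lam l)⁻¹ * lam μ * lam ν) * Γ l μ ν)
      (fun α β => lam α * lam β * h α β)
      (fun γ α β => r⁻¹ * (lam γ * lam α * lam β) * dh γ α β) γ α β =
      r⁻¹ * (lam γ * lam α * lam β) * covA Γ h dh γ α β := by
  simp only [covA, mul_sub, Finset.mul_sum]
  congr 1
  refine Finset.sum_congr rfl fun l _ => ?_
  have := hl l
  field_simp

/-- Every term contains exactly one derivative of a perturbation, whence one r⁻¹, and has one free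
upper index, whence λ_ν⁻¹. -/
theorem omA_scale (hl : ∀ μ, lam μ ≠ 0) (ν : ι) :
    omA (fun α β => (lam α)⁻¹ * (lam β)⁻¹ * I α β) (fun α β => lam α * lam β * h₁ α β)
      (fun α β => lam α * lam β * h₂ α β) (fun γ α β => r⁻¹ * (lam γ * lam α * lam β) * c₁ γ α β)
      (fun γ α β => r⁻¹ * (lam γ * lam α * lam β) * c₂ γ α β) ν =
      r⁻¹ * (lam ν)⁻¹ * omA I h₁ h₂ c₁ c₂ ν := by
  simp only [omA, Finset.mul_sum]
  refine Finset.sum_congr rfl fun ρ _ => Finset.sum_congr rfl fun σ _ =>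
    Finset.sum_congr rfl fun α _ => Finset.sum_congr rfl fun β _ =>
    Finset.sum_congr rfl fun γ _ => ?_
  have h1 := hl ρ
  have h2 := hl σ
  have h3 := hl α
  have h4 := hl β
  have h5 := hl γ
  field_simp

/-- Every term contains one derivative, of ξ or of the perturbation, and has two free upper indices.
-/
theorem preA_scale (hl : ∀ μ, lam μ ≠ 0) {v : ι → ι → ℝ} {ξ : ι → ℝ} (μ ν : ι) :
    preA (fun α β => (lam α)⁻¹ * (lam β)⁻¹ * I α β) (fun α β => lam α * lam β * h α β)
      (fun γ α β => r⁻¹ * (lam γ * lam α * lam β) * c γ α β)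
      (fun α ν => r⁻¹ * (lam α * (lam ν)⁻¹) * v α ν) (fun α => (lam α)⁻¹ * ξ α) μ ν =
      r⁻¹ * ((lam μ)⁻¹ * (lam ν)⁻¹) * preA I h c v ξ μ ν := by
  have e1 : ∑ α, ∑ β, (lam α)⁻¹ * (lam β)⁻¹ * I α β * (lam α * lam β * h α β) =
      ∑ α, ∑ β, I α β * h α β :=
    Finset.sum_congr rfl fun α _ => Finset.sum_congr rfl fun β _ => by
      have h1 := hl α; have h2 := hl β; field_simp
  simp only [preA, e1, mul_add, mul_sub, Finset.mul_sum]
  congr 1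
  · congr 1
    · congr 1
      · congr 1
        · refine Finset.sum_congr rfl fun l _ => ?_
          have h1 := hl l; field_simp
        · refine Finset.sum_congr rfl fun α _ => Finset.sum_congr rfl fun β _ =>
            Finset.sum_congr rfl fun γ _ => ?_
          have h1 := hl α; have h2 := hl β; have h3 := hl γ; field_simp
      · refine Finset.sum_congr rfl fun α _ => Finset.sum_congr rfl fun β _ =>
          Finset.sum_congr rfl fun γ _ => ?_
        have h1 := hl α; have h2 := hl β; have h3 := hl γ; field_simp
    · refine Finset.sum_congr rfl fun α _ => Finset.sum_congr rfl fun β _ =>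
        Finset.sum_congr rfl fun γ _ => ?_
      have h1 := hl α; have h2 := hl β; have h3 := hl γ; field_simp
  · refine Finset.sum_congr rfl fun α _ => Finset.sum_congr rfl fun β _ =>
      Finset.sum_congr rfl fun γ _ => ?_
    have h1 := hl α; have h2 := hl β; have h3 := hl γ; field_simp

theorem inverse_scale (lam : ι → ℝ) (hl : ∀ μ, lam μ ≠ 0) (A : Matrix ι ι ℝ) (μ ν : ι) :
    (Matrix.of fun α β => lam α * lam β * A α β)⁻¹ μ ν = (lam μ)⁻¹ * (lam ν)⁻¹ * A⁻¹ μ ν := by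
  have h1 : (Matrix.of fun α β => lam α * lam β * A α β) =
      Matrix.diagonal lam * A * Matrix.diagonal lam := by
    ext i j; simp [Matrix.diagonal_mul, Matrix.mul_diagonal]; ring
  have h2 : (Matrix.diagonal lam)⁻¹ = Matrix.diagonal fun μ => (lam μ)⁻¹ := by
    refine Matrix.inv_eq_right_inv ?_
    rw [Matrix.diagonal_mul_diagonal, ← Matrix.diagonal_one]
    congr 1; ext i; exact mul_inv_cancel₀ (hl i)
  rw [h1, Matrix.mul_inv_rev, Matrix.mul_inv_rev, h2]
  simp [Matrix.diagonal_mul, Matrix.mul_diagonal]; ring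

theorem det_scale (lam : ι → ℝ) (A : Matrix ι ι ℝ) :
    (Matrix.of fun α β => lam α * lam β * A α β).det = (∏ μ, lam μ) ^ 2 * A.det := by
  have h1 : (Matrix.of fun α β => lam α * lam β * A α β) =
      Matrix.diagonal lam * A * Matrix.diagonal lam := by
    ext i j; simp [Matrix.diagonal_mul, Matrix.mul_diagonal]; ring
  rw [h1, Matrix.det_mul, Matrix.det_mul, Matrix.det_diagonal]; ring

end Algebra

/-! ### Contractions of block-diagonal tensors -/

section Block

variable {n : ℕ}

/-- The two indices `t, ρ`. -/
def planeIdx (n : ℕ) (b : Bool) : Fin (n + 2) := if b then 1 else 0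

/-- A 2-tensor without mixed components between the `t, ρ` plane and the cross-section. -/
structure BlockDiag (h : Fin (n + 2) → Fin (n + 2) → ℝ) : Prop where
  left : ∀ (a : Bool) (M : Fin n), h (planeIdx n a) M.succ.succ = 0
  right : ∀ (M : Fin n) (a : Bool), h M.succ.succ (planeIdx n a) = 0

/-- A 3-tensor that has only `t, ρ` components. -/
structure PlaneOnly (c : Fin (n + 2) → Fin (n + 2) → Fin (n + 2) → ℝ) : Prop where
  fst : ∀ (M : Fin n) α β, c M.succ.succ α β = 0
  snd : ∀ γ (M : Fin n) β, c γ M.succ.succ β = 0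
  trd : ∀ γ α (M : Fin n), c γ α M.succ.succ = 0

theorem sum_plane {F : Fin (n + 2) → ℝ} (h : ∀ M : Fin n, F M.succ.succ = 0) :
    ∑ μ, F μ = ∑ a, F (planeIdx n a) := by
  rw [sum_split]; simp [h, planeIdx, add_comm (F 0)]

theorem sum_plane_add (F : Fin (n + 2) → ℝ) :
    ∑ μ, F μ = ∑ a, F (planeIdx n a) + ∑ M : Fin n, F M.succ.succ := by
  rw [sum_split]; simp [planeIdx, add_comm (F 0)]

variable {I h h₁ h₂ : Fin (n + 2) → Fin (n + 2) → ℝ}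
  {c c₁ c₂ dg dh Γ : Fin (n + 2) → Fin (n + 2) → Fin (n + 2) → ℝ}

/-- Restriction of a 2-tensor to the `t, ρ` plane. -/
def res2 (h : Fin (n + 2) → Fin (n + 2) → ℝ) (a b : Bool) : ℝ := h (planeIdx n a) (planeIdx n b)

/-- Restriction of a 3-tensor to the `t, ρ` plane. -/
def res3 (c : Fin (n + 2) → Fin (n + 2) → Fin (n + 2) → ℝ) (a b d : Bool) : ℝ :=
  c (planeIdx n a) (planeIdx n b) (planeIdx n d)

/-- The trace of the cross-section block. -/
def crossTr (I h : Fin (n + 2) → Fin (n + 2) → ℝ) : ℝ :=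
  ∑ M : Fin n, ∑ N : Fin n, I M.succ.succ N.succ.succ * h M.succ.succ N.succ.succ

/-- The vector `∇_β h^{αβ} - ∇^α h` in the `t, ρ` plane. -/
def divVec (I : Bool → Bool → ℝ) (c : Bool → Bool → Bool → ℝ) (a : Bool) : ℝ :=
  ∑ α, ∑ β, ∑ γ, (I a α * I β γ - I a γ * I α β) * c γ α β

theorem chrA_planeOnly (hI : BlockDiag I) (hd : PlaneOnly dg) : PlaneOnly (chrA I dg) := by
  have hd1 := hd.fst
  have hd2 := hd.snd
  have hd3 := hd.trd
  refine ⟨fun M α β => ?_, fun γ M β => ?_, fun γ α M => ?_⟩ <;> unfold chrA <;>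
    rw [sum_plane_add] <;> simp [hd1, hd2, hd3, hI.right]

theorem res3_chrA (hd : PlaneOnly dg) :
    res3 (chrA I dg) = chrA (res2 I) (res3 dg) := by
  have hd1 := hd.fst
  have hd2 := hd.snd
  have hd3 := hd.trd
  ext a b d
  unfold res3 chrA
  rw [sum_plane fun M => by simp [hd1, hd2, hd3]]
  rfl

theorem covA_planeOnly (hh : BlockDiag h) (hΓ : PlaneOnly Γ) (hd : PlaneOnly dh) :
    PlaneOnly (covA Γ h dh) := by
  have hd1 := hd.fst
  have hd2 := hd.snd
  have hd3 := hd.trd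
  have h1 := hΓ.fst
  have h2 := hΓ.snd
  have h3 := hΓ.trd
  refine ⟨fun M α β => ?_, fun γ M β => ?_, fun γ α M => ?_⟩ <;> unfold covA <;>
    rw [sum_plane_add] <;> simp [hd1, hd2, hd3, h1, h2, h3, hh.left, hh.right]

theorem res3_covA (hΓ : PlaneOnly Γ) :
    res3 (covA Γ h dh) = covA (res3 Γ) (res2 h) (res3 dh) := by
  have h1 := hΓ.fst
  ext a b d
  unfold res3 covA
  rw [sum_plane fun M => by simp [h1]]
  rfl

/-- The covariant derivatives have plane indices only, so with a block-diagonal inverse a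
cross-section index can occur only in an undifferentiated perturbation, contracted with itself. This
produces the trace times the plane vector ∇_β h^{αβ} - ∇^α h. -/
theorem omA_plane (hI : BlockDiag I) (h₁b : BlockDiag h₁) (h₂b : BlockDiag h₂) (hc₁ : PlaneOnly c₁)
    (hc₂ : PlaneOnly c₂) (a : Bool) :
    omA I h₁ h₂ c₁ c₂ (planeIdx n a) =
      omA (res2 I) (res2 h₁) (res2 h₂) (res3 c₁) (res3 c₂) a +
        (1 / 2) * (crossTr I h₁ * divVec (res2 I) (res3 c₂) a -
          crossTr I h₂ * divVec (res2 I) (res3 c₁) a) := by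
  have a1 := hc₁.fst
  have a2 := hc₁.snd
  have a3 := hc₁.trd
  have b1 := hc₂.fst
  have b2 := hc₂.snd
  have b3 := hc₂.trd
  have e : (1 / 2) * (crossTr I h₁ * divVec (res2 I) (res3 c₂) a -
      crossTr I h₂ * divVec (res2 I) (res3 c₁) a) =
      ∑ M : Fin n, ∑ N : Fin n, ∑ α : Bool, ∑ β : Bool, ∑ γ : Bool, I M.succ.succ N.succ.succ *
        (res2 I a α * res2 I β γ - res2 I a γ * res2 I α β) *
        ((1 / 2) * (h₁ M.succ.succ N.succ.succ * res3 c₂ γ α β -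
          h₂ M.succ.succ N.succ.succ * res3 c₁ γ α β)) := by
    have e' : ∀ M N : Fin n, ∑ α : Bool, ∑ β : Bool, ∑ γ : Bool, I M.succ.succ N.succ.succ *
        (res2 I a α * res2 I β γ - res2 I a γ * res2 I α β) *
        ((1 / 2) * (h₁ M.succ.succ N.succ.succ * res3 c₂ γ α β -
          h₂ M.succ.succ N.succ.succ * res3 c₁ γ α β)) =
        (1 / 2) * (I M.succ.succ N.succ.succ * h₁ M.succ.succ N.succ.succ *
            divVec (res2 I) (res3 c₂) a -
          I M.succ.succ N.succ.succ * h₂ M.succ.succ N.succ.succ *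
            divVec (res2 I) (res3 c₁) a) := by
      intro M N
      simp only [divVec, Fintype.sum_bool]
      ring
    simp only [e', ← Finset.mul_sum, Finset.sum_sub_distrib, ← Finset.sum_mul, crossTr]
  rw [e]
  unfold omA
  simp only [sum_plane_add, a1, a2, a3, b1, b2, b3, hI.left, hI.right, h₁b.left, h₁b.right, h₂b.left,
    h₂b.right, mul_zero, zero_mul, sub_zero, add_zero, Finset.sum_const_zero, zero_add]
  congr 1
  refine Finset.sum_congr rfl fun M _ => Finset.sum_congr rfl fun N _ =>
    Finset.sum_congr rfl fun α _ => Finset.sum_congr rfl fun β _ =>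
    Finset.sum_congr rfl fun γ _ => ?_
  simp only [res2, res3]
  ring

end Block

/-! ### The leading order of the current in the `t, ρ` plane -/

section Plane

/-- The symmetric tensor in the plane with components `p = tt`, `q = tρ`, `r = ρρ`. -/
def symB (p q r : ℝ) (a b : Bool) : ℝ := if a then (if b then r else q) else (if b then q else p)

/-- A 3-tensor in the plane from the derivatives along `t` and along `ρ`. -/
def tens3 (D₀ D₁ : Bool → Bool → ℝ) (c a b : Bool) : ℝ := if c then D₁ a b else D₀ a b

variable (E B M s j γ : ℝ)

/-- The leading order of a metric in the orbit of the background. -/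
def planeG : Bool → Bool → ℝ := symB (E * (B ^ 2 - M)) (E * B) E

/-- The inverse of `planeG`. -/
def planeI : Bool → Bool → ℝ := symB (-1 / (M * E)) (B / (M * E)) ((M - B ^ 2) / (M * E))

/-- The derivatives of the metric with leading order `planeG`. -/
def planeDG : Bool → Bool → Bool → ℝ :=
  tens3 (symB (2 * B * (E * (B ^ 2 - M))) (2 * B * (E * B)) (2 * B * E))
    (symB (2 * (E * (B ^ 2 - M))) (E * B) 0)

/-- The leading order of a Lie derivative of the metric. -/
def planeH : Bool → Bool → ℝ :=
  symB (E * (2 * (B ^ 2 - M) * s + 2 * B * j - 2 * M * γ)) (E * (2 * B * s + j)) (E * (2 * s))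

/-- The derivatives of the perturbation with leading order `planeH`. -/
def planeDH : Bool → Bool → Bool → ℝ :=
  tens3 (symB (2 * B * (E * (2 * (B ^ 2 - M) * s + 2 * B * j - 2 * M * γ)) +
      E * (2 * (B ^ 2 - M) * j))
    (2 * B * (E * (2 * B * s + j)) + E * (2 * B * j)) (2 * B * (E * (2 * s)) + E * (2 * j)))
  (symB (2 * (E * (2 * (B ^ 2 - M) * s + 2 * B * j - 2 * M * γ))) (E * (2 * B * s + j)) 0)

variable {E B M}

/-- For E((dρ + Bρ dt)² - Mρ² dt²) the factor E drops out, since it enters only through ∂_t E / E =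
2B. -/
theorem chrA_plane (hE : E ≠ 0) (hM : M ≠ 0) (a b c : Bool) :
    chrA (planeI E B M) (planeDG E B M) a b c =
      if a then symB (M - B ^ 2) 0 0 b c else symB (2 * B) 1 0 b c := by
  have hME : M * E ≠ 0 := mul_ne_zero hM hE
  cases a <;> cases b <;> cases c <;>
    simp only [chrA, planeI, planeDG, symB, tens3, Fintype.sum_bool, if_true, if_false,
      Bool.false_eq_true] <;> field_simp <;> ring

/-- On the horizon the rescaled ρ-derivative of a perturbation is covariantly zero, and s drops out:
it describes a change of E. This sparsity makes the evaluations of the current and of the charge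
short. -/
theorem covA_plane (hE : E ≠ 0) (hM : M ≠ 0) (c a b : Bool) :
    covA (chrA (planeI E B M) (planeDG E B M)) (planeH E B M s j γ) (planeDH E B M s j γ) c a b =
      if c then 0 else symB (4 * E * M * (B * γ - j)) (2 * E * M * γ) 0 a b := by
  cases a <;> cases b <;> cases c <;>
    simp only [covA, chrA_plane hE hM, planeH, planeDH, symB, tens3, Fintype.sum_bool, if_true,
      if_false, Bool.false_eq_true] <;> ring

theorem covA_plane_fun (hE : E ≠ 0) (hM : M ≠ 0) :
    covA (chrA (planeI E B M) (planeDG E B M)) (planeH E B M s j γ) (planeDH E B M s j γ) =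
      fun c a b => if c then 0 else symB (4 * E * M * (B * γ - j)) (2 * E * M * γ) 0 a b := by
  ext c a b
  exact covA_plane s j γ hE hM c a b

theorem divVec_plane (hE : E ≠ 0) (hM : M ≠ 0) (a : Bool) :
    divVec (planeI E B M)
      (covA (chrA (planeI E B M) (planeDG E B M)) (planeH E B M s j γ) (planeDH E B M s j γ)) a =
      if a then -2 * γ / E else 0 := by
  rw [covA_plane_fun s j γ hE hM]
  cases a <;>
    simp only [divVec, planeI, symB, Fintype.sum_bool, if_true,
      if_false, Bool.false_eq_true] <;> field_simp <;> ring

/-- Leaves the trace terms of `omA_plane` as the only contribution to the current on the horizon. -/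
theorem omA_plane_zero (hE : E ≠ 0) (hM : M ≠ 0) (s' j' γ' : ℝ) (a : Bool) :
    omA (planeI E B M) (planeH E B M s j γ) (planeH E B M s' j' γ')
      (covA (chrA (planeI E B M) (planeDG E B M)) (planeH E B M s j γ) (planeDH E B M s j γ))
      (covA (chrA (planeI E B M) (planeDG E B M)) (planeH E B M s' j' γ')
        (planeDH E B M s' j' γ')) a = 0 := by
  rw [covA_plane_fun s j γ hE hM, covA_plane_fun s' j' γ' hE hM]
  cases a <;>
    simp only [omA, planeI, planeH, symB, Fintype.sum_bool, if_true,
      if_false, Bool.false_eq_true, mul_zero, zero_mul, sub_zero, zero_sub, add_zero, zero_add,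
      sub_self] <;> field_simp <;> ring

end Plane

/-! ### Rescaled components

The `t`-components of covariant tensors are divided by `ρ`. -/

section Hat

variable {n : ℕ} {s V : Set (Fin (n + 2) → ℝ)}

/-- The weight of an index: `1` for `t`, `0` otherwise. -/
def wt (μ : Fin (n + 2)) : ℝ := if μ = 0 then 1 else 0

/-- The scale factor of an index: `ρ` for `t`, `1` otherwise. -/
def lam (x : Fin (n + 2) → ℝ) (μ : Fin (n + 2)) : ℝ := if μ = 0 then x 1 else 1

@[simp] theorem lam_zero (x : Fin (n + 2) → ℝ) : lam x 0 = x 1 := if_pos rfl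

@[simp] theorem lam_one (x : Fin (n + 2) → ℝ) : lam x 1 = 1 := if_neg (by simp)

@[simp] theorem lam_succ (x : Fin (n + 2) → ℝ) (M : Fin n) : lam x M.succ.succ = 1 :=
  if_neg (succ_succ_ne_zero M)

@[simp] theorem wt_zero : wt (0 : Fin (n + 2)) = 1 := if_pos rfl

@[simp] theorem wt_one : wt (1 : Fin (n + 2)) = 0 := if_neg (by simp)

@[simp] theorem wt_succ (M : Fin n) : wt M.succ.succ = 0 := if_neg (succ_succ_ne_zero M)

theorem lam_ne {x : Fin (n + 2) → ℝ} (h : x 1 ≠ 0) (μ : Fin (n + 2)) : lam x μ ≠ 0 := by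
  unfold lam; split_ifs <;> simp [h]

theorem prod_lam (x : Fin (n + 2) → ℝ) : ∏ μ, lam x μ = x 1 := by
  simp [lam]

theorem contDiff_lam (μ : Fin (n + 2)) : ContDiff ℝ ∞ fun x : Fin (n + 2) → ℝ => lam x μ := by
  unfold lam; split_ifs <;> fun_prop

/-- `F` are the rescaled components of `h` on `V`. -/
structure Hat (V : Set (Fin (n + 2) → ℝ)) (h F : Fin (n + 2) → Fin (n + 2) → (Fin (n + 2) → ℝ) → ℝ) :
    Prop where
  smooth : ∀ α β, ContDiffOn ℝ ∞ (F α β) V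
  eq : ∀ α β, ∀ x ∈ V, h α β x = lam x α * lam x β * F α β x

/-- The derivative in the direction `μ`, rescaled. -/
def hatPd (s : Set (Fin (n + 2) → ℝ)) (μ : Fin (n + 2)) (f : (Fin (n + 2) → ℝ) → ℝ)
    (x : Fin (n + 2) → ℝ) : ℝ :=
  if μ = 0 then pd s 0 f x else x 1 * pd s μ f x

/-- The rescaled derivatives of the components of a 2-tensor, from its rescaled components. -/
def hatD (s : Set (Fin (n + 2) → ℝ)) (F : Fin (n + 2) → Fin (n + 2) → (Fin (n + 2) → ℝ) → ℝ)
    (γ α β : Fin (n + 2)) (x : Fin (n + 2) → ℝ) : ℝ :=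
  hatPd s γ (F α β) x + if γ = 1 then (wt α + wt β) * F α β x else 0

theorem Nested.pd_lam (N : Nested s V) (γ α : Fin (n + 2)) {x : Fin (n + 2) → ℝ} (hx : x ∈ V) :
    pd s γ (fun y => lam y α) x = if γ = 1 then wt α else 0 := by
  unfold lam wt
  split_ifs with h1 h2 h2
  · rw [N.pd_coord γ 1 hx, h2]; simp
  · rw [N.pd_coord γ 1 hx, if_neg (Ne.symm h2)]
  · simp [pd]
  · simp [pd]

theorem Hat.pd_eq {h F} (hF : Hat V h F) (N : Nested s V) (γ α β : Fin (n + 2))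
    {x : Fin (n + 2) → ℝ} (hx : x ∈ V) :
    pd s γ (h α β) x = lam x α * lam x β * pd s γ (F α β) x +
      (if γ = 1 then (wt α * lam x β + lam x α * wt β) * F α β x else 0) := by
  have h1 := (contDiff_lam (n := n) α).contDiffOn (s := V)
  have h2 := (contDiff_lam (n := n) β).contDiffOn (s := V)
  have h3 := hF.smooth α β
  rw [N.pd_congr (hF.eq α β) γ hx, N.pd_mul (f := fun y => lam y α * lam y β) (by fun_prop) h3 γ hx,
    N.pd_mul h1 h2 γ hx, N.pd_lam γ α hx, N.pd_lam γ β hx]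
  split_ifs <;> ring

theorem wt_mul_lam (x : Fin (n + 2) → ℝ) (α : Fin (n + 2)) : wt α * x 1 = wt α * lam x α := by
  unfold wt lam; split_ifs <;> ring

/-- Leibniz: besides ∂F there is the derivative of the factors λ, present only along ρ and equal to
the weights of the indices. The prefactor is arranged so that λ_γ/ρ is 1 along t and 1/ρ otherwise;
the latter is offset by the factor ρ in `hatPd`. -/
theorem Hat.pd_hat {h F} (hF : Hat V h F) (N : Nested s V) (γ α β : Fin (n + 2))
    {x : Fin (n + 2) → ℝ} (hx : x ∈ V) (h1 : x 1 ≠ 0) :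
    pd s γ (h α β) x = (x 1)⁻¹ * (lam x γ * lam x α * lam x β) * hatD s F γ α β x := by
  rw [hF.pd_eq N γ α β hx]
  have e1 : wt α = (x 1)⁻¹ * (wt α * lam x α) := by rw [← wt_mul_lam]; field_simp
  have e2 : wt β = (x 1)⁻¹ * (wt β * lam x β) := by rw [← wt_mul_lam]; field_simp
  unfold hatD hatPd
  rcases eq_or_ne γ 0 with rfl | h0
  · have h01 : (0 : Fin (n + 2)) ≠ 1 := by simp
    rw [if_neg h01, if_pos rfl, if_neg h01, lam_zero]; field_simp; ring
  · rw [if_neg h0, show lam x γ = 1 from if_neg h0]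
    rcases eq_or_ne γ 1 with rfl | h2
    · rw [if_pos rfl, if_pos rfl]
      conv_lhs => rw [e1, e2]
      field_simp
    · rw [if_neg h2, if_neg h2]; field_simp; ring

theorem contDiffOn_hatPd (N : Nested s V) {f : (Fin (n + 2) → ℝ) → ℝ} (hf : ContDiffOn ℝ ∞ f V)
    (μ : Fin (n + 2)) : ContDiffOn ℝ ∞ (hatPd s μ f) V := by
  have := N.contDiffOn_pd hf
  unfold hatPd
  split_ifs <;> fun_prop

theorem contDiffOn_hatD (N : Nested s V) {F : Fin (n + 2) → Fin (n + 2) → (Fin (n + 2) → ℝ) → ℝ}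
    (hF : ∀ α β, ContDiffOn ℝ ∞ (F α β) V) (γ α β : Fin (n + 2)) :
    ContDiffOn ℝ ∞ (hatD s F γ α β) V := by
  have h1 := contDiffOn_hatPd N (hF α β) γ
  have h2 := hF α β
  unfold hatD
  split_ifs <;> fun_prop

/-- Rescaled Christoffel symbols. -/
def hatChr (s : Set (Fin (n + 2) → ℝ)) (F : Fin (n + 2) → Fin (n + 2) → (Fin (n + 2) → ℝ) → ℝ)
    (l μ ν : Fin (n + 2)) (x : Fin (n + 2) → ℝ) : ℝ :=
  chrA (fun α β => inv F α β x) (fun γ α β => hatD s F γ α β x) l μ ν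

/-- The rescaled covariant derivative of a 2-tensor. -/
def hatCov (s : Set (Fin (n + 2) → ℝ)) (F H : Fin (n + 2) → Fin (n + 2) → (Fin (n + 2) → ℝ) → ℝ)
    (γ α β : Fin (n + 2)) (x : Fin (n + 2) → ℝ) : ℝ :=
  covA (fun l μ ν => hatChr s F l μ ν x) (fun α β => H α β x) (fun γ α β => hatD s H γ α β x) γ α β

/-- The rescaled pre-symplectic current. -/
def hatOmega (GN : ℝ) (s : Set (Fin (n + 2) → ℝ))
    (F H₁ H₂ : Fin (n + 2) → Fin (n + 2) → (Fin (n + 2) → ℝ) → ℝ) (ν : Fin (n + 2))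
    (x : Fin (n + 2) → ℝ) : ℝ :=
  Real.sqrt (-metricDet F x) / (16 * Real.pi * GN) *
    omA (fun α β => inv F α β x) (fun α β => H₁ α β x) (fun α β => H₂ α β x)
      (fun γ α β => hatCov s F H₁ γ α β x) (fun γ α β => hatCov s F H₂ γ α β x) ν

section Smooth

variable {F H H₁ H₂ : Fin (n + 2) → Fin (n + 2) → (Fin (n + 2) → ℝ) → ℝ} (N : Nested s V)
  (hF : ∀ α β, ContDiffOn ℝ ∞ (F α β) V) (hdet : ∀ x ∈ V, metricDet F x ≠ 0)

include hF hdet in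
theorem contDiffOn_inv (α β : Fin (n + 2)) : ContDiffOn ℝ ∞ (inv F α β) V :=
  contDiffOn_inverse hF hdet α β

include N hF hdet

theorem contDiffOn_hatChr (l μ ν : Fin (n + 2)) : ContDiffOn ℝ ∞ (hatChr s F l μ ν) V := by
  have h1 := contDiffOn_inv hF hdet
  have h2 := contDiffOn_hatD N hF
  unfold hatChr chrA
  fun_prop

theorem contDiffOn_hatCov (hH : ∀ α β, ContDiffOn ℝ ∞ (H α β) V) (γ α β : Fin (n + 2)) :
    ContDiffOn ℝ ∞ (hatCov s F H γ α β) V := by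
  have h1 := contDiffOn_hatChr N hF hdet
  have h2 := contDiffOn_hatD N hH
  unfold hatCov covA
  fun_prop

theorem contDiffOn_hatOmega (hH₁ : ∀ α β, ContDiffOn ℝ ∞ (H₁ α β) V)
    (hH₂ : ∀ α β, ContDiffOn ℝ ∞ (H₂ α β) V) (GN : ℝ) (ν : Fin (n + 2)) :
    ContDiffOn ℝ ∞ (hatOmega GN s F H₁ H₂ ν) V := by
  have h1 := contDiffOn_inv hF hdet
  have h2 := contDiffOn_hatCov N hF hdet hH₁
  have h3 := contDiffOn_hatCov N hF hdet hH₂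
  have h4 : ContDiffOn ℝ ∞ (fun x => Real.sqrt (-metricDet F x)) V :=
    ContDiffOn.sqrt (contDiffOn_det hF).neg fun x hx => neg_ne_zero.2 (hdet x hx)
  unfold hatOmega
  refine ContDiffOn.mul (h4.div_const _) ?_
  unfold omA
  fun_prop

end Smooth

variable {g h h₁ h₂ F H H₁ H₂ : Fin (n + 2) → Fin (n + 2) → (Fin (n + 2) → ℝ) → ℝ}
  {x : Fin (n + 2) → ℝ}

theorem Hat.inv_eq (hg : Hat V g F) (hx : x ∈ V) (h1 : x 1 ≠ 0) (α β : Fin (n + 2)) :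
    inv g α β x = (lam x α)⁻¹ * (lam x β)⁻¹ * inv F α β x := by
  have e : (Matrix.of fun α β => g α β x) =
      Matrix.of fun α β => lam x α * lam x β * (Matrix.of fun α β => F α β x) α β := by
    ext α β; exact hg.eq α β x hx
  rw [inv, e, inverse_scale _ (lam_ne h1)]; rfl

theorem Hat.metricDet_eq (hg : Hat V g F) (hx : x ∈ V) :
    metricDet g x = x 1 ^ 2 * metricDet F x := by
  have e : (Matrix.of fun α β => g α β x) =
      Matrix.of fun α β => lam x α * lam x β * (Matrix.of fun α β => F α β x) α β := by
    ext α β; exact hg.eq α β x hx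
  rw [metricDet, e, det_scale, prod_lam]; rfl

theorem Hat.sqrt_det_eq (hg : Hat V g F) (hx : x ∈ V) (h1 : 0 < x 1) :
    Real.sqrt (-metricDet g x) = x 1 * Real.sqrt (-metricDet F x) := by
  rw [hg.metricDet_eq hx, ← mul_neg, Real.sqrt_mul (sq_nonneg _), Real.sqrt_sq h1.le]

theorem Hat.christoffel_eq (hg : Hat V g F) (N : Nested s V) (hx : x ∈ V) (h1 : x 1 ≠ 0)
    (l μ ν : Fin (n + 2)) : christoffel s g l μ ν x =
      (x 1)⁻¹ * ((lam x l)⁻¹ * lam x μ * lam x ν) * hatChr s F l μ ν x := by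
  rw [KillingHorizon.christoffel_eq, hatChr, ← chrA_scale (lam_ne h1)]
  simp only [hg.inv_eq hx h1, hg.pd_hat N _ _ _ hx h1]

theorem Hat.covT_eq (hg : Hat V g F) (hh : Hat V h H) (N : Nested s V) (hx : x ∈ V) (h1 : x 1 ≠ 0)
    (γ α β : Fin (n + 2)) : covT s g h γ α β x =
      (x 1)⁻¹ * (lam x γ * lam x α * lam x β) * hatCov s F H γ α β x := by
  rw [KillingHorizon.covT_eq, hatCov, ← covA_scale (lam_ne h1)]
  simp only [hg.christoffel_eq N hx h1, hh.pd_hat N _ _ _ hx h1, hh.eq _ _ x hx]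

/-- The density √(-g) supplies a factor ρ, which cancels the ρ⁻¹ of the one derivative. Only the
free index keeps a factor, so ω^ρ and ω^M extend smoothly and ω^t has at most a simple pole. -/
theorem Hat.omega_eq (hg : Hat V g F) (hh₁ : Hat V h₁ H₁) (hh₂ : Hat V h₂ H₂) (N : Nested s V)
    (hx : x ∈ V) (h1 : 0 < x 1) (GN : ℝ) (ν : Fin (n + 2)) :
    omega GN s g h₁ h₂ ν x = (lam x ν)⁻¹ * hatOmega GN s F H₁ H₂ ν x := by
  have h2 := h1.ne'
  rw [KillingHorizon.omega_eq, hg.sqrt_det_eq hx h1]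
  simp only [hg.inv_eq hx h2, hh₁.eq _ _ x hx, hh₂.eq _ _ x hx, hg.covT_eq hh₁ N hx h2,
    hg.covT_eq hh₂ N hx h2]
  rw [omA_scale (lam_ne h2), hatOmega]
  field_simp

end Hat

/-! ### Leading order at the horizon -/

section Horizon

variable {n : ℕ} {s V : Set (Fin (n + 2) → ℝ)}

theorem planeIdx_true : planeIdx n true = 1 := rfl

theorem planeIdx_false : planeIdx n false = 0 := rfl

/-- The splitting of the indices into `t, ρ` and the cross-section. -/
def indexEquiv (n : ℕ) : Bool ⊕ Fin n ≃ Fin (n + 2) :=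
  Equiv.ofBijective (Sum.elim (planeIdx n) fun P => P.succ.succ) <| by
    refine ⟨?_, fun μ => ?_⟩
    · rintro (a | P) (b | Q) h
      · cases a <;> cases b <;> simp [planeIdx] at h ⊢
      · cases a
        · exact absurd h.symm (succ_succ_ne_zero Q)
        · exact absurd h.symm (succ_succ_ne_one Q)
      · cases b
        · exact absurd h (succ_succ_ne_zero P)
        · exact absurd h (succ_succ_ne_one P)
      · simpa using h
    · revert μ
      exact index_cases ⟨.inl false, rfl⟩ ⟨.inl true, rfl⟩ fun M => ⟨.inr M, rfl⟩

/-- The rescaled components `F` of a metric that at the horizon has the leading order shared by all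
metrics in the orbit of the background. -/
structure OrbitMetric (s V : Set (Fin (n + 2) → ℝ))
    (F : Fin (n + 2) → Fin (n + 2) → (Fin (n + 2) → ℝ) → ℝ) (E B M : (Fin (n + 2) → ℝ) → ℝ) :
    Prop where
  nested : Nested s V
  smooth : ∀ α β, ContDiffOn ℝ ∞ (F α β) V
  smooth_E : ContDiffOn ℝ ∞ E V
  smooth_B : ContDiffOn ℝ ∞ B V
  smooth_M : ContDiffOn ℝ ∞ M V
  det_ne : ∀ x ∈ V, metricDet F x ≠ 0
  E_ne : ∀ x ∈ V, E x ≠ 0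
  M_ne : ∀ x ∈ V, M x ≠ 0
  plane : ∀ x ∈ V, x 1 = 0 → ∀ a b,
    F (planeIdx n a) (planeIdx n b) x = planeG (E x) (B x) (M x) a b
  left : ∀ x ∈ V, x 1 = 0 → ∀ a (P : Fin n), F (planeIdx n a) P.succ.succ x = 0
  right : ∀ x ∈ V, x 1 = 0 → ∀ (P : Fin n) a, F P.succ.succ (planeIdx n a) x = 0
  symm : ∀ x ∈ V, x 1 = 0 → ∀ P Q : Fin n, F P.succ.succ Q.succ.succ x = F Q.succ.succ P.succ.succ x
  pd_E : ∀ x ∈ V, x 1 = 0 → pd s 0 E x = 2 * B x * E x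
  pd_B : ∀ x ∈ V, x 1 = 0 → pd s 0 B x = 0
  pd_M : ∀ x ∈ V, x 1 = 0 → pd s 0 M x = 0
  pd_cross : ∀ x ∈ V, x 1 = 0 → ∀ P Q : Fin n, pd s 0 (F P.succ.succ Q.succ.succ) x = 0

/-- The rescaled components `H` of a perturbation that at the horizon has the leading order of a
Lie derivative of the metric. -/
structure OrbitPert (s V : Set (Fin (n + 2) → ℝ)) (E B M : (Fin (n + 2) → ℝ) → ℝ)
    (H : Fin (n + 2) → Fin (n + 2) → (Fin (n + 2) → ℝ) → ℝ) (S j γ : (Fin (n + 2) → ℝ) → ℝ) :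
    Prop where
  smooth : ∀ α β, ContDiffOn ℝ ∞ (H α β) V
  smooth_S : ContDiffOn ℝ ∞ S V
  smooth_j : ContDiffOn ℝ ∞ j V
  smooth_γ : ContDiffOn ℝ ∞ γ V
  plane : ∀ x ∈ V, x 1 = 0 → ∀ a b, H (planeIdx n a) (planeIdx n b) x =
    planeH (E x) (B x) (M x) (S x) (j x) (γ x) a b
  left : ∀ x ∈ V, x 1 = 0 → ∀ a (P : Fin n), H (planeIdx n a) P.succ.succ x = 0
  right : ∀ x ∈ V, x 1 = 0 → ∀ (P : Fin n) a, H P.succ.succ (planeIdx n a) x = 0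
  pd_S : ∀ x ∈ V, x 1 = 0 → pd s 0 S x = j x
  pd_j : ∀ x ∈ V, x 1 = 0 → pd s 0 j x = 0
  pd_γ : ∀ x ∈ V, x 1 = 0 → pd s 0 γ x = 0
  pd_cross : ∀ x ∈ V, x 1 = 0 → ∀ P Q : Fin n, pd s 0 (H P.succ.succ Q.succ.succ) x = 0

variable {F H H₁ H₂ : Fin (n + 2) → Fin (n + 2) → (Fin (n + 2) → ℝ) → ℝ}
  {E B M S j γ S₁ j₁ γ₁ S₂ j₂ γ₂ : (Fin (n + 2) → ℝ) → ℝ} {x : Fin (n + 2) → ℝ}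

/-- At the horizon only the `t`- and `ρ`-derivatives of the plane components survive. -/
theorem hatD_planeOnly (N : Nested s V) (hH : ∀ α β, ContDiffOn ℝ ∞ (H α β) V)
    (left : ∀ x ∈ V, x 1 = 0 → ∀ a (P : Fin n), H (planeIdx n a) P.succ.succ x = 0)
    (right : ∀ x ∈ V, x 1 = 0 → ∀ (P : Fin n) a, H P.succ.succ (planeIdx n a) x = 0)
    (cross : ∀ x ∈ V, x 1 = 0 → ∀ P Q : Fin n, pd s 0 (H P.succ.succ Q.succ.succ) x = 0)
    (hx : x ∈ V) (h0 : x 1 = 0) : PlaneOnly (fun γ α β => hatD s H γ α β x) := by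
  have z : ∀ α β, (∀ x ∈ V, x 1 = 0 → H α β x = 0) → pd s 0 (H α β) x = 0 := fun α β h => by
    rw [N.pd_tangential (hH α β) (g := fun _ => 0) contDiffOn_const h (by simp) hx h0]; simp [pd]
  have l0 := fun P x hx h => left x hx h false P
  have l1 := fun P x hx h => left x hx h true P
  have r0 := fun P x hx h => right x hx h P false
  have r1 := fun P x hx h => right x hx h P true
  simp only [planeIdx_true, planeIdx_false] at l0 l1 r0 r1
  refine ⟨fun P α β => ?_, fun γ P => index_cases ?_ ?_ fun Q => ?_,
    fun γ => index_cases (fun P => ?_) (fun P => ?_) fun Q P => ?_⟩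
  · simp [hatD, hatPd, succ_succ_ne_one, h0]
  all_goals
    simp only [hatD, hatPd, h0, zero_mul, wt_succ, wt_zero, wt_one, zero_add, add_zero]
    split_ifs <;> simp_all

theorem OrbitPert.blockDiag (P : OrbitPert s V E B M H S j γ) (hx : x ∈ V) (h0 : x 1 = 0) :
    BlockDiag (fun α β => H α β x) :=
  ⟨P.left x hx h0, P.right x hx h0⟩

theorem OrbitPert.res2_eq (P : OrbitPert s V E B M H S j γ) (hx : x ∈ V) (h0 : x 1 = 0) :
    res2 (fun α β => H α β x) = planeH (E x) (B x) (M x) (S x) (j x) (γ x) := by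
  ext a b
  exact P.plane x hx h0 a b

namespace OrbitMetric

variable (O : OrbitMetric s V F E B M)

include O

theorem blockDiag (hx : x ∈ V) (h0 : x 1 = 0) : BlockDiag (fun α β => F α β x) :=
  ⟨O.left x hx h0, O.right x hx h0⟩

theorem planeOnly (hx : x ∈ V) (h0 : x 1 = 0) : PlaneOnly (fun γ α β => hatD s F γ α β x) :=
  hatD_planeOnly O.nested O.smooth O.left O.right O.pd_cross hx h0

/-- Along t the derivative is tangential, so it sees only the leading form together with the
t-dependence of E, B and M. Along ρ the derivative carries a factor ρ and only the weights survive.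
-/
theorem res3_hatD (hx : x ∈ V) (h0 : x 1 = 0) :
    res3 (fun γ α β => hatD s F γ α β x) = planeDG (E x) (B x) (M x) := by
  have N := O.nested
  have h1 := O.smooth_E
  have h2 := O.smooth_B
  have h3 := O.smooth_M
  have T : ∀ a b, pd s 0 (F (planeIdx n a) (planeIdx n b)) x =
      pd s 0 (fun x => planeG (E x) (B x) (M x) a b) x := fun a b =>
    N.pd_tangential (O.smooth _ _) (by cases a <;> cases b <;> simp [planeG, symB] <;> fun_prop)
      (fun y hy hy0 => O.plane y hy hy0 a b) (by simp) hx h0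
  have T1 : pd s 0 (fun x => E x * (B x ^ 2 - M x)) x = 2 * B x * (E x * (B x ^ 2 - M x)) := by
    have : (fun x => E x * (B x ^ 2 - M x)) = fun x => E x * (B x * B x - M x) := by ext; ring
    rw [this, N.pd_mul h1 (by fun_prop) 0 hx, N.pd_sub (by fun_prop) h3 0 hx, N.pd_mul h2 h2 0 hx,
      O.pd_E x hx h0, O.pd_B x hx h0, O.pd_M x hx h0]
    ring
  have T2 : pd s 0 (fun x => E x * B x) x = 2 * B x * (E x * B x) := by
    rw [N.pd_mul h1 h2 0 hx, O.pd_E x hx h0, O.pd_B x hx h0]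
    ring
  have p := O.plane x hx h0
  ext c a b
  simp only [res3, hatD, hatPd]
  cases c
  · rw [planeIdx_false, if_pos rfl, if_neg (by simp), T]
    cases a <;> cases b <;> simp [planeG, planeDG, tens3, symB, T1, T2, O.pd_E x hx h0]
  · rw [planeIdx_true, if_neg (by simp), if_pos rfl, h0, zero_mul, p]
    cases a <;> cases b <;>
      simp [planeG, planeDG, tens3, symB, planeIdx_false, planeIdx_true] <;>
      first | ring1 | (left; norm_num)

omit O in
theorem submatrix_eq {A : Matrix (Fin (n + 2)) (Fin (n + 2)) ℝ} (h : BlockDiag A) :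
    A.submatrix (indexEquiv n) (indexEquiv n) = Matrix.fromBlocks (Matrix.of (res2 A)) 0 0
      (Matrix.of fun P Q : Fin n => A P.succ.succ Q.succ.succ) := by
  ext i j
  rcases i with a | P <;> rcases j with b | Q
  · rfl
  · exact h.left a Q
  · exact h.right P b
  · rfl

omit O in
theorem metricDet_of_block {e b m : ℝ} (h : BlockDiag fun α β => F α β x)
    (p : ∀ a c, F (planeIdx n a) (planeIdx n c) x = planeG e b m a c) : metricDet F x =
    -(m * e ^ 2) * (Matrix.of fun P Q : Fin n => F P.succ.succ Q.succ.succ x).det := by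
  have k := submatrix_eq (A := Matrix.of fun α β => F α β x) ⟨h.left, h.right⟩
  rw [metricDet, ← Matrix.det_submatrix_equiv_self (indexEquiv n), k, Matrix.det_fromBlocks_zero₂₁,
    ← Matrix.det_submatrix_equiv_self finTwoEquiv, Matrix.det_fin_two]
  congr 1
  simp only [Matrix.submatrix_apply, Matrix.of_apply, res2, p]
  simp [planeG, symB, finTwoEquiv]
  ring

theorem metricDet_horizon (hx : x ∈ V) (h0 : x 1 = 0) : metricDet F x =
    -(M x * E x ^ 2) * (Matrix.of fun P Q : Fin n => F P.succ.succ Q.succ.succ x).det :=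
  metricDet_of_block (O.blockDiag hx h0) (O.plane x hx h0)

theorem cross_det_ne (hx : x ∈ V) (h0 : x 1 = 0) :
    (Matrix.of fun P Q : Fin n => F P.succ.succ Q.succ.succ x).det ≠ 0 := fun h =>
  O.det_ne x hx (by rw [O.metricDet_horizon hx h0, h, mul_zero])

theorem inv_horizon (hx : x ∈ V) (h0 : x 1 = 0) : BlockDiag (fun α β => inv F α β x) ∧
    res2 (fun α β => inv F α β x) = planeI (E x) (B x) (M x) ∧
    ∀ P Q : Fin n, inv F P.succ.succ Q.succ.succ x =
      (Matrix.of fun P Q : Fin n => F P.succ.succ Q.succ.succ x)⁻¹ P Q := by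
  have hd := O.cross_det_ne hx h0
  have hE := O.E_ne x hx
  have hM := O.M_ne x hx
  have h := O.blockDiag hx h0
  have e := submatrix_eq (A := Matrix.of fun α β => F α β x) ⟨h.left, h.right⟩
  set Q := Matrix.of fun P Q : Fin n => F P.succ.succ Q.succ.succ x with hQ
  have p : Matrix.of (res2 (Matrix.of fun α β => F α β x)) =
      Matrix.of (planeG (E x) (B x) (M x)) := by
    ext a b; exact O.plane x hx h0 a b
  have pinv : Matrix.of (planeG (E x) (B x) (M x)) * Matrix.of (planeI (E x) (B x) (M x)) = 1 := by
    ext a b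
    cases a <;> cases b <;> simp [Matrix.mul_apply, planeG, planeI, symB] <;> field_simp <;> ring
  have k : ((Matrix.of fun α β => F α β x).submatrix (indexEquiv n) (indexEquiv n))⁻¹ =
      Matrix.fromBlocks (Matrix.of (planeI (E x) (B x) (M x))) 0 0 Q⁻¹ := by
    rw [e, p]
    refine Matrix.inv_eq_right_inv ?_
    rw [Matrix.fromBlocks_multiply, ← Matrix.fromBlocks_one]
    congr 1
    · simpa using pinv
    · simp
    · simp
    · simpa using Matrix.mul_nonsing_inv Q (isUnit_iff_ne_zero.2 hd)
  rw [Matrix.inv_submatrix_equiv] at k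
  have k' : ∀ i j, inv F (indexEquiv n i) (indexEquiv n j) x = _ := fun i j =>
    congrFun (congrFun k i) j
  refine ⟨⟨fun a P => k' (.inl a) (.inr P), fun P a => k' (.inr P) (.inl a)⟩, ?_,
    fun P Q => k' (.inr P) (.inr Q)⟩
  ext a b
  exact k' (.inl a) (.inl b)

theorem hatChr_horizon (hx : x ∈ V) (h0 : x 1 = 0) : PlaneOnly (fun l μ ν => hatChr s F l μ ν x) ∧
    res3 (fun l μ ν => hatChr s F l μ ν x) =
      chrA (planeI (E x) (B x) (M x)) (planeDG (E x) (B x) (M x)) := by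
  obtain ⟨i1, i2, -⟩ := O.inv_horizon hx h0
  have d1 := O.planeOnly hx h0
  refine ⟨chrA_planeOnly i1 d1, ?_⟩
  rw [← i2, ← O.res3_hatD hx h0]
  exact res3_chrA d1

variable (P₁ : OrbitPert s V E B M H₁ S₁ j₁ γ₁) (P₂ : OrbitPert s V E B M H₂ S₂ j₂ γ₂)
include P₁

theorem res3_hatD_pert (hx : x ∈ V) (h0 : x 1 = 0) :
    res3 (fun γ α β => hatD s H₁ γ α β x) =
      planeDH (E x) (B x) (M x) (S₁ x) (j₁ x) (γ₁ x) := by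
  have N := O.nested
  have h1 := O.smooth_E
  have h2 := O.smooth_B
  have h3 := O.smooth_M
  have k1 := P₁.smooth_S
  have k2 := P₁.smooth_j
  have k3 := P₁.smooth_γ
  have T : ∀ a b, pd s 0 (H₁ (planeIdx n a) (planeIdx n b)) x =
      pd s 0 (fun x => planeH (E x) (B x) (M x) (S₁ x) (j₁ x) (γ₁ x) a b) x := fun a b =>
    N.pd_tangential (P₁.smooth _ _) (by cases a <;> cases b <;> simp [planeH, symB] <;> fun_prop)
      (fun y hy hy0 => P₁.plane y hy hy0 a b) (by simp) hx h0
  have T1 : pd s 0 (fun x => E x * (2 * (B x ^ 2 - M x) * S₁ x + 2 * B x * j₁ x -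
      2 * M x * γ₁ x)) x = 2 * B x * (E x * (2 * (B x ^ 2 - M x) * S₁ x + 2 * B x * j₁ x -
      2 * M x * γ₁ x)) + E x * (2 * (B x ^ 2 - M x) * j₁ x) := by
    have : (fun x => E x * (2 * (B x ^ 2 - M x) * S₁ x + 2 * B x * j₁ x - 2 * M x * γ₁ x)) =
      fun x => E x * (2 * ((B x * B x - M x) * S₁ x + B x * j₁ x - M x * γ₁ x)) := by ext; ring
    rw [this, N.pd_mul h1 (by fun_prop) 0 hx, N.pd_const_mul 2 (by fun_prop) 0 hx,
      N.pd_sub (by fun_prop) (by fun_prop) 0 hx, N.pd_add (by fun_prop) (by fun_prop) 0 hx,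
      N.pd_mul (by fun_prop) k1 0 hx, N.pd_sub (by fun_prop) h3 0 hx, N.pd_mul h2 h2 0 hx,
      N.pd_mul h2 k2 0 hx, N.pd_mul h3 k3 0 hx,
      O.pd_E x hx h0, O.pd_B x hx h0, O.pd_M x hx h0, P₁.pd_S x hx h0, P₁.pd_j x hx h0,
      P₁.pd_γ x hx h0]
    ring
  have T2 : pd s 0 (fun x => E x * (2 * B x * S₁ x + j₁ x)) x =
      2 * B x * (E x * (2 * B x * S₁ x + j₁ x)) + E x * (2 * B x * j₁ x) := by
    have : (fun x => E x * (2 * B x * S₁ x + j₁ x)) =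
      fun x => E x * (2 * (B x * S₁ x) + j₁ x) := by ext; ring
    rw [this, N.pd_mul h1 (by fun_prop) 0 hx, N.pd_add (by fun_prop) k2 0 hx,
      N.pd_const_mul 2 (by fun_prop) 0 hx, N.pd_mul h2 k1 0 hx,
      O.pd_E x hx h0, O.pd_B x hx h0, P₁.pd_S x hx h0, P₁.pd_j x hx h0]
    ring
  have T3 : pd s 0 (fun x => E x * (2 * S₁ x)) x =
      2 * B x * (E x * (2 * S₁ x)) + E x * (2 * j₁ x) := by
    rw [N.pd_mul h1 (by fun_prop) 0 hx, N.pd_const_mul 2 (by fun_prop) 0 hx,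
      O.pd_E x hx h0, P₁.pd_S x hx h0]
    ring
  have p := P₁.plane x hx h0
  ext c a b
  simp only [res3, hatD, hatPd]
  cases c
  · rw [planeIdx_false, if_pos rfl, if_neg (by simp), T]
    cases a <;> cases b <;> simp [planeH, planeDH, tens3, symB, T1, T2, T3]
  · rw [planeIdx_true, if_neg (by simp), if_pos rfl, h0, zero_mul, p]
    cases a <;> cases b <;>
      simp [planeH, planeDH, tens3, symB, planeIdx_false, planeIdx_true] <;>
      first | ring1 | (left; norm_num)

theorem hatCov_horizon (hx : x ∈ V) (h0 : x 1 = 0) :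
    PlaneOnly (fun γ α β => hatCov s F H₁ γ α β x) ∧
    res3 (fun γ α β => hatCov s F H₁ γ α β x) =
      covA (chrA (planeI (E x) (B x) (M x)) (planeDG (E x) (B x) (M x)))
        (planeH (E x) (B x) (M x) (S₁ x) (j₁ x) (γ₁ x))
        (planeDH (E x) (B x) (M x) (S₁ x) (j₁ x) (γ₁ x)) := by
  have d2 := hatD_planeOnly O.nested P₁.smooth P₁.left P₁.right P₁.pd_cross hx h0
  obtain ⟨g1, g2⟩ := O.hatChr_horizon hx h0
  refine ⟨covA_planeOnly (P₁.blockDiag hx h0) g1 d2, (res3_covA g1).trans ?_⟩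
  rw [g2, O.res3_hatD_pert P₁ hx h0]
  rw [P₁.res2_eq hx h0]

include P₂

theorem hatOmega_zero (hx : x ∈ V) (h0 : x 1 = 0) (GN : ℝ) : hatOmega GN s F H₁ H₂ 0 x = 0 := by
  obtain ⟨i1, i2, -⟩ := O.inv_horizon hx h0
  obtain ⟨c1, c2⟩ := O.hatCov_horizon P₁ hx h0
  obtain ⟨d1, d2⟩ := O.hatCov_horizon P₂ hx h0
  have := omA_plane i1 (P₁.blockDiag hx h0) (P₂.blockDiag hx h0)
    c1 d1 false
  rw [hatOmega, ← planeIdx_false, this, i2, c2, d2, P₁.res2_eq hx h0, P₂.res2_eq hx h0,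
    omA_plane_zero _ _ _ (O.E_ne x hx) (O.M_ne x hx), divVec_plane _ _ _ (O.E_ne x hx) (O.M_ne x hx),
    divVec_plane _ _ _ (O.E_ne x hx) (O.M_ne x hx)]
  simp

/-- By `divVec_plane` the vector that multiplies the traces is -2γ/E along ρ and has no t-component;
the latter makes ω̂^t vanish in `hatOmega_zero`. -/
theorem hatOmega_one (hx : x ∈ V) (h0 : x 1 = 0) (GN : ℝ) : hatOmega GN s F H₁ H₂ 1 x =
    Real.sqrt (-metricDet F x) / (16 * Real.pi * GN) *
      ((crossTr (fun α β => inv F α β x) (fun α β => H₂ α β x) * γ₁ x -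
        crossTr (fun α β => inv F α β x) (fun α β => H₁ α β x) * γ₂ x) / E x) := by
  obtain ⟨i1, i2, -⟩ := O.inv_horizon hx h0
  obtain ⟨c1, c2⟩ := O.hatCov_horizon P₁ hx h0
  obtain ⟨d1, d2⟩ := O.hatCov_horizon P₂ hx h0
  have := omA_plane i1 (P₁.blockDiag hx h0) (P₂.blockDiag hx h0)
    c1 d1 true
  rw [hatOmega, ← planeIdx_true, this, i2, c2, d2, P₁.res2_eq hx h0, P₂.res2_eq hx h0,
    omA_plane_zero _ _ _ (O.E_ne x hx) (O.M_ne x hx), divVec_plane _ _ _ (O.E_ne x hx) (O.M_ne x hx),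
    divVec_plane _ _ _ (O.E_ne x hx) (O.M_ne x hx), if_pos rfl, if_pos rfl]
  ring

end OrbitMetric

end Horizon

/-! ### Lie derivatives in rescaled components -/

section Lie

variable {n : ℕ} {ε : ℝ} {U : Set (Fin n → ℝ)} {V : Set (Fin (n + 2) → ℝ)}

/-- The derivative along the cross-section components of `ξ`. -/
def crossDer (s : Set (Fin (n + 2) → ℝ)) (ξ : (Fin (n + 2) → ℝ) → (Fin (n + 2) → ℝ))
    (f : (Fin (n + 2) → ℝ) → ℝ) (x : Fin (n + 2) → ℝ) : ℝ :=
  ∑ P : Fin n, ξ x P.succ.succ * pd s P.succ.succ f x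

/-- A vector field of `𝒜'` with its rescaled `ρ`-component `a` and its rescaled derivatives
`d α μ = λ_α ∂_μ ξ^α / λ_μ`. -/
structure HatVec (ε : ℝ) (U : Set (Fin n → ℝ)) (F G H J : (Fin n → ℝ) → ℝ)
    (K : (Fin n → ℝ) → (Fin n → ℝ)) (ξ : (Fin (n + 2) → ℝ) → (Fin (n + 2) → ℝ))
    (a : (Fin (n + 2) → ℝ) → ℝ) (d : Fin (n + 2) → Fin (n + 2) → (Fin (n + 2) → ℝ) → ℝ) :
    Prop extends JetForm ε U F G H J K ξ where
  smooth_a : ContDiffOn ℝ ∞ a (region ε U)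
  smooth_d : ∀ α μ, ContDiffOn ℝ ∞ (d α μ) (region ε U)
  eq_a : ∀ x ∈ region ε U, ξ x 1 = x 1 * a x
  eq_d : ∀ α μ, ∀ x ∈ region ε U, lam x α * pd (region ε U) μ (fun y => ξ y α) x =
    lam x μ * d α μ x
  a_horizon : ∀ x ∈ region ε U, x 1 = 0 → a x = H (ang x) + x 0 * J (ang x)
  d00 : ∀ x ∈ region ε U, x 1 = 0 → d 0 0 x = G (ang x)
  d01 : ∀ x ∈ region ε U, x 1 = 0 → d 0 1 x = 0
  d0M : ∀ x ∈ region ε U, x 1 = 0 → ∀ P : Fin n, d 0 P.succ.succ x = 0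
  d10 : ∀ x ∈ region ε U, x 1 = 0 → d 1 0 x = J (ang x)
  d11 : ∀ x ∈ region ε U, x 1 = 0 → d 1 1 x = a x
  d1M : ∀ x ∈ region ε U, x 1 = 0 → ∀ P : Fin n, d 1 P.succ.succ x = 0
  dM0 : ∀ x ∈ region ε U, x 1 = 0 → ∀ P : Fin n, d P.succ.succ 0 x = 0
  dM1 : ∀ x ∈ region ε U, x 1 = 0 → ∀ P : Fin n, d P.succ.succ 1 x = 0
  dMN : ∀ x ∈ region ε U, x 1 = 0 → ∀ P Q : Fin n,
    d P.succ.succ Q.succ.succ x = pd U Q (fun σ => K σ P) (ang x)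

variable {G₀ F₀ H₀ J₀ : (Fin n → ℝ) → ℝ} {K : (Fin n → ℝ) → (Fin n → ℝ)}
  {ξ : (Fin (n + 2) → ℝ) → (Fin (n + 2) → ℝ)} {a : (Fin (n + 2) → ℝ) → ℝ}
  {d g F : Fin (n + 2) → Fin (n + 2) → (Fin (n + 2) → ℝ) → ℝ} {x : Fin (n + 2) → ℝ}

/-- Division by ρ is needed only for ξ^ρ and for ∂_t ξ^α with α ≠ t. All of these vanish on the
horizon, so Hadamard's lemma supplies smooth quotients and identifies their horizon values as
ρ-derivatives. -/
theorem JetForm.exists_hatVec (hU : IsOpen U) (h : JetForm ε U F₀ G₀ H₀ J₀ K ξ) :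
    ∃ a d, HatVec ε U F₀ G₀ H₀ J₀ K ξ a d := by
  have N := (halfOpen_region (ε := ε) hU).nested_self
  obtain ⟨a, ha, hae, ha0⟩ := N.exists_div (h.smooth 1) h.val_ρ
  obtain ⟨e, he, hee, he0⟩ := N.exists_div (N.contDiffOn_pd (h.smooth 1) 0)
    fun x hx h0 => h.pd_tangential_ρ hU hx h0 (by simp)
  have := fun P : Fin n => N.exists_div (N.contDiffOn_pd (h.smooth P.succ.succ) 0)
    fun x hx h0 => h.pd_zero_M hU hx h0 P
  choose m hm hme hm0 using this
  have hp := fun α μ => N.contDiffOn_pd (h.smooth α) μ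
  refine ⟨a, fun α μ => Fin.cases (motive := fun _ => (Fin (n + 2) → ℝ) → ℝ)
    (if μ = 0 then pd (region ε U) 0 (fun y => ξ y 0) else
      fun x => x 1 * pd (region ε U) μ (fun y => ξ y 0) x)
    (fun i => if μ = 0 then Fin.cases (motive := fun _ => (Fin (n + 2) → ℝ) → ℝ) e m i else
      pd (region ε U) μ (fun y => ξ y i.succ)) α,
    { h with
      smooth_a := ha
      smooth_d := fun α μ => ?_
      eq_a := hae
      eq_d := fun α μ x hx => ?_
      a_horizon := fun x hx h0 => (ha0 x hx h0).trans (h.der_ρ x hx h0)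
      d00 := fun x hx h0 => ?_
      d01 := fun x hx h0 => ?_
      d0M := fun x hx h0 P => ?_
      d10 := fun x hx h0 => ?_
      d11 := fun x hx h0 => ?_
      d1M := fun x hx h0 P => ?_
      dM0 := fun x hx h0 P => ?_
      dM1 := fun x hx h0 P => ?_
      dMN := fun x hx h0 P Q => ?_ }⟩
  · by_cases hμ : μ = 0
    · simp only [hμ, if_true]
      revert α
      exact index_cases (hp 0 0) he hm
    · simp only [hμ, if_false]
      revert α
      exact index_cases (by have := hp 0 μ; simp only [Fin.cases_zero]; fun_prop) (hp 1 μ)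
        fun P => hp _ μ
  · by_cases hμ : μ = 0
    · simp only [hμ, if_true, lam_zero]
      revert α
      refine index_cases (by simp) ?_ fun P => ?_
      · rw [lam_one, one_mul]; exact hee x hx
      · rw [lam_succ, one_mul]; exact hme P x hx
    · simp only [hμ, if_false, show lam x μ = 1 from if_neg hμ, one_mul]
      revert α
      refine index_cases (by simp) ?_ fun P => ?_
      · rw [lam_one, one_mul]; rfl
      · rw [lam_succ, one_mul]; rfl
  · exact h.pd_zero_t hU hx h0
  · simp [h0]
  · simp [h0]
  · exact (he0 x hx h0).trans (h.pd_pd_zero_ρ hU hx h0)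
  · exact (ha0 x hx h0).symm
  · simp only [succ_succ_ne_zero, if_false]
    exact h.pd_tangential_ρ hU hx h0 (succ_succ_ne_one P)
  · exact (hm0 P x hx h0).trans (h.pd_pd_M hU hx h0 P (by simp))
  · exact h.der_M x hx h0 P
  · simp only [succ_succ_ne_zero, if_false]
    exact h.pd_succ_M hU hx h0 P Q

/-- The Lie derivative in rescaled components. -/
def hatLie (s : Set (Fin (n + 2) → ℝ)) (ξ : (Fin (n + 2) → ℝ) → (Fin (n + 2) → ℝ))
    (a : (Fin (n + 2) → ℝ) → ℝ) (d F : Fin (n + 2) → Fin (n + 2) → (Fin (n + 2) → ℝ) → ℝ)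
    (μ ν : Fin (n + 2)) (x : Fin (n + 2) → ℝ) : ℝ :=
  ∑ α, ξ x α * pd s α (F μ ν) x + a x * (wt μ + wt ν) * F μ ν x +
    ∑ α, (F α ν x * d α μ x + F μ α x * d α ν x)

/-- The factors λ are themselves differentiated by ξ^ρ ∂_ρ, which gives a times the weights because
ξ^ρ = ρ a. In the terms with ∂ξ the factor λ of the contracted index is exchanged for that of the
free one by the definition of d. -/
theorem Hat.lieDeriv (hg : Hat V g F) (N : Nested (region ε U) V)
    (h : HatVec ε U F₀ G₀ H₀ J₀ K ξ a d) :
    Hat V (lieDeriv (region ε U) ξ g) (hatLie (region ε U) ξ a d F) := by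
  have h1 := hg.smooth
  have h2 := fun α => (h.smooth α).mono N.sub
  have h3 := h.smooth_a.mono N.sub
  have h4 := fun α μ => (h.smooth_d α μ).mono N.sub
  have h5 := fun α β γ => N.contDiffOn_pd (h1 α β) γ
  refine ⟨fun μ ν => ?_, fun μ ν x hx => ?_⟩
  · unfold hatLie
    fun_prop
  · simp only [KillingHorizon.lieDeriv, hatLie, hg.pd_eq N _ _ _ hx, Finset.sum_add_distrib, mul_add]
    have hxs := N.sub hx
    have e1 : ∑ α, ξ x α * (if α = 1 then (wt μ * lam x ν + lam x μ * wt ν) * F μ ν x else 0) =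
        lam x μ * lam x ν * (a x * wt μ * F μ ν x + a x * wt ν * F μ ν x) := by
      simp only [mul_ite, mul_zero, Finset.sum_ite_eq', Finset.mem_univ, if_true]
      rw [h.eq_a x hxs]
      linear_combination a x * F μ ν x * (lam x ν * wt_mul_lam x μ + lam x μ * wt_mul_lam x ν)
    rw [e1]
    have e2 : ∀ i, g i ν x * pd (region ε U) μ (fun y => ξ y i) x =
        lam x μ * lam x ν * (F i ν x * d i μ x) := fun i => by
      rw [hg.eq i ν x hx]
      linear_combination lam x ν * F i ν x * h.eq_d i μ x hxs
    have e3 : ∀ i, g μ i x * pd (region ε U) ν (fun y => ξ y i) x =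
        lam x μ * lam x ν * (F μ i x * d i ν x) := fun i => by
      rw [hg.eq μ i x hx]
      linear_combination lam x μ * F μ i x * h.eq_d i ν x hxs
    have e4 : ∑ i, ξ x i * (lam x μ * lam x ν * pd (region ε U) i (F μ ν) x) =
        lam x μ * lam x ν * ∑ i, ξ x i * pd (region ε U) i (F μ ν) x := by
      rw [Finset.mul_sum]
      exact Finset.sum_congr rfl fun i _ => by ring
    simp only [e2, e3, e4, ← Finset.mul_sum]
    ring

section crossDer

variable {f k : (Fin (n + 2) → ℝ) → ℝ} (N : Nested (region ε U) V) (hξ : ∀ μ, ContDiffOn ℝ ∞ (fun x => ξ x μ) V)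
  (hf : ContDiffOn ℝ ∞ f V) (hk : ContDiffOn ℝ ∞ k V)

include N hf

include hξ in
theorem contDiffOn_crossDer : ContDiffOn ℝ ∞ (crossDer (region ε U) ξ f) V := by
  have := N.contDiffOn_pd hf
  unfold crossDer
  fun_prop

include hk

theorem crossDer_congr (h : ∀ x ∈ V, x 1 = 0 → f x = k x) (hx : x ∈ V) (h0 : x 1 = 0) :
    crossDer (region ε U) ξ f x = crossDer (region ε U) ξ k x := by
  refine Finset.sum_congr rfl fun P _ => ?_
  rw [N.pd_tangential hf hk h (succ_succ_ne_one P) hx h0]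

theorem crossDer_mul (hx : x ∈ V) : crossDer (region ε U) ξ (fun y => f y * k y) x =
    crossDer (region ε U) ξ f x * k x + f x * crossDer (region ε U) ξ k x := by
  simp only [crossDer, N.pd_mul hf hk _ hx, Finset.sum_mul, Finset.mul_sum, ← Finset.sum_add_distrib]
  exact Finset.sum_congr rfl fun _ _ => by ring

theorem crossDer_sub (hx : x ∈ V) : crossDer (region ε U) ξ (fun y => f y - k y) x =
    crossDer (region ε U) ξ f x - crossDer (region ε U) ξ k x := by
  simp only [crossDer, N.pd_sub hf hk _ hx, ← Finset.sum_sub_distrib]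
  exact Finset.sum_congr rfl fun _ _ => by ring

end crossDer

/-- On the horizon ξ^M = K^M does not depend on t, so ∂_t commutes with the derivative along K. -/
theorem HatVec.pd_zero_crossDer (h : HatVec ε U F₀ G₀ H₀ J₀ K ξ a d) (hU : IsOpen U)
    (N : Nested (region ε U) V) {f k : (Fin (n + 2) → ℝ) → ℝ} (hf : ContDiffOn ℝ ∞ f V)
    (hk : ContDiffOn ℝ ∞ k V) (hfk : ∀ x ∈ V, x 1 = 0 → pd (region ε U) 0 f x = k x)
    (hx : x ∈ V) (h0 : x 1 = 0) :
    pd (region ε U) 0 (crossDer (region ε U) ξ f) x = crossDer (region ε U) ξ k x := by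
  have h2 := fun α => (h.smooth α).mono N.sub
  have h5 := fun γ => N.contDiffOn_pd hf γ
  rw [← crossDer_congr N (h5 0) hk hfk hx h0]
  unfold crossDer
  rw [N.pd_sum _ (fun P _ => by fun_prop) 0 hx]
  refine Finset.sum_congr rfl fun P _ => ?_
  rw [N.pd_mul (h2 _) (h5 _) 0 hx, h.pd_zero_M hU (N.sub hx) h0, N.pd_comm hf 0 _ hx]
  ring

/-- The Lie derivative of a metric in the orbit has the expected leading order. -/
theorem OrbitMetric.orbitPert {E B M : (Fin (n + 2) → ℝ) → ℝ} (O : OrbitMetric (region ε U) V F E B M)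
    (hU : IsOpen U) (h : HatVec ε U F₀ G₀ H₀ J₀ K ξ a d) :
    OrbitPert (region ε U) V E B M (hatLie (region ε U) ξ a d F)
      (fun x => B x * ξ x 0 + a x + crossDer (region ε U) ξ E x * (2 * E x)⁻¹)
      (fun x => B x * angPull G₀ x + angPull J₀ x + crossDer (region ε U) ξ B x)
      (fun x => angPull G₀ x + crossDer (region ε U) ξ M x * (2 * M x)⁻¹) := by
  have N := O.nested
  have h1 := O.smooth
  have h2 := fun α => (h.smooth α).mono N.sub
  have h3 := h.smooth_a.mono N.sub
  have h4 := fun α μ => (h.smooth_d α μ).mono N.sub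
  have h5 := fun α β γ => N.contDiffOn_pd (h1 α β) γ
  have hE := O.smooth_E
  have hB := O.smooth_B
  have hM := O.smooth_M
  have hG := contDiffOn_comp_ang (V := V) h.smooth_G fun x hx => ang_mem (N.sub hx)
  have hJ := contDiffOn_comp_ang (V := V) h.smooth_J fun x hx => ang_mem (N.sub hx)
  have cE := contDiffOn_crossDer N h2 hE
  have cB := contDiffOn_crossDer N h2 hB
  have cM := contDiffOn_crossDer N h2 hM
  have iE : ContDiffOn ℝ ∞ (fun x => (2 * E x)⁻¹) V :=
    ContDiffOn.inv (by fun_prop) fun x hx => mul_ne_zero two_ne_zero (O.E_ne x hx)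
  have iM : ContDiffOn ℝ ∞ (fun x => (2 * M x)⁻¹) V :=
    ContDiffOn.inv (by fun_prop) fun x hx => mul_ne_zero two_ne_zero (O.M_ne x hx)
  -- Since ξ^ρ = 0 on the horizon, the transport term is tangential and may be evaluated on the
  -- leading form.
  have adv : ∀ x ∈ V, x 1 = 0 → ∀ μ ν, hatLie (region ε U) ξ a d F μ ν x =
      ξ x 0 * pd (region ε U) 0 (F μ ν) x + crossDer (region ε U) ξ (F μ ν) x +
      a x * (wt μ + wt ν) * F μ ν x + ∑ α, (F α ν x * d α μ x + F μ α x * d α ν x) := by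
    intro x hx h0 μ ν
    rw [hatLie, sum_split (fun α => ξ x α * _), h.val_ρ x (N.sub hx) h0, zero_mul, add_zero]
    rfl
  have zt : ∀ α β, (∀ x ∈ V, x 1 = 0 → F α β x = 0) → ∀ x ∈ V, x 1 = 0 →
      pd (region ε U) 0 (F α β) x = 0 ∧ crossDer (region ε U) ξ (F α β) x = 0 := by
    intro α β hz x hx h0
    rw [N.pd_tangential (h1 α β) (g := fun _ => 0) contDiffOn_const hz (by simp) hx h0,
      crossDer_congr N (h1 α β) (k := fun _ => 0) contDiffOn_const hz hx h0]
    simp [pd, crossDer]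
  have crossP : ∀ x ∈ V, x 1 = 0 → ∀ P Q : Fin n,
      hatLie (region ε U) ξ a d F P.succ.succ Q.succ.succ x =
        crossDer (region ε U) ξ (F P.succ.succ Q.succ.succ) x +
          ∑ R : Fin n, (F R.succ.succ Q.succ.succ x * pd U P (fun σ => K σ R) (ang x) +
            F P.succ.succ R.succ.succ x * pd U Q (fun σ => K σ R) (ang x)) := by
    intro x hx h0 P Q
    have hxs := N.sub hx
    rw [adv x hx h0, O.pd_cross x hx h0, sum_split]
    simp only [h.d0M x hxs h0, h.d1M x hxs h0, h.dMN x hxs h0, wt_succ]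
    ring
  refine
    { smooth := fun μ ν => ?_
      smooth_S := by fun_prop
      smooth_j := by fun_prop
      smooth_γ := by fun_prop
      plane := fun x hx h0 => ?_
      left := fun x hx h0 b P => ?_
      right := fun x hx h0 P b => ?_
      pd_S := fun x hx h0 => ?_
      pd_j := fun x hx h0 => ?_
      pd_γ := fun x hx h0 => ?_
      pd_cross := fun x hx h0 P Q => ?_ }
  · unfold hatLie
    fun_prop
  · have hxs := N.sub hx
    have p := O.plane x hx h0
    have tt : ∀ a b, pd (region ε U) 0 (F (planeIdx n a) (planeIdx n b)) x =
        planeDG (E x) (B x) (M x) false a b := fun a b => by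
      have := congrFun (congrFun (congrFun (O.res3_hatD hx h0) false) a) b
      simpa [res3, hatD, hatPd, planeIdx_false] using this
    have cc : ∀ a b, crossDer (region ε U) ξ (F (planeIdx n a) (planeIdx n b)) x =
        symB (crossDer (region ε U) ξ E x * (B x ^ 2 - M x) +
            E x * (2 * B x * crossDer (region ε U) ξ B x - crossDer (region ε U) ξ M x))
          (crossDer (region ε U) ξ E x * B x + E x * crossDer (region ε U) ξ B x)
          (crossDer (region ε U) ξ E x) a b := by
      have w := fun a b (k : (Fin (n + 2) → ℝ) → ℝ) (hk : ContDiffOn ℝ ∞ k V)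
        (e : ∀ x ∈ V, x 1 = 0 → planeG (E x) (B x) (M x) a b = k x) =>
        crossDer_congr (ξ := ξ) N (h1 (planeIdx n a) (planeIdx n b)) hk
          (fun y hy hy0 => (O.plane y hy hy0 a b).trans (e y hy hy0)) hx h0
      intro a b
      cases a <;> cases b
      · rw [w false false (fun x => E x * (B x * B x - M x)) (by fun_prop)
          (fun y _ _ => by simp [planeG, symB]; ring_nf; simp), crossDer_mul N hE (by fun_prop) hx,
          crossDer_sub N (by fun_prop) hM hx, crossDer_mul N hB hB hx]
        simp only [symB, Bool.false_eq_true, if_false]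
        ring
      · rw [w false true (fun x => E x * B x) (by fun_prop) (fun y _ _ => by simp [planeG, symB]),
          crossDer_mul N hE hB hx]
        simp [symB]
      · rw [w true false (fun x => E x * B x) (by fun_prop) (fun y _ _ => by simp [planeG, symB]),
          crossDer_mul N hE hB hx]
        simp [symB]
      · rw [w true true E (by fun_prop) (fun y _ _ => by simp [planeG, symB])]
        simp [symB]
    have l0 := fun P => O.left x hx h0 false P
    have l1 := fun P => O.left x hx h0 true P
    have r0 := fun P => O.right x hx h0 P false
    have r1 := fun P => O.right x hx h0 P true
    have p00 := p false false
    have p01 := p false true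
    have p10 := p true false
    have p11 := p true true
    simp only [planeIdx_true, planeIdx_false] at l0 l1 r0 r1 p00 p01 p10 p11
    have hE0 := O.E_ne x hx
    have hM0 := O.M_ne x hx
    intro α β
    rw [adv x hx h0, tt, cc]
    cases α <;> cases β <;>
      simp only [planeIdx_true, planeIdx_false, sum_split, l0, l1, r0, r1, p00, p01, p10, p11,
        h.d00 x hxs h0, h.d01 x hxs h0, h.d10 x hxs h0, h.d11 x hxs h0, wt_zero, wt_one,
        zero_mul, mul_zero, Finset.sum_const_zero, add_zero, zero_add, planeG, planeDG, planeH, symB,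
        tens3, Bool.false_eq_true, if_true, if_false, angPull] <;>
      field_simp <;> ring
  · have hxs := N.sub hx
    rw [adv x hx h0, (zt _ _ (fun y hy hy0 => O.left y hy hy0 b P) x hx h0).1,
      (zt _ _ (fun y hy hy0 => O.left y hy hy0 b P) x hx h0).2, O.left x hx h0, sum_split]
    have l0 := O.left x hx h0 false
    have l1 := O.left x hx h0 true
    simp only [planeIdx_true, planeIdx_false] at l0 l1
    cases b <;>
      simp [l0, l1, h.d0M x hxs h0, h.d1M x hxs h0, h.dM0 x hxs h0, h.dM1 x hxs h0, planeIdx_true,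
        planeIdx_false]
  · have hxs := N.sub hx
    rw [adv x hx h0, (zt _ _ (fun y hy hy0 => O.right y hy hy0 P b) x hx h0).1,
      (zt _ _ (fun y hy hy0 => O.right y hy hy0 P b) x hx h0).2, O.right x hx h0, sum_split]
    have r0 := fun P => O.right x hx h0 P false
    have r1 := fun P => O.right x hx h0 P true
    simp only [planeIdx_true, planeIdx_false] at r0 r1
    cases b <;>
      simp [r0, r1, h.d0M x hxs h0, h.d1M x hxs h0, h.dM0 x hxs h0, h.dM1 x hxs h0, planeIdx_true,
        planeIdx_false]
  · have hxs := N.sub hx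
    have hE0 := O.E_ne x hx
    -- On the horizon a = H + tJ. The other contributions to ∂_t S are BG from B ξ^t and the
    -- derivative of B along K, which is left of the last summand because ∂_t E = 2BE.
    have ta : pd (region ε U) 0 a x = J₀ (ang x) := by
      have hH := contDiffOn_comp_ang (V := V) h.smooth_H fun x hx => ang_mem (N.sub hx)
      rw [N.pd_tangential h3 (g := fun y => angPull H₀ y + y 0 * angPull J₀ y) (by fun_prop)
        (fun y hy hy0 => h.a_horizon y (N.sub hy) hy0) (by simp) hx h0,
        N.pd_add hH (by fun_prop) 0 hx, N.pd_mul (by fun_prop) hJ 0 hx, N.pd_coord 0 0 hx,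
        N.pd_zero_ang hU h.smooth_H hx hxs.2.2, N.pd_zero_ang hU h.smooth_J hx hxs.2.2]
      simp [angPull]
    rw [N.pd_add (by fun_prop) (by fun_prop) 0 hx, N.pd_add (by fun_prop) h3 0 hx,
      N.pd_mul hB (h2 0) 0 hx, N.pd_mul cE iE 0 hx, O.pd_B x hx h0, h.pd_zero_t hU hxs h0, ta,
      N.pd_inv (by fun_prop) 0 hx (mul_ne_zero two_ne_zero hE0), N.pd_const_mul 2 hE 0 hx,
      O.pd_E x hx h0, h.pd_zero_crossDer hU N hE (k := fun y => 2 * (B y * E y)) (by fun_prop)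
        (fun y hy hy0 => (O.pd_E y hy hy0).trans (by ring)) hx h0,
      crossDer_mul (f := fun _ => 2) N contDiffOn_const (by fun_prop) hx, crossDer_mul N hB hE hx]
    have c2 : crossDer (region ε U) ξ (fun _ => (2 : ℝ)) x = 0 := by simp [crossDer, pd]
    rw [c2]
    simp only [angPull]
    field_simp
    ring
  · have hxs := N.sub hx
    rw [N.pd_add (by fun_prop) cB 0 hx, N.pd_add (by fun_prop) hJ 0 hx, N.pd_mul hB hG 0 hx,
      O.pd_B x hx h0, N.pd_zero_ang hU h.smooth_G hx hxs.2.2, N.pd_zero_ang hU h.smooth_J hx hxs.2.2,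
      h.pd_zero_crossDer hU N hB (k := fun _ => 0) contDiffOn_const O.pd_B hx h0]
    simp [crossDer, pd]
  · have hxs := N.sub hx
    have hM0 := O.M_ne x hx
    rw [N.pd_add hG (by fun_prop) 0 hx, N.pd_mul cM iM 0 hx, N.pd_zero_ang hU h.smooth_G hx hxs.2.2,
      N.pd_inv (by fun_prop) 0 hx (mul_ne_zero two_ne_zero hM0), N.pd_const_mul 2 hM 0 hx,
      O.pd_M x hx h0, h.pd_zero_crossDer hU N hM (k := fun _ => 0) contDiffOn_const O.pd_M hx h0]
    simp [crossDer, pd]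
  · have hxs := N.sub hx
    have hK : ∀ P R, ContDiffOn ℝ ∞ (angPull (pd U P fun σ => K σ R)) V := fun P R =>
      contDiffOn_comp_ang (contDiffOn_pd_of_isOpen hU (h.smooth_K R) P) fun x hx => ang_mem (N.sub hx)
    have hsm : ∀ μ ν, ContDiffOn ℝ ∞ (hatLie (region ε U) ξ a d F μ ν) V := fun μ ν => by
      unfold hatLie
      fun_prop
    have cF := contDiffOn_crossDer (f := F P.succ.succ Q.succ.succ) N h2 (h1 _ _)
    rw [N.pd_tangential (hsm _ _) (g := fun x =>
        crossDer (region ε U) ξ (F P.succ.succ Q.succ.succ) x +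
          ∑ R : Fin n, (F R.succ.succ Q.succ.succ x * angPull (pd U P fun σ => K σ R) x +
            F P.succ.succ R.succ.succ x * angPull (pd U Q fun σ => K σ R) x)) (by fun_prop)
        (fun y hy hy0 => crossP y hy hy0 P Q) (by simp) hx h0, N.pd_add cF (by fun_prop) 0 hx,
      h.pd_zero_crossDer hU N (h1 _ _) (k := fun _ => 0) contDiffOn_const
        (fun y hy hy0 => O.pd_cross y hy hy0 P Q) hx h0, N.pd_sum _ (fun R _ => by fun_prop) 0 hx]
    have z : ∀ R, pd (region ε U) 0 (fun y => F R.succ.succ Q.succ.succ y *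
        angPull (pd U P fun σ => K σ R) y + F P.succ.succ R.succ.succ y *
        angPull (pd U Q fun σ => K σ R) y) x = 0 := fun R => by
      rw [N.pd_add (by fun_prop) (by fun_prop) 0 hx, N.pd_mul (h1 _ _) (hK _ _) 0 hx,
        N.pd_mul (h1 _ _) (hK _ _) 0 hx, O.pd_cross x hx h0, O.pd_cross x hx h0,
        N.pd_zero_ang hU (contDiffOn_pd_of_isOpen hU (h.smooth_K R) P) hx hxs.2.2,
        N.pd_zero_ang hU (contDiffOn_pd_of_isOpen hU (h.smooth_K R) Q) hx hxs.2.2]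
      ring
    rw [Finset.sum_eq_zero fun R _ => z R]
    simp [crossDer, pd]

/-- The cross-section trace of a Lie derivative is twice the divergence of `K`. -/
theorem OrbitMetric.crossTr_hatLie {E B M : (Fin (n + 2) → ℝ) → ℝ}
    {q : Fin n → Fin n → (Fin n → ℝ) → ℝ} (hq : IsCrossMetric U q)
    (O : OrbitMetric (region ε U) V F E B M) (h : HatVec ε U F₀ G₀ H₀ J₀ K ξ a d)
    (hdet : ∀ x ∈ V, x 1 = 0 →
      (Matrix.of fun P Q : Fin n => F P.succ.succ Q.succ.succ x).det = metricDet q (ang x))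
    (hx : x ∈ V) (h0 : x 1 = 0) :
    crossTr (fun α β => inv F α β x) (fun α β => hatLie (region ε U) ξ a d F α β x) =
      2 * divergence U q K (ang x) := by
  have N := O.nested
  have hU := hq.isOpen
  have hxs := N.sub hx
  have h1 := O.smooth
  have hd := O.cross_det_ne hx h0
  have hI := (O.inv_horizon hx h0).2.2
  have hd2 := hq.det_mul_divergence (K := K) hxs.2.2
  set A := Matrix.of fun P Q : Fin n => F P.succ.succ Q.succ.succ x with hA
  have hsymm : A.transpose = A := by
    ext P Q; exact O.symm x hx h0 Q P
  have hIA : ∀ P R, ∑ Q, A⁻¹ P Q * A R Q = if P = R then 1 else 0 := fun P R => by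
    have := congrFun (congrFun (Matrix.nonsing_inv_mul A (isUnit_iff_ne_zero.2 hd)) P) R
    rw [Matrix.mul_apply, Matrix.one_apply] at this
    rw [← this]
    exact Finset.sum_congr rfl fun Q _ => by rw [← congrFun (congrFun hsymm R) Q]; rfl
  have hAI : ∀ R Q, ∑ P, A⁻¹ P Q * A R P = if R = Q then 1 else 0 := fun R Q => by
    have := congrFun (congrFun (Matrix.mul_nonsing_inv A (isUnit_iff_ne_zero.2 hd)) R) Q
    rw [Matrix.mul_apply, Matrix.one_apply] at this
    rw [← this]
    exact Finset.sum_congr rfl fun Q _ => mul_comm _ _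
  -- The cross-section block itself is not q, but its determinant is, all along the horizon.
  -- Jacobi's formula for both shows that only the determinant enters the trace.
  have hJac : ∀ R : Fin n, pd U R (metricDet q) (ang x) =
      A.det * ∑ P, ∑ Q, A⁻¹ P Q * pd (region ε U) R.succ.succ (F P.succ.succ Q.succ.succ) x := by
    intro R
    have hs : ContDiffOn ℝ ∞ (fun x => (Matrix.of fun P Q : Fin n => F P.succ.succ Q.succ.succ x).det) V :=
      contDiffOn_det fun P Q => h1 _ _
    have e1 := N.pd_tangential hs (contDiffOn_comp_ang hq.smooth_det fun x hx => ang_mem (N.sub hx)) hdet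
      (succ_succ_ne_one R) hx h0
    rw [N.pd_succ_ang hU hq.smooth_det hx hxs.2.2] at e1
    have e2 := hasFDerivWithinAt_det (A := fun P Q : Fin n => F P.succ.succ Q.succ.succ) (x := x)
      (V := region ε U) fun P Q => (N.diffAt (h1 P.succ.succ Q.succ.succ) hx).hasFDerivWithinAt
    rw [← e1, pd, e2.fderivWithin (N.uniq hx), ← hA]
    simp only [_root_.sum_apply, _root_.smul_apply, smul_eq_mul, adjugate_eq_det_mul_inv _ hd,
      Finset.mul_sum]
    rw [Finset.sum_comm]
    refine Finset.sum_congr rfl fun Q _ => Finset.sum_congr rfl fun P _ => ?_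
    rw [N.pd_tangential (h1 _ _) (h1 _ _) (fun y hy hy0 => O.symm y hy hy0 Q P) (succ_succ_ne_one R)
      hx h0, pd, ← mul_assoc]
  rw [← hdet x hx h0] at hd2
  refine mul_left_cancel₀ hd ?_
  have e : crossTr (fun α β => inv F α β x) (fun α β => hatLie (region ε U) ξ a d F α β x) =
      ∑ R : Fin n, K (ang x) R * ∑ P, ∑ Q, A⁻¹ P Q *
        pd (region ε U) R.succ.succ (F P.succ.succ Q.succ.succ) x +
      2 * ∑ P, pd U P (fun y => K y P) (ang x) := by
    have hL : ∀ P Q : Fin n, hatLie (region ε U) ξ a d F P.succ.succ Q.succ.succ x =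
        ∑ R : Fin n, K (ang x) R * pd (region ε U) R.succ.succ (F P.succ.succ Q.succ.succ) x +
          (∑ R, A R Q * pd U P (fun σ => K σ R) (ang x) +
            ∑ R, A P R * pd U Q (fun σ => K σ R) (ang x)) := by
      intro P Q
      rw [hatLie, sum_split, sum_split, h.val_ρ x hxs h0, O.pd_cross x hx h0]
      simp only [h.d0M x hxs h0, h.d1M x hxs h0, h.dMN x hxs h0, wt_succ, h.val_M x hxs h0, hA,
        Matrix.of_apply, Finset.sum_add_distrib]
      ring
    have t1 : ∑ P, ∑ Q, A⁻¹ P Q * ∑ R, A R Q * pd U P (fun σ => K σ R) (ang x) =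
        ∑ P, pd U P (fun y => K y P) (ang x) := by
      refine Finset.sum_congr rfl fun P _ => ?_
      simp only [Finset.mul_sum, ← mul_assoc]
      rw [Finset.sum_comm]
      simp only [← Finset.sum_mul, hIA]
      simp
    have t2 : ∑ P, ∑ Q, A⁻¹ P Q * ∑ R, A P R * pd U Q (fun σ => K σ R) (ang x) =
        ∑ P, pd U P (fun y => K y P) (ang x) := by
      rw [Finset.sum_comm]
      refine Finset.sum_congr rfl fun Q _ => ?_
      simp only [Finset.mul_sum, ← mul_assoc]
      rw [Finset.sum_comm]
      have hAI' : ∀ R, ∑ P, A⁻¹ P Q * A P R = if R = Q then 1 else 0 := fun R => by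
        rw [← hAI]
        exact Finset.sum_congr rfl fun P _ => by rw [← congrFun (congrFun hsymm P) R]; rfl
      simp only [← Finset.sum_mul, hAI']
      simp
    have t3 : ∑ P, ∑ Q, A⁻¹ P Q * ∑ R : Fin n, K (ang x) R *
        pd (region ε U) R.succ.succ (F P.succ.succ Q.succ.succ) x =
        ∑ R : Fin n, K (ang x) R * ∑ P, ∑ Q, A⁻¹ P Q *
          pd (region ε U) R.succ.succ (F P.succ.succ Q.succ.succ) x := by
      simp only [Finset.mul_sum]
      rw [Finset.sum_comm_cycle]
      refine Finset.sum_congr rfl fun P _ => Finset.sum_congr rfl fun Q _ =>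
        Finset.sum_congr rfl fun R _ => by ring
    simp only [crossTr, hI, hL, mul_add, Finset.sum_add_distrib]
    rw [t1, t2, t3]
    ring
  rw [e, mul_left_comm, ← mul_assoc, hd2, mul_add]
  simp only [hJac]
  rw [add_comm]
  congr 1
  · ring
  · rw [Finset.mul_sum]
    exact Finset.sum_congr rfl fun R _ => by ring

end Lie

/-! ### The background -/

section Background

variable {n : ℕ} {ε κ : ℝ} {U : Set (Fin n → ℝ)} {f : Fin n → (Fin n → ℝ) → ℝ}
  {q : Fin n → Fin n → (Fin n → ℝ) → ℝ}
  {g F : Fin (n + 2) → Fin (n + 2) → (Fin (n + 2) → ℝ) → ℝ} {x : Fin (n + 2) → ℝ}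

theorem IsHorizonBackground.isCrossMetric (hg : IsHorizonBackground ε U κ f q g) (hU : IsOpen U) :
    IsCrossMetric U q where
  isOpen := hU
  smooth := hg.smooth_q
  symm M N σ hσ := by simpa using (hg.posDef_q σ hσ).isHermitian.apply N M
  pos σ hσ := (hg.posDef_q σ hσ).det_pos

/-- The rescaled components of the background, with their values and `ρ`-derivatives at the
horizon. -/
structure BgHat (ε : ℝ) (U : Set (Fin n → ℝ)) (κ : ℝ) (f : Fin n → (Fin n → ℝ) → ℝ)
    (q : Fin n → Fin n → (Fin n → ℝ) → ℝ) (g F : Fin (n + 2) → Fin (n + 2) → (Fin (n + 2) → ℝ) → ℝ) :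
    Prop extends Hat (region ε U) g F where
  v00 : ∀ x ∈ region ε U, x 1 = 0 → F 0 0 x = -κ ^ 2
  v01 : ∀ x ∈ region ε U, x 1 = 0 → F 0 1 x = 0
  v0M : ∀ x ∈ region ε U, x 1 = 0 → ∀ P : Fin n, F 0 P.succ.succ x = 0
  v10 : ∀ x ∈ region ε U, x 1 = 0 → F 1 0 x = 0
  v11 : ∀ x ∈ region ε U, x 1 = 0 → F 1 1 x = 1
  v1M : ∀ x ∈ region ε U, x 1 = 0 → ∀ P : Fin n, F 1 P.succ.succ x = 0
  vM0 : ∀ x ∈ region ε U, x 1 = 0 → ∀ P : Fin n, F P.succ.succ 0 x = 0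
  vM1 : ∀ x ∈ region ε U, x 1 = 0 → ∀ P : Fin n, F P.succ.succ 1 x = 0
  vMN : ∀ x ∈ region ε U, x 1 = 0 → ∀ P Q : Fin n, F P.succ.succ Q.succ.succ x = q P Q (ang x)
  s00 : ∀ x ∈ region ε U, x 1 = 0 → pd (region ε U) 1 (F 0 0) x = 0
  s01 : ∀ x ∈ region ε U, x 1 = 0 → pd (region ε U) 1 (F 0 1) x = 0
  s0M : ∀ x ∈ region ε U, x 1 = 0 → ∀ P : Fin n, pd (region ε U) 1 (F 0 P.succ.succ) x = f P (ang x)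
  s10 : ∀ x ∈ region ε U, x 1 = 0 → pd (region ε U) 1 (F 1 0) x = 0
  s11 : ∀ x ∈ region ε U, x 1 = 0 → pd (region ε U) 1 (F 1 1) x = 0
  s1M : ∀ x ∈ region ε U, x 1 = 0 → ∀ P : Fin n, pd (region ε U) 1 (F 1 P.succ.succ) x = 0
  sMN : ∀ x ∈ region ε U, x 1 = 0 → ∀ P Q : Fin n,
    pd (region ε U) 1 (F P.succ.succ Q.succ.succ) x = 0

/-- Removing one ρ per index t from the fall-offs leaves -κ² + O(ρ²), O(ρ³), ρ f_M + O(ρ³), 1 +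
O(ρ²), O(ρ³) and q + O(ρ²). The only non-zero first-order coefficient is f_M, which is how f enters
the bracket. -/
theorem IsHorizonBackground.exists_bgHat (hg : IsHorizonBackground ε U κ f q g) (hU : IsOpen U) :
    ∃ F, BgHat ε U κ f q g F := by
  have N := (halfOpen_region (ε := ε) hU).nested_self
  obtain ⟨a, ha, hae⟩ := hg.tt
  obtain ⟨b, hb, hbe⟩ := hg.tρ
  choose c hc hce using hg.tM
  obtain ⟨d, hd, hde⟩ := hg.ρρ
  choose e he hee using hg.ρM
  choose k hk hke using hg.MN
  have hf := fun P => contDiffOn_comp_ang (V := region ε U) (hg.smooth_f P) fun x hx => ang_mem hx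
  have hq := fun P Q => contDiffOn_comp_ang (V := region ε U) (hg.smooth_q P Q) fun x hx => ang_mem hx
  have d1 : ∀ (u h : (Fin (n + 2) → ℝ) → ℝ), ContDiffOn ℝ ∞ u (region ε U) →
      ContDiffOn ℝ ∞ h (region ε U) → ∀ x ∈ region ε U, x 1 = 0 →
      pd (region ε U) 1 (fun y => u y + y 1 ^ 2 * h y) x = pd (region ε U) 1 u x := by
    intro u h hu hh x hx h0
    rw [N.pd_add hu (by fun_prop) 1 hx, N.pd_rho_sq_mul hh hx h0, add_zero]
  have d0 : ∀ h : (Fin (n + 2) → ℝ) → ℝ, ContDiffOn ℝ ∞ h (region ε U) → ∀ x ∈ region ε U,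
      x 1 = 0 → pd (region ε U) 1 (fun y => y 1 ^ 2 * (y 1 * h y)) x = 0 := fun h hh x hx h0 =>
    N.pd_rho_sq_mul (by fun_prop) hx h0
  have df : ∀ P, ∀ x ∈ region ε U, x 1 = 0 →
      pd (region ε U) 1 (fun y => y 1 * (angPull (f P) y + y 1 ^ 2 * c P y)) x = f P (ang x) :=
    fun P x hx h0 => by
      rw [N.pd_rho_mul (by fun_prop) hx h0, h0]; simp [angPull]
  let F0M : Fin n → (Fin (n + 2) → ℝ) → ℝ := fun P x => x 1 * (angPull (f P) x + x 1 ^ 2 * c P x)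
  let F1M : Fin n → (Fin (n + 2) → ℝ) → ℝ := fun P x => x 1 ^ 2 * (x 1 * e P x)
  let F01 : (Fin (n + 2) → ℝ) → ℝ := fun x => x 1 ^ 2 * (x 1 * b x)
  refine ⟨fun μ ν => Fin.cases (motive := fun _ => (Fin (n + 2) → ℝ) → ℝ)
    (Fin.cases (motive := fun _ => (Fin (n + 2) → ℝ) → ℝ) (fun x => -κ ^ 2 + x 1 ^ 2 * a x)
      (Fin.cases (motive := fun _ => (Fin (n + 2) → ℝ) → ℝ) F01 F0M) ν)
    (Fin.cases (motive := fun _ => (Fin (n + 2) → ℝ) → ℝ)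
      (Fin.cases (motive := fun _ => (Fin (n + 2) → ℝ) → ℝ) F01
        (Fin.cases (motive := fun _ => (Fin (n + 2) → ℝ) → ℝ) (fun x => 1 + x 1 ^ 2 * d x) F1M) ν)
      (fun P => Fin.cases (motive := fun _ => (Fin (n + 2) → ℝ) → ℝ) (F0M P)
        (Fin.cases (motive := fun _ => (Fin (n + 2) → ℝ) → ℝ) (F1M P)
          fun Q x => angPull (q P Q) x + x 1 ^ 2 * k P Q x) ν)) μ,
    { smooth := fun μ ν => ?_
      eq := fun μ ν x hx => ?_
      v00 := fun x hx h0 => by simp [h0]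
      v01 := fun x hx h0 => show x 1 ^ 2 * (x 1 * b x) = 0 by simp [h0]
      v0M := fun x hx h0 P => show x 1 * (angPull (f P) x + x 1 ^ 2 * c P x) = 0 by simp [h0]
      v10 := fun x hx h0 => show x 1 ^ 2 * (x 1 * b x) = 0 by simp [h0]
      v11 := fun x hx h0 => show 1 + x 1 ^ 2 * d x = 1 by simp [h0]
      v1M := fun x hx h0 P => show x 1 ^ 2 * (x 1 * e P x) = 0 by simp [h0]
      vM0 := fun x hx h0 P => show x 1 * (angPull (f P) x + x 1 ^ 2 * c P x) = 0 by simp [h0]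
      vM1 := fun x hx h0 P => show x 1 ^ 2 * (x 1 * e P x) = 0 by simp [h0]
      vMN := fun x hx h0 P Q => show angPull (q P Q) x + x 1 ^ 2 * k P Q x = _ by simp [h0, angPull]
      s00 := fun x hx h0 => (d1 (fun _ => -κ ^ 2) a contDiffOn_const ha x hx h0).trans (by simp [pd])
      s01 := d0 b hb
      s0M := fun x hx h0 P => df P x hx h0
      s10 := d0 b hb
      s11 := fun x hx h0 => (d1 (fun _ => 1) d contDiffOn_const hd x hx h0).trans (by simp [pd])
      s1M := fun x hx h0 P => d0 (e P) (he P) x hx h0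
      sMN := fun x hx h0 P Q => (d1 _ (k P Q) (hq P Q) (hk P Q) x hx h0).trans
        (N.pd_one_ang hU (hg.smooth_q P Q) hx hx.2.2) }⟩
  · have s0 : ∀ P, ContDiffOn ℝ ∞ (F0M P) (region ε U) := fun P => by simp only [F0M]; fun_prop
    have s1 : ∀ P, ContDiffOn ℝ ∞ (F1M P) (region ε U) := fun P => by simp only [F1M]; fun_prop
    have s2 : ContDiffOn ℝ ∞ F01 (region ε U) := by simp only [F01]; fun_prop
    revert μ ν
    refine index_cases (index_cases ?_ s2 s0) (index_cases s2 ?_ s1)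
      fun P => index_cases (s0 P) (s1 P) fun Q => ?_
    · simp only [Fin.cases_zero]; fun_prop
    · change ContDiffOn ℝ ∞ (fun x : Fin (n + 2) → ℝ => 1 + x 1 ^ 2 * d x) _; fun_prop
    · change ContDiffOn ℝ ∞ (fun x : Fin (n + 2) → ℝ => angPull (q P Q) x + x 1 ^ 2 * k P Q x) _
      fun_prop
  · have t01 : g 0 1 x = x 1 * 1 * (x 1 ^ 2 * (x 1 * b x)) := by rw [hbe x hx]; ring
    have t0M : ∀ P : Fin n, g 0 P.succ.succ x = x 1 * 1 * (x 1 * (f P (ang x) + x 1 ^ 2 * c P x)) :=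
      fun P => by linear_combination hce P x hx
    have t1M : ∀ P : Fin n, g 1 P.succ.succ x = 1 * 1 * (x 1 ^ 2 * (x 1 * e P x)) := fun P => by
      rw [hee P x hx]; ring
    revert μ ν
    refine index_cases (index_cases ?_ ?_ fun P => ?_) (index_cases ?_ ?_ fun P => ?_)
      fun P => index_cases ?_ ?_ fun Q => ?_
    all_goals simp only [lam_zero, lam_one, lam_succ]
    · simp only [Fin.cases_zero]; linear_combination hae x hx
    · exact t01
    · exact t0M P
    · rw [hg.symm 1 0 x hx, t01, mul_comm (x 1) 1]; rfl
    · change _ = 1 * 1 * (1 + x 1 ^ 2 * d x); linear_combination hde x hx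
    · exact t1M P
    · rw [hg.symm _ 0 x hx, t0M, mul_comm (x 1) 1]; rfl
    · rw [hg.symm _ 1 x hx, t1M]; rfl
    · change _ = 1 * 1 * (q P Q (ang x) + x 1 ^ 2 * k P Q x); linear_combination hke P Q x hx

theorem BgHat.left (hF : BgHat ε U κ f q g F) (hx : x ∈ region ε U) (h0 : x 1 = 0) (a : Bool)
    (P : Fin n) : F (planeIdx n a) P.succ.succ x = 0 := by
  cases a
  · exact hF.v0M x hx h0 P
  · exact hF.v1M x hx h0 P

theorem BgHat.right (hF : BgHat ε U κ f q g F) (hx : x ∈ region ε U) (h0 : x 1 = 0) (P : Fin n)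
    (a : Bool) : F P.succ.succ (planeIdx n a) x = 0 := by
  cases a
  · exact hF.vM0 x hx h0 P
  · exact hF.vM1 x hx h0 P

theorem BgHat.plane (hF : BgHat ε U κ f q g F) (hx : x ∈ region ε U) (h0 : x 1 = 0) (a b : Bool) :
    F (planeIdx n a) (planeIdx n b) x = planeG 1 0 (κ ^ 2) a b := by
  cases a <;> cases b <;>
    simp [planeIdx, planeG, symB, hF.v00 x hx h0, hF.v01 x hx h0, hF.v10 x hx h0, hF.v11 x hx h0]

theorem BgHat.metricDet_horizon (hF : BgHat ε U κ f q g F) (hx : x ∈ region ε U) (h0 : x 1 = 0) :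
    metricDet F x = -(κ ^ 2 * metricDet q (ang x)) := by
  rw [OrbitMetric.metricDet_of_block ⟨hF.left hx h0, hF.right hx h0⟩ (hF.plane hx h0)]
  simp only [hF.vMN x hx h0, metricDet]
  ring

theorem BgHat.orbitMetric (hF : BgHat ε U κ f q g F) (hg : IsHorizonBackground ε U κ f q g)
    (hU : IsOpen U) (hκ : 0 < κ) :
    OrbitMetric (region ε U) (region ε U) F (fun _ => 1) (fun _ => 0) (fun _ => κ ^ 2) where
  nested := (halfOpen_region hU).nested_self
  smooth := hF.smooth
  smooth_E := contDiffOn_const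
  smooth_B := contDiffOn_const
  smooth_M := contDiffOn_const
  -- For ρ > 0 the assumed non-degeneracy applies; on the horizon the rescaled determinant is -κ²
  -- det q, non-zero as q is positive definite.
  det_ne x hx h := by
    rcases (show 0 ≤ x 1 from hx.1).eq_or_lt with h0 | h0
    · rw [hF.metricDet_horizon hx h0.symm, neg_eq_zero] at h
      exact (mul_pos (pow_pos hκ 2) ((hg.isCrossMetric hU).pos _ hx.2.2)).ne' h
    · exact hg.nondegenerate x hx h0 (by rw [hF.metricDet_eq hx, h, mul_zero])
  E_ne _ _ := one_ne_zero
  M_ne _ _ := (pow_pos hκ 2).ne'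
  plane _ hx h0 := hF.plane hx h0
  left _ hx h0 := hF.left hx h0
  right _ hx h0 := hF.right hx h0
  symm x hx h0 P Q := by
    rw [hF.vMN x hx h0, hF.vMN x hx h0, (hg.isCrossMetric hU).symm P Q _ hx.2.2]
  pd_E x hx h0 := by simp [pd]
  pd_B x hx h0 := by simp [pd]
  pd_M x hx h0 := by simp [pd]
  pd_cross x hx h0 P Q := by
    have N := (halfOpen_region (ε := ε) hU).nested_self
    rw [N.pd_tangential (hF.smooth _ _) (contDiffOn_comp_ang (hg.smooth_q P Q) fun x hx => ang_mem hx)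
      (fun y hy hy0 => hF.vMN y hy hy0 P Q) (by simp) hx h0, N.pd_zero_ang hU (hg.smooth_q P Q) hx hx.2.2]

end Background

/-! ### Limits at the horizon -/

section Limits

variable {n : ℕ} {ε : ℝ} {U : Set (Fin n → ℝ)} {V : Set (Fin (n + 2) → ℝ)}

@[simp] theorem pt_zero (t ρ : ℝ) (σ : Fin n → ℝ) : pt t ρ σ 0 = t := rfl

@[simp] theorem pt_one (t ρ : ℝ) (σ : Fin n → ℝ) : pt t ρ σ 1 = ρ := rfl

@[simp] theorem pt_succ (t ρ : ℝ) (σ : Fin n → ℝ) (M : Fin n) : pt t ρ σ M.succ.succ = σ M := rfl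

@[simp] theorem ang_pt (t ρ : ℝ) (σ : Fin n → ℝ) : ang (pt t ρ σ) = σ := rfl

theorem continuous_pt : Continuous fun p : ℝ × ℝ × (Fin n → ℝ) => pt p.1 p.2.1 p.2.2 := by
  refine continuous_pi (index_cases ?_ ?_ fun M => ?_)
  · exact continuous_fst
  · exact continuous_snd.fst
  · exact (continuous_apply M).comp continuous_snd.snd

theorem pt_mem_region (hε : 0 < ε) (t : ℝ) {σ : Fin n → ℝ} (hσ : σ ∈ U) : pt t 0 σ ∈ region ε U :=
  ⟨le_rfl, hε, hσ⟩

/-- A property that holds near a compact portion of the horizon holds uniformly. -/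
theorem exists_forall_near_horizon {T : Set ℝ} {C : Set (Fin n → ℝ)} (hT : IsCompact T)
    (hC : IsCompact C) {P : (Fin (n + 2) → ℝ) → Prop}
    (h : ∀ t ∈ T, ∀ σ ∈ C, ∀ᶠ y in 𝓝 (pt t 0 σ), P y) :
    ∃ δ > 0, ∀ t ∈ T, ∀ σ ∈ C, ∀ ρ : ℝ, |ρ| < δ → P (pt t ρ σ) := by
  have key := (hT.prod hC).eventually_forall_of_forall_eventually (x₀ := (0 : ℝ))
    (P := fun ρ p => P (pt p.1 ρ p.2)) fun p hp => by
      have hc : Continuous fun z : ℝ × ℝ × (Fin n → ℝ) => pt z.2.1 z.1 z.2.2 :=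
        continuous_pt.comp (continuous_snd.fst.prodMk (continuous_fst.prodMk continuous_snd.snd))
      exact hc.continuousAt.eventually (h p.1 hp.1 p.2 hp.2)
  obtain ⟨δ, hδ, hb⟩ := Metric.eventually_nhds_iff.1 key
  exact ⟨δ, hδ, fun t ht σ hσ ρ hρ => hb (by simpa using hρ) (t, σ) ⟨ht, hσ⟩⟩

/-- Near a compact portion of the horizon a function that is continuous up to the horizon is
uniformly bounded. -/
theorem exists_bound_near_horizon {T : Set ℝ} {C : Set (Fin n → ℝ)} (hT : IsCompact T)
    (hC : IsCompact C) (hV : HalfOpen V) (hsub : ∀ t ∈ T, ∀ σ ∈ C, pt t 0 σ ∈ V)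
    {B : (Fin (n + 2) → ℝ) → ℝ} (hB : ContinuousOn B V) :
    ∃ c, ∃ δ > 0, ∀ t ∈ T, ∀ σ ∈ C, ∀ ρ : ℝ, 0 ≤ ρ → ρ < δ → pt t ρ σ ∈ V ∧ |B (pt t ρ σ)| ≤ c := by
  have hK : IsCompact ((fun p : ℝ × (Fin n → ℝ) => pt p.1 0 p.2) '' (T ×ˢ C)) :=
    (hT.prod hC).image (continuous_pt.comp
      (continuous_fst.prodMk (continuous_const.prodMk continuous_snd)))
  obtain ⟨c, hc⟩ := hK.exists_bound_of_continuousOn (hB.mono (by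
    rintro _ ⟨p, hp, rfl⟩; exact hsub _ hp.1 _ hp.2))
  obtain ⟨δ, hδ, h⟩ := exists_forall_near_horizon hT hC
    (P := fun y => 0 ≤ y 1 → y ∈ V ∧ |B y| ≤ c + 1) fun t ht σ hσ => by
      have hx := hsub t ht σ hσ
      have h1 : ∀ᶠ y in 𝓝[V] (pt t 0 σ), |B y| < c + 1 := by
        refine (hB _ hx).norm.eventually (gt_mem_nhds ?_)
        exact (hc _ ⟨(t, σ), ⟨ht, hσ⟩, rfl⟩).trans_lt (lt_add_one c)
      have h2 := hV.mem_nhdsWithin hx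
      have h3 : 𝓝[V] (pt t 0 σ) = 𝓝[{y | 0 ≤ y 1}] (pt t 0 σ) := by
        refine le_antisymm (nhdsWithin_mono _ hV.subset) (le_inf inf_le_left ?_)
        exact le_principal_iff.2 h2
      rw [h3] at h1
      have h4 := eventually_nhdsWithin_iff.1 (h1.and h2)
      filter_upwards [h4] with y hy hy1 using ⟨(hy hy1).2, (hy hy1).1.le⟩
  refine ⟨c + 1, δ, hδ, fun t ht σ hσ ρ h0 hρ => h t ht σ hσ ρ (by rwa [abs_of_nonneg h0]) h0⟩

theorem bigO_of_continuousOn (hV : HalfOpen V) (hsub : ∀ t : ℝ, ∀ σ ∈ U, pt t 0 σ ∈ V) (k : ℕ)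
    {b B : (Fin (n + 2) → ℝ) → ℝ} (hB : ContinuousOn B V)
    (h : ∀ x ∈ V, 0 < x 1 → b x = x 1 ^ k * B x) : BigO U k b := by
  intro T C hT hC hCU
  obtain ⟨c, δ, hδ, hb⟩ := exists_bound_near_horizon hT hC hV
    (fun t _ σ hσ => hsub t σ (hCU hσ)) hB
  refine ⟨c, δ, hδ, fun t ht σ hσ ρ h0 hρ => ?_⟩
  obtain ⟨h1, h2⟩ := hb t ht σ hσ ρ h0.le hρ
  rw [h _ h1 h0, abs_mul, pt_one, abs_of_nonneg (pow_nonneg h0.le k), mul_comm]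
  exact mul_le_mul_of_nonneg_right h2 (pow_nonneg h0.le k)

/-- A density that extends continuously to the horizon is integrated there. -/
theorem hasBoundaryIntegral_of_continuousOn {C : Set (Fin n → ℝ)} (hC : IsCompact C) (t : ℝ)
    (hV : HalfOpen V) (hsub : ∀ σ ∈ C, pt t 0 σ ∈ V) {b B : (Fin (n + 2) → ℝ) → ℝ}
    (hB : ContinuousOn B V) (h : ∀ x ∈ V, 0 < x 1 → b x = B x) :
    HasBoundaryIntegral C t b (∫ σ in C, B (pt t 0 σ)) := by
  obtain ⟨c, δ, hδ, hb⟩ := exists_bound_near_horizon (T := {t}) isCompact_singleton hC hV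
    (fun s hs σ hσ => by rw [hs]; exact hsub σ hσ) hB
  have hρ : ∀ᶠ ρ in 𝓝[>] (0 : ℝ), 0 < ρ ∧ ρ < δ := by
    filter_upwards [Ioo_mem_nhdsGT hδ] with ρ hρ using hρ
  have hcont : ∀ ρ, 0 ≤ ρ → ρ < δ → ContinuousOn (fun σ => B (pt t ρ σ)) C := fun ρ h0 h1 => by
    refine hB.comp ?_ fun σ hσ => (hb t rfl σ hσ ρ h0 h1).1
    exact (continuous_pt.comp (continuous_const.prodMk
      (continuous_const.prodMk continuous_id))).continuousOn
  have heq : ∀ ρ, 0 < ρ → ρ < δ → ∀ σ ∈ C, b (pt t ρ σ) = B (pt t ρ σ) := fun ρ h0 h1 σ hσ =>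
    h _ (hb t rfl σ hσ ρ h0.le h1).1 h0
  refine ⟨?_, ?_⟩
  · filter_upwards [hρ] with ρ hρ
    exact ((hcont ρ hρ.1.le hρ.2).integrableOn_compact hC).congr_fun
      (fun σ hσ => (heq ρ hρ.1 hρ.2 σ hσ).symm) hC.measurableSet
  · have hlim : Tendsto (fun ρ => ∫ σ in C, B (pt t ρ σ)) (𝓝[>] (0 : ℝ)) (𝓝 (∫ σ in C, B (pt t 0 σ))) := by
      refine tendsto_integral_filter_of_dominated_convergence (fun _ => c) ?_ ?_ ?_ ?_
      · filter_upwards [hρ] with ρ hρ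
        exact (hcont ρ hρ.1.le hρ.2).aestronglyMeasurable hC.measurableSet
      · filter_upwards [hρ] with ρ hρ
        filter_upwards [ae_restrict_mem hC.measurableSet] with σ hσ
        exact (hb t rfl σ hσ ρ hρ.1.le hρ.2).2
      · exact integrableOn_const hC.measure_lt_top.ne
      · filter_upwards [ae_restrict_mem hC.measurableSet] with σ hσ
        have h1 := hB _ (hsub σ hσ)
        refine h1.tendsto.comp (tendsto_nhdsWithin_iff.2 ⟨?_, ?_⟩)
        · have : Continuous fun ρ : ℝ => pt t ρ σ :=
            continuous_pt.comp (continuous_const.prodMk (continuous_id.prodMk continuous_const))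
          exact (this.tendsto 0).mono_left nhdsWithin_le_nhds
        · filter_upwards [hρ] with ρ hρ using (hb t rfl σ hσ ρ hρ.1.le hρ.2).1
    refine hlim.congr' ?_
    filter_upwards [hρ] with ρ hρ
    exact setIntegral_congr_fun hC.measurableSet fun σ hσ => (heq ρ hρ.1 hρ.2 σ hσ).symm

end Limits

/-! ### Fields with prescribed coefficients -/

section Field

variable {n : ℕ} {ε : ℝ} {U : Set (Fin n → ℝ)}

/-- The vector field with prescribed coefficients and no higher-order terms. -/
def fieldOf (F G H J : (Fin n → ℝ) → ℝ) (K : (Fin n → ℝ) → (Fin n → ℝ)) (x : Fin (n + 2) → ℝ) :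
    Fin (n + 2) → ℝ :=
  pt (F (ang x) + x 0 * G (ang x)) (x 1 * (H (ang x) + x 0 * J (ang x))) (K (ang x))

theorem hasForm_fieldOf {F G H J : (Fin n → ℝ) → ℝ} {K : (Fin n → ℝ) → (Fin n → ℝ)}
    (hF : ContDiffOn ℝ ∞ F U) (hG : ContDiffOn ℝ ∞ G U) (hH : ContDiffOn ℝ ∞ H U)
    (hJ : ContDiffOn ℝ ∞ J U) (hK : ContDiffOn ℝ ∞ K U) :
    HasForm ε U F G H J K (fieldOf F G H J K) :=
  ⟨hF, hG, hH, hJ, hK, ⟨0, contDiffOn_const, fun x _ => by simp [fieldOf]⟩,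
    ⟨0, contDiffOn_const, fun x _ => by simp [fieldOf]⟩,
    fun M => ⟨0, contDiffOn_const, fun x _ => by simp [fieldOf]⟩⟩

end Field

/-! ### The current at the background -/

section Current

variable {n : ℕ} {ε κ GN : ℝ} {U : Set (Fin n → ℝ)} {f : Fin n → (Fin n → ℝ) → ℝ}
  {q : Fin n → Fin n → (Fin n → ℝ) → ℝ}
  {g : Fin (n + 2) → Fin (n + 2) → (Fin (n + 2) → ℝ) → ℝ}
  {F₁ G₁ H₁ J₁ F₂ G₂ H₂ J₂ : (Fin n → ℝ) → ℝ} {K₁ K₂ : (Fin n → ℝ) → (Fin n → ℝ)}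
  {η ξ : (Fin (n + 2) → ℝ) → (Fin (n + 2) → ℝ)}

/-- The current at the background is `(ρ⁻¹ w^t, w^ρ, w^M)` with `w` smooth up to the horizon, where
`w^t` and `w^M` vanish. -/
theorem exists_current (hg : IsHorizonBackground ε U κ f q g) (hU : IsOpen U) (hκ : 0 < κ)
    (GN : ℝ) (h₁ : HasForm ε U F₁ G₁ H₁ J₁ K₁ η) (h₂ : HasForm ε U F₂ G₂ H₂ J₂ K₂ ξ) :
    ∃ w : Fin (n + 2) → (Fin (n + 2) → ℝ) → ℝ, (∀ ν, ContDiffOn ℝ ∞ (w ν) (region ε U)) ∧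
      (∀ ν, ∀ x ∈ region ε U, 0 < x 1 → bgCurrent GN ε U g η ξ ν x = (lam x ν)⁻¹ * w ν x) ∧
      (∀ x ∈ region ε U, x 1 = 0 → w 0 x = 0) ∧
      ∀ x ∈ region ε U, x 1 = 0 → w 1 x =
        Real.sqrt (κ ^ 2 * metricDet q (ang x)) / (16 * Real.pi * GN) *
          (2 * divergence U q K₂ (ang x) * G₁ (ang x) - 2 * divergence U q K₁ (ang x) * G₂ (ang x)) := by
  obtain ⟨F, hF⟩ := hg.exists_bgHat hU
  obtain ⟨a₁, d₁, v₁⟩ := (h₁.jetForm hU).exists_hatVec hU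
  obtain ⟨a₂, d₂, v₂⟩ := (h₂.jetForm hU).exists_hatVec hU
  have O := hF.orbitMetric hg hU hκ
  have N := O.nested
  have hq := hg.isCrossMetric hU
  have L₁ := hF.toHat.lieDeriv N v₁
  have L₂ := hF.toHat.lieDeriv N v₂
  have P₁ := O.orbitPert hU v₁
  have P₂ := O.orbitPert hU v₂
  have hdet : ∀ x ∈ region ε U, x 1 = 0 →
      (Matrix.of fun P Q : Fin n => F P.succ.succ Q.succ.succ x).det = metricDet q (ang x) :=
    fun x hx h0 => by simp only [hF.vMN x hx h0, metricDet]
  refine ⟨hatOmega GN (region ε U) F (hatLie (region ε U) η a₁ d₁ F) (hatLie (region ε U) ξ a₂ d₂ F),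
    contDiffOn_hatOmega N O.smooth O.det_ne L₁.smooth L₂.smooth GN,
    fun ν x hx h1 => hF.toHat.omega_eq L₁ L₂ N hx h1 GN ν,
    fun x hx h0 => O.hatOmega_zero P₁ P₂ hx h0 GN, fun x hx h0 => ?_⟩
  rw [O.hatOmega_one P₁ P₂ hx h0, O.crossTr_hatLie hq v₁ hdet hx h0, O.crossTr_hatLie hq v₂ hdet hx h0,
    hF.metricDet_horizon hx h0, neg_neg]
  simp [crossDer, pd, angPull]

/-- The component along t is ρ⁻¹ w^t with w^t zero on the horizon, and a quotient by ρ of such a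
function is smooth. The other components are smooth already. -/
theorem bgCurrent_bigO (hg : IsHorizonBackground ε U κ f q g) (hU : IsOpen U) (hε : 0 < ε)
    (hκ : 0 < κ) {η ξ} (hη : η ∈ algA' ε U) (hξ : ξ ∈ algA' ε U) (μ : Fin (n + 2)) :
    BigO U 0 (bgCurrent GN ε U g η ξ μ) := by
  obtain ⟨F₁, G₁, H₁, J₁, K₁, h₁⟩ := hη
  obtain ⟨F₂, G₂, H₂, J₂, K₂, h₂⟩ := hξ
  obtain ⟨w, hw, he, h0, -⟩ := exists_current hg hU hκ GN h₁ h₂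
  have hs := halfOpen_region (ε := ε) hU
  obtain ⟨m, hm, hwm, -⟩ := hs.nested_self.exists_div (hw 0) h0
  have hsub : ∀ t : ℝ, ∀ σ ∈ U, pt t 0 σ ∈ region ε U := fun t σ hσ => pt_mem_region hε t hσ
  rcases eq_or_ne μ 0 with rfl | hμ
  · refine bigO_of_continuousOn hs hsub 0 hm.continuousOn fun x hx h1 => ?_
    rw [he 0 x hx h1, hwm x hx, lam_zero, pow_zero, one_mul, inv_mul_cancel_left₀ h1.ne']
  · refine bigO_of_continuousOn hs hsub 0 (hw μ).continuousOn fun x hx h1 => ?_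
    rw [he μ x hx h1, show lam x μ = 1 from if_neg hμ]; simp

/-- The horizon value of ω^ρ is a combination of the divergences of K₁ and K₂, so it vanishes on 𝒜
and a factor ρ can be split off. -/
theorem bgCurrent_bigO_one (hg : IsHorizonBackground ε U κ f q g) (hU : IsOpen U) (hε : 0 < ε)
    (hκ : 0 < κ) {η ξ} (hη : η ∈ algA ε U q) (hξ : ξ ∈ algA ε U q) :
    BigO U 1 (bgCurrent GN ε U g η ξ 1) := by
  obtain ⟨F₁, G₁, H₁, J₁, K₁, h₁, hd₁⟩ := hη
  obtain ⟨F₂, G₂, H₂, J₂, K₂, h₂, hd₂⟩ := hξ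
  obtain ⟨w, hw, he, -, hw1⟩ := exists_current hg hU hκ GN h₁ h₂
  have hs := halfOpen_region (ε := ε) hU
  obtain ⟨m, hm, hwm, -⟩ := hs.nested_self.exists_div (hw 1) fun x hx h0 => by
    rw [hw1 x hx h0, hd₁ _ hx.2.2, hd₂ _ hx.2.2]; ring
  refine bigO_of_continuousOn hs (fun t σ hσ => pt_mem_region hε t hσ) 1 hm.continuousOn
    fun x hx h1 => ?_
  rw [he 1 x hx h1, hwm x hx, lam_one, pow_one, inv_one, one_mul]

theorem algA_subset : algA ε U q ⊆ algA' ε U := fun _ ⟨F, G, H, J, K, h, _⟩ => ⟨F, G, H, J, K, h⟩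

theorem exists_not_bigO (hn : 1 ≤ n) (hg : IsHorizonBackground ε U κ f q g) (hU : IsOpen U)
    (hUne : U.Nonempty) (hε : 0 < ε) (hκ : 0 < κ) (hGN : 0 < GN) :
    ∃ η ∈ algA' ε U, ∃ ξ ∈ algA' ε U, ¬ BigO U 1 (bgCurrent GN ε U g η ξ 1) := by
  obtain ⟨τ, hτ⟩ := hUne
  have hq := hg.isCrossMetric hU
  let M₀ : Fin n := ⟨0, hn⟩
  -- A linear field that vanishes at τ: the Christoffel terms of its divergence drop out there, and
  -- the divergence is 1 for every metric q.
  let K : (Fin n → ℝ) → (Fin n → ℝ) := fun σ M => if M = M₀ then σ M₀ - τ M₀ else 0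
  have hKs : ContDiffOn ℝ ∞ K U := by
    refine contDiffOn_pi.2 fun M => ?_
    simp only [K]
    split_ifs <;> fun_prop
  -- This is t ∂_t, with G = 1. Paired with K it gives ω^ρ a positive limit at τ.
  have h₁ : HasForm ε U (fun _ => 0) (fun _ => 1) (fun _ => 0) (fun _ => 0) (fun _ => 0) _ :=
    hasForm_fieldOf contDiffOn_const contDiffOn_const contDiffOn_const contDiffOn_const
      contDiffOn_const
  have h₂ : HasForm ε U (fun _ => 0) (fun _ => 0) (fun _ => 0) (fun _ => 0) K _ :=
    hasForm_fieldOf contDiffOn_const contDiffOn_const contDiffOn_const contDiffOn_const hKs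
  refine ⟨_, ⟨_, _, _, _, _, h₁⟩, _, ⟨_, _, _, _, _, h₂⟩, fun hO => ?_⟩
  obtain ⟨w, hw, he, -, hw1⟩ := exists_current hg hU hκ GN h₁ h₂
  have hdiv : divergence U q K τ = 1 := by
    rw [hq.divergence_eq hτ]
    have hz : ∀ M, K τ M = 0 := fun M => by simp [K]
    have hd : ∀ M, pd U M (fun y => K y M) τ = if M = M₀ then 1 else 0 := fun M => by
      by_cases hM : M = M₀
      · subst hM
        have h := ((hasFDerivWithinAt_apply (𝕜 := ℝ) M₀ τ U).sub_const (τ M₀)).fderivWithin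
          (hU.uniqueDiffOn τ hτ)
        simp only [pd, K, if_true]
        rw [h]; simp
      · simp [pd, K, hM]
    simp [hz, hd]
  have hdiv0 : divergence U q (fun _ => 0) τ = 0 := by
    rw [hq.divergence_eq hτ]; simp [pd]
  have hmem := pt_mem_region (U := U) hε 0 hτ
  obtain ⟨c, δ, hδ, hb⟩ := hO {0} {τ} isCompact_singleton isCompact_singleton (by simpa using hτ)
  have hcont : Continuous fun ρ : ℝ => pt 0 ρ τ :=
    continuous_pt.comp (continuous_const.prodMk (continuous_id.prodMk continuous_const))
  have hev : ∀ᶠ ρ in 𝓝[>] (0 : ℝ), ρ < δ ∧ pt 0 ρ τ ∈ region ε U := by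
    filter_upwards [Ioo_mem_nhdsGT hδ, Ioo_mem_nhdsGT hε] with ρ h1 h2
    exact ⟨h1.2, h2.1.le, h2.2, hτ⟩
  have hlim : Tendsto (fun ρ => w 1 (pt 0 ρ τ)) (𝓝[>] (0 : ℝ)) (𝓝 (w 1 (pt 0 0 τ))) := by
    refine ((hw 1).continuousOn _ hmem).tendsto.comp (tendsto_nhdsWithin_iff.2 ⟨?_, ?_⟩)
    · exact (hcont.tendsto 0).mono_left nhdsWithin_le_nhds
    · filter_upwards [hev] with ρ h using h.2
  have hzero : Tendsto (fun ρ => w 1 (pt 0 ρ τ)) (𝓝[>] (0 : ℝ)) (𝓝 0) := by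
    refine squeeze_zero_norm' (a := fun ρ => c * ρ ^ 1) ?_ ?_
    · filter_upwards [hev, self_mem_nhdsWithin] with ρ h h0
      have h0 : 0 < ρ := h0
      have := hb 0 rfl τ rfl ρ h0 h.1
      rw [he 1 _ h.2 h0, lam_one, inv_one, one_mul] at this
      exact this
    · have : Tendsto (fun ρ : ℝ => c * ρ ^ 1) (𝓝 0) (𝓝 (c * 0 ^ 1)) := by
        exact (continuous_const.mul (continuous_id.pow 1)).tendsto 0
      simpa using this.mono_left nhdsWithin_le_nhds
  have := tendsto_nhds_unique hlim hzero
  rw [hw1 _ hmem rfl, ang_pt, hdiv, hdiv0] at this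
  have hpos : 0 < Real.sqrt (κ ^ 2 * metricDet q τ) :=
    Real.sqrt_pos.2 (mul_pos (pow_pos hκ 2) (hq.pos τ hτ))
  have hpos' : 0 < Real.sqrt (κ ^ 2 * metricDet q τ) / (16 * Real.pi * GN) := by positivity
  have h : Real.sqrt (κ ^ 2 * metricDet q τ) / (16 * Real.pi * GN) * (2 * 1 * 1 - 2 * 0 * 0) = 0 :=
    this
  linarith

end Current

/-! ### Linear differential equations -/

section LinearODE

theorem HasDerivWithinAt.Ici_of_Icc {E : Type*} [NormedAddCommGroup E] [NormedSpace ℝ E] {u : ℝ → E}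
    {u' : E} {r : ℝ} (hr : r ∈ Ico (0 : ℝ) 1) (h : HasDerivWithinAt u u' (Icc 0 1) r) :
    HasDerivWithinAt u u' (Ici r) r :=
  h.mono_of_mem_nhdsWithin (mem_of_superset (Icc_mem_nhdsGE hr.2) (Icc_subset_Icc_left hr.1))

/-- A scalar linear equation. -/
theorem eq_mul_exp_of_linear {k : ℝ → ℝ} (hk : ContinuousOn k (Icc 0 1)) :
    ∃ e : ℝ → ℝ, ∀ u : ℝ → ℝ,
      (∀ r ∈ Icc (0 : ℝ) 1, HasDerivWithinAt u (k r * u r) (Icc 0 1) r) →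
      ∀ r ∈ Icc (0 : ℝ) 1, u r = u 0 * Real.exp (e r) := by
  -- Constant extension beyond [0, 1] makes the coefficient continuous on the line, so its primitive
  -- is differentiable at the endpoints too.
  let k' : ℝ → ℝ := IccExtend zero_le_one ((Icc 0 1).domRestrict k)
  have hk' : Continuous k' := (continuousOn_iff_continuous_domRestrict.1 hk).Icc_extend'
  have hkk : ∀ r ∈ Icc (0 : ℝ) 1, k' r = k r := fun r hr => IccExtend_of_mem _ _ hr
  refine ⟨fun r => ∫ y in (0 : ℝ)..r, k' y, fun u hu r hr => ?_⟩
  have he : ∀ r, HasDerivAt (fun r => ∫ y in (0 : ℝ)..r, k' y) (k' r) r := fun r =>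
    intervalIntegral.integral_hasDerivAt_right (hk'.intervalIntegrable _ _)
      (hk'.stronglyMeasurableAtFilter _ _) hk'.continuousAt
  have hv : ∀ r ∈ Icc (0 : ℝ) 1,
      HasDerivWithinAt (fun r => u r * Real.exp (-∫ y in (0 : ℝ)..r, k' y)) 0 (Icc 0 1) r := by
    intro r hr
    have := (hu r hr).mul ((he r).neg.exp.hasDerivWithinAt (s := Icc 0 1))
    refine this.congr_deriv ?_
    rw [hkk r hr]; ring
  have hc := constant_of_has_deriv_right_zero (fun r hr => (hv r hr).continuousWithinAt)
    (fun r hr => (hv r (Ico_subset_Icc_self hr)).Ici_of_Icc hr) r hr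
  simp only [intervalIntegral.integral_same, neg_zero, Real.exp_zero, mul_one] at hc
  rw [← hc, mul_assoc, ← Real.exp_add]; simp

theorem eq_zero_of_linear {k u : ℝ → ℝ} (hk : ContinuousOn k (Icc 0 1))
    (hu : ∀ r ∈ Icc (0 : ℝ) 1, HasDerivWithinAt u (k r * u r) (Icc 0 1) r) (h0 : u 0 = 0)
    {r : ℝ} (hr : r ∈ Icc (0 : ℝ) 1) : u r = 0 := by
  obtain ⟨e, he⟩ := eq_mul_exp_of_linear hk
  rw [he u hu r hr, h0, zero_mul]

theorem pos_of_linear {k u : ℝ → ℝ} (hk : ContinuousOn k (Icc 0 1))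
    (hu : ∀ r ∈ Icc (0 : ℝ) 1, HasDerivWithinAt u (k r * u r) (Icc 0 1) r) (h0 : u 0 = 1)
    {r : ℝ} (hr : r ∈ Icc (0 : ℝ) 1) : 0 < u r := by
  obtain ⟨e, he⟩ := eq_mul_exp_of_linear hk
  rw [he u hu r hr, h0, one_mul]
  exact Real.exp_pos _

/-- A homogeneous linear system. -/
theorem eq_zero_of_linear_system {ι : Type*} [Fintype ι] {A : ι → ι → ℝ → ℝ} {u : ι → ℝ → ℝ}
    (hA : ∀ i j, ContinuousOn (A i j) (Icc 0 1))
    (hu : ∀ i, ∀ r ∈ Icc (0 : ℝ) 1, HasDerivWithinAt (u i) (∑ j, A i j r * u j r) (Icc 0 1) r)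
    (h0 : ∀ i, u i 0 = 0) (i : ι) {r : ℝ} (hr : r ∈ Icc (0 : ℝ) 1) : u i r = 0 := by
  have hb : ∀ i j, ∃ c, ∀ r ∈ Icc (0 : ℝ) 1, ‖A i j r‖ ≤ c := fun i j =>
    isCompact_Icc.exists_bound_of_continuousOn (hA i j)
  choose c hc using hb
  have hv : ∀ r ∈ Icc (0 : ℝ) 1, HasDerivWithinAt (fun r i => u i r)
      (fun i => ∑ j, A i j r * u j r) (Icc 0 1) r := fun r hr =>
    hasDerivWithinAt_pi.2 fun i => hu i r hr
  -- Grönwall in the sup norm; the constant is the sum of bounds for all matrix entries over the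
  -- compact interval.
  have := eq_zero_of_abs_deriv_le_mul_abs_self_of_eq_zero_right (K := ∑ i, ∑ j, |c i j|)
    (f := fun r i => u i r) (f' := fun r i => ∑ j, A i j r * u j r) (a := 0) (b := 1)
    (fun r hr => (hv r hr).continuousWithinAt)
    (fun r hr => (hv r (Ico_subset_Icc_self hr)).Ici_of_Icc hr) (funext h0) (fun r hr => ?_) r hr
  · exact congrFun this i
  · refine (pi_norm_le_iff_of_nonneg (by positivity)).2 fun i => (norm_sum_le _ _).trans ?_
    have h1 : ∑ j, ‖A i j r * u j r‖ ≤ ∑ j, |c i j| * ‖fun i => u i r‖ := by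
      refine Finset.sum_le_sum fun j _ => ?_
      rw [norm_mul]
      exact mul_le_mul ((hc i j r (Ico_subset_Icc_self hr)).trans (le_abs_self _))
        (norm_le_pi_norm (fun i => u i r) j) (norm_nonneg _) (abs_nonneg _)
    refine h1.trans ?_
    rw [← Finset.sum_mul]
    refine mul_le_mul_of_nonneg_right ?_ (norm_nonneg _)
    exact Finset.single_le_sum (f := fun i => ∑ j, |c i j|)
      (fun i _ => Finset.sum_nonneg fun j _ => abs_nonneg _) (Finset.mem_univ i)

end LinearODE

/-! ### Functions that depend on a parameter -/

section Param

variable {n : ℕ} {s W : Set (Fin (n + 2) → ℝ)} {f g : ℝ → (Fin (n + 2) → ℝ) → ℝ}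

/-- `f` depends smoothly on the parameter in `[0, 1]` and the point in `W`. -/
def ParamSmooth (W : Set (Fin (n + 2) → ℝ)) (f : ℝ → (Fin (n + 2) → ℝ) → ℝ) : Prop :=
  ContDiffOn ℝ ∞ (fun p : ℝ × (Fin (n + 2) → ℝ) => f p.1 p.2) (Icc 0 1 ×ˢ W)

/-- `g` is the derivative of `f` with respect to the parameter. -/
def Evolves (W : Set (Fin (n + 2) → ℝ)) (f g : ℝ → (Fin (n + 2) → ℝ) → ℝ) : Prop :=
  ∀ r ∈ Icc (0 : ℝ) 1, ∀ x ∈ W, HasDerivWithinAt (fun r' => f r' x) (g r x) (Icc 0 1) r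

theorem HalfOpen.uniqueDiffOn_param (hW : HalfOpen W) : UniqueDiffOn ℝ (Icc (0 : ℝ) 1 ×ˢ W) :=
  (uniqueDiffOn_Icc zero_lt_one).prod hW.uniqueDiffOn

theorem ParamSmooth.slice (hf : ParamSmooth W f) {r : ℝ} (hr : r ∈ Icc (0 : ℝ) 1) :
    ContDiffOn ℝ ∞ (f r) W :=
  ContDiffOn.comp (g := fun p : ℝ × (Fin (n + 2) → ℝ) => f p.1 p.2) hf
    (contDiffOn_const.prodMk contDiffOn_id) fun _ hx => ⟨hr, hx⟩

theorem ParamSmooth.continuousOn (hf : ParamSmooth W f) {x : Fin (n + 2) → ℝ} (hx : x ∈ W) :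
    ContinuousOn (fun r => f r x) (Icc 0 1) :=
  ContinuousOn.comp (g := fun p : ℝ × (Fin (n + 2) → ℝ) => f p.1 p.2) (ContDiffOn.continuousOn hf)
    (continuousOn_id.prodMk continuousOn_const) fun _ hr => ⟨hr, hx⟩

theorem ParamSmooth.pd_eq (hf : ParamSmooth W f) (N : Nested s W) {r : ℝ} (hr : r ∈ Icc (0 : ℝ) 1)
    {x : Fin (n + 2) → ℝ} (hx : x ∈ W) (μ : Fin (n + 2)) : pd s μ (f r) x =
      fderivWithin ℝ (fun p : ℝ × (Fin (n + 2) → ℝ) => f p.1 p.2) (Icc 0 1 ×ˢ W) (r, x)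
        (0, Pi.single μ 1) := by
  have h1 := ((hf.differentiableOn (by simp)) (r, x) ⟨hr, hx⟩).hasFDerivWithinAt
  have h2 := HasFDerivWithinAt.comp (g := fun p : ℝ × (Fin (n + 2) → ℝ) => f p.1 p.2) x h1
    ((hasFDerivWithinAt_const r x W).prodMk (hasFDerivWithinAt_id x W)) fun y hy => ⟨hr, hy⟩
  rw [N.pd_eq (hf.slice hr) μ hx, pd]
  exact (DFunLike.congr_fun (h2.fderivWithin (N.small.uniqueDiffOn x hx)) _).trans (by simp)

theorem ParamSmooth.pd (hf : ParamSmooth W f) (N : Nested s W) (μ : Fin (n + 2)) :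
    ParamSmooth W fun r => pd s μ (f r) := by
  have h1 := ContDiffOn.fderivWithin hf N.small.uniqueDiffOn_param (m := ∞) (by simp)
  exact (h1.clm_apply (contDiffOn_const (c := ((0 : ℝ), (Pi.single μ 1 : Fin (n + 2) → ℝ))))).congr
    fun p hp => hf.pd_eq N hp.1 hp.2 μ

theorem ParamSmooth.hasDerivWithinAt {E : Type*} [NormedAddCommGroup E] [NormedSpace ℝ E]
    {k : ℝ × (Fin (n + 2) → ℝ) → E} (hk : ContDiffOn ℝ ∞ k (Icc 0 1 ×ˢ W)) {r : ℝ}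
    (hr : r ∈ Icc (0 : ℝ) 1) {x : Fin (n + 2) → ℝ} (hx : x ∈ W) :
    HasDerivWithinAt (fun r' => k (r', x)) (fderivWithin ℝ k (Icc 0 1 ×ˢ W) (r, x) (1, 0))
      (Icc 0 1) r := by
  have h1 := ((hk.differentiableOn (by simp)) (r, x) ⟨hr, hx⟩).hasFDerivWithinAt
  exact HasFDerivWithinAt.comp_hasDerivWithinAt (f := fun r' : ℝ => (r', x)) r h1
    ((hasDerivWithinAt_id r (Icc 0 1)).prodMk (hasDerivWithinAt_const r (Icc 0 1) x))
    fun r' hr' => ⟨hr', hx⟩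

/-- Differentiation along the flow commutes with partial derivatives. -/
theorem Evolves.pd (h : Evolves W f g) (N : Nested s W) (hf : ParamSmooth W f) (μ : Fin (n + 2)) :
    Evolves W (fun r => pd s μ (f r)) (fun r => pd s μ (g r)) := by
  intro r hr x hx
  set S := Icc (0 : ℝ) 1 ×ˢ W with hS
  set k : ℝ × (Fin (n + 2) → ℝ) → ℝ := fun p => f p.1 p.2 with hk
  have uS := N.small.uniqueDiffOn_param
  have hD : ContDiffOn ℝ ∞ (fderivWithin ℝ k S) S := ContDiffOn.fderivWithin hf uS (by simp)
  have hmem : (r, x) ∈ S := ⟨hr, hx⟩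
  have hg : ∀ y ∈ W, g r y = fderivWithin ℝ k S (r, y) (1, 0) := fun y hy =>
    (uniqueDiffOn_Icc zero_lt_one r hr).eq_deriv _ (h r hr y hy)
      (ParamSmooth.hasDerivWithinAt hf hr hy)
  have e1 : HasDerivWithinAt (fun r' => KillingHorizon.pd s μ (f r') x)
      (fderivWithin ℝ (fderivWithin ℝ k S) S (r, x) (1, 0) (0, Pi.single μ 1)) (Icc 0 1) r := by
    have h1 := (ParamSmooth.hasDerivWithinAt hD hr hx).clm_apply
      (hasDerivWithinAt_const r (Icc 0 1) ((0 : ℝ), (Pi.single μ 1 : Fin (n + 2) → ℝ)))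
    simp only [map_zero, add_zero] at h1
    exact h1.congr (fun r' hr' => hf.pd_eq N hr' hx μ) (hf.pd_eq N hr hx μ)
  have e2 : KillingHorizon.pd s μ (g r) x =
      fderivWithin ℝ (fderivWithin ℝ k S) S (r, x) (0, Pi.single μ 1) (1, 0) := by
    have h1 : HasFDerivWithinAt (fderivWithin ℝ k S) (fderivWithin ℝ (fderivWithin ℝ k S) S (r, x)) S
        (r, x) := ((hD.differentiableOn (by simp)) (r, x) hmem).hasFDerivWithinAt
    have h2 := HasFDerivWithinAt.comp x h1
      ((hasFDerivWithinAt_const r x W).prodMk (hasFDerivWithinAt_id x W)) fun y hy => ⟨hr, hy⟩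
    have h3 := h2.clm_apply (hasFDerivWithinAt_const ((1 : ℝ), (0 : Fin (n + 2) → ℝ)) x W)
    have h4 : ContDiffOn ℝ ∞ (fun y => fderivWithin ℝ k S (r, y) (1, 0)) W :=
      (ContDiffOn.comp hD (contDiffOn_const.prodMk contDiffOn_id) fun y hy => ⟨hr, hy⟩).clm_apply
        contDiffOn_const
    rw [N.pd_congr hg μ hx, N.pd_eq h4 μ hx, KillingHorizon.pd]
    exact (DFunLike.congr_fun (h3.fderivWithin (N.small.uniqueDiffOn x hx)) _).trans (by simp)
  refine e1.congr_deriv ?_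
  change _ = KillingHorizon.pd s μ (g r) x
  rw [e2]
  -- Both sides are second derivatives of one function of (r, x), taken in opposite orders on a
  -- product set that lies in the closure of its interior.
  refine (ContDiffWithinAt.isSymmSndFDerivWithinAt (hf (r, x) hmem) (by
      simp only [minSmoothness_of_isRCLikeNormedField]; exact WithTop.coe_le_coe.2 le_top)
    uS ?_ hmem).eq _ _
  rw [interior_prod_eq, closure_prod_eq, interior_Icc, closure_Ioo zero_ne_one]
  exact ⟨hr, N.small.closure_interior hx⟩

end Param

/-! ### The horizon jets of the diffeomorphisms generated by `𝒜` -/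

section Orbit

variable {n : ℕ} {ε : ℝ} {U : Set (Fin n → ℝ)} {q : Fin n → Fin n → (Fin n → ℝ) → ℝ}

theorem Nested.pd_comp {s V V' : Set (Fin (n + 2) → ℝ)} (N : Nested s V) (N' : Nested s V')
    {ψ : (Fin (n + 2) → ℝ) → (Fin (n + 2) → ℝ)} (hψ : ∀ μ, ContDiffOn ℝ ∞ (fun x => ψ x μ) V)
    (maps : MapsTo ψ V V') {k : (Fin (n + 2) → ℝ) → ℝ} (hk : ContDiffOn ℝ ∞ k V') (μ : Fin (n + 2))
    {x : Fin (n + 2) → ℝ} (hx : x ∈ V) :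
    pd s μ (fun y => k (ψ y)) x = ∑ β, pd s β k (ψ x) * pd s μ (fun y => ψ y β) x := by
  have h1 : HasFDerivWithinAt k (fderivWithin ℝ k s (ψ x)) V' (ψ x) :=
    (N'.diffAt hk (maps hx)).hasFDerivWithinAt.mono N'.sub
  have h2 : HasFDerivWithinAt ψ
      (ContinuousLinearMap.pi fun β => fderivWithin ℝ (fun y => ψ y β) s x) V x :=
    (hasFDerivWithinAt_pi.2 fun β => (N.diffAt (hψ β) hx).hasFDerivWithinAt).mono N.sub
  have h3 := (h1.comp x h2 maps).mono_of_mem_nhdsWithin (N.mem_nhdsWithin hx)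
  rw [pd, show (fun y => k (ψ y)) = k ∘ ψ from rfl, h3.fderivWithin (N.uniq hx),
    ContinuousLinearMap.comp_apply, fderivWithin_apply]
  exact Finset.sum_congr rfl fun β _ => mul_comm _ _

/-- The properties at the horizon of a diffeomorphism generated by `𝒜`. -/
structure OrbitMap (ε : ℝ) (U : Set (Fin n → ℝ)) (q : Fin n → Fin n → (Fin n → ℝ) → ℝ)
    (W : Set (Fin (n + 2) → ℝ)) (φ : (Fin (n + 2) → ℝ) → (Fin (n + 2) → ℝ)) : Prop where
  nested : Nested (region ε U) W
  smooth : ∀ μ, ContDiffOn ℝ ∞ (fun x => φ x μ) W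
  maps : MapsTo φ W (region ε U)
  rho : ∀ x ∈ W, x 1 = 0 → φ x 1 = 0
  d10 : ∀ x ∈ W, x 1 = 0 → pd (region ε U) 1 (fun y => φ y 0) x = 0
  d1M : ∀ x ∈ W, x 1 = 0 → ∀ P : Fin n, pd (region ε U) 1 (fun y => φ y P.succ.succ) x = 0
  d11 : ∀ x ∈ W, x 1 = 0 → 0 < pd (region ε U) 1 (fun y => φ y 1) x
  d00 : ∀ x ∈ W, x 1 = 0 → 0 < pd (region ε U) 0 (fun y => φ y 0) x
  d0M : ∀ x ∈ W, x 1 = 0 → ∀ P : Fin n, pd (region ε U) 0 (fun y => φ y P.succ.succ) x = 0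
  d000 : ∀ x ∈ W, x 1 = 0 → pd (region ε U) 0 (pd (region ε U) 0 fun y => φ y 0) x = 0
  d011 : ∀ x ∈ W, x 1 = 0 → pd (region ε U) 1 (fun y => φ y 1) x *
    pd (region ε U) 0 (pd (region ε U) 0 (pd (region ε U) 1 fun y => φ y 1)) x =
      pd (region ε U) 0 (pd (region ε U) 1 fun y => φ y 1) x ^ 2
  det : ∀ x ∈ W, x 1 = 0 → metricDet q (ang (φ x)) *
    (Matrix.of fun P Q : Fin n => pd (region ε U) Q.succ.succ (fun y => φ y P.succ.succ) x).det ^ 2 =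
      metricDet q (ang x)

namespace OrbitMap

variable {W W' : Set (Fin (n + 2) → ℝ)} {φ ψ : (Fin (n + 2) → ℝ) → (Fin (n + 2) → ℝ)}
  {x : Fin (n + 2) → ℝ}

theorem d_rho (h : OrbitMap ε U q W φ) {μ : Fin (n + 2)} (hμ : μ ≠ 1) (hx : x ∈ W) (h0 : x 1 = 0) :
    pd (region ε U) μ (fun y => φ y 1) x = 0 := by
  rw [h.nested.pd_tangential (h.smooth 1) (g := fun _ => 0) contDiffOn_const h.rho hμ hx h0]
  simp [pd]

theorem id (hU : IsOpen U) (hW : RelOpen (region ε U) W) : OrbitMap ε U q W fun x => x := by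
  have hs := halfOpen_region (ε := ε) hU
  have N : Nested (region ε U) W := ⟨hs, hs.of_relOpen hW, by
    obtain ⟨O, hO, rfl⟩ := hW; exact inter_subset_right⟩
  have hc : ∀ μ ν, ∀ x ∈ W, pd (region ε U) μ (fun y : Fin (n + 2) → ℝ => y ν) x =
      if ν = μ then 1 else 0 := fun μ ν x hx => N.pd_coord μ ν hx
  have hk : ∀ μ ν ρ, ∀ x ∈ W,
      pd (region ε U) ρ (pd (region ε U) μ (fun y : Fin (n + 2) → ℝ => y ν)) x = 0 :=
    fun μ ν ρ x hx => by rw [N.pd_congr (hc μ ν) ρ hx]; simp [pd]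
  have hk2 : ∀ μ ν ρ τ, ∀ x ∈ W, pd (region ε U) τ (pd (region ε U) ρ
      (pd (region ε U) μ (fun y : Fin (n + 2) → ℝ => y ν))) x = 0 :=
    fun μ ν ρ τ x hx => by rw [N.pd_congr (hk μ ν ρ) τ hx]; simp [pd]
  refine ⟨N, fun μ => by fun_prop, fun x hx => N.sub hx, fun x hx h0 => h0,
    fun x hx h0 => ?_, fun x hx h0 P => ?_, fun x hx h0 => ?_, fun x hx h0 => ?_, fun x hx h0 P => ?_,
    fun x hx h0 => hk _ _ _ x hx, fun x hx h0 => ?_, fun x hx h0 => ?_⟩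
  · rw [hc _ _ x hx]; simp
  · rw [hc _ _ x hx, if_neg (succ_succ_ne_one P)]
  · rw [hc _ _ x hx]; simp
  · rw [hc _ _ x hx]; simp
  · rw [hc _ _ x hx, if_neg (succ_succ_ne_zero P)]
  · rw [hk _ _ _ x hx, hk2 _ _ _ _ x hx]; simp
  · have : (Matrix.of fun P Q : Fin n => pd (region ε U) Q.succ.succ
        (fun y : Fin (n + 2) → ℝ => y P.succ.succ) x) = 1 := by
      ext P Q; simp [hc _ _ x hx, Matrix.one_apply]
    rw [this]; simp

/-- On the horizon the chain rule along t involves only ∂_t φ^t, and along ρ only ∂_ρ φ^ρ. So b =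
∂_t φ^t and m = ∂_ρ φ^ρ are multiplicative under composition. The condition m ∂_t²m = (∂_t m)² says
that log m is affine in t, and it persists because φ^t is affine in t on the horizon. The Jacobians
of the cross-section multiply. -/
theorem comp (h : OrbitMap ε U q W φ) (h' : OrbitMap ε U q W' ψ) (hm : MapsTo φ W W') :
    OrbitMap ε U q W fun x => ψ (φ x) := by
  have N := h.nested
  have N' := h'.nested
  have hφ : ContDiffOn ℝ ∞ φ W := contDiffOn_pi.2 h.smooth
  have hsm : ∀ k : (Fin (n + 2) → ℝ) → ℝ, ContDiffOn ℝ ∞ k W' → ContDiffOn ℝ ∞ (fun x => k (φ x)) W :=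
    fun k hk => hk.comp hφ hm
  have ch : ∀ k : (Fin (n + 2) → ℝ) → ℝ, ContDiffOn ℝ ∞ k W' → ∀ μ, ∀ x ∈ W,
      pd (region ε U) μ (fun y => k (φ y)) x =
        pd (region ε U) 0 k (φ x) * pd (region ε U) μ (fun y => φ y 0) x +
        pd (region ε U) 1 k (φ x) * pd (region ε U) μ (fun y => φ y 1) x +
        ∑ P : Fin n, pd (region ε U) P.succ.succ k (φ x) *
          pd (region ε U) μ (fun y => φ y P.succ.succ) x :=
    fun k hk μ x hx => by rw [N.pd_comp N' h.smooth hm hk μ hx, sum_split]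
  have ch0 : ∀ k : (Fin (n + 2) → ℝ) → ℝ, ContDiffOn ℝ ∞ k W' → ∀ x ∈ W, x 1 = 0 →
      pd (region ε U) 0 (fun y => k (φ y)) x =
        pd (region ε U) 0 k (φ x) * pd (region ε U) 0 (fun y => φ y 0) x := fun k hk x hx h0 => by
    rw [ch k hk 0 x hx, h.d_rho (by simp) hx h0]; simp [h.d0M x hx h0]
  have ch1 : ∀ k : (Fin (n + 2) → ℝ) → ℝ, ContDiffOn ℝ ∞ k W' → ∀ x ∈ W, x 1 = 0 →
      pd (region ε U) 1 (fun y => k (φ y)) x =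
        pd (region ε U) 1 k (φ x) * pd (region ε U) 1 (fun y => φ y 1) x := fun k hk x hx h0 => by
    rw [ch k hk 1 x hx, h.d10 x hx h0]; simp [h.d1M x hx h0]
  have s1 := fun μ => hsm _ (h'.smooth μ)
  have sm' := N'.contDiffOn_pd (h'.smooth 1) 1
  have sm := N.contDiffOn_pd (h.smooth 1) 1
  have sb := N.contDiffOn_pd (h.smooth 0) 0
  have sb' := N'.contDiffOn_pd (h'.smooth 0) 0
  have c1 := hsm _ sm'
  have c2 := hsm _ (N'.contDiffOn_pd sm' 0)
  have c3 := hsm _ sb'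
  have smt := N.contDiffOn_pd sm 0
  have e11 := ch1 _ (h'.smooth 1)
  have e00 := ch0 _ (h'.smooth 0)
  have et : ∀ x ∈ W, x 1 = 0 →
      pd (region ε U) 0 (pd (region ε U) 1 fun y => ψ (φ y) 1) x =
        pd (region ε U) 0 (pd (region ε U) 1 fun y => ψ y 1) (φ x) *
          pd (region ε U) 0 (fun y => φ y 0) x * pd (region ε U) 1 (fun y => φ y 1) x +
        pd (region ε U) 1 (fun y => ψ y 1) (φ x) *
          pd (region ε U) 0 (pd (region ε U) 1 fun y => φ y 1) x := fun x hx h0 => by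
    rw [N.pd_tangential (N.contDiffOn_pd (s1 1) 1) (c1.mul sm) e11 (by simp) hx h0,
      N.pd_mul c1 sm 0 hx, ch0 _ sm' x hx h0]
  have ett : ∀ x ∈ W, x 1 = 0 →
      pd (region ε U) 0 (pd (region ε U) 0 (pd (region ε U) 1 fun y => ψ (φ y) 1)) x =
        pd (region ε U) 0 (pd (region ε U) 0 (pd (region ε U) 1 fun y => ψ y 1)) (φ x) *
          pd (region ε U) 0 (fun y => φ y 0) x ^ 2 * pd (region ε U) 1 (fun y => φ y 1) x +
        2 * (pd (region ε U) 0 (pd (region ε U) 1 fun y => ψ y 1) (φ x) *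
          pd (region ε U) 0 (fun y => φ y 0) x *
          pd (region ε U) 0 (pd (region ε U) 1 fun y => φ y 1) x) +
        pd (region ε U) 1 (fun y => ψ y 1) (φ x) *
          pd (region ε U) 0 (pd (region ε U) 0 (pd (region ε U) 1 fun y => φ y 1)) x :=
    fun x hx h0 => by
    rw [N.pd_tangential (N.contDiffOn_pd (N.contDiffOn_pd (s1 1) 1) 0)
        (((c2.mul sb).mul sm).add (c1.mul smt)) et (by simp) hx h0,
      N.pd_add ((c2.mul sb).mul sm) (c1.mul smt) 0 hx, N.pd_mul (c2.mul sb) sm 0 hx,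
      N.pd_mul c2 sb 0 hx, N.pd_mul c1 smt 0 hx, ch0 _ (N'.contDiffOn_pd sm' 0) x hx h0,
      ch0 _ sm' x hx h0, h.d000 x hx h0]
    ring
  refine ⟨N, s1, fun x hx => h'.maps (hm hx), fun x hx h0 => h'.rho _ (hm hx) (h.rho x hx h0),
    fun x hx h0 => ?_, fun x hx h0 P => ?_, fun x hx h0 => ?_, fun x hx h0 => ?_, fun x hx h0 P => ?_,
    fun x hx h0 => ?_, fun x hx h0 => ?_, fun x hx h0 => ?_⟩
  · rw [ch1 _ (h'.smooth 0) x hx h0, h'.d10 _ (hm hx) (h.rho x hx h0), zero_mul]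
  · rw [ch1 _ (h'.smooth _) x hx h0, h'.d1M _ (hm hx) (h.rho x hx h0), zero_mul]
  · rw [e11 x hx h0]
    exact mul_pos (h'.d11 _ (hm hx) (h.rho x hx h0)) (h.d11 x hx h0)
  · rw [e00 x hx h0]
    exact mul_pos (h'.d00 _ (hm hx) (h.rho x hx h0)) (h.d00 x hx h0)
  · rw [ch0 _ (h'.smooth _) x hx h0, h'.d0M _ (hm hx) (h.rho x hx h0), zero_mul]
  · rw [N.pd_tangential (N.contDiffOn_pd (s1 0) 0) (c3.mul sb) e00 (by simp) hx h0,
      N.pd_mul c3 sb 0 hx, ch0 _ sb' x hx h0, h'.d000 _ (hm hx) (h.rho x hx h0), h.d000 x hx h0]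
    ring
  · rw [e11 x hx h0, et x hx h0, ett x hx h0]
    have k1 := h'.d011 _ (hm hx) (h.rho x hx h0)
    have k2 := h.d011 x hx h0
    -- For a product m = (m_ψ ∘ φ) m_φ, m ∂_t²m - (∂_t m)² is the sum of the corresponding
    -- expressions of the factors: that of ψ times b² m_φ², and that of φ times m_ψ².
    linear_combination pd (region ε U) 0 (fun y => φ y 0) x ^ 2 *
      pd (region ε U) 1 (fun y => φ y 1) x ^ 2 * k1 +
      pd (region ε U) 1 (fun y => ψ y 1) (φ x) ^ 2 * k2
  · have e : (Matrix.of fun P Q : Fin n =>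
        pd (region ε U) Q.succ.succ (fun y => ψ (φ y) P.succ.succ) x) =
        (Matrix.of fun P Q : Fin n =>
          pd (region ε U) Q.succ.succ (fun y => ψ y P.succ.succ) (φ x)) *
        Matrix.of fun P Q : Fin n => pd (region ε U) Q.succ.succ (fun y => φ y P.succ.succ) x := by
      ext P Q
      simp only [Matrix.of_apply, Matrix.mul_apply]
      rw [ch _ (h'.smooth P.succ.succ) _ x hx, h'.d0M _ (hm hx) (h.rho x hx h0),
        h'.d1M _ (hm hx) (h.rho x hx h0)]
      simp
    rw [e, Matrix.det_mul, mul_pow, ← mul_assoc, h'.det _ (hm hx) (h.rho x hx h0), h.det x hx h0]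

end OrbitMap

end Orbit

/-! ### Variational equations along a flow -/

section Flow

variable {n : ℕ} {ε : ℝ} {U : Set (Fin n → ℝ)} {q : Fin n → Fin n → (Fin n → ℝ) → ℝ}
  {W : Set (Fin (n + 2) → ℝ)} {F₀ G₀ H₀ J₀ : (Fin n → ℝ) → ℝ} {K : (Fin n → ℝ) → (Fin n → ℝ)}
  {ξ : (Fin (n + 2) → ℝ) → (Fin (n + 2) → ℝ)} {a : (Fin (n + 2) → ℝ) → ℝ}
  {d : Fin (n + 2) → Fin (n + 2) → (Fin (n + 2) → ℝ) → ℝ}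
  {Φ : ℝ → (Fin (n + 2) → ℝ) → (Fin (n + 2) → ℝ)} {x : Fin (n + 2) → ℝ} {r : ℝ}

theorem HatVec.pd_zero_a (h : HatVec ε U F₀ G₀ H₀ J₀ K ξ a d) (hU : IsOpen U)
    (hx : x ∈ region ε U) (h0 : x 1 = 0) : pd (region ε U) 0 a x = J₀ (ang x) := by
  have N := (halfOpen_region (ε := ε) hU).nested_self
  have hH := contDiffOn_comp_ang (V := region ε U) h.smooth_H fun x hx => ang_mem hx
  have hJ := contDiffOn_comp_ang (V := region ε U) h.smooth_J fun x hx => ang_mem hx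
  rw [N.pd_tangential h.smooth_a (g := fun y => angPull H₀ y + y 0 * angPull J₀ y) (by fun_prop)
    h.a_horizon (by simp) hx h0, N.pd_add hH (by fun_prop) 0 hx, N.pd_mul (by fun_prop) hJ 0 hx,
    N.pd_coord 0 0 hx, N.pd_zero_ang hU h.smooth_H hx hx.2.2, N.pd_zero_ang hU h.smooth_J hx hx.2.2]
  simp [angPull]

/-- The flow of an element of `𝒜'`. -/
structure FlowData (ε : ℝ) (U : Set (Fin n → ℝ)) (F₀ G₀ H₀ J₀ : (Fin n → ℝ) → ℝ)
    (K : (Fin n → ℝ) → (Fin n → ℝ)) (ξ : (Fin (n + 2) → ℝ) → (Fin (n + 2) → ℝ))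
    (a : (Fin (n + 2) → ℝ) → ℝ) (d : Fin (n + 2) → Fin (n + 2) → (Fin (n + 2) → ℝ) → ℝ)
    (W : Set (Fin (n + 2) → ℝ)) (Φ : ℝ → (Fin (n + 2) → ℝ) → (Fin (n + 2) → ℝ)) : Prop where
  isOpen : IsOpen U
  vec : HatVec ε U F₀ G₀ H₀ J₀ K ξ a d
  nested : Nested (region ε U) W
  flow : IsFlow (region ε U) W ξ Φ

namespace FlowData

variable (D : FlowData ε U F₀ G₀ H₀ J₀ K ξ a d W Φ)
include D

theorem smooth_comp {k : (Fin (n + 2) → ℝ) → ℝ} (hk : ContDiffOn ℝ ∞ k (region ε U)) :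
    ParamSmooth W fun r x => k (Φ r x) :=
  ContDiffOn.comp (g := k) hk D.flow.smooth fun p hp => D.flow.maps p.1 hp.1 p.2 hp.2

theorem smooth_apply (μ : Fin (n + 2)) : ParamSmooth W fun r x => Φ r x μ :=
  contDiffOn_pi.1 D.flow.smooth μ

theorem smooth_vec (μ : Fin (n + 2)) : ParamSmooth W fun r x => ξ (Φ r x) μ :=
  D.smooth_comp (D.vec.smooth μ)

theorem evolves (μ : Fin (n + 2)) : Evolves W (fun r x => Φ r x μ) fun r x => ξ (Φ r x) μ :=
  fun r hr x hx => hasDerivWithinAt_pi.1 (D.flow.ode r hr x hx) μ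

theorem chain {k : (Fin (n + 2) → ℝ) → ℝ} (hk : ContDiffOn ℝ ∞ k (region ε U)) (μ : Fin (n + 2))
    (hr : r ∈ Icc (0 : ℝ) 1) (hx : x ∈ W) : pd (region ε U) μ (fun y => k (Φ r y)) x =
      pd (region ε U) 0 k (Φ r x) * pd (region ε U) μ (fun y => Φ r y 0) x +
        pd (region ε U) 1 k (Φ r x) * pd (region ε U) μ (fun y => Φ r y 1) x +
        ∑ P : Fin n, pd (region ε U) P.succ.succ k (Φ r x) *
          pd (region ε U) μ (fun y => Φ r y P.succ.succ) x := by
  rw [D.nested.pd_comp (halfOpen_region D.isOpen).nested_self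
    (fun μ => (D.smooth_apply μ).slice hr) (fun y hy => D.flow.maps r hr y hy) hk μ hx, sum_split]

theorem init_pd (μ ν : Fin (n + 2)) (hx : x ∈ W) :
    pd (region ε U) μ (fun y => Φ 0 y ν) x = if ν = μ then 1 else 0 := by
  rw [D.nested.pd_congr (g := fun y => y ν) (fun y hy => by rw [D.flow.init y hy]) μ hx,
    D.nested.pd_coord μ ν hx]

theorem init_pd_pd (μ ν τ : Fin (n + 2)) (hx : x ∈ W) :
    pd (region ε U) τ (pd (region ε U) μ (fun y => Φ 0 y ν)) x = 0 := by
  rw [D.nested.pd_congr (fun y hy => D.init_pd μ ν hy) τ hx]; simp [pd]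

theorem init_pd_pd_pd (μ ν τ υ : Fin (n + 2)) (hx : x ∈ W) :
    pd (region ε U) υ (pd (region ε U) τ (pd (region ε U) μ (fun y => Φ 0 y ν))) x = 0 := by
  rw [D.nested.pd_congr (fun y hy => D.init_pd_pd μ ν τ hy) υ hx]; simp [pd]

/-- Since ξ^ρ = ρ a, the ρ-coordinate along the flow solves a homogeneous linear equation, so the
horizon is invariant. -/
theorem rho (hx : x ∈ W) (h0 : x 1 = 0) (hr : r ∈ Icc (0 : ℝ) 1) : Φ r x 1 = 0 := by
  refine eq_zero_of_linear ((D.smooth_comp D.vec.smooth_a).continuousOn hx) (u := fun r => Φ r x 1)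
    (fun r hr => ?_) (by rw [D.flow.init x hx, h0]) hr
  refine (D.evolves 1 r hr x hx).congr_deriv ?_
  beta_reduce
  rw [D.vec.eq_a _ (D.flow.maps r hr x hx)]
  ring

/-- The variational equation closes on the cross-section components: ∂_t ξ^M and ∂_ρ ξ^M vanish on
the horizon. A homogeneous linear system with zero initial values has the zero solution. The
t-derivatives below obey the same system. -/
theorem d1M (hx : x ∈ W) (h0 : x 1 = 0) (hr : r ∈ Icc (0 : ℝ) 1) (P : Fin n) :
    pd (region ε U) 1 (fun y => Φ r y P.succ.succ) x = 0 := by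
  refine eq_zero_of_linear_system
    (A := fun P Q r => pd (region ε U) Q.succ.succ (fun y => ξ y P.succ.succ) (Φ r x))
    (u := fun P r => pd (region ε U) 1 (fun y => Φ r y P.succ.succ) x)
    (fun P Q => (D.smooth_comp ((halfOpen_region D.isOpen).nested_self.contDiffOn_pd
      (D.vec.smooth P.succ.succ) Q.succ.succ)).continuousOn hx)
    (fun P r hr => ?_) (fun P => by rw [D.init_pd _ _ hx, if_neg (succ_succ_ne_one P)]) P hr
  refine ((D.evolves P.succ.succ).pd D.nested (D.smooth_apply _) 1 r hr x hx).congr_deriv ?_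
  beta_reduce
  have hm := D.flow.maps r hr x hx
  have hz := D.rho hx h0 hr
  rw [D.chain (D.vec.smooth _) 1 hr hx, D.vec.pd_zero_M D.isOpen hm hz, D.vec.der_M _ hm hz]
  ring

theorem d0M (hx : x ∈ W) (h0 : x 1 = 0) (hr : r ∈ Icc (0 : ℝ) 1) (P : Fin n) :
    pd (region ε U) 0 (fun y => Φ r y P.succ.succ) x = 0 := by
  refine eq_zero_of_linear_system
    (A := fun P Q r => pd (region ε U) Q.succ.succ (fun y => ξ y P.succ.succ) (Φ r x))
    (u := fun P r => pd (region ε U) 0 (fun y => Φ r y P.succ.succ) x)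
    (fun P Q => (D.smooth_comp ((halfOpen_region D.isOpen).nested_self.contDiffOn_pd
      (D.vec.smooth P.succ.succ) Q.succ.succ)).continuousOn hx)
    (fun P r hr => ?_) (fun P => by rw [D.init_pd _ _ hx, if_neg (succ_succ_ne_zero P)]) P hr
  refine ((D.evolves P.succ.succ).pd D.nested (D.smooth_apply _) 0 r hr x hx).congr_deriv ?_
  beta_reduce
  have hm := D.flow.maps r hr x hx
  have hz := D.rho hx h0 hr
  rw [D.chain (D.vec.smooth _) 0 hr hx, D.vec.pd_zero_M D.isOpen hm hz, D.vec.der_M _ hm hz]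
  ring

theorem d01 (hx : x ∈ W) (h0 : x 1 = 0) (hr : r ∈ Icc (0 : ℝ) 1) {μ : Fin (n + 2)} (hμ : μ ≠ 1) :
    pd (region ε U) μ (fun y => Φ r y 1) x = 0 := by
  rw [D.nested.pd_tangential ((D.smooth_apply 1).slice hr) (g := fun _ => 0) contDiffOn_const
    (fun y hy hy0 => D.rho hy hy0 hr) hμ hx h0]
  simp [pd]

theorem chain_zero {k : (Fin (n + 2) → ℝ) → ℝ} (hk : ContDiffOn ℝ ∞ k (region ε U))
    (hx : x ∈ W) (h0 : x 1 = 0) (hr : r ∈ Icc (0 : ℝ) 1) :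
    pd (region ε U) 0 (fun y => k (Φ r y)) x =
      pd (region ε U) 0 k (Φ r x) * pd (region ε U) 0 (fun y => Φ r y 0) x := by
  rw [D.chain hk 0 hr hx, D.d01 hx h0 hr (by simp)]
  simp [D.d0M hx h0 hr]

theorem chain_one {k : (Fin (n + 2) → ℝ) → ℝ} (hk : ContDiffOn ℝ ∞ k (region ε U))
    (hx : x ∈ W) (h0 : x 1 = 0) (hr : r ∈ Icc (0 : ℝ) 1) :
    pd (region ε U) 1 (fun y => k (Φ r y)) x =
      pd (region ε U) 0 k (Φ r x) * pd (region ε U) 1 (fun y => Φ r y 0) x +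
      pd (region ε U) 1 k (Φ r x) * pd (region ε U) 1 (fun y => Φ r y 1) x := by
  rw [D.chain hk 1 hr hx]
  simp [D.d1M hx h0 hr]

theorem smooth_angPull {k : (Fin n → ℝ) → ℝ} (hk : ContDiffOn ℝ ∞ k U) :
    ParamSmooth W fun r x => angPull k (Φ r x) :=
  D.smooth_comp (contDiffOn_comp_ang hk fun _ hx => ang_mem hx)

/-- With ∂_ρ Φ^M = 0 and ∂_ρ ξ^t = 0 on the horizon the variational equation reduces to u' = G u
with u(0) = 0. -/
theorem d10 (hx : x ∈ W) (h0 : x 1 = 0) (hr : r ∈ Icc (0 : ℝ) 1) :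
    pd (region ε U) 1 (fun y => Φ r y 0) x = 0 := by
  refine eq_zero_of_linear ((D.smooth_angPull D.vec.smooth_G).continuousOn hx)
    (u := fun r => pd (region ε U) 1 (fun y => Φ r y 0) x) (fun r hr => ?_)
    (by rw [D.init_pd _ _ hx]; simp) hr
  refine ((D.evolves 0).pd D.nested (D.smooth_apply _) 1 r hr x hx).congr_deriv ?_
  beta_reduce
  have hm := D.flow.maps r hr x hx
  have hz := D.rho hx h0 hr
  rw [D.chain_one (D.vec.smooth 0) hx h0 hr, D.vec.pd_zero_t D.isOpen hm hz, D.vec.der_t _ hm hz, zero_mul,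
    add_zero]
  rfl

theorem deriv_b (hx : x ∈ W) (h0 : x 1 = 0) (hr : r ∈ Icc (0 : ℝ) 1) :
    pd (region ε U) 0 (fun y => ξ (Φ r y) 0) x =
      angPull G₀ (Φ r x) * pd (region ε U) 0 (fun y => Φ r y 0) x := by
  rw [D.chain_zero (D.vec.smooth 0) hx h0 hr,
    D.vec.pd_zero_t D.isOpen (D.flow.maps r hr x hx) (D.rho hx h0 hr)]
  rfl

theorem deriv_m (hx : x ∈ W) (h0 : x 1 = 0) (hr : r ∈ Icc (0 : ℝ) 1) :
    pd (region ε U) 1 (fun y => ξ (Φ r y) 1) x =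
      a (Φ r x) * pd (region ε U) 1 (fun y => Φ r y 1) x := by
  have hm := D.flow.maps r hr x hx
  have hz := D.rho hx h0 hr
  rw [D.chain_one (D.vec.smooth 1) hx h0 hr, D.vec.pd_tangential_ρ D.isOpen hm hz (by simp),
    D.vec.der_ρ _ hm hz, D.vec.a_horizon _ hm hz]
  ring

/-- Here b = ∂_t Φ^t solves b' = G b with b(0) = 1, so it is an exponential. Likewise m = ∂_ρ Φ^ρ
solves m' = a m in the next lemma. -/
theorem d00 (hx : x ∈ W) (h0 : x 1 = 0) (hr : r ∈ Icc (0 : ℝ) 1) :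
    0 < pd (region ε U) 0 (fun y => Φ r y 0) x := by
  refine pos_of_linear ((D.smooth_angPull D.vec.smooth_G).continuousOn hx)
    (u := fun r => pd (region ε U) 0 (fun y => Φ r y 0) x) (fun r hr => ?_)
    (by rw [D.init_pd _ _ hx]; simp) hr
  exact ((D.evolves 0).pd D.nested (D.smooth_apply _) 0 r hr x hx).congr_deriv (D.deriv_b hx h0 hr)

theorem d11 (hx : x ∈ W) (h0 : x 1 = 0) (hr : r ∈ Icc (0 : ℝ) 1) :
    0 < pd (region ε U) 1 (fun y => Φ r y 1) x := by
  refine pos_of_linear ((D.smooth_comp D.vec.smooth_a).continuousOn hx)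
    (u := fun r => pd (region ε U) 1 (fun y => Φ r y 1) x) (fun r hr => ?_)
    (by rw [D.init_pd _ _ hx]; simp) hr
  exact ((D.evolves 1).pd D.nested (D.smooth_apply _) 1 r hr x hx).congr_deriv (D.deriv_m hx h0 hr)

theorem pd_zero_angPull {k : (Fin n → ℝ) → ℝ} (hk : ContDiffOn ℝ ∞ k U) (hx : x ∈ W) (h0 : x 1 = 0)
    (hr : r ∈ Icc (0 : ℝ) 1) : pd (region ε U) 0 (fun y => angPull k (Φ r y)) x = 0 := by
  have N := (halfOpen_region (ε := ε) D.isOpen).nested_self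
  have hm := D.flow.maps r hr x hx
  rw [D.chain_zero (contDiffOn_comp_ang hk fun x hx => ang_mem hx) hx h0 hr,
    N.pd_zero_ang D.isOpen hk hm hm.2.2, zero_mul]

/-- On the horizon the coefficient G along the flow does not depend on t, since Φ^M does not.
Differentiating b' = G b in t gives the same equation for ∂_t b, which starts at zero. -/
theorem d000 (hx : x ∈ W) (h0 : x 1 = 0) (hr : r ∈ Icc (0 : ℝ) 1) :
    pd (region ε U) 0 (pd (region ε U) 0 fun y => Φ r y 0) x = 0 := by
  have N := D.nested
  have b := (D.smooth_apply 0).pd N 0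
  refine eq_zero_of_linear ((D.smooth_angPull D.vec.smooth_G).continuousOn hx)
    (u := fun r => pd (region ε U) 0 (pd (region ε U) 0 fun y => Φ r y 0) x) (fun r hr => ?_)
    (D.init_pd_pd _ _ _ hx) hr
  refine (((D.evolves 0).pd N (D.smooth_apply _) 0).pd N b 0 r hr x hx).congr_deriv ?_
  beta_reduce
  have g := (D.smooth_angPull D.vec.smooth_G).slice hr
  rw [N.pd_tangential (((D.smooth_vec 0).pd N 0).slice hr) (g.mul (b.slice hr))
    (fun y hy hy0 => D.deriv_b hy hy0 hr) (by simp) hx h0, N.pd_mul g (b.slice hr) 0 hx,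
    D.pd_zero_angPull D.vec.smooth_G hx h0 hr]
  ring

theorem deriv_mt (hx : x ∈ W) (h0 : x 1 = 0) (hr : r ∈ Icc (0 : ℝ) 1) :
    pd (region ε U) 0 (pd (region ε U) 1 fun y => ξ (Φ r y) 1) x =
      angPull J₀ (Φ r x) * pd (region ε U) 0 (fun y => Φ r y 0) x *
          pd (region ε U) 1 (fun y => Φ r y 1) x +
        a (Φ r x) * pd (region ε U) 0 (pd (region ε U) 1 fun y => Φ r y 1) x := by
  have N := D.nested
  have m := ((D.smooth_apply 1).pd N 1).slice hr
  have sa := (D.smooth_comp D.vec.smooth_a).slice hr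
  rw [N.pd_tangential (((D.smooth_vec 1).pd N 1).slice hr) (sa.mul m)
    (fun y hy hy0 => D.deriv_m hy hy0 hr) (by simp) hx h0, N.pd_mul sa m 0 hx,
    D.chain_zero D.vec.smooth_a hx h0 hr,
    D.vec.pd_zero_a D.isOpen (D.flow.maps r hr x hx) (D.rho hx h0 hr)]
  rfl

theorem deriv_mtt (hx : x ∈ W) (h0 : x 1 = 0) (hr : r ∈ Icc (0 : ℝ) 1) :
    pd (region ε U) 0 (pd (region ε U) 0 (pd (region ε U) 1 fun y => ξ (Φ r y) 1)) x =
      2 * (angPull J₀ (Φ r x) * pd (region ε U) 0 (fun y => Φ r y 0) x *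
          pd (region ε U) 0 (pd (region ε U) 1 fun y => Φ r y 1) x) +
        a (Φ r x) * pd (region ε U) 0 (pd (region ε U) 0 (pd (region ε U) 1 fun y => Φ r y 1)) x := by
  have N := D.nested
  have m := ((D.smooth_apply 1).pd N 1).slice hr
  have mt := (((D.smooth_apply 1).pd N 1).pd N 0).slice hr
  have b := ((D.smooth_apply 0).pd N 0).slice hr
  have sa := (D.smooth_comp D.vec.smooth_a).slice hr
  have sj := (D.smooth_angPull D.vec.smooth_J).slice hr
  rw [N.pd_tangential ((((D.smooth_vec 1).pd N 1).pd N 0).slice hr)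
    (((sj.mul b).mul m).add (sa.mul mt)) (fun y hy hy0 => D.deriv_mt hy hy0 hr) (by simp) hx h0,
    N.pd_add ((sj.mul b).mul m) (sa.mul mt) 0 hx, N.pd_mul (sj.mul b) m 0 hx, N.pd_mul sj b 0 hx,
    N.pd_mul sa mt 0 hx, D.chain_zero D.vec.smooth_a hx h0 hr, D.pd_zero_angPull D.vec.smooth_J hx h0 hr,
    D.d000 hx h0 hr, D.vec.pd_zero_a D.isOpen (D.flow.maps r hr x hx) (D.rho hx h0 hr)]
  simp only [angPull]
  ring

/-- With m' = a m, (∂_t m)' = J b m + a ∂_t m and (∂_t²m)' = 2 J b ∂_t m + a ∂_t²m, the J-terms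
cancel in the derivative of m ∂_t²m - (∂_t m)². This quantity therefore solves u' = 2a u with u(0) =
0. -/
theorem d011 (hx : x ∈ W) (h0 : x 1 = 0) (hr : r ∈ Icc (0 : ℝ) 1) :
    pd (region ε U) 1 (fun y => Φ r y 1) x *
        pd (region ε U) 0 (pd (region ε U) 0 (pd (region ε U) 1 fun y => Φ r y 1)) x -
      pd (region ε U) 0 (pd (region ε U) 1 fun y => Φ r y 1) x ^ 2 = 0 := by
  have N := D.nested
  have m := (D.smooth_apply 1).pd N 1
  have E := (D.evolves 1).pd N (D.smooth_apply 1) 1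
  refine eq_zero_of_linear (k := fun r => 2 * a (Φ r x))
    (continuousOn_const.mul ((D.smooth_comp D.vec.smooth_a).continuousOn hx))
    (u := fun r => pd (region ε U) 1 (fun y => Φ r y 1) x *
        pd (region ε U) 0 (pd (region ε U) 0 (pd (region ε U) 1 fun y => Φ r y 1)) x -
      pd (region ε U) 0 (pd (region ε U) 1 fun y => Φ r y 1) x ^ 2) (fun r hr => ?_)
    (by rw [D.init_pd_pd_pd _ _ _ _ hx, D.init_pd_pd _ _ _ hx]; ring) hr
  have e1 := E r hr x hx
  have e2 := E.pd N m 0 r hr x hx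
  have e3 := (E.pd N m 0).pd N (m.pd N 0) 0 r hr x hx
  refine ((e1.mul e3).sub (e2.pow 2)).congr_deriv ?_
  beta_reduce
  simp only [D.deriv_m hx h0 hr, D.deriv_mt hx h0 hr, D.deriv_mtt hx h0 hr]
  push_cast
  ring

/-- Liouville's formula: the logarithm of the cross-section Jacobian grows at rate ∂_M K^M and that
of det q at rate K^M ∂_M log det q. Twice the former plus the latter is 2 D_M K^M = 0, so the
product is constant along the flow. -/
theorem det (hq : IsCrossMetric U q) (hK : ∀ σ ∈ U, divergence U q K σ = 0) (hx : x ∈ W)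
    (h0 : x 1 = 0) (hr : r ∈ Icc (0 : ℝ) 1) : metricDet q (ang (Φ r x)) *
    (Matrix.of fun P Q : Fin n => pd (region ε U) Q.succ.succ (fun y => Φ r y P.succ.succ) x).det ^ 2 -
      metricDet q (ang x) = 0 := by
  have N := D.nested
  have NR := (halfOpen_region (ε := ε) D.isOpen).nested_self
  refine eq_zero_of_linear (k := fun _ => 0) continuousOn_const
    (u := fun r => metricDet q (ang (Φ r x)) * (Matrix.of fun P Q : Fin n =>
      pd (region ε U) Q.succ.succ (fun y => Φ r y P.succ.succ) x).det ^ 2 - metricDet q (ang x))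
    (fun r hr => ?_) ?_ hr
  · have hm := D.flow.maps r hr x hx
    have hz := D.rho hx h0 hr
    set A := Matrix.of fun P Q : Fin n =>
      pd (region ε U) Q.succ.succ (fun y => Φ r y P.succ.succ) x with hA
    have hsq := contDiffOn_comp_ang (V := region ε U) hq.smooth_det fun x hx => ang_mem hx
    have e1 : HasDerivWithinAt (fun r => angPull (metricDet q) (Φ r x))
        (∑ P, K (ang (Φ r x)) P * pd U P (metricDet q) (ang (Φ r x))) (Icc 0 1) r := by
      have h1 := (NR.diffAt hsq hm).hasFDerivWithinAt
      have h2 := h1.comp_hasDerivWithinAt r (D.flow.ode r hr x hx)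
        fun y hy => D.flow.maps y hy x hx
      refine h2.congr_deriv ?_
      beta_reduce
      rw [Nested.fderivWithin_apply, sum_split, NR.pd_zero_ang D.isOpen hq.smooth_det hm hm.2.2,
        NR.pd_one_ang D.isOpen hq.smooth_det hm hm.2.2]
      simp only [NR.pd_succ_ang D.isOpen hq.smooth_det hm hm.2.2, D.vec.val_M _ hm hz]
      ring
    have hA' : ∀ P Q : Fin n, HasDerivWithinAt
        (fun r => pd (region ε U) Q.succ.succ (fun y => Φ r y P.succ.succ) x)
        (∑ R, pd U R (fun σ => K σ P) (ang (Φ r x)) * A R Q) (Icc 0 1) r := fun P Q => by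
      refine ((D.evolves P.succ.succ).pd N (D.smooth_apply _) Q.succ.succ r hr x hx).congr_deriv ?_
      beta_reduce
      rw [D.chain (D.vec.smooth _) _ hr hx, D.vec.pd_zero_M D.isOpen hm hz, D.vec.der_M _ hm hz]
      simp only [D.vec.pd_succ_M D.isOpen hm hz, zero_mul, zero_add]
      rfl
    have e2 : HasDerivWithinAt (fun r => (Matrix.of fun P Q : Fin n =>
        pd (region ε U) Q.succ.succ (fun y => Φ r y P.succ.succ) x).det)
        (A.det * ∑ P, pd U P (fun σ => K σ P) (ang (Φ r x))) (Icc 0 1) r := by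
      have h := (hasFDerivWithinAt_det (A := fun (P Q : Fin n) r =>
        pd (region ε U) Q.succ.succ (fun y => Φ r y P.succ.succ) x)
        fun P Q => (hA' P Q).hasFDerivWithinAt).hasDerivWithinAt
      refine h.congr_deriv ?_
      beta_reduce
      rw [← hA]
      simp only [_root_.sum_apply, _root_.smul_apply, ContinuousLinearMap.toSpanSingleton_apply,
        smul_eq_mul, one_mul, Finset.mul_sum]
      refine Finset.sum_congr rfl fun P _ => ?_
      rw [Finset.sum_comm]
      -- The variation of the Jacobian matrix A is (∂K) A, and A adj(A) = (det A) 1 turns Jacobi's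
      -- formula into det A times the trace of ∂K.
      have hadj : ∀ R, ∑ Q, A.adjugate Q P * (pd U R (fun σ => K σ P) (ang (Φ r x)) * A R Q) =
          pd U R (fun σ => K σ P) (ang (Φ r x)) * (A.det * if R = P then 1 else 0) := fun R => by
        have := congrFun (congrFun (Matrix.mul_adjugate A) R) P
        rw [Matrix.mul_apply, Matrix.smul_apply, Matrix.one_apply, smul_eq_mul] at this
        rw [← this, Finset.mul_sum]
        exact Finset.sum_congr rfl fun Q _ => by ring
      simp only [hadj]
      simp [mul_comm]
    refine ((e1.mul (e2.pow 2)).sub_const _).congr_deriv ?_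
    beta_reduce
    have := hq.det_mul_divergence (K := K) hm.2.2
    rw [hK _ hm.2.2, mul_zero] at this
    simp only [angPull, Pi.pow_apply, ← hA]
    push_cast
    linear_combination -A.det ^ 2 * this
  · have : (Matrix.of fun P Q : Fin n =>
        pd (region ε U) Q.succ.succ (fun y => Φ 0 y P.succ.succ) x) = 1 := by
      ext P Q; simp [D.init_pd _ _ hx, Matrix.one_apply]
    simp only [this, D.flow.init x hx]; simp

theorem orbitMap (hq : IsCrossMetric U q) (hK : ∀ σ ∈ U, divergence U q K σ = 0) :
    OrbitMap ε U q W (Φ 1) := by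
  have h1 : (1 : ℝ) ∈ Icc (0 : ℝ) 1 := ⟨zero_le_one, le_rfl⟩
  exact ⟨D.nested, fun μ => (D.smooth_apply μ).slice h1, fun x hx => D.flow.maps 1 h1 x hx,
    fun x hx h0 => D.rho hx h0 h1, fun x hx h0 => D.d10 hx h0 h1, fun x hx h0 P => D.d1M hx h0 h1 P,
    fun x hx h0 => D.d11 hx h0 h1, fun x hx h0 => D.d00 hx h0 h1, fun x hx h0 P => D.d0M hx h0 h1 P,
    fun x hx h0 => D.d000 hx h0 h1, fun x hx h0 => sub_eq_zero.1 (D.d011 hx h0 h1),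
    fun x hx h0 => sub_eq_zero.1 (D.det hq hK hx h0 h1)⟩

end FlowData

theorem Generated.orbitMap (hq : IsCrossMetric U q) {φ : (Fin (n + 2) → ℝ) → (Fin (n + 2) → ℝ)}
    (h : Generated (region ε U) (algA ε U q) W φ) : OrbitMap ε U q W φ := by
  induction h with
  | id hW => exact OrbitMap.id hq.isOpen hW
  | comp W' φ ξ Φ hφ hW' hmaps hξ hΦ ih =>
    obtain ⟨F, G, H, J, K, hf, hK⟩ := hξ
    obtain ⟨a, d, v⟩ := (hf.jetForm hq.isOpen).exists_hatVec hq.isOpen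
    have hs := halfOpen_region (ε := ε) hq.isOpen
    have N' : Nested (region ε U) W' := ⟨hs, hs.of_relOpen hW', by
      obtain ⟨O, hO, rfl⟩ := hW'; exact inter_subset_right⟩
    exact ih.comp (FlowData.orbitMap ⟨hq.isOpen, v, N', hΦ⟩ hq hK) hmaps

end Flow

/-! ### Metrics in the orbit of the background -/

section Pullback

variable {n : ℕ} {ε κ GN : ℝ} {U : Set (Fin n → ℝ)} {q : Fin n → Fin n → (Fin n → ℝ) → ℝ}
  {f : Fin n → (Fin n → ℝ) → ℝ} {W : Set (Fin (n + 2) → ℝ)}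
  {φ : (Fin (n + 2) → ℝ) → (Fin (n + 2) → ℝ)} {x : Fin (n + 2) → ℝ}
  {g F : Fin (n + 2) → Fin (n + 2) → (Fin (n + 2) → ℝ) → ℝ}

/-- The rescaled derivatives `e α μ = λ_α(φ) ∂_μ φ^α / λ_μ` of a diffeomorphism. -/
structure HatMap (ε : ℝ) (U : Set (Fin n → ℝ)) (q : Fin n → Fin n → (Fin n → ℝ) → ℝ)
    (W : Set (Fin (n + 2) → ℝ)) (φ : (Fin (n + 2) → ℝ) → (Fin (n + 2) → ℝ))
    (e : Fin (n + 2) → Fin (n + 2) → (Fin (n + 2) → ℝ) → ℝ) : Prop extends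
    OrbitMap ε U q W φ where
  smooth_e : ∀ α μ, ContDiffOn ℝ ∞ (e α μ) W
  eq_e : ∀ α μ, ∀ x ∈ W, lam (φ x) α * pd (region ε U) μ (fun y => φ y α) x = lam x μ * e α μ x
  e00 : ∀ x ∈ W, x 1 = 0 → e 0 0 x =
    pd (region ε U) 1 (fun y => φ y 1) x * pd (region ε U) 0 (fun y => φ y 0) x
  e01 : ∀ x ∈ W, x 1 = 0 → e 0 1 x = 0
  e0M : ∀ x ∈ W, x 1 = 0 → ∀ P : Fin n, e 0 P.succ.succ x = 0
  e10 : ∀ x ∈ W, x 1 = 0 → e 1 0 x = pd (region ε U) 0 (pd (region ε U) 1 fun y => φ y 1) x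
  e11 : ∀ x ∈ W, x 1 = 0 → e 1 1 x = pd (region ε U) 1 (fun y => φ y 1) x
  e1M : ∀ x ∈ W, x 1 = 0 → ∀ P : Fin n, e 1 P.succ.succ x = 0
  eM0 : ∀ x ∈ W, x 1 = 0 → ∀ P : Fin n, e P.succ.succ 0 x = 0
  eM1 : ∀ x ∈ W, x 1 = 0 → ∀ P : Fin n, e P.succ.succ 1 x = 0
  eMN : ∀ x ∈ W, x 1 = 0 → ∀ P Q : Fin n,
    e P.succ.succ Q.succ.succ x = pd (region ε U) Q.succ.succ (fun y => φ y P.succ.succ) x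

/-- Parallel to `JetForm.exists_hatVec`: φ^ρ = ρ m, while ∂_t φ^ρ and ∂_t φ^M vanish on the horizon
and can be divided by ρ. These are the only quotients needed. -/
theorem OrbitMap.exists_hatMap (h : OrbitMap ε U q W φ) : ∃ e, HatMap ε U q W φ e := by
  have N := h.nested
  have hp := fun α μ => N.contDiffOn_pd (h.smooth α) μ
  have hs := h.smooth
  obtain ⟨m, hm, hme, hm0⟩ := N.exists_div (h.smooth 1) h.rho
  obtain ⟨k, hk, hke, hk0⟩ := N.exists_div (hp 1 0) fun x hx h0 => h.d_rho (by simp) hx h0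
  have := fun P : Fin n => N.exists_div (hp P.succ.succ 0) fun x hx h0 => h.d0M x hx h0 P
  choose l hl hle hl0 using this
  refine ⟨fun α μ => Fin.cases (motive := fun _ => (Fin (n + 2) → ℝ) → ℝ)
    (if μ = 0 then fun x => m x * pd (region ε U) 0 (fun y => φ y 0) x else
      fun x => φ x 1 * pd (region ε U) μ (fun y => φ y 0) x)
    (fun i => if μ = 0 then Fin.cases (motive := fun _ => (Fin (n + 2) → ℝ) → ℝ) k l i else
      pd (region ε U) μ (fun y => φ y i.succ)) α,
    { h with
      smooth_e := fun α μ => ?_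
      eq_e := fun α μ x hx => ?_
      e00 := fun x hx h0 => ?_
      e01 := fun x hx h0 => ?_
      e0M := fun x hx h0 P => ?_
      e10 := fun x hx h0 => ?_
      e11 := fun x hx h0 => ?_
      e1M := fun x hx h0 P => ?_
      eM0 := fun x hx h0 P => ?_
      eM1 := fun x hx h0 P => ?_
      eMN := fun x hx h0 P Q => ?_ }⟩
  · by_cases hμ : μ = 0
    · simp only [hμ, if_true]
      revert α
      exact index_cases (by have := hp 0 0; simp only [Fin.cases_zero]; fun_prop) hk hl
    · simp only [hμ, if_false]
      revert α
      exact index_cases (by have := hp 0 μ; simp only [Fin.cases_zero]; fun_prop) (hp 1 μ)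
        fun P => hp _ μ
  · by_cases hμ : μ = 0
    · simp only [hμ, if_true, lam_zero]
      revert α
      refine index_cases ?_ ?_ fun P => ?_
      · rw [lam_zero, hme x hx, mul_assoc]; rfl
      · rw [lam_one, one_mul]; exact hke x hx
      · rw [lam_succ, one_mul]; exact hle P x hx
    · simp only [hμ, if_false, show lam x μ = 1 from if_neg hμ, one_mul]
      revert α
      refine index_cases (by simp) ?_ fun P => ?_
      · rw [lam_one, one_mul]; rfl
      · rw [lam_succ, one_mul]; rfl
  · simp only [if_true, Fin.cases_zero]; rw [hm0 x hx h0]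
  · simp [h.rho x hx h0]
  · simp [h.rho x hx h0]
  · exact (hk0 x hx h0).trans (N.pd_comm (hs 1) 1 0 hx)
  · rfl
  · simp only [succ_succ_ne_zero, if_false]
    exact h.d_rho (succ_succ_ne_one P) hx h0
  · refine (hl0 P x hx h0).trans ?_
    rw [N.pd_comm (hs _) 1 0 hx, N.pd_tangential (hp _ 1) (g := fun _ => 0) contDiffOn_const
      (fun y hy hy0 => h.d1M y hy hy0 P) (by simp) hx h0]
    simp [pd]
  · exact h.d1M x hx h0 P
  · simp only [succ_succ_ne_zero, if_false]; rfl

/-- The pulled-back metric in rescaled components. -/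
def hatPull (φ : (Fin (n + 2) → ℝ) → (Fin (n + 2) → ℝ))
    (e F : Fin (n + 2) → Fin (n + 2) → (Fin (n + 2) → ℝ) → ℝ) (μ ν : Fin (n + 2))
    (x : Fin (n + 2) → ℝ) : ℝ :=
  ∑ α, ∑ β, F α β (φ x) * e α μ x * e β ν x

variable {e : Fin (n + 2) → Fin (n + 2) → (Fin (n + 2) → ℝ) → ℝ}

namespace HatMap

variable (h : HatMap ε U q W φ e) (hF : BgHat ε U κ f q g F)
include h hF

theorem hat : Hat W (pullback (region ε U) φ g) (hatPull φ e F) := by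
  have h1 := h.smooth_e
  have h2 : ∀ α β, ContDiffOn ℝ ∞ (fun x => F α β (φ x)) W := fun α β =>
    (hF.smooth α β).comp (contDiffOn_pi.2 h.smooth) h.maps
  refine ⟨fun μ ν => ?_, fun μ ν x hx => ?_⟩
  · exact ContDiffOn.sum fun α _ => ContDiffOn.sum fun β _ =>
      ((h2 α β).mul (h1 α μ)).mul (h1 β ν)
  · simp only [pullback, hatPull, Finset.mul_sum]
    refine Finset.sum_congr rfl fun α _ => Finset.sum_congr rfl fun β _ => ?_
    rw [hF.eq α β _ (h.maps hx)]
    linear_combination F α β (φ x) * (lam (φ x) β * pd (region ε U) ν (fun y => φ y β) x) *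
      h.eq_e α μ x hx + F α β (φ x) * lam x μ * e α μ x * h.eq_e β ν x hx

theorem cross (hx : x ∈ W) (h0 : x 1 = 0) (P Q : Fin n) : hatPull φ e F P.succ.succ Q.succ.succ x =
    ∑ R : Fin n, ∑ S : Fin n, q R S (ang (φ x)) *
      pd (region ε U) P.succ.succ (fun y => φ y R.succ.succ) x *
      pd (region ε U) Q.succ.succ (fun y => φ y S.succ.succ) x := by
  simp [hatPull, sum_split, h.e0M x hx h0, h.e1M x hx h0, h.eMN x hx h0,
    hF.vMN _ (h.maps hx) (h.rho x hx h0)]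

theorem left (hx : x ∈ W) (h0 : x 1 = 0) (a : Bool) (P : Fin n) :
    hatPull φ e F (planeIdx n a) P.succ.succ x = 0 := by
  cases a <;>
    simp [planeIdx, hatPull, sum_split, h.e0M x hx h0, h.e1M x hx h0, h.eM0 x hx h0, h.eM1 x hx h0,
      hF.v0M _ (h.maps hx) (h.rho x hx h0), hF.v1M _ (h.maps hx) (h.rho x hx h0)]

theorem right (hx : x ∈ W) (h0 : x 1 = 0) (P : Fin n) (a : Bool) :
    hatPull φ e F P.succ.succ (planeIdx n a) x = 0 := by
  cases a <;>
    simp [planeIdx, hatPull, sum_split, h.e0M x hx h0, h.e1M x hx h0, h.eM0 x hx h0, h.eM1 x hx h0,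
      hF.vM0 _ (h.maps hx) (h.rho x hx h0), hF.vM1 _ (h.maps hx) (h.rho x hx h0)]

/-- To leading order dρ pulls back to m (dρ + (∂_t m / m) ρ dt) and ρ dt to m b ρ dt, where m = ∂_ρ
φ^ρ and b = ∂_t φ^t. Hence E = m², B = ∂_t m / m and M = κ² b². -/
theorem plane (hx : x ∈ W) (h0 : x 1 = 0) (a b : Bool) :
    hatPull φ e F (planeIdx n a) (planeIdx n b) x =
      planeG (pd (region ε U) 1 (fun y => φ y 1) x ^ 2)
        (pd (region ε U) 0 (pd (region ε U) 1 fun y => φ y 1) x * (pd (region ε U) 1 (fun y => φ y 1) x)⁻¹)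
        (κ ^ 2 * pd (region ε U) 0 (fun y => φ y 0) x ^ 2) a b := by
  have hm := (h.d11 x hx h0).ne'
  have hy := h.maps hx
  have hz := h.rho x hx h0
  cases a <;> cases b <;>
    simp [planeIdx, hatPull, sum_split, h.e00 x hx h0, h.e01 x hx h0, h.e10 x hx h0, h.e11 x hx h0,
      h.eM0 x hx h0, h.eM1 x hx h0, hF.v00 _ hy hz, hF.v01 _ hy hz, hF.v10 _ hy hz, hF.v11 _ hy hz,
      planeG, symB] <;>
    field_simp <;> try ring

/-- The block is Aᵀ q A with A the Jacobian of the cross-section map, which preserves the volume of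
q. -/
theorem det_cross (hx : x ∈ W) (h0 : x 1 = 0) :
    (Matrix.of fun P Q : Fin n => hatPull φ e F P.succ.succ Q.succ.succ x).det =
      metricDet q (ang x) := by
  set A := Matrix.of fun P Q : Fin n => pd (region ε U) Q.succ.succ (fun y => φ y P.succ.succ) x with hA
  have k : (Matrix.of fun P Q : Fin n => hatPull φ e F P.succ.succ Q.succ.succ x) =
      A.transpose * (Matrix.of fun R S => q R S (ang (φ x))) * A := by
    ext P Q
    rw [Matrix.of_apply, h.cross hF hx h0, Matrix.mul_apply, Finset.sum_comm]
    simp only [Matrix.mul_apply, Matrix.transpose_apply, Finset.sum_mul, hA, Matrix.of_apply]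
    exact Finset.sum_congr rfl fun S _ => Finset.sum_congr rfl fun R _ => by ring
  rw [k, Matrix.det_mul, Matrix.det_mul, Matrix.det_transpose, ← h.det x hx h0]
  simp only [metricDet]
  ring

/-- The domain on which the pulled-back metric is known to be non-degenerate. -/
theorem exists_orbitMetric (hq : IsCrossMetric U q) (hκ : 0 < κ) :
    ∃ V E B M, V ⊆ W ∧ (∀ x ∈ W, x 1 = 0 → x ∈ V) ∧
      OrbitMetric (region ε U) V (hatPull φ e F) E B M := by
  have N := h.nested
  have hp := fun α μ => N.contDiffOn_pd (h.smooth α) μ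
  have hH := h.hat hF
  set m := pd (region ε U) 1 (fun y => φ y 1) with hm
  set b := pd (region ε U) 0 (fun y => φ y 0) with hb
  have sm : ContDiffOn ℝ ∞ m W := hp 1 1
  have sb : ContDiffOn ℝ ∞ b W := hp 0 0
  have smt := N.contDiffOn_pd sm 0
  have sdet : ContDiffOn ℝ ∞ (metricDet (hatPull φ e F)) W := contDiffOn_det hH.smooth
  -- Away from the horizon the pulled-back metric may degenerate. Restricting to the relatively open
  -- set where its determinant and m, b are non-zero keeps all horizon points of W, and only these
  -- matter for the limit.
  let V := {x | x ∈ W ∧ metricDet (hatPull φ e F) x * (m x * b x) ≠ 0}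
  have hVW : V ⊆ W := fun x hx => hx.1
  have hV : HalfOpen V := N.small.ne_zero (sdet.mul (sm.mul sb)).continuousOn
  have NV : Nested (region ε U) V := ⟨N.big, hV, hVW.trans N.sub⟩
  have m0 : ∀ x ∈ V, m x ≠ 0 := fun x hx => left_ne_zero_of_mul (right_ne_zero_of_mul hx.2)
  have b0 : ∀ x ∈ V, b x ≠ 0 := fun x hx => right_ne_zero_of_mul (right_ne_zero_of_mul hx.2)
  have im : ContDiffOn ℝ ∞ (fun x => (m x)⁻¹) V := (sm.mono hVW).inv m0
  refine ⟨V, fun x => m x ^ 2, fun x => pd (region ε U) 0 m x * (m x)⁻¹, fun x => κ ^ 2 * b x ^ 2, hVW,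
    fun x hx h0 => ⟨hx, ?_⟩,
    { nested := NV
      smooth := fun α β => (hH.smooth α β).mono hVW
      smooth_E := (sm.mono hVW).pow 2
      smooth_B := (smt.mono hVW).mul im
      smooth_M := contDiffOn_const.mul ((sb.mono hVW).pow 2)
      det_ne := fun x hx => left_ne_zero_of_mul hx.2
      E_ne := fun x hx => pow_ne_zero 2 (m0 x hx)
      M_ne := fun x hx => mul_ne_zero (pow_pos hκ 2).ne' (pow_ne_zero 2 (b0 x hx))
      plane := fun x hx h0 => h.plane hF (hVW hx) h0
      left := fun x hx h0 => h.left hF (hVW hx) h0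
      right := fun x hx h0 => h.right hF (hVW hx) h0
      symm := fun x hx h0 P Q => ?_
      pd_E := fun x hx h0 => ?_
      pd_B := fun x hx h0 => ?_
      pd_M := fun x hx h0 => ?_
      pd_cross := fun x hx h0 P Q => ?_ }⟩
  · have hmx := h.d11 x hx h0
    have hbx := h.d00 x hx h0
    rw [OrbitMetric.metricDet_of_block ⟨h.left hF hx h0, h.right hF hx h0⟩ (h.plane hF hx h0),
      h.det_cross hF hx h0]
    have := hq.pos _ (N.sub hx).2.2
    refine mul_ne_zero (mul_ne_zero (neg_ne_zero.2 ?_) this.ne') (mul_pos hmx hbx).ne'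
    positivity
  · rw [h.cross hF (hVW hx) h0, h.cross hF (hVW hx) h0, Finset.sum_comm]
    refine Finset.sum_congr rfl fun R _ => Finset.sum_congr rfl fun S _ => ?_
    rw [hq.symm S R _ (h.maps (hVW hx)).2.2]
    ring
  · have : (fun x => m x ^ 2) = fun x => m x * m x := by ext; ring
    have := m0 x hx
    rw [‹(fun x => m x ^ 2) = _›, N.pd_mul sm sm 0 (hVW hx)]
    field_simp
    ring
  · have := m0 x hx
    rw [NV.pd_mul (smt.mono hVW) im 0 hx, NV.pd_inv (sm.mono hVW) 0 hx this]
    field_simp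
    -- The t-derivative of ∂_t m / m vanishes exactly when m ∂_t²m = (∂_t m)².
    linear_combination h.d011 x (hVW hx) h0
  · have : (fun x => κ ^ 2 * b x ^ 2) = fun x => κ ^ 2 * (b x * b x) := by ext; ring
    rw [this, N.pd_const_mul _ (by fun_prop) 0 (hVW hx), N.pd_mul sb sb 0 (hVW hx),
      h.d000 x (hVW hx) h0]
    ring
  · have hx := hVW hx
    have sq : ∀ R S, ContDiffOn ℝ ∞ (fun x => angPull (q R S) (φ x)) W := fun R S =>
      (contDiffOn_comp_ang (hq.smooth R S) fun x hx => ang_mem hx).comp (contDiffOn_pi.2 h.smooth) h.maps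
    rw [N.pd_tangential (hH.smooth _ _) (g := fun x => ∑ R : Fin n, ∑ S : Fin n, angPull (q R S) (φ x) *
      pd (region ε U) P.succ.succ (fun y => φ y R.succ.succ) x *
      pd (region ε U) Q.succ.succ (fun y => φ y S.succ.succ) x) (by fun_prop)
      (fun y hy hy0 => h.cross hF hy hy0 P Q) (by simp) hx h0, N.pd_sum _ (fun R _ => by fun_prop) 0 hx]
    refine Finset.sum_eq_zero fun R _ => ?_
    rw [N.pd_sum _ (fun R _ => by fun_prop) 0 hx]
    refine Finset.sum_eq_zero fun S _ => ?_
    have NR := N.big.nested_self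
    have z1 : pd (region ε U) 0 (fun y => angPull (q R S) (φ y)) x = 0 := by
      have hm := h.maps hx
      rw [N.pd_comp NR h.smooth h.maps
        (contDiffOn_comp_ang (hq.smooth R S) fun x hx => ang_mem hx) 0 hx, sum_split,
        NR.pd_zero_ang hq.isOpen (hq.smooth R S) hm hm.2.2,
        NR.pd_one_ang hq.isOpen (hq.smooth R S) hm hm.2.2]
      simp [h.d0M x hx h0]
    have z2 : ∀ (P R : Fin n), pd (region ε U) 0
        (pd (region ε U) P.succ.succ (fun y => φ y R.succ.succ)) x = 0 := fun P R => by
      rw [N.pd_comm (h.smooth _) 0 _ hx, N.pd_tangential (hp _ 0) (g := fun _ => 0) contDiffOn_const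
        (fun y hy hy0 => h.d0M y hy hy0 R) (succ_succ_ne_one P) hx h0]
      simp [pd]
    rw [N.pd_mul ((sq R S).mul (hp _ _)) (hp _ _) 0 hx, N.pd_mul (sq R S) (hp _ _) 0 hx, z1, z2, z2]
    ring

end HatMap

/-- The factor ρ in ξ^ρ = ρ a absorbs the pole of ω^t, so the density extends continuously to ½(ξ^t
ω̂^ρ - a ω̂^t). On the horizon ω̂^t always vanishes, and ω̂^ρ does so because both traces are
divergences for q. -/
theorem integrableCharges (hg : IsHorizonBackground ε U κ f q g) (hU : IsOpen U) (hκ : 0 < κ) :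
    IntegrableCharges GN ε U g (algA ε U q) := by
  intro W φ hφ g' hg' ξ hξ η hη χ hχ t C hC hCU hCW
  subst hg'
  have hq := hg.isCrossMetric hU
  obtain ⟨F, hF⟩ := hg.exists_bgHat hU
  obtain ⟨e, he⟩ := (hφ.orbitMap hq).exists_hatMap
  obtain ⟨V, E, B, M, hVW, hWV, O⟩ := he.exists_orbitMetric hF hq hκ
  have H := he.hat hF
  have HV : Hat V (pullback (region ε U) φ g) (hatPull φ e F) :=
    ⟨fun α β => (H.smooth α β).mono hVW, fun α β x hx => H.eq α β x (hVW hx)⟩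
  have N := O.nested
  obtain ⟨F₀, G₀, H₀, J₀, K₀, h₀, -⟩ := hξ
  obtain ⟨F₁, G₁, H₁, J₁, K₁, h₁, hd₁⟩ := hη
  obtain ⟨F₂, G₂, H₂, J₂, K₂, h₂, hd₂⟩ := hχ
  obtain ⟨a₀, d₀, v₀⟩ := (h₀.jetForm hU).exists_hatVec hU
  obtain ⟨a₁, d₁, v₁⟩ := (h₁.jetForm hU).exists_hatVec hU
  obtain ⟨a₂, d₂, v₂⟩ := (h₂.jetForm hU).exists_hatVec hU
  have L₁ := HV.lieDeriv N v₁
  have L₂ := HV.lieDeriv N v₂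
  have P₁ := O.orbitPert hU v₁
  have P₂ := O.orbitPert hU v₂
  have hdet : ∀ x ∈ V, x 1 = 0 → (Matrix.of fun P Q : Fin n =>
      hatPull φ e F P.succ.succ Q.succ.succ x).det = metricDet q (ang x) :=
    fun x hx h0 => he.det_cross hF (hVW hx) h0
  set w := hatOmega GN (region ε U) (hatPull φ e F) (hatLie (region ε U) η a₁ d₁ (hatPull φ e F))
    (hatLie (region ε U) χ a₂ d₂ (hatPull φ e F)) with hw
  have sw := fun ν => (contDiffOn_hatOmega N O.smooth O.det_ne L₁.smooth L₂.smooth GN ν).continuousOn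
  have key := hasBoundaryIntegral_of_continuousOn hC t N.small (fun σ hσ => hWV _ (hCW σ hσ) rfl)
    (b := fun x => (1 / 2) *
        (ξ x 0 * omega GN (region ε U) (pullback (region ε U) φ g)
            (lieDeriv (region ε U) η (pullback (region ε U) φ g))
            (lieDeriv (region ε U) χ (pullback (region ε U) φ g)) 1 x -
          ξ x 1 * omega GN (region ε U) (pullback (region ε U) φ g)
            (lieDeriv (region ε U) η (pullback (region ε U) φ g))
            (lieDeriv (region ε U) χ (pullback (region ε U) φ g)) 0 x))
    (B := fun x => (1 / 2) * (ξ x 0 * w 1 x - a₀ x * w 0 x))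
    (continuousOn_const.mul ((((v₀.smooth 0).continuousOn.mono N.sub).mul (sw 1)).sub
      ((v₀.smooth_a.continuousOn.mono N.sub).mul (sw 0)))) fun x hx h1 => by
      rw [HV.omega_eq L₁ L₂ N hx h1, HV.omega_eq L₁ L₂ N hx h1, v₀.eq_a x (N.sub hx), lam_one, lam_zero]
      have := h1.ne'
      field_simp
      rw [hw]
  convert key using 1
  refine (setIntegral_eq_zero_of_forall_eq_zero fun σ hσ => ?_).symm
  have hx := hWV _ (hCW σ hσ) rfl
  rw [hw, O.hatOmega_zero P₁ P₂ hx rfl, O.hatOmega_one P₁ P₂ hx rfl, O.crossTr_hatLie hq v₁ hdet hx rfl,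
    O.crossTr_hatLie hq v₂ hdet hx rfl, ang_pt, hd₁ _ (hCU hσ), hd₂ _ (hCU hσ)]
  ring

end Pullback

/-! ### Pointwise algebra of the charge density -/

section ChargeAlgebra

variable {ι : Type} [Fintype ι] [DecidableEq ι]

/-- The expression is linear in ξ and its gradient together; this separates the parts of ξ of
different order in ρ. -/
theorem preA_add_smul (I h : ι → ι → ℝ) (c : ι → ι → ι → ℝ) (v v' : ι → ι → ℝ) (ξ ξ' : ι → ℝ) (r : ℝ)
    (μ ν : ι) : preA I h c (fun α β => r * v α β + v' α β) (fun α => r * ξ α + ξ' α) μ ν =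
      r * preA I h c v ξ μ ν + preA I h c v' ξ' μ ν := by
  have e1 : ∑ l, I μ l * (r * v l ν + v' l ν) =
      r * ∑ l, I μ l * v l ν + ∑ l, I μ l * v' l ν := by
    rw [Finset.mul_sum, ← Finset.sum_add_distrib]
    exact Finset.sum_congr rfl fun _ _ => by ring
  have e2 : ∑ α, ∑ β, ∑ γ, I α β * I μ γ * h β γ * (r * v α ν + v' α ν) =
      r * ∑ α, ∑ β, ∑ γ, I α β * I μ γ * h β γ * v α ν +
        ∑ α, ∑ β, ∑ γ, I α β * I μ γ * h β γ * v' α ν := by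
    simp only [Finset.mul_sum, ← Finset.sum_add_distrib]
    exact Finset.sum_congr rfl fun _ _ => Finset.sum_congr rfl fun _ _ =>
      Finset.sum_congr rfl fun _ _ => by ring
  have e3 : ∑ l, ∑ β, ∑ α, I μ l * I ν β * c l β α * (r * ξ α + ξ' α) =
      r * ∑ l, ∑ β, ∑ α, I μ l * I ν β * c l β α * ξ α +
        ∑ l, ∑ β, ∑ α, I μ l * I ν β * c l β α * ξ' α := by
    simp only [Finset.mul_sum, ← Finset.sum_add_distrib]
    exact Finset.sum_congr rfl fun _ _ => Finset.sum_congr rfl fun _ _ =>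
      Finset.sum_congr rfl fun _ _ => by ring
  rw [preA, e1, e2, e3, preA, preA]
  ring

/-- The coefficient of `∇_α ξ^ν` in `preS`. -/
def gradCoeff (I h : ι → ι → ℝ) (μ α : ι) : ℝ :=
  -(1 / 2) * (∑ β, ∑ γ, I β γ * h β γ) * I μ α + ∑ β, ∑ γ, I α β * I μ γ * h β γ

/-- For a field tangent to the cross-section the two terms proportional to ξ^μ are absent, and what
is left is linear in ∇ξ and in ∇h · ξ. Both vanish on the horizon for the cross-section part. -/
theorem preA_of_eq_zero (I h : ι → ι → ℝ) (c : ι → ι → ι → ℝ) (v : ι → ι → ℝ) {ξ : ι → ℝ} {μ : ι}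
    (hξ : ξ μ = 0) (ν : ι) : preA I h c v ξ μ ν =
      ∑ α, gradCoeff I h μ α * v α ν - ∑ l, ∑ β, I μ l * I ν β * ∑ α, c l β α * ξ α := by
  have e : ∑ α, gradCoeff I h μ α * v α ν =
      -(1 / 2) * (∑ α, ∑ β, I α β * h α β) * (∑ l, I μ l * v l ν) +
        ∑ α, ∑ β, ∑ γ, I α β * I μ γ * h β γ * v α ν := by
    rw [Finset.mul_sum, ← Finset.sum_add_distrib]
    refine Finset.sum_congr rfl fun α _ => ?_
    simp only [gradCoeff, add_mul, Finset.sum_mul]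
    ring
  have e' : ∑ l, ∑ β, I μ l * I ν β * ∑ α, c l β α * ξ α =
      ∑ l, ∑ β, ∑ α, I μ l * I ν β * c l β α * ξ α := by
    simp only [Finset.mul_sum, mul_assoc]
  rw [e, e', preA, hξ, zero_mul, zero_mul, add_zero, sub_zero]

variable {n : ℕ} {I h : Fin (n + 2) → Fin (n + 2) → ℝ}
  {c : Fin (n + 2) → Fin (n + 2) → Fin (n + 2) → ℝ}

theorem sum_mul_eq (hI : BlockDiag I) : ∑ α, ∑ β, I α β * h α β =
    ∑ a, ∑ b, res2 I a b * res2 h a b + crossTr I h := by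
  simp only [sum_plane_add, hI.left, hI.right, zero_mul, Finset.sum_const_zero, add_zero, zero_add]
  rfl

theorem gradCoeff_right (hI : BlockDiag I) (hh : BlockDiag h) (a : Bool) (P : Fin n) :
    gradCoeff I h (planeIdx n a) P.succ.succ = 0 := by
  simp only [gradCoeff, sum_plane_add, hI.left, hI.right, hh.right, zero_mul, mul_zero,
    Finset.sum_const_zero, add_zero, zero_add]

theorem gradCoeff_plane (hI : BlockDiag I) (a b : Bool) :
    gradCoeff I h (planeIdx n a) (planeIdx n b) =
      gradCoeff (res2 I) (res2 h) a b - (1 / 2) * crossTr I h * res2 I a b := by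
  have e : ∑ β, ∑ γ, I (planeIdx n b) β * I (planeIdx n a) γ * h β γ =
      ∑ β, ∑ γ, res2 I b β * res2 I a γ * res2 h β γ := by
    simp only [sum_plane_add, hI.left, zero_mul, mul_zero, Finset.sum_const_zero, add_zero]
    rfl
  rw [gradCoeff, gradCoeff, sum_mul_eq hI, e, show I (planeIdx n a) (planeIdx n b) = res2 I a b from rfl]
  ring

/-- As for the current, block-diagonality confines all contractions to the plane, except for the
trace of h over the cross-section in the first term. -/
theorem preA_plane (hI : BlockDiag I) (hh : BlockDiag h) (hc : PlaneOnly c)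
    (v : Fin (n + 2) → Fin (n + 2) → ℝ) (ξ : Fin (n + 2) → ℝ) (a b : Bool) :
    preA I h c v ξ (planeIdx n a) (planeIdx n b) =
      preA (res2 I) (res2 h) (res3 c) (res2 v) (fun d => ξ (planeIdx n d)) a b -
        (1 / 2) * crossTr I h * ∑ l, res2 I a l * res2 v l b := by
  have c1 := hc.fst
  have c2 := hc.snd
  have c3 := hc.trd
  simp only [preA]
  rw [sum_mul_eq hI]
  have e1 : ∑ l, I (planeIdx n a) l * v l (planeIdx n b) = ∑ l, res2 I a l * res2 v l b := by
    rw [sum_plane fun M => by rw [hI.left, zero_mul]]; rfl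
  have e2 : ∑ α, ∑ β, ∑ γ, I α β * I (planeIdx n a) γ * h β γ * v α (planeIdx n b) =
      ∑ α, ∑ β, ∑ γ, res2 I α β * res2 I a γ * res2 h β γ * res2 v α b := by
    simp only [sum_plane_add, hI.left, hI.right, hh.right, zero_mul, mul_zero,
      Finset.sum_const_zero, add_zero]
    rfl
  have e3 : ∑ l, ∑ β, ∑ α, I (planeIdx n a) l * I (planeIdx n b) β * c l β α * ξ α =
      ∑ l, ∑ β, ∑ α, res2 I a l * res2 I b β * res3 c l β α * ξ (planeIdx n α) := by
    simp only [sum_plane_add, hI.left, c3, zero_mul, mul_zero, Finset.sum_const_zero, add_zero]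
    rfl
  have e4 : ∑ α, ∑ β, ∑ γ, I (planeIdx n b) β * I α γ * c α β γ =
      ∑ α, ∑ β, ∑ γ, res2 I b β * res2 I α γ * res3 c α β γ := by
    simp only [sum_plane_add, hI.left, hI.right, c1, c3, zero_mul, mul_zero, Finset.sum_const_zero, add_zero]
    rfl
  have e5 : ∑ l, ∑ α, ∑ β, I (planeIdx n b) l * I α β * c l α β =
      ∑ l, ∑ α, ∑ β, res2 I b l * res2 I α β * res3 c l α β := by
    simp only [sum_plane_add, hI.left, hI.right, c2, c3, zero_mul, mul_zero, Finset.sum_const_zero, add_zero]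
    rfl
  rw [e1, e2, e3, e4, e5]
  ring

/-- The algebraic identity behind the central term `G₁ J₂ - J₁ G₂`. -/
theorem preA_plane_background {M : ℝ} (hM : M ≠ 0) (S j γ G J a τ : ℝ) (v : Bool → Bool → ℝ)
    (ξ : Bool → ℝ) (v00 : v false false = G + a) (v01 : v false true = J + M * τ)
    (v10 : v true false = τ) (v11 : v true true = a) (ξ0 : ξ false = τ) (ξ1 : ξ true = a) :
    preA (planeI 1 0 M) (planeH 1 0 M S j γ)
        (covA (chrA (planeI 1 0 M) (planeDG 1 0 M)) (planeH 1 0 M S j γ) (planeDH 1 0 M S j γ))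
        v ξ false true -
      preA (planeI 1 0 M) (planeH 1 0 M S j γ)
        (covA (chrA (planeI 1 0 M) (planeDG 1 0 M)) (planeH 1 0 M S j γ) (planeDH 1 0 M S j γ))
        v ξ true false = (G * j - J * γ) / M := by
  rw [covA_plane_fun S j γ one_ne_zero hM]
  simp only [preA, planeI, planeH, symB, Fintype.sum_bool, if_true, if_false, Bool.false_eq_true,
    v00, v01, v10, v11, ξ0, ξ1]
  field_simp
  ring

end ChargeAlgebra

/-! ### The charge density in rescaled components -/

section ChargeDensity

variable {n : ℕ} {ε : ℝ} {U : Set (Fin n → ℝ)}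

/-- The `t, ρ` components of `ξ`, divided by `ρ` after rescaling. -/
def planePart (ξ : (Fin (n + 2) → ℝ) → (Fin (n + 2) → ℝ)) (a : (Fin (n + 2) → ℝ) → ℝ)
    (α : Fin (n + 2)) (x : Fin (n + 2) → ℝ) : ℝ :=
  if α = 0 then ξ x 0 else if α = 1 then a x else 0

/-- The cross-section components of `ξ`. -/
def crossPart (ξ : (Fin (n + 2) → ℝ) → (Fin (n + 2) → ℝ)) (α : Fin (n + 2))
    (x : Fin (n + 2) → ℝ) : ℝ :=
  if α = 0 then 0 else if α = 1 then 0 else ξ x α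

variable {ξ : (Fin (n + 2) → ℝ) → (Fin (n + 2) → ℝ)} {a : (Fin (n + 2) → ℝ) → ℝ}

@[simp] theorem planePart_zero (x : Fin (n + 2) → ℝ) : planePart ξ a 0 x = ξ x 0 := by
  simp [planePart]

@[simp] theorem planePart_one (x : Fin (n + 2) → ℝ) : planePart ξ a 1 x = a x := by
  simp [planePart]

@[simp] theorem planePart_succ (x : Fin (n + 2) → ℝ) (P : Fin n) :
    planePart ξ a P.succ.succ x = 0 := by
  simp [planePart, succ_succ_ne_one]

@[simp] theorem crossPart_zero (x : Fin (n + 2) → ℝ) : crossPart ξ 0 x = 0 := by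
  simp [crossPart]

@[simp] theorem crossPart_one (x : Fin (n + 2) → ℝ) : crossPart ξ 1 x = 0 := by
  simp [crossPart]

@[simp] theorem crossPart_succ (x : Fin (n + 2) → ℝ) (P : Fin n) :
    crossPart ξ P.succ.succ x = ξ x P.succ.succ := by
  simp [crossPart, succ_succ_ne_one]

/-- The part of the rescaled covariant derivative of `ξ` from `planePart ξ`. -/
def planeGrad (s : Set (Fin (n + 2) → ℝ)) (F d : Fin (n + 2) → Fin (n + 2) → (Fin (n + 2) → ℝ) → ℝ)
    (ξ : (Fin (n + 2) → ℝ) → (Fin (n + 2) → ℝ)) (a : (Fin (n + 2) → ℝ) → ℝ) (α ν : Fin (n + 2))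
    (x : Fin (n + 2) → ℝ) : ℝ :=
  d ν α x + ∑ β, hatChr s F ν α β x * planePart ξ a β x

/-- The part of the rescaled covariant derivative of `ξ` from `crossPart ξ`. -/
def crossGrad (s : Set (Fin (n + 2) → ℝ)) (F : Fin (n + 2) → Fin (n + 2) → (Fin (n + 2) → ℝ) → ℝ)
    (ξ : (Fin (n + 2) → ℝ) → (Fin (n + 2) → ℝ)) (α ν : Fin (n + 2)) (x : Fin (n + 2) → ℝ) : ℝ :=
  ∑ β, hatChr s F ν α β x * crossPart ξ β x

/-- The contribution of `planePart ξ` to the charge density. -/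
def planeCharge (s : Set (Fin (n + 2) → ℝ)) (F H d : Fin (n + 2) → Fin (n + 2) → (Fin (n + 2) → ℝ) → ℝ)
    (ξ : (Fin (n + 2) → ℝ) → (Fin (n + 2) → ℝ)) (a : (Fin (n + 2) → ℝ) → ℝ) (μ ν : Fin (n + 2))
    (x : Fin (n + 2) → ℝ) : ℝ :=
  preA (fun α β => inv F α β x) (fun α β => H α β x) (fun γ α β => hatCov s F H γ α β x)
    (fun α ν => planeGrad s F d ξ a α ν x) (fun α => planePart ξ a α x) μ ν

/-- The contribution of `crossPart ξ` to the charge density. -/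
def crossCharge (s : Set (Fin (n + 2) → ℝ)) (F H : Fin (n + 2) → Fin (n + 2) → (Fin (n + 2) → ℝ) → ℝ)
    (ξ : (Fin (n + 2) → ℝ) → (Fin (n + 2) → ℝ)) (μ ν : Fin (n + 2)) (x : Fin (n + 2) → ℝ) : ℝ :=
  preA (fun α β => inv F α β x) (fun α β => H α β x) (fun γ α β => hatCov s F H γ α β x)
    (fun α ν => crossGrad s F ξ α ν x) (fun α => crossPart ξ α x) μ ν

variable {G₀ F₀ H₀ J₀ : (Fin n → ℝ) → ℝ} {K : (Fin n → ℝ) → (Fin n → ℝ)}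
  {V : Set (Fin (n + 2) → ℝ)}
  {d g h F H : Fin (n + 2) → Fin (n + 2) → (Fin (n + 2) → ℝ) → ℝ} {x : Fin (n + 2) → ℝ}

/-- The rescaled components ρ ξ^t and ξ^ρ = ρ a carry a factor ρ and the cross-section components do
not, so the two parts of ξ enter the charge at different orders. -/
theorem HatVec.lam_mul (v : HatVec ε U F₀ G₀ H₀ J₀ K ξ a d) (hx : x ∈ region ε U) (α : Fin (n + 2)) :
    lam x α * ξ x α = x 1 * planePart ξ a α x + crossPart ξ α x := by
  revert α
  exact index_cases (by simp) (by simp [v.eq_a x hx]) (by simp)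

theorem Hat.covV_eq (hg : Hat V g F) (N : Nested (region ε U) V)
    (v : HatVec ε U F₀ G₀ H₀ J₀ K ξ a d) (hx : x ∈ V) (h1 : x 1 ≠ 0) (α ν : Fin (n + 2)) :
    covV (region ε U) g ξ α ν x = (x 1)⁻¹ * (lam x α * (lam x ν)⁻¹) *
      (x 1 * planeGrad (region ε U) F d ξ a α ν x + crossGrad (region ε U) F ξ α ν x) := by
  have hν := lam_ne h1 ν
  have e1 : pd (region ε U) α (fun y => ξ y ν) x = (lam x ν)⁻¹ * (lam x α * d ν α x) := by
    rw [← v.eq_d ν α x (N.sub hx), inv_mul_cancel_left₀ hν]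
  have e2 : ∑ β, christoffel (region ε U) g ν α β x * ξ x β =
      (x 1)⁻¹ * (lam x α * (lam x ν)⁻¹) *
        (x 1 * ∑ β, hatChr (region ε U) F ν α β x * planePart ξ a β x +
          ∑ β, hatChr (region ε U) F ν α β x * crossPart ξ β x) := by
    rw [Finset.mul_sum, ← Finset.sum_add_distrib, Finset.mul_sum]
    refine Finset.sum_congr rfl fun β _ => ?_
    rw [hg.christoffel_eq N hx h1]
    linear_combination (x 1)⁻¹ * (lam x α * (lam x ν)⁻¹) * hatChr (region ε U) F ν α β x *
      v.lam_mul (N.sub hx) β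
  rw [covV, e1, e2, planeGrad, crossGrad]
  field_simp
  ring

/-- Power counting: ρ from the density, ρ⁻¹ from the derivative and ρ⁻¹ from the upper index t. The
plane part, with its extra ρ, is finite; the cross-section part appears divided by ρ, so its
first-order coefficient decides the limit. -/
theorem Hat.chargeS_eq (hg : Hat V g F) (hh : Hat V h H) (N : Nested (region ε U) V)
    (v : HatVec ε U F₀ G₀ H₀ J₀ K ξ a d) (hx : x ∈ V) (h1 : 0 < x 1) (GN : ℝ) :
    chargeS GN (region ε U) g h ξ 0 1 x = Real.sqrt (-metricDet F x) / (8 * Real.pi * GN) * ((1 / 2) *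
      ((planeCharge (region ε U) F H d ξ a 0 1 x - planeCharge (region ε U) F H d ξ a 1 0 x) +
        (x 1)⁻¹ * (crossCharge (region ε U) F H ξ 0 1 x - crossCharge (region ε U) F H ξ 1 0 x))) := by
  have h2 := h1.ne'
  have e : ∀ α, ξ x α = (lam x α)⁻¹ * (x 1 * planePart ξ a α x + crossPart ξ α x) := fun α => by
    rw [← v.lam_mul (N.sub hx), inv_mul_cancel_left₀ (lam_ne h2 α)]
  have eξ : ξ x = fun α => (lam x α)⁻¹ * (x 1 * planePart ξ a α x + crossPart ξ α x) := funext e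
  have key : ∀ μ ν, preS (region ε U) g h ξ μ ν x = (x 1)⁻¹ * ((lam x μ)⁻¹ * (lam x ν)⁻¹) *
      (x 1 * planeCharge (region ε U) F H d ξ a μ ν x + crossCharge (region ε U) F H ξ μ ν x) := by
    intro μ ν
    rw [preS_eq, eξ]
    simp only [hg.inv_eq hx h2, hh.eq _ _ x hx, hg.covT_eq hh N hx h2, hg.covV_eq N v hx h2]
    rw [preA_scale (lam_ne h2), preA_add_smul]
    rfl
  rw [chargeS, key, key, hg.sqrt_det_eq hx h1, lam_zero, lam_one]
  field_simp
  ring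

section Smooth

variable (N : Nested (region ε U) V) (hF : ∀ α β, ContDiffOn ℝ ∞ (F α β) V)
  (hdet : ∀ x ∈ V, metricDet F x ≠ 0) (hH : ∀ α β, ContDiffOn ℝ ∞ (H α β) V)
  (v : HatVec ε U F₀ G₀ H₀ J₀ K ξ a d)

include N v

theorem contDiffOn_planePart (α : Fin (n + 2)) : ContDiffOn ℝ ∞ (planePart ξ a α) V := by
  have h1 := (v.smooth 0).mono N.sub
  have h2 := v.smooth_a.mono N.sub
  unfold planePart
  split_ifs <;> fun_prop

theorem contDiffOn_crossPart (α : Fin (n + 2)) : ContDiffOn ℝ ∞ (crossPart ξ α) V := by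
  have h1 := (v.smooth α).mono N.sub
  unfold crossPart
  split_ifs <;> fun_prop

include hF hdet

theorem contDiffOn_planeGrad (α ν : Fin (n + 2)) :
    ContDiffOn ℝ ∞ (planeGrad (region ε U) F d ξ a α ν) V := by
  have h1 := contDiffOn_planePart N v
  have h2 := (v.smooth_d ν α).mono N.sub
  have h3 := contDiffOn_hatChr N hF hdet
  unfold planeGrad
  fun_prop

theorem contDiffOn_crossGrad (α ν : Fin (n + 2)) :
    ContDiffOn ℝ ∞ (crossGrad (region ε U) F ξ α ν) V := by
  have h1 := contDiffOn_crossPart N v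
  have h3 := contDiffOn_hatChr N hF hdet
  unfold crossGrad
  fun_prop

include hH

theorem contDiffOn_planeCharge (μ ν : Fin (n + 2)) :
    ContDiffOn ℝ ∞ (planeCharge (region ε U) F H d ξ a μ ν) V := by
  have h1 := contDiffOn_planePart N v
  have h2 := contDiffOn_planeGrad N hF hdet v
  have h3 := contDiffOn_inv hF hdet
  have h4 := contDiffOn_hatCov N hF hdet hH
  unfold planeCharge preA
  fun_prop

theorem contDiffOn_crossCharge (μ ν : Fin (n + 2)) :
    ContDiffOn ℝ ∞ (crossCharge (region ε U) F H ξ μ ν) V := by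
  have h1 := contDiffOn_crossPart N v
  have h2 := contDiffOn_crossGrad N hF hdet v
  have h3 := contDiffOn_inv hF hdet
  have h4 := contDiffOn_hatCov N hF hdet hH
  unfold crossCharge preA
  fun_prop

end Smooth

end ChargeDensity

/-! ### First-order expansion at the horizon of the background -/

section Slopes

variable {n : ℕ} {ε κ : ℝ} {U : Set (Fin n → ℝ)} {f : Fin n → (Fin n → ℝ) → ℝ}
  {q : Fin n → Fin n → (Fin n → ℝ) → ℝ} {s V : Set (Fin (n + 2) → ℝ)}
  {g F H : Fin (n + 2) → Fin (n + 2) → (Fin (n + 2) → ℝ) → ℝ} {x : Fin (n + 2) → ℝ}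

theorem Nested.pd_mul_of_eq_zero (N : Nested s V) {u w : (Fin (n + 2) → ℝ) → ℝ}
    (hu : ContDiffOn ℝ ∞ u V) (hw : ContDiffOn ℝ ∞ w V) (μ : Fin (n + 2)) (hx : x ∈ V)
    (h : w x = 0) : pd s μ (fun y => u y * w y) x = u x * pd s μ w x := by
  rw [N.pd_mul hu hw μ hx, h, mul_zero, zero_add]

/-- Rescaled derivatives other than ∂_t carry an explicit ρ, so their ρ-derivative at ρ = 0 is just
the derivative itself. Second derivatives in ρ never appear. -/
theorem Nested.pd_hatD (N : Nested s V) (hH : ∀ α β, ContDiffOn ℝ ∞ (H α β) V) (hx : x ∈ V)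
    (h0 : x 1 = 0) (γ α β : Fin (n + 2)) : pd s 1 (hatD s H γ α β) x =
      (if γ = 0 then pd s 0 (pd s 1 (H α β)) x else pd s γ (H α β) x) +
        if γ = 1 then (wt α + wt β) * pd s 1 (H α β) x else 0 := by
  have h1 := hH α β
  have h2 := N.contDiffOn_pd h1
  have e : hatD s H γ α β = fun y => hatPd s γ (H α β) y +
      (if γ = 1 then (wt α + wt β) else 0) * H α β y := by
    ext y; simp only [hatD, ite_mul, zero_mul]
  have e2 : pd s 1 (hatPd s γ (H α β)) x =
      if γ = 0 then pd s 0 (pd s 1 (H α β)) x else pd s γ (H α β) x := by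
    unfold hatPd
    split_ifs
    · exact N.pd_comm h1 1 0 hx
    · exact N.pd_rho_mul (h2 γ) hx h0
  rw [e, N.pd_add (contDiffOn_hatPd N h1 γ) (by fun_prop) 1 hx, e2, N.pd_const_mul _ h1 1 hx, ite_mul,
    zero_mul]

namespace BgHat

variable (hF : BgHat ε U κ f q g F) (hg : IsHorizonBackground ε U κ f q g) (hU : IsOpen U)

include hF

include hg hU in
theorem symm (hx : x ∈ region ε U) (α β : Fin (n + 2)) : F α β x = F β α x := by
  rcases (show 0 ≤ x 1 from hx.1).eq_or_lt with h0 | h0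
  · replace h0 := h0.symm
    revert α β
    refine index_cases (index_cases rfl ?_ fun P => ?_) (index_cases ?_ rfl fun P => ?_)
      fun P => index_cases ?_ ?_ fun Q => ?_
    · rw [hF.v01 x hx h0, hF.v10 x hx h0]
    · rw [hF.v0M x hx h0, hF.vM0 x hx h0]
    · rw [hF.v01 x hx h0, hF.v10 x hx h0]
    · rw [hF.v1M x hx h0, hF.vM1 x hx h0]
    · rw [hF.v0M x hx h0, hF.vM0 x hx h0]
    · rw [hF.v1M x hx h0, hF.vM1 x hx h0]
    · rw [hF.vMN x hx h0, hF.vMN x hx h0, (hg.isCrossMetric hU).symm P Q _ hx.2.2]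
  · have h := hg.symm α β x hx
    rw [hF.eq α β x hx, hF.eq β α x hx, mul_comm (lam x β)] at h
    exact mul_left_cancel₀ (mul_ne_zero (lam_ne h0.ne' _) (lam_ne h0.ne' _)) h

include hg hU in
theorem hatChr_symm (hx : x ∈ region ε U) (l μ ν : Fin (n + 2)) :
    hatChr (region ε U) F l μ ν x = hatChr (region ε U) F l ν μ x := by
  have N := (halfOpen_region (ε := ε) hU).nested_self
  have e : ∀ τ, hatD (region ε U) F τ μ ν x = hatD (region ε U) F τ ν μ x := fun τ => by
    have e1 : pd (region ε U) τ (F μ ν) x = pd (region ε U) τ (F ν μ) x :=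
      N.pd_congr (fun y hy => hF.symm hg hU hy μ ν) τ hx
    have e2 := N.pd_congr (fun y hy => hF.symm hg hU hy μ ν) 0 hx
    simp only [hatD, hatPd, e1, e2, hF.symm hg hU hx μ ν, add_comm (wt μ)]
  simp only [hatChr, chrA, e]
  congr 1
  exact Finset.sum_congr rfl fun τ _ => by ring

/-- The `ρ`-derivatives of the mixed plane components vanish along with their tangential
derivatives. -/
theorem pd_value (hU : IsOpen U) (hx : x ∈ region ε U) (h0 : x 1 = 0) {α β : Fin (n + 2)} {c : ℝ}
    (h : ∀ y ∈ region ε U, y 1 = 0 → F α β y = c) {μ : Fin (n + 2)} (hμ : μ ≠ 1) :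
    pd (region ε U) μ (F α β) x = 0 := by
  have N := (halfOpen_region (ε := ε) hU).nested_self
  rw [N.pd_tangential (hF.smooth α β) (g := fun _ => c) contDiffOn_const h hμ hx h0]
  simp [pd]

theorem pd_slope (hU : IsOpen U) (hx : x ∈ region ε U) (h0 : x 1 = 0) {α β : Fin (n + 2)} {c : ℝ}
    (h : ∀ y ∈ region ε U, y 1 = 0 → pd (region ε U) 1 (F α β) y = c) {μ : Fin (n + 2)} (hμ : μ ≠ 1) :
    pd (region ε U) μ (pd (region ε U) 1 (F α β)) x = 0 := by
  have N := (halfOpen_region (ε := ε) hU).nested_self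
  rw [N.pd_tangential (N.contDiffOn_pd (hF.smooth α β) 1) (g := fun _ => c) contDiffOn_const h hμ hx h0]
  simp [pd]

include hg hU

theorem pd_slope_f (hx : x ∈ region ε U) (h0 : x 1 = 0) {α β : Fin (n + 2)} {P : Fin n}
    (h : ∀ y ∈ region ε U, y 1 = 0 → pd (region ε U) 1 (F α β) y = f P (ang y)) :
    pd (region ε U) 0 (pd (region ε U) 1 (F α β)) x = 0 ∧
    ∀ Q : Fin n, pd (region ε U) Q.succ.succ (pd (region ε U) 1 (F α β)) x = pd U Q (f P) (ang x) := by
  have N := (halfOpen_region (ε := ε) hU).nested_self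
  have hf := contDiffOn_comp_ang (V := region ε U) (hg.smooth_f P) fun x hx => ang_mem hx
  refine ⟨?_, fun Q => ?_⟩
  · rw [N.pd_tangential (N.contDiffOn_pd (hF.smooth α β) 1) hf h (by simp) hx h0,
      N.pd_zero_ang hU (hg.smooth_f P) hx hx.2.2]
  · rw [N.pd_tangential (N.contDiffOn_pd (hF.smooth α β) 1) hf h (succ_succ_ne_one Q) hx h0,
      N.pd_succ_ang hU (hg.smooth_f P) hx hx.2.2]

/-- The combination of metric derivatives with a cross-section index vanishes on the horizon, so the
inverse metric need not be expanded. At first order only the ρ-derivative f_M of the rescaled tM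
component contributes. -/
theorem pd_hatChr_cross (hκ : 0 < κ) (hx : x ∈ region ε U) (h0 : x 1 = 0) (P : Fin n) (a b : Bool) :
    pd (region ε U) 1 (hatChr (region ε U) F (planeIdx n a) (planeIdx n b) P.succ.succ) x =
      if a then (if b then 0 else -f P (ang x)) else (if b then -f P (ang x) / κ ^ 2 else 0) := by
  have O := hF.orbitMetric hg hU hκ
  have N := O.nested
  have sD := contDiffOn_hatD N hF.smooth
  have sI := contDiffOn_inv hF.smooth O.det_ne
  obtain ⟨i1, i2, -⟩ := O.inv_horizon hx h0
  have hD := O.planeOnly hx h0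
  have e : ∀ i, pd (region ε U) 1 (hatChr (region ε U) F (planeIdx n a) i P.succ.succ) x =
      (1 / 2) * ∑ τ, inv F (planeIdx n a) τ x *
        (pd (region ε U) 1 (hatD (region ε U) F i τ P.succ.succ) x +
          pd (region ε U) 1 (hatD (region ε U) F P.succ.succ τ i) x -
          pd (region ε U) 1 (hatD (region ε U) F τ i P.succ.succ) x) := by
    intro i
    have : hatChr (region ε U) F (planeIdx n a) i P.succ.succ = fun y => (1 / 2) *
        ∑ τ, inv F (planeIdx n a) τ y * (hatD (region ε U) F i τ P.succ.succ y +
          hatD (region ε U) F P.succ.succ τ i y - hatD (region ε U) F τ i P.succ.succ y) := rfl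
    rw [this, N.pd_const_mul _ (by fun_prop) 1 hx, N.pd_sum _ (fun τ _ => by fun_prop) 1 hx]
    congr 1
    refine Finset.sum_congr rfl fun τ _ => ?_
    rw [N.pd_mul_of_eq_zero (sI _ _) (by fun_prop) 1 hx (by rw [hD.trd, hD.fst, hD.trd]; ring),
      N.pd_sub (by fun_prop) (sD _ _ _) 1 hx, N.pd_add (sD _ _ _) (sD _ _ _) 1 hx]
  have I00 : inv F 0 0 x = -1 / (κ ^ 2 * 1) := congrFun (congrFun i2 false) false
  have I01 : inv F 0 1 x = 0 / (κ ^ 2 * 1) := congrFun (congrFun i2 false) true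
  have I10 : inv F 1 0 x = 0 / (κ ^ 2 * 1) := congrFun (congrFun i2 true) false
  have I11 : inv F 1 1 x = (κ ^ 2 - 0 ^ 2) / (κ ^ 2 * 1) := congrFun (congrFun i2 true) true
  have hκ2 : κ ^ 2 ≠ 0 := (pow_pos hκ 2).ne'
  rw [e, sum_plane fun M => by rw [i1.left, zero_mul]]
  simp only [N.pd_hatD hF.smooth hx h0, succ_succ_ne_zero, succ_succ_ne_one, if_false, Fintype.sum_bool,
    planeIdx_true, planeIdx_false]
  have s1 := hF.s0M x hx h0 P
  have s2 := hF.s1M x hx h0 P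
  have z1 := (hF.pd_slope_f hg hU hx h0 (fun y hy hy0 => hF.s0M y hy hy0 P)).1
  have z2 := hF.pd_slope hU hx h0 (fun y hy hy0 => hF.s1M y hy hy0 P) (μ := 0) (by simp)
  have w1 := hF.pd_value hU hx h0 hF.v00 (succ_succ_ne_one P)
  have w2 := hF.pd_value hU hx h0 hF.v01 (succ_succ_ne_one P)
  have w3 := hF.pd_value hU hx h0 hF.v10 (succ_succ_ne_one P)
  have w4 := hF.pd_value hU hx h0 hF.v11 (succ_succ_ne_one P)
  cases a <;> cases b <;>
    simp [planeIdx_true, planeIdx_false, I00, I01, I10, I11, s1, s2, z1, z2, w1, w2, w3, w4] <;>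
    field_simp <;> ring

end BgHat

end Slopes

/-! ### First-order expansion of a Lie derivative of the background -/

section LieSlopes

variable {n : ℕ} {ε κ : ℝ} {U : Set (Fin n → ℝ)} {f : Fin n → (Fin n → ℝ) → ℝ}
  {q : Fin n → Fin n → (Fin n → ℝ) → ℝ}
  {G₀ F₀ H₀ J₀ : (Fin n → ℝ) → ℝ} {K : (Fin n → ℝ) → (Fin n → ℝ)}
  {η : (Fin (n + 2) → ℝ) → (Fin (n + 2) → ℝ)} {a : (Fin (n + 2) → ℝ) → ℝ}
  {d g F : Fin (n + 2) → Fin (n + 2) → (Fin (n + 2) → ℝ) → ℝ} {x : Fin (n + 2) → ℝ}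

namespace HatVec

variable (v : HatVec ε U F₀ G₀ H₀ J₀ K η a d) (hU : IsOpen U)
include v hU

theorem pd_d0M (hx : x ∈ region ε U) (h0 : x 1 = 0) (P : Fin n) :
    pd (region ε U) 1 (d 0 P.succ.succ) x = pd (region ε U) P.succ.succ (fun y => η y 0) x := by
  have N := (halfOpen_region (ε := ε) hU).nested_self
  rw [N.pd_congr (g := fun y => y 1 * pd (region ε U) P.succ.succ (fun y => η y 0) y)
    (fun y hy => by simpa using (v.eq_d 0 P.succ.succ y hy).symm) 1 hx,
    N.pd_rho_mul (N.contDiffOn_pd (v.smooth 0) _) hx h0]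

theorem pd_d1M (hx : x ∈ region ε U) (h0 : x 1 = 0) (P : Fin n) :
    pd (region ε U) 1 (d 1 P.succ.succ) x = pd U P H₀ (ang x) + x 0 * pd U P J₀ (ang x) := by
  have N := (halfOpen_region (ε := ε) hU).nested_self
  rw [N.pd_congr (g := pd (region ε U) P.succ.succ (fun y => η y 1))
    (fun y hy => by simpa using (v.eq_d 1 P.succ.succ y hy).symm) 1 hx]
  exact v.pd_pd_succ_ρ hU hx h0 P

/-- Writing ξ^M = K^M + ρ² Z^M, ∂_t ξ^M / ρ has first-order coefficient ∂_t Z^M and ∂_ρ ξ^M has 2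
Z^M. The factor 2 is what later lets the unknown Z cancel. -/
theorem pd_pd_dM1 (hx : x ∈ region ε U) (h0 : x 1 = 0) (P : Fin n) :
    pd (region ε U) 0 (pd (region ε U) 1 (d P.succ.succ 1)) x =
      2 * pd (region ε U) 1 (d P.succ.succ 0) x := by
  have N := (halfOpen_region (ε := ε) hU).nested_self
  set u : (Fin (n + 2) → ℝ) → ℝ := fun y => η y P.succ.succ with hu
  have su : ContDiffOn ℝ ∞ u (region ε U) := v.smooth _
  have s1 := N.contDiffOn_pd su 1
  have sd := v.smooth_d P.succ.succ 0
  have sd1 := N.contDiffOn_pd sd 1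
  have e1 : ∀ y ∈ region ε U, d P.succ.succ 1 y = pd (region ε U) 1 u y := fun y hy => by
    simpa using (v.eq_d P.succ.succ 1 y hy).symm
  have e2 : ∀ y ∈ region ε U, pd (region ε U) 0 u y = y 1 * d P.succ.succ 0 y := fun y hy => by
    simpa using v.eq_d P.succ.succ 0 y hy
  have e3 : ∀ y ∈ region ε U, pd (region ε U) 0 (pd (region ε U) 1 u) y =
      d P.succ.succ 0 y + y 1 * pd (region ε U) 1 (d P.succ.succ 0) y := fun y hy => by
    rw [N.pd_comm su 0 1 hy, N.pd_congr e2 1 hy, N.pd_mul (by fun_prop) sd 1 hy, N.pd_coord 1 1 hy,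
      if_pos rfl, one_mul]
  rw [N.pd_congr (fun y hy => N.pd_congr e1 1 hy) 0 hx, N.pd_comm s1 0 1 hx, N.pd_congr e3 1 hx,
    N.pd_add sd (by fun_prop) 1 hx, N.pd_rho_mul sd1 hx h0]
  ring

end HatVec

/-- The product rule on the horizon. As ξ^ρ = 0 there, the transport term yields a ∂_ρ F and
tangential derivatives of ∂_ρ F, but no ∂_ρ² F. -/
theorem HatVec.pd_hatLie (v : HatVec ε U F₀ G₀ H₀ J₀ K η a d) (hU : IsOpen U)
    (hF : ∀ α β, ContDiffOn ℝ ∞ (F α β) (region ε U)) (hx : x ∈ region ε U) (h0 : x 1 = 0)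
    (μ ν : Fin (n + 2)) : pd (region ε U) 1 (hatLie (region ε U) η a d F μ ν) x =
      a x * pd (region ε U) 1 (F μ ν) x +
      (η x 0 * pd (region ε U) 0 (pd (region ε U) 1 (F μ ν)) x +
        ∑ P : Fin n, K (ang x) P * pd (region ε U) P.succ.succ (pd (region ε U) 1 (F μ ν)) x) +
      (pd (region ε U) 1 (fun y => a y * (wt μ + wt ν)) x * F μ ν x +
        a x * (wt μ + wt ν) * pd (region ε U) 1 (F μ ν) x) +
      ∑ α, (pd (region ε U) 1 (F α ν) x * d α μ x + F α ν x * pd (region ε U) 1 (d α μ) x +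
        (pd (region ε U) 1 (F μ α) x * d α ν x + F μ α x * pd (region ε U) 1 (d α ν) x)) := by
  have N := (halfOpen_region (ε := ε) hU).nested_self
  have s1 := v.smooth
  have s2 := v.smooth_a
  have s3 := v.smooth_d
  have s4 := fun α β γ => N.contDiffOn_pd (hF α β) γ
  have e1 : pd (region ε U) 1 (fun y => ∑ α, η y α * pd (region ε U) α (F μ ν) y) x =
      a x * pd (region ε U) 1 (F μ ν) x +
      (η x 0 * pd (region ε U) 0 (pd (region ε U) 1 (F μ ν)) x +
        ∑ P : Fin n, K (ang x) P * pd (region ε U) P.succ.succ (pd (region ε U) 1 (F μ ν)) x) := by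
    rw [N.pd_sum _ (fun α _ => by fun_prop) 1 hx]
    have : ∀ α, pd (region ε U) 1 (fun y => η y α * pd (region ε U) α (F μ ν) y) x =
        pd (region ε U) 1 (fun y => η y α) x * pd (region ε U) α (F μ ν) x +
          η x α * pd (region ε U) α (pd (region ε U) 1 (F μ ν)) x := fun α => by
      rw [N.pd_mul (s1 α) (s4 μ ν α) 1 hx, N.pd_comm (hF μ ν) 1 α hx]
    simp only [this]
    rw [sum_split]
    simp only [v.der_t x hx h0, v.der_ρ x hx h0, v.der_M x hx h0, v.val_ρ x hx h0, v.val_M x hx h0,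
      v.a_horizon x hx h0]
    ring_nf
  have e2 : hatLie (region ε U) η a d F μ ν = fun y => ∑ α, η y α * pd (region ε U) α (F μ ν) y +
      a y * (wt μ + wt ν) * F μ ν y + ∑ α, (F α ν y * d α μ y + F μ α y * d α ν y) := rfl
  rw [e2, N.pd_add (by fun_prop) (by fun_prop) 1 hx, N.pd_add (by fun_prop) (by fun_prop) 1 hx, e1,
    N.pd_mul (by fun_prop) (hF μ ν) 1 hx, N.pd_sum _ (fun α _ => by fun_prop) 1 hx]
  congr 1
  refine Finset.sum_congr rfl fun α _ => ?_
  rw [N.pd_add (by fun_prop) (by fun_prop) 1 hx, N.pd_mul (hF _ _) (s3 _ _) 1 hx,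
    N.pd_mul (hF _ _) (s3 _ _) 1 hx]

namespace BgHat

variable (hF : BgHat ε U κ f q g F) (hg : IsHorizonBackground ε U κ f q g) (hU : IsOpen U)
  (v : HatVec ε U F₀ G₀ H₀ J₀ K η a d)

include hF hg hU v

theorem orbitPert (hκ : 0 < κ) : OrbitPert (region ε U) (region ε U) (fun _ => 1) (fun _ => 0)
    (fun _ => κ ^ 2) (hatLie (region ε U) η a d F) a (angPull J₀) (angPull G₀) := by
  have h := (hF.orbitMetric hg hU hκ).orbitPert hU v
  simpa [crossDer, pd] using h

theorem pd_hatLie_zero (hx : x ∈ region ε U) (h0 : x 1 = 0) (P : Fin n) :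
    pd (region ε U) 1 (hatLie (region ε U) η a d F 0 P.succ.succ) x =
      (2 * a x + G₀ (ang x)) * f P (ang x) +
      ∑ Q, (K (ang x) Q * pd U Q (f P) (ang x) + f Q (ang x) * pd U P (fun σ => K σ Q) (ang x)) -
      κ ^ 2 * pd (region ε U) P.succ.succ (fun y => η y 0) x +
      ∑ Q, q Q P (ang x) * pd (region ε U) 1 (d Q.succ.succ 0) x := by
  have z := hF.pd_slope_f hg hU hx h0 (fun y hy hy0 => hF.s0M y hy hy0 P)
  rw [v.pd_hatLie hU hF.smooth hx h0, z.1, sum_split]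
  simp only [z.2, hF.s0M x hx h0, hF.v0M x hx h0, hF.v1M x hx h0, hF.s1M x hx h0, hF.sMN x hx h0,
    hF.vMN x hx h0, hF.s00 x hx h0, hF.s01 x hx h0, hF.v00 x hx h0, hF.v01 x hx h0, v.d00 x hx h0,
    v.d0M x hx h0, v.dMN x hx h0, v.pd_d0M hU hx h0, wt_zero, wt_succ, Finset.sum_add_distrib]
  simp only [zero_mul, mul_zero, add_zero, zero_add, Finset.sum_const_zero]
  ring

theorem pd_hatLie_one (hx : x ∈ region ε U) (h0 : x 1 = 0) (P : Fin n) :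
    pd (region ε U) 1 (hatLie (region ε U) η a d F 1 P.succ.succ) x =
      ∑ Q, q Q P (ang x) * pd (region ε U) 1 (d Q.succ.succ 1) x +
        (pd U P H₀ (ang x) + x 0 * pd U P J₀ (ang x)) := by
  have z0 := hF.pd_slope hU hx h0 (fun y hy hy0 => hF.s1M y hy hy0 P) (μ := 0) (by simp)
  have z := fun Q : Fin n =>
    hF.pd_slope hU hx h0 (fun y hy hy0 => hF.s1M y hy hy0 P) (succ_succ_ne_one Q)
  rw [v.pd_hatLie hU hF.smooth hx h0, z0, sum_split]
  simp only [z, hF.s0M x hx h0, hF.v0M x hx h0, hF.v1M x hx h0, hF.s1M x hx h0, hF.sMN x hx h0,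
    hF.vMN x hx h0, hF.s10 x hx h0, hF.s11 x hx h0, hF.v10 x hx h0, hF.v11 x hx h0, v.d01 x hx h0,
    v.dM1 x hx h0, v.pd_d1M hU hx h0, wt_one, wt_succ, Finset.sum_add_distrib]
  simp only [zero_mul, mul_zero, add_zero, zero_add, Finset.sum_const_zero]
  ring

/-- The first-order coefficient of the ρM component is known along the whole horizon and may be
differentiated in t. The second-order part of η^M enters through `HatVec.pd_pd_dM1`. -/
theorem pd_pd_hatLie_one (hκ : 0 < κ) (hx : x ∈ region ε U) (h0 : x 1 = 0) (P : Fin n) :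
    pd (region ε U) 0 (pd (region ε U) 1 (hatLie (region ε U) η a d F 1 P.succ.succ)) x =
      2 * ∑ Q, q Q P (ang x) * pd (region ε U) 1 (d Q.succ.succ 0) x + pd U P J₀ (ang x) := by
  have N := (halfOpen_region (ε := ε) hU).nested_self
  have sq := fun Q => contDiffOn_comp_ang (V := region ε U) (hg.smooth_q Q P) fun x hx => ang_mem hx
  have dH := contDiffOn_pd_of_isOpen hU v.smooth_H P
  have dJ := contDiffOn_pd_of_isOpen hU v.smooth_J P
  have sH := contDiffOn_comp_ang (V := region ε U) dH fun x hx => ang_mem hx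
  have sJ := contDiffOn_comp_ang (V := region ε U) dJ fun x hx => ang_mem hx
  have sd := fun Q : Fin n => N.contDiffOn_pd (v.smooth_d Q.succ.succ 1) 1
  have hL := (hF.orbitPert hg hU v hκ).smooth
  rw [N.pd_tangential (N.contDiffOn_pd (hL 1 P.succ.succ) 1)
    (g := fun y => ∑ Q, angPull (q Q P) y * pd (region ε U) 1 (d Q.succ.succ 1) y +
      (angPull (pd U P H₀) y + y 0 * angPull (pd U P J₀) y)) (by fun_prop)
    (fun y hy hy0 => hF.pd_hatLie_one hg hU v hy hy0 P) (by simp) hx h0,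
    N.pd_add (by fun_prop) (by fun_prop) 0 hx, N.pd_sum _ (fun Q _ => by fun_prop) 0 hx,
    N.pd_add sH (by fun_prop) 0 hx, N.pd_mul (by fun_prop) sJ 0 hx, N.pd_coord 0 0 hx, if_pos rfl,
    N.pd_zero_ang hU dH hx hx.2.2, N.pd_zero_ang hU dJ hx hx.2.2, Finset.mul_sum]
  have e : ∀ Q, pd (region ε U) 0 (fun y => angPull (q Q P) y *
      pd (region ε U) 1 (d Q.succ.succ 1) y) x =
      2 * (q Q P (ang x) * pd (region ε U) 1 (d Q.succ.succ 0) x) := fun Q => by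
    rw [N.pd_mul (sq Q) (sd Q) 0 hx, N.pd_zero_ang hU (hg.smooth_q Q P) hx hx.2.2,
      v.pd_pd_dM1 hU hx h0, angPull]
    ring
  rw [Finset.sum_congr rfl fun Q _ => e Q]
  simp only [angPull]
  ring

/-- The `ρ`-derivative of the antisymmetrised covariant derivative of `£_η ḡ`. -/
theorem pd_hatCov_cross (hκ : 0 < κ) (hx : x ∈ region ε U) (h0 : x 1 = 0) (P : Fin n) :
    pd (region ε U) 1 (hatCov (region ε U) F (hatLie (region ε U) η a d F) 0 1 P.succ.succ) x -
      pd (region ε U) 1 (hatCov (region ε U) F (hatLie (region ε U) η a d F) 1 0 P.succ.succ) x =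
      pd U P J₀ (ang x) + 2 * κ ^ 2 * pd (region ε U) P.succ.succ (fun y => η y 0) x -
      2 * ∑ Q, (K (ang x) Q * pd U Q (f P) (ang x) +
        f Q (ang x) * pd U P (fun σ => K σ Q) (ang x)) := by
  have O := hF.orbitMetric hg hU hκ
  have N := O.nested
  have B := hF.orbitPert hg hU v hκ
  have hH := B.smooth
  set H := hatLie (region ε U) η a d F with hHdef
  have sD := contDiffOn_hatD N hH
  have sC := contDiffOn_hatCov N hF.smooth O.det_ne hH
  have sΓ := contDiffOn_hatChr N hF.smooth O.det_ne
  obtain ⟨g1, g2⟩ := O.hatChr_horizon hx h0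
  -- Antisymmetrising in the first two indices removes the Christoffel term that is symmetric in t
  -- and ρ.
  have e : ∀ y ∈ region ε U, hatCov (region ε U) F H 0 1 P.succ.succ y -
      hatCov (region ε U) F H 1 0 P.succ.succ y =
      hatD (region ε U) H 0 1 P.succ.succ y - hatD (region ε U) H 1 0 P.succ.succ y +
      ∑ l, (H 0 l y * hatChr (region ε U) F l 1 P.succ.succ y -
        H 1 l y * hatChr (region ε U) F l 0 P.succ.succ y) := by
    intro y hy
    simp only [hatCov, covA, hF.hatChr_symm hg hU hy _ 0 1, Finset.sum_add_distrib,
      Finset.sum_sub_distrib, mul_comm (H _ _ y)]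
    ring
  rw [← N.pd_sub (sC _ _ _) (sC _ _ _) 1 hx, N.pd_congr e 1 hx,
    N.pd_add (by fun_prop) (by fun_prop) 1 hx, N.pd_sub (sD _ _ _) (sD _ _ _) 1 hx,
    N.pd_sum _ (fun l _ => by fun_prop) 1 hx]
  have e2 : ∀ l, pd (region ε U) 1 (fun y => H 0 l y * hatChr (region ε U) F l 1 P.succ.succ y -
        H 1 l y * hatChr (region ε U) F l 0 P.succ.succ y) x =
      H 0 l x * pd (region ε U) 1 (hatChr (region ε U) F l 1 P.succ.succ) x -
        H 1 l x * pd (region ε U) 1 (hatChr (region ε U) F l 0 P.succ.succ) x := fun l => by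
    rw [N.pd_sub (by fun_prop) (by fun_prop) 1 hx,
      N.pd_mul_of_eq_zero (hH _ _) (sΓ _ _ _) 1 hx (g1.trd _ _ _),
      N.pd_mul_of_eq_zero (hH _ _) (sΓ _ _ _) 1 hx (g1.trd _ _ _)]
  simp only [e2]
  rw [sum_plane fun M => by rw [show H 0 M.succ.succ x = 0 from B.left x hx h0 false M,
    show H 1 M.succ.succ x = 0 from B.left x hx h0 true M]; ring]
  have c := hF.pd_hatChr_cross hg hU hκ hx h0 P
  have c00 := c false false
  have c01 := c false true
  have c10 := c true false
  have c11 := c true true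
  have p00 : H 0 0 x = _ := B.plane x hx h0 false false
  have p11 : H 1 1 x = _ := B.plane x hx h0 true true
  have k0 : pd (region ε U) 1 (H 0 P.succ.succ) x = _ := hF.pd_hatLie_zero hg hU v hx h0 P
  have k1 : pd (region ε U) 0 (pd (region ε U) 1 (H 1 P.succ.succ)) x = _ :=
    hF.pd_pd_hatLie_one hg hU v hκ hx h0 P
  simp only [planeIdx_true, planeIdx_false] at c00 c01 c10 c11
  simp only [Fintype.sum_bool, planeIdx_true, planeIdx_false, c00, c01, c10, c11,
    N.pd_hatD hH hx h0, p00, p11, wt_zero, wt_succ, planeH, symB, angPull]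
  have hκ2 := hκ.ne'
  -- The second-order part of η^M appears as 2 q ∂_t Z in both derivatives and cancels. The terms
  -- (2a + G) f cancel against the products of the plane components of £_η ḡ with the first-order
  -- Christoffel symbols.
  simp [k0, k1]
  field_simp
  ring

end BgHat

end LieSlopes

/-! ### The charge density at the horizon -/

section Density

variable {n : ℕ} {ε κ : ℝ} {U : Set (Fin n → ℝ)} {f : Fin n → (Fin n → ℝ) → ℝ}
  {q : Fin n → Fin n → (Fin n → ℝ) → ℝ}
  {F₁ G₁ H₁ J₁ F₂ G₂ H₂ J₂ : (Fin n → ℝ) → ℝ} {K₁ K₂ : (Fin n → ℝ) → (Fin n → ℝ)}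
  {ξ η : (Fin (n + 2) → ℝ) → (Fin (n + 2) → ℝ)} {a₁ a₂ : (Fin (n + 2) → ℝ) → ℝ}
  {d₁ d₂ g F : Fin (n + 2) → Fin (n + 2) → (Fin (n + 2) → ℝ) → ℝ} {x : Fin (n + 2) → ℝ}

namespace BgHat

variable (hF : BgHat ε U κ f q g F) (hg : IsHorizonBackground ε U κ f q g) (hU : IsOpen U)
  (hκ : 0 < κ) (v₁ : HatVec ε U F₁ G₁ H₁ J₁ K₁ ξ a₁ d₁) (v₂ : HatVec ε U F₂ G₂ H₂ J₂ K₂ η a₂ d₂)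

include hF hg hU hκ v₂

theorem crossTr_hatLie (hx : x ∈ region ε U) (h0 : x 1 = 0) :
    crossTr (fun α β => inv F α β x) (fun α β => hatLie (region ε U) η a₂ d₂ F α β x) =
      2 * divergence U q K₂ (ang x) :=
  (hF.orbitMetric hg hU hκ).crossTr_hatLie (hg.isCrossMetric hU) v₂
    (fun y hy hy0 => by simp only [hF.vMN y hy hy0, metricDet]) hx h0

include v₁

/-- The cross-section trace of £_η ḡ vanishes because K₂ is divergence-free, which leaves the
two-dimensional identity `preA_plane_background`. -/
theorem planeCharge_horizon (hdiv : ∀ σ ∈ U, divergence U q K₂ σ = 0) (hx : x ∈ region ε U)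
    (h0 : x 1 = 0) :
    planeCharge (region ε U) F (hatLie (region ε U) η a₂ d₂ F) d₁ ξ a₁ 0 1 x -
      planeCharge (region ε U) F (hatLie (region ε U) η a₂ d₂ F) d₁ ξ a₁ 1 0 x =
      (G₁ (ang x) * J₂ (ang x) - J₁ (ang x) * G₂ (ang x)) / κ ^ 2 := by
  have O := hF.orbitMetric hg hU hκ
  have B := hF.orbitPert hg hU v₂ hκ
  have hκ2 : κ ^ 2 ≠ 0 := (pow_pos hκ 2).ne'
  obtain ⟨i1, i2, -⟩ := O.inv_horizon hx h0
  obtain ⟨c1, c2⟩ := O.hatCov_horizon B hx h0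
  obtain ⟨g1, g2⟩ := O.hatChr_horizon hx h0
  have tr := hF.crossTr_hatLie hg hU hκ v₂ hx h0
  rw [hdiv _ hx.2.2, mul_zero] at tr
  have hv : ∀ b c, res2 (fun α ν => planeGrad (region ε U) F d₁ ξ a₁ α ν x) b c =
      d₁ (planeIdx n c) (planeIdx n b) x + ∑ e, (if c then symB (κ ^ 2 - 0 ^ 2) 0 0 b e
        else symB (2 * 0) 1 0 b e) * planePart ξ a₁ (planeIdx n e) x := fun b c => by
    rw [res2, planeGrad, sum_plane fun M => by rw [planePart_succ, mul_zero]]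
    simp only [← chrA_plane one_ne_zero hκ2, ← g2]
    rfl
  have key := fun b c => preA_plane i1 (B.blockDiag hx h0) c1
    (fun α ν => planeGrad (region ε U) F d₁ ξ a₁ α ν x) (fun α => planePart ξ a₁ α x) b c
  simp only [tr, i2, c2, B.res2_eq hx h0] at key
  rw [planeCharge, planeCharge, ← planeIdx_false, ← planeIdx_true, key, key]
  have fin := preA_plane_background hκ2 (a₂ x) (angPull J₂ x) (angPull G₂ x) (G₁ (ang x)) (J₁ (ang x))
    (a₁ x) (ξ x 0) (res2 fun α ν => planeGrad (region ε U) F d₁ ξ a₁ α ν x)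
    (fun e => planePart ξ a₁ (planeIdx n e) x)
    (by rw [hv]; simp [symB, planeIdx_false, planeIdx_true, v₁.d00 x hx h0])
    (by rw [hv]; simp [symB, planeIdx_false, planeIdx_true, v₁.d10 x hx h0])
    (by rw [hv]; simp [symB, planeIdx_false, planeIdx_true, v₁.d01 x hx h0])
    (by rw [hv]; simp [symB, planeIdx_false, planeIdx_true, v₁.d11 x hx h0])
    (by simp [planeIdx_false]) (by simp [planeIdx_true])
  rw [mul_zero, zero_mul, zero_mul, sub_zero, sub_zero, fin]
  simp only [angPull]

/-- Both the gradient of the cross-section part and the contraction of ∇h with it involve rescaled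
symbols with a cross-section index, which vanish on the horizon. At first order only these factors
are differentiated. -/
theorem crossCharge_horizon (hx : x ∈ region ε U) (h0 : x 1 = 0) (b c : Bool) :
    crossCharge (region ε U) F (hatLie (region ε U) η a₂ d₂ F) ξ (planeIdx n b) (planeIdx n c) x = 0 ∧
    pd (region ε U) 1 (crossCharge (region ε U) F (hatLie (region ε U) η a₂ d₂ F) ξ
      (planeIdx n b) (planeIdx n c)) x =
      ∑ e, gradCoeff (fun α β => inv F α β x) (fun α β => hatLie (region ε U) η a₂ d₂ F α β x)
          (planeIdx n b) (planeIdx n e) * ∑ P : Fin n, K₁ (ang x) P *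
          pd (region ε U) 1 (hatChr (region ε U) F (planeIdx n c) (planeIdx n e) P.succ.succ) x -
        ∑ l, ∑ e, planeI 1 0 (κ ^ 2) b l * planeI 1 0 (κ ^ 2) c e * ∑ P : Fin n, K₁ (ang x) P *
          pd (region ε U) 1 (hatCov (region ε U) F (hatLie (region ε U) η a₂ d₂ F)
            (planeIdx n l) (planeIdx n e) P.succ.succ) x := by
  have O := hF.orbitMetric hg hU hκ
  have N := O.nested
  have B := hF.orbitPert hg hU v₂ hκ
  have hH := B.smooth
  set H := hatLie (region ε U) η a₂ d₂ F with hHdef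
  have sI := contDiffOn_inv hF.smooth O.det_ne
  have sC := contDiffOn_hatCov N hF.smooth O.det_ne hH
  have sΓ := contDiffOn_hatChr N hF.smooth O.det_ne
  have sξ := contDiffOn_crossPart N v₁
  have sG := contDiffOn_crossGrad N hF.smooth O.det_ne v₁
  obtain ⟨i1, i2, -⟩ := O.inv_horizon hx h0
  obtain ⟨c1, c2⟩ := O.hatCov_horizon B hx h0
  obtain ⟨g1, g2⟩ := O.hatChr_horizon hx h0
  have zero : ∀ b, ∀ y, crossPart ξ (planeIdx n b) y = 0 := fun b y => by cases b <;> simp [planeIdx]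
  have sW : ∀ α, ContDiffOn ℝ ∞ (fun y => gradCoeff (fun α β => inv F α β y) (fun α β => H α β y)
      (planeIdx n b) α) (region ε U) := fun α => by unfold gradCoeff; fun_prop
  have e : crossCharge (region ε U) F H ξ (planeIdx n b) (planeIdx n c) = fun y =>
      ∑ α, gradCoeff (fun α β => inv F α β y) (fun α β => H α β y) (planeIdx n b) α *
        crossGrad (region ε U) F ξ α (planeIdx n c) y -
      ∑ l, ∑ β, inv F (planeIdx n b) l y * inv F (planeIdx n c) β y *
        ∑ α, hatCov (region ε U) F H l β α y * crossPart ξ α y := by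
    ext y
    exact preA_of_eq_zero (fun α β => inv F α β y) (fun α β => H α β y)
      (fun γ α β => hatCov (region ε U) F H γ α β y) (fun α ν => crossGrad (region ε U) F ξ α ν y)
      (ξ := fun α => crossPart ξ α y) (μ := planeIdx n b) (zero b y) _
  have z1 : ∀ α ν, crossGrad (region ε U) F ξ α ν x = 0 := fun α ν => by
    rw [crossGrad, sum_plane_add]; simp [zero, g1.trd]
  have z2 : ∀ l β, ∑ α, hatCov (region ε U) F H l β α x * crossPart ξ α x = 0 := fun l β => by
    rw [sum_plane_add]; simp [zero, c1.trd]
  have p1 : ∀ α ν, pd (region ε U) 1 (crossGrad (region ε U) F ξ α ν) x = ∑ P : Fin n, K₁ (ang x) P *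
      pd (region ε U) 1 (hatChr (region ε U) F ν α P.succ.succ) x := fun α ν => by
    have : ∀ y ∈ region ε U, crossGrad (region ε U) F ξ α ν y =
        ∑ P : Fin n, crossPart ξ P.succ.succ y * hatChr (region ε U) F ν α P.succ.succ y :=
      fun y _ => by
        rw [crossGrad, sum_plane_add]; simp [zero, mul_comm]
    rw [N.pd_congr this 1 hx, N.pd_sum _ (fun P _ => by fun_prop) 1 hx]
    refine Finset.sum_congr rfl fun P _ => ?_
    rw [N.pd_mul_of_eq_zero (sξ _) (sΓ _ _ _) 1 hx (g1.trd _ _ _), crossPart_succ, v₁.val_M x hx h0]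
  have p2 : ∀ l β, pd (region ε U) 1 (fun y => ∑ α, hatCov (region ε U) F H l β α y *
      crossPart ξ α y) x = ∑ P : Fin n, K₁ (ang x) P *
      pd (region ε U) 1 (hatCov (region ε U) F H l β P.succ.succ) x := fun l β => by
    have : ∀ y ∈ region ε U, ∑ α, hatCov (region ε U) F H l β α y * crossPart ξ α y =
        ∑ P : Fin n, crossPart ξ P.succ.succ y * hatCov (region ε U) F H l β P.succ.succ y :=
      fun y _ => by
        rw [sum_plane_add]; simp [zero, mul_comm]
    rw [N.pd_congr this 1 hx, N.pd_sum _ (fun P _ => by fun_prop) 1 hx]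
    refine Finset.sum_congr rfl fun P _ => ?_
    rw [N.pd_mul_of_eq_zero (sξ _) (sC _ _ _) 1 hx (c1.trd _ _ _), crossPart_succ, v₁.val_M x hx h0]
  refine ⟨?_, ?_⟩
  · rw [e]; simp [z1, z2]
  · rw [e, N.pd_sub (by fun_prop) (by fun_prop) 1 hx, N.pd_sum _ (fun α _ => by fun_prop) 1 hx,
      N.pd_sum _ (fun l _ => by fun_prop) 1 hx]
    have e1 : ∀ α, pd (region ε U) 1 (fun y => gradCoeff (fun α β => inv F α β y) (fun α β => H α β y)
        (planeIdx n b) α * crossGrad (region ε U) F ξ α (planeIdx n c) y) x = _ := fun α =>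
      N.pd_mul_of_eq_zero (sW α) (sG _ _) 1 hx (z1 _ _)
    have e2 : ∀ l, pd (region ε U) 1 (fun y => ∑ β, inv F (planeIdx n b) l y *
        inv F (planeIdx n c) β y * ∑ α, hatCov (region ε U) F H l β α y * crossPart ξ α y) x =
        ∑ β, inv F (planeIdx n b) l x * inv F (planeIdx n c) β x * ∑ P : Fin n, K₁ (ang x) P *
          pd (region ε U) 1 (hatCov (region ε U) F H l β P.succ.succ) x := fun l => by
      rw [N.pd_sum _ (fun β _ => by fun_prop) 1 hx]
      refine Finset.sum_congr rfl fun β _ => ?_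
      rw [N.pd_mul_of_eq_zero (by fun_prop) (by fun_prop) 1 hx (z2 l β), p2]
    simp only [e1, e2, p1]
    congr 1
    · exact sum_plane fun M => by rw [gradCoeff_right i1 (B.blockDiag hx h0), zero_mul]
    · rw [sum_plane fun M => by simp [i1.left]]
      refine Finset.sum_congr rfl fun l _ => ?_
      rw [sum_plane fun M => by simp [i1.left], ← i2]
      rfl

/-- The two Christoffel contributions, ±G₂ f · K₁ / κ², cancel, for which the vanishing
cross-section trace is needed. What remains is the antisymmetrised first-order part of ∇(£_η ḡ),
times the product 1/κ² of inverse metric components. -/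
theorem pd_crossCharge (hdiv : ∀ σ ∈ U, divergence U q K₂ σ = 0) (hx : x ∈ region ε U)
    (h0 : x 1 = 0) :
    pd (region ε U) 1 (crossCharge (region ε U) F (hatLie (region ε U) η a₂ d₂ F) ξ 0 1) x -
      pd (region ε U) 1 (crossCharge (region ε U) F (hatLie (region ε U) η a₂ d₂ F) ξ 1 0) x =
      (∑ P, K₁ (ang x) P * (pd U P J₂ (ang x) +
        2 * κ ^ 2 * (pd U P F₂ (ang x) + x 0 * pd U P G₂ (ang x)) -
        2 * ∑ Q, (K₂ (ang x) Q * pd U Q (f P) (ang x) +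
          f Q (ang x) * pd U P (fun σ => K₂ σ Q) (ang x)))) / κ ^ 2 := by
  have O := hF.orbitMetric hg hU hκ
  have B := hF.orbitPert hg hU v₂ hκ
  have hκ2 : κ ^ 2 ≠ 0 := (pow_pos hκ 2).ne'
  obtain ⟨i1, i2, -⟩ := O.inv_horizon hx h0
  have tr := hF.crossTr_hatLie hg hU hκ v₂ hx h0
  rw [hdiv _ hx.2.2, mul_zero] at tr
  have W := fun b e => gradCoeff_plane i1 (h := fun α β => hatLie (region ε U) η a₂ d₂ F α β x) b e
  simp only [tr, i2, B.res2_eq hx h0] at W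
  have k01 := (hF.crossCharge_horizon hg hU hκ v₁ v₂ hx h0 false true).2
  have k10 := (hF.crossCharge_horizon hg hU hκ v₁ v₂ hx h0 true false).2
  rw [planeIdx_false, planeIdx_true] at k01 k10
  have cov := fun P => hF.pd_hatCov_cross hg hU v₂ hκ hx h0 P
  simp only [v₂.pd_succ_t hU hx h0] at cov
  simp only [← cov]
  rw [k01, k10]
  have c := fun b e P => hF.pd_hatChr_cross hg hU hκ hx h0 P b e
  have s : ∀ r : ℝ, ∑ P, K₁ (ang x) P * (-f P (ang x) / r) =
      (∑ P, K₁ (ang x) P * -f P (ang x)) / r := fun r => by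
    rw [Finset.sum_div]; exact Finset.sum_congr rfl fun P _ => by ring
  have W00 := W false false
  have W01 := W false true
  have W10 := W true false
  have W11 := W true true
  have c00 := c false false
  have c01 := c false true
  have c10 := c true false
  have c11 := c true true
  simp only [planeIdx_false, planeIdx_true, if_true, if_false, Bool.false_eq_true] at W00 W01 W10 W11 c00 c01 c10 c11
  simp only [Fintype.sum_bool, planeIdx_false, planeIdx_true, W00, W01, W10, W11, c00, c01, c10, c11,
    mul_zero, Finset.sum_const_zero, s, mul_sub, Finset.sum_sub_distrib]
  simp only [gradCoeff, planeI, planeH, symB, Fintype.sum_bool, if_true, if_false, Bool.false_eq_true]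
  field_simp
  ring

end BgHat

end Density

/-! ### The divergence theorem on the cross-section -/

section DivergenceTheorem

variable {n : ℕ} {U C : Set (Fin n → ℝ)} {q : Fin n → Fin n → (Fin n → ℝ) → ℝ}

/-- The integral of a partial derivative of a compactly supported function vanishes. -/
theorem setIntegral_pd_eq_zero (hU : IsOpen U) (hC : IsCompact C) (hCU : C ⊆ U)
    {w : (Fin n → ℝ) → ℝ} (hw : ContDiffOn ℝ ∞ w U) (h0 : ∀ σ ∈ U, σ ∉ C → w σ = 0) (P : Fin n) :
    IntegrableOn (pd U P w) U ∧ ∫ σ in U, pd U P w σ = 0 := by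
  classical
  -- Extension by zero is smooth on the whole space because w vanishes on U outside C; then
  -- integration by parts against the constant 1 applies.
  set W : (Fin n → ℝ) → ℝ := U.indicator w with hW
  have zero : ∀ σ, σ ∉ C → W σ = 0 := fun σ hσ => by
    by_cases hU' : σ ∈ U
    · rw [hW, indicator_of_mem hU', h0 σ hU' hσ]
    · exact indicator_of_notMem hU' _
  have ez : ∀ σ, σ ∉ C → W =ᶠ[𝓝 σ] fun _ => 0 := fun σ hσ => by
    filter_upwards [hC.isClosed.isOpen_compl.mem_nhds hσ] with y hy using zero y hy
  have ew : ∀ σ ∈ U, W =ᶠ[𝓝 σ] w := fun σ hσ => by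
    filter_upwards [hU.mem_nhds hσ] with y hy using indicator_of_mem hy _
  have hs : ContDiff ℝ ∞ W := contDiff_iff_contDiffAt.2 fun σ => by
    by_cases hσ : σ ∈ U
    · exact (hw.contDiffAt (hU.mem_nhds hσ)).congr_of_eventuallyEq (ew σ hσ)
    · exact contDiffAt_const.congr_of_eventuallyEq (ez σ fun h => hσ (hCU h))
  have hd : ∀ σ ∈ U, pd U P w σ = fderiv ℝ W σ (Pi.single P 1) := fun σ hσ => by
    rw [pd, fderivWithin_of_isOpen hU hσ, (ew σ hσ).fderiv_eq]
  have hdz : ∀ σ, σ ∉ C → fderiv ℝ W σ (Pi.single P 1) = 0 := fun σ hσ => by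
    rw [(ez σ hσ).fderiv_eq]; simp
  have cW : HasCompactSupport W := HasCompactSupport.intro hC zero
  have cd : HasCompactSupport fun σ => fderiv ℝ W σ (Pi.single P 1) := HasCompactSupport.intro hC hdz
  have kd : Continuous fun σ => fderiv ℝ W σ (Pi.single P 1) :=
    (hs.continuous_fderiv (by simp)).clm_apply continuous_const
  have iW := hs.continuous.integrable_of_hasCompactSupport (μ := volume) cW
  have id := kd.integrable_of_hasCompactSupport (μ := volume) cd
  have key := integral_mul_fderiv_eq_neg_fderiv_mul_of_integrable (μ := volume) (f := fun _ => (1 : ℝ))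
    (g := W) (v := Pi.single P 1) (by simp) (by simpa using id) (by simpa using iW)
    (fun _ _ => differentiableAt_const _) fun σ _ => (hs.differentiable (by simp)) σ
  simp only [one_mul, fderiv_fun_const, Pi.zero_apply, zero_apply, zero_mul, integral_zero, neg_zero] at key
  refine ⟨(id.integrableOn (s := U)).congr_fun (fun σ hσ => (hd σ hσ).symm) hU.measurableSet, ?_⟩
  rw [setIntegral_congr_fun hU.measurableSet hd, setIntegral_eq_integral_of_forall_compl_eq_zero, key]
  exact fun σ hσ => hdz σ fun h => hσ (hCU h)

theorem IsCrossMetric.smooth_sqrt_det (hq : IsCrossMetric U q) :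
    ContDiffOn ℝ ∞ (fun σ => Real.sqrt (metricDet q σ)) U :=
  hq.smooth_det.sqrt fun σ hσ => (hq.pos σ hσ).ne'

/-- Integration by parts against a divergence-free vector field. -/
theorem IsCrossMetric.integral_divergence_free (hq : IsCrossMetric U q) (hC : IsCompact C)
    (hCU : C ⊆ U) {K : (Fin n → ℝ) → (Fin n → ℝ)} (hK : ∀ M, ContDiffOn ℝ ∞ (fun σ => K σ M) U)
    (hdiv : ∀ σ ∈ U, divergence U q K σ = 0) (hK0 : ∀ σ ∈ U, σ ∉ C → K σ = 0)
    {u : (Fin n → ℝ) → ℝ} (hu : ContDiffOn ℝ ∞ u U) :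
    IntegrableOn (fun σ => Real.sqrt (metricDet q σ) * ∑ P, K σ P * pd U P u σ) U ∧
      ∫ σ in U, Real.sqrt (metricDet q σ) * ∑ P, K σ P * pd U P u σ = 0 := by
  have hU := hq.isOpen
  set w : (Fin n → ℝ) → ℝ := fun σ => Real.sqrt (metricDet q σ) with hw
  have sw : ContDiffOn ℝ ∞ w U := hq.smooth_sqrt_det
  have ww : ∀ σ ∈ U, metricDet q σ = w σ * w σ := fun σ hσ =>
    (Real.mul_self_sqrt (hq.pos σ hσ).le).symm
  have w0 : ∀ σ ∈ U, w σ ≠ 0 := fun σ hσ => (Real.sqrt_pos.2 (hq.pos σ hσ)).ne'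
  have s := fun P => setIntegral_pd_eq_zero hU hC hCU (w := fun σ => w σ * K σ P * u σ)
    ((sw.mul (hK P)).mul hu) (fun σ hσ hσC => by simp [hK0 σ hσ hσC]) P
  -- With w = √(det q), vanishing divergence means ∂_P (w K^P) = 0, so the integrand is the total
  -- derivative ∂_P (w K^P u).
  have e : ∀ σ ∈ U, w σ * ∑ P, K σ P * pd U P u σ =
      ∑ P, pd U P (fun σ => w σ * K σ P * u σ) σ := by
    intro σ hσ
    have e1 := hq.det_mul_divergence (K := K) hσ
    rw [hdiv σ hσ, mul_zero] at e1
    have e2 : ∀ P, pd U P (metricDet q) σ = 2 * w σ * pd U P w σ := fun P => by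
      rw [pd_open_congr ww P hσ, pd_open_mul hU sw sw P hσ]; ring
    have e3 : ∑ P, (pd U P w σ * K σ P + w σ * pd U P (fun y => K y P) σ) = 0 := by
      refine mul_left_cancel₀ (mul_ne_zero two_ne_zero (w0 σ hσ)) ?_
      rw [mul_zero, e1, ww σ hσ, Finset.mul_sum, Finset.mul_sum, ← Finset.sum_add_distrib]
      refine Finset.sum_congr rfl fun P _ => ?_
      rw [e2]
      ring
    have e4 : ∀ P, pd U P (fun σ => w σ * K σ P * u σ) σ =
        (pd U P w σ * K σ P + w σ * pd U P (fun y => K y P) σ) * u σ +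
          w σ * (K σ P * pd U P u σ) := fun P => by
      rw [pd_open_mul hU (sw.mul (hK P)) hu P hσ, pd_open_mul hU sw (hK P) P hσ]
      ring
    simp only [e4]
    rw [Finset.sum_add_distrib, ← Finset.sum_mul, e3, zero_mul, zero_add, Finset.mul_sum]
  refine ⟨IntegrableOn.congr_fun (f := fun σ => ∑ P, pd U P (fun σ => w σ * K σ P * u σ) σ)
    (integrable_finsetSum _ fun P _ => (s P).1) (fun σ hσ => (e σ hσ).symm) hU.measurableSet, ?_⟩
  rw [setIntegral_congr_fun hU.measurableSet e, integral_finsetSum _ fun P _ => (s P).1]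
  exact Finset.sum_eq_zero fun P _ => (s P).2

end DivergenceTheorem

/-! ### The bracket of the charges -/

section Bracket

variable {n : ℕ} {ε κ GN : ℝ} {U C : Set (Fin n → ℝ)} {f : Fin n → (Fin n → ℝ) → ℝ}
  {q : Fin n → Fin n → (Fin n → ℝ) → ℝ}
  {F₁ G₁ H₁ J₁ F₂ G₂ H₂ J₂ : (Fin n → ℝ) → ℝ} {K₁ K₂ : (Fin n → ℝ) → (Fin n → ℝ)}
  {ξ η : (Fin (n + 2) → ℝ) → (Fin (n + 2) → ℝ)}
  {g : Fin (n + 2) → Fin (n + 2) → (Fin (n + 2) → ℝ) → ℝ} {x : Fin (n + 2) → ℝ}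

/-- The density of the bracket. -/
def bracketDensity (U : Set (Fin n → ℝ)) (f : Fin n → (Fin n → ℝ) → ℝ) (G₁ J₁ G₂ J₂ : (Fin n → ℝ) → ℝ)
    (K₁ K₂ : (Fin n → ℝ) → (Fin n → ℝ)) (σ : Fin n → ℝ) : ℝ :=
  (1 / 2) * (G₁ σ * J₂ σ - J₁ σ * G₂ σ) +
    ∑ M, ∑ N, (pd U M (f N) σ - pd U N (f M) σ) * K₁ σ M * K₂ σ N

/-- The function whose derivative along `K₁` is the part of the charge density that integrates to
zero. -/
def exactPart (κ t : ℝ) (f : Fin n → (Fin n → ℝ) → ℝ) (F₂ G₂ J₂ : (Fin n → ℝ) → ℝ)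
    (K₂ : (Fin n → ℝ) → (Fin n → ℝ)) (σ : Fin n → ℝ) : ℝ :=
  (1 / 2) * J₂ σ + κ ^ 2 * (F₂ σ + t * G₂ σ) - ∑ N, f N σ * K₂ σ N

theorem pd_open_const_mul (hU : IsOpen U) (c : ℝ) {F : (Fin n → ℝ) → ℝ} (hF : ContDiffOn ℝ ∞ F U)
    (M : Fin n) {σ : Fin n → ℝ} (hσ : σ ∈ U) : pd U M (fun y => c * F y) σ = c * pd U M F σ := by
  rw [pd_open_mul hU contDiffOn_const hF M hσ]
  simp [pd]

/-- The charge density extends smoothly to the horizon. -/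
theorem exists_chargeDensity (hg : IsHorizonBackground ε U κ f q g) (hU : IsOpen U) (hκ : 0 < κ)
    (GN : ℝ) (h₁ : HasForm ε U F₁ G₁ H₁ J₁ K₁ ξ) (h₂ : HasForm ε U F₂ G₂ H₂ J₂ K₂ η)
    (hdiv : ∀ σ ∈ U, divergence U q K₂ σ = 0) :
    ∃ B, ContDiffOn ℝ ∞ B (region ε U) ∧
      (∀ x ∈ region ε U, 0 < x 1 →
        chargeS GN (region ε U) g (lieDeriv (region ε U) η g) ξ 0 1 x = B x) ∧
      ∀ x ∈ region ε U, x 1 = 0 → B x = 1 / (8 * Real.pi * GN) *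
        (Real.sqrt (metricDet q (ang x)) / κ * bracketDensity U f G₁ J₁ G₂ J₂ K₁ K₂ (ang x) +
          κ⁻¹ * (Real.sqrt (metricDet q (ang x)) *
            ∑ P, K₁ (ang x) P * pd U P (exactPart κ (x 0) f F₂ G₂ J₂ K₂) (ang x))) := by
  obtain ⟨F, hF⟩ := hg.exists_bgHat hU
  have j₁ := h₁.jetForm hU
  have j₂ := h₂.jetForm hU
  obtain ⟨a₁, d₁, v₁⟩ := j₁.exists_hatVec hU
  obtain ⟨a₂, d₂, v₂⟩ := j₂.exists_hatVec hU
  have O := hF.orbitMetric hg hU hκ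
  have N := O.nested
  have L := hF.toHat.lieDeriv N v₂
  set H := hatLie (region ε U) η a₂ d₂ F with hH
  have sp := contDiffOn_planeCharge N hF.smooth O.det_ne L.smooth v₁
  have sc := contDiffOn_crossCharge N hF.smooth O.det_ne L.smooth v₁
  -- The cross-section charge divided by ρ, extended to the horizon by its ρ-derivative.
  obtain ⟨m, hm, hme, hm0⟩ := N.exists_div ((sc 0 1).sub (sc 1 0)) fun x hx h0 => by
    have e1 := (hF.crossCharge_horizon hg hU hκ v₁ v₂ hx h0 false true).1
    have e2 := (hF.crossCharge_horizon hg hU hκ v₁ v₂ hx h0 true false).1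
    rw [planeIdx_false, planeIdx_true] at e1 e2
    rw [e1, e2, sub_zero]
  have sd : ContDiffOn ℝ ∞ (fun x => Real.sqrt (-metricDet F x)) (region ε U) :=
    ContDiffOn.sqrt (contDiffOn_det hF.smooth).neg fun x hx => neg_ne_zero.2 (O.det_ne x hx)
  refine ⟨fun x => Real.sqrt (-metricDet F x) / (8 * Real.pi * GN) * ((1 / 2) *
      ((planeCharge (region ε U) F H d₁ ξ a₁ 0 1 x - planeCharge (region ε U) F H d₁ ξ a₁ 1 0 x) +
        m x)), ?_, fun x hx h1 => ?_, fun x hx h0 => ?_⟩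
  · exact (sd.div_const _).mul (contDiffOn_const.mul (((sp 0 1).sub (sp 1 0)).add hm))
  · rw [hF.toHat.chargeS_eq L N v₁ hx h1, hme x hx, inv_mul_cancel_left₀ h1.ne']
  · have hσ : ang x ∈ U := hx.2.2
    have e1 := N.pd_sub (sc 0 1) (sc 1 0) 1 hx
    have e2 := hF.planeCharge_horizon hg hU hκ v₁ v₂ hdiv hx h0
    have e3 := hF.pd_crossCharge hg hU hκ v₁ v₂ hdiv hx h0
    have e4 : ∀ P, pd U P (exactPart κ (x 0) f F₂ G₂ J₂ K₂) (ang x) =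
        (1 / 2) * pd U P J₂ (ang x) + κ ^ 2 * (pd U P F₂ (ang x) + x 0 * pd U P G₂ (ang x)) -
          ∑ Q, (pd U P (f Q) (ang x) * K₂ (ang x) Q +
            f Q (ang x) * pd U P (fun σ => K₂ σ Q) (ang x)) := fun P => by
      have sf := hg.smooth_f
      have k1 := j₂.smooth_F
      have k2 := j₂.smooth_G
      have k3 := j₂.smooth_J
      have k4 := j₂.smooth_K
      have : exactPart κ (x 0) f F₂ G₂ J₂ K₂ = fun σ => ((1 / 2) * J₂ σ +
        κ ^ 2 * (F₂ σ + x 0 * G₂ σ)) - ∑ N, f N σ * K₂ σ N := rfl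
      rw [this, pd_open_sub hU (by fun_prop) (by fun_prop) P hσ,
        pd_open_add hU (by fun_prop) (by fun_prop) P hσ, pd_open_const_mul hU _ k3 P hσ,
        pd_open_const_mul hU _ (by fun_prop) P hσ, pd_open_add hU k1 (by fun_prop) P hσ,
        pd_open_const_mul hU _ k2 P hσ, pd_open_sum hU _ (fun Q _ => by fun_prop) P hσ]
      simp only [pd_open_mul hU (sf _) (k4 _) P hσ]
    beta_reduce
    rw [(hm0 x hx h0).trans e1, e2, e3, hF.metricDet_horizon hx h0, neg_neg, Real.sqrt_mul (sq_nonneg κ), Real.sqrt_sq hκ.le]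
    have e5 : bracketDensity U f G₁ J₁ G₂ J₂ K₁ K₂ (ang x) = (1 / 2) *
        (G₁ (ang x) * J₂ (ang x) - J₁ (ang x) * G₂ (ang x)) + ∑ P, K₁ (ang x) P *
          (∑ Q, pd U P (f Q) (ang x) * K₂ (ang x) Q - ∑ Q, K₂ (ang x) Q * pd U Q (f P) (ang x)) := by
      rw [bracketDensity]
      congr 1
      refine Finset.sum_congr rfl fun P _ => ?_
      rw [← Finset.sum_sub_distrib, Finset.mul_sum]
      exact Finset.sum_congr rfl fun Q _ => by ring
    -- Cartan's formula £_{K₂} f = i_{K₂} df + d(f · K₂): the first term gives the curl of f, and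
    -- the second joins the gradients of J₂, F₂ and tG₂ in the exact part.
    have e6 : (1 / 2) * ∑ P, K₁ (ang x) P * (pd U P J₂ (ang x) +
        2 * κ ^ 2 * (pd U P F₂ (ang x) + x 0 * pd U P G₂ (ang x)) -
        2 * ∑ Q, (K₂ (ang x) Q * pd U Q (f P) (ang x) +
          f Q (ang x) * pd U P (fun σ => K₂ σ Q) (ang x))) =
        ∑ P, K₁ (ang x) P * (∑ Q, pd U P (f Q) (ang x) * K₂ (ang x) Q -
          ∑ Q, K₂ (ang x) Q * pd U Q (f P) (ang x)) +
        ∑ P, K₁ (ang x) P * pd U P (exactPart κ (x 0) f F₂ G₂ J₂ K₂) (ang x) := by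
      rw [← Finset.sum_add_distrib, Finset.mul_sum]
      refine Finset.sum_congr rfl fun P _ => ?_
      rw [e4, Finset.sum_add_distrib, Finset.sum_add_distrib]
      ring
    rw [e5]
    have hκ0 := hκ.ne'
    set S₁ := ∑ P, K₁ (ang x) P * (pd U P J₂ (ang x) +
        2 * κ ^ 2 * (pd U P F₂ (ang x) + x 0 * pd U P G₂ (ang x)) -
        2 * ∑ Q, (K₂ (ang x) Q * pd U Q (f P) (ang x) +
          f Q (ang x) * pd U P (fun σ => K₂ σ Q) (ang x)))
    set S₂ := ∑ P, K₁ (ang x) P * pd U P (exactPart κ (x 0) f F₂ G₂ J₂ K₂) (ang x)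
    set S₃ := ∑ P, K₁ (ang x) P * (∑ Q, pd U P (f Q) (ang x) * K₂ (ang x) Q -
          ∑ Q, K₂ (ang x) Q * pd U Q (f P) (ang x))
    have e7 : S₁ = 2 * (S₃ + S₂) := by linarith
    rw [e7, div_eq_mul_inv _ (8 * Real.pi * GN), one_div (8 * Real.pi * GN)]
    field_simp
    ring

end Bracket

/-! ### Compactly supported fields -/

section CompactSupport

variable {n : ℕ} {ε κ GN : ℝ} {U C : Set (Fin n → ℝ)} {f : Fin n → (Fin n → ℝ) → ℝ}
  {q : Fin n → Fin n → (Fin n → ℝ) → ℝ}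
  {F₁ G₁ H₁ J₁ F₂ G₂ H₂ J₂ : (Fin n → ℝ) → ℝ} {K₁ K₂ : (Fin n → ℝ) → (Fin n → ℝ)}
  {ξ η : (Fin (n + 2) → ℝ) → (Fin (n + 2) → ℝ)}
  {g : Fin (n + 2) → Fin (n + 2) → (Fin (n + 2) → ℝ) → ℝ} {x : Fin (n + 2) → ℝ}

section Zero

variable (hU : IsOpen U) (hC : IsCompact C) (h : ∀ x ∈ region ε U, ang x ∉ C → ξ x = 0)
  (hx : x ∈ region ε U) (hxC : ang x ∉ C)

include hU hC h hx hxC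

theorem pd_eq_zero_of_notMem (μ ν : Fin (n + 2)) : pd (region ε U) μ (fun y => ξ y ν) x = 0 := by
  have hs := halfOpen_region (ε := ε) hU
  have N : Nested (region ε U) (region ε U ∩ ang ⁻¹' Cᶜ) :=
    ⟨hs, hs.inter_open (hC.isClosed.isOpen_compl.preimage continuous_ang), inter_subset_left⟩
  rw [N.pd_congr (g := fun _ => 0) (fun y hy => by rw [h y hy.1 hy.2]; rfl) μ ⟨hx, hxC⟩]
  simp [pd]

theorem chargeS_eq_zero_of_notMem (k : Fin (n + 2) → Fin (n + 2) → (Fin (n + 2) → ℝ) → ℝ)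
    (μ ν : Fin (n + 2)) : chargeS GN (region ε U) g k ξ μ ν x = 0 := by
  simp [chargeS, preS, covV, h x hx hxC, pd_eq_zero_of_notMem hU hC h hx hxC]

end Zero

/-- The coefficients of a compactly supported vector field vanish outside the support. -/
theorem HasForm.eq_zero_of_notMem (h₁ : HasForm ε U F₁ G₁ H₁ J₁ K₁ ξ) (hU : IsOpen U) (hε : 0 < ε)
    (hC : IsCompact C) (h : ∀ x ∈ region ε U, ang x ∉ C → ξ x = 0) {σ : Fin n → ℝ} (hσ : σ ∈ U)
    (hσC : σ ∉ C) : G₁ σ = 0 ∧ J₁ σ = 0 ∧ K₁ σ = 0 := by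
  have j := h₁.jetForm hU
  have mem := fun t => pt_mem_region (U := U) hε t hσ
  have t := fun t => (j.val_t _ (mem t) rfl).symm
  have r := fun t => (j.der_ρ _ (mem t) rfl).symm
  simp only [h _ (mem _) hσC, pd_eq_zero_of_notMem hU hC h (mem _) hσC, ang_pt, pt_zero, Pi.zero_apply]
    at t r
  refine ⟨?_, ?_, funext fun M => ?_⟩
  -- The identity F + tG = 0 holds for every t; evaluating it at t = 0 and t = 1 isolates G.
  · linarith [t 0, t 1]
  · linarith [r 0, r 1]
  · rw [← ang_pt 0 0 σ, ← j.val_M _ (mem 0) rfl M, h _ (mem 0) hσC]; rfl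

/-- The bracket of the charges at the background. -/
theorem hasBracket (hg : IsHorizonBackground ε U κ f q g) (hU : IsOpen U) (hε : 0 < ε) (hκ : 0 < κ)
    (GN : ℝ) (h₁ : HasForm ε U F₁ G₁ H₁ J₁ K₁ ξ) (hdiv₁ : ∀ σ ∈ U, divergence U q K₁ σ = 0)
    (h₂ : HasForm ε U F₂ G₂ H₂ J₂ K₂ η) (hdiv₂ : ∀ σ ∈ U, divergence U q K₂ σ = 0)
    (hξ : CompactlySupported ε U ξ) (t : ℝ) :
    HasBracket GN ε U g t ξ η (1 / (8 * Real.pi * GN) *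
      ∫ σ in U, Real.sqrt (metricDet q σ) / κ * bracketDensity U f G₁ J₁ G₂ J₂ K₁ K₂ σ) := by
  obtain ⟨C, hC, hCU, hsupp⟩ := hξ
  have hq := hg.isCrossMetric hU
  have j₁ := h₁.jetForm hU
  have j₂ := h₂.jetForm hU
  obtain ⟨B, hB, hBe, hB0⟩ := exists_chargeDensity hg hU hκ GN h₁ h₂ hdiv₂
  have zero := fun σ hσ hσC => h₁.eq_zero_of_notMem hU hε hC hsupp (σ := σ) hσ hσC
  have key := hasBoundaryIntegral_of_continuousOn hC t (halfOpen_region hU)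
    (fun σ hσ => pt_mem_region hε t (hCU hσ)) hB.continuousOn hBe
  have sf := hg.smooth_f
  have s1 := j₁.smooth_G
  have s2 := j₁.smooth_J
  have s3 := j₁.smooth_K
  have k0 := j₂.smooth_F
  have k1 := j₂.smooth_G
  have k2 := j₂.smooth_J
  have k3 := j₂.smooth_K
  have sdf := fun M N => contDiffOn_pd_of_isOpen hU (sf N) M
  have sw := hq.smooth_sqrt_det
  have su : ContDiffOn ℝ ∞ (exactPart κ t f F₂ G₂ J₂ K₂) U := by
    unfold exactPart; fun_prop
  have sb : ContDiffOn ℝ ∞ (bracketDensity U f G₁ J₁ G₂ J₂ K₁ K₂) U := by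
    unfold bracketDensity; fun_prop
  have im : IntegrableOn (fun σ => Real.sqrt (metricDet q σ) / κ *
      bracketDensity U f G₁ J₁ G₂ J₂ K₁ K₂ σ) C :=
    (((sw.div_const κ).mul sb).continuousOn.mono hCU).integrableOn_compact hC
  -- The exact part contains all of the explicit t-dependence. It integrates to zero by the
  -- divergence theorem for K₁, so the bracket is the same on every cross-section.
  obtain ⟨ie, he⟩ := hq.integral_divergence_free hC hCU s3 hdiv₁ (fun σ hσ hσC => (zero σ hσ hσC).2.2) su
  have val : ∫ σ in C, B (pt t 0 σ) = 1 / (8 * Real.pi * GN) *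
      ∫ σ in U, Real.sqrt (metricDet q σ) / κ * bracketDensity U f G₁ J₁ G₂ J₂ K₁ K₂ σ := by
    rw [setIntegral_congr_fun hC.measurableSet
      fun σ hσ => hB0 (pt t 0 σ) (pt_mem_region hε t (hCU hσ)) rfl]
    simp only [ang_pt, pt_zero]
    have e1 := setIntegral_eq_of_subset_of_forall_sdiff_eq_zero (μ := volume) (f := fun σ =>
      Real.sqrt (metricDet q σ) / κ * bracketDensity U f G₁ J₁ G₂ J₂ K₁ K₂ σ) hU.measurableSet hCU
      fun σ hσ => by
        obtain ⟨z1, z2, z3⟩ := zero σ hσ.1 hσ.2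
        simp [bracketDensity, z1, z2, z3]
    have e2 := setIntegral_eq_of_subset_of_forall_sdiff_eq_zero (μ := volume) (f := fun σ =>
      Real.sqrt (metricDet q σ) * ∑ P, K₁ σ P * pd U P (exactPart κ t f F₂ G₂ J₂ K₂) σ)
      hU.measurableSet hCU fun σ hσ => by simp [(zero σ hσ.1 hσ.2).2.2]
    rw [integral_const_mul, integral_add im ((ie.mono_set hCU).const_mul _), integral_const_mul,
      ← e1, ← e2, he, mul_zero, add_zero]
  rw [val] at key
  have out : ∀ᶠ ρ in 𝓝[>] (0 : ℝ), ∀ σ ∈ U, σ ∉ C →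
      chargeS GN (region ε U) g (lieDeriv (region ε U) η g) ξ 0 1 (pt t ρ σ) = 0 := by
    filter_upwards [Ioo_mem_nhdsGT hε] with ρ hρ σ hσ hσC
    exact chargeS_eq_zero_of_notMem hU hC hsupp (show pt t ρ σ ∈ region ε U from ⟨hρ.1.le, hρ.2, hσ⟩) hσC _ 0 1
  refine ⟨?_, key.2.congr' ?_⟩
  · filter_upwards [key.1, out] with ρ h1 h2
    exact h1.of_forall_sdiff_eq_zero hU.measurableSet fun σ hσ => h2 σ hσ.1 hσ.2
  · filter_upwards [out] with ρ h2
    exact (setIntegral_eq_of_subset_of_forall_sdiff_eq_zero hU.measurableSet hCU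
      fun σ hσ => h2 σ hσ.1 hσ.2).symm

/-- The charges are non-trivial. -/
theorem exists_bracket_ne_zero (hg : IsHorizonBackground ε U κ f q g) (hU : IsOpen U)
    (hUne : U.Nonempty) (hε : 0 < ε) (hκ : 0 < κ) (hGN : 0 < GN) :
    ∃ ξ ∈ algA ε U q, ∃ η ∈ algA ε U q,
      CompactlySupported ε U ξ ∧ CompactlySupported ε U η ∧
      ∃ L : ℝ, L ≠ 0 ∧ ∀ t : ℝ, HasBracket GN ε U g t ξ η L := by
  obtain ⟨τ, hτ⟩ := hUne
  have hq := hg.isCrossMetric hU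
  obtain ⟨b, hbU, hbc, hb, hbr, hbτ⟩ := exists_contDiff_tsupport_subset (n := ⊤) (hU.mem_nhds hτ)
  have b0 : ∀ σ, 0 ≤ b σ := fun σ => (hbr (mem_range_self σ)).1
  have z0 : ContDiffOn ℝ ∞ (fun _ : Fin n → ℝ => (0 : ℝ)) U := contDiffOn_const
  -- One field has only G = b and the other only J = b, with K = 0. The density is then a positive
  -- multiple of b², so the integral is positive.
  have h₁ : HasForm ε U (fun _ => 0) b (fun _ => 0) (fun _ => 0) (fun _ => 0) _ :=
    hasForm_fieldOf z0 hb.contDiffOn z0 z0 contDiffOn_const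
  have h₂ : HasForm ε U (fun _ => 0) (fun _ => 0) (fun _ => 0) b (fun _ => 0) _ :=
    hasForm_fieldOf z0 z0 z0 hb.contDiffOn contDiffOn_const
  have hdiv : ∀ σ ∈ U, divergence U q (fun _ => 0) σ = 0 := fun σ hσ => by
    rw [hq.divergence_eq hσ]; simp [pd]
  have hz : ∀ σ, σ ∉ tsupport b → b σ = 0 := fun σ hσ => image_eq_zero_of_notMem_tsupport hσ
  have hc₁ : CompactlySupported ε U (fieldOf (fun _ => 0) b (fun _ => 0) (fun _ => 0) fun _ => 0) :=
    ⟨_, hbc, hbU, fun x _ hx => funext (index_cases (by simp [fieldOf, hz _ hx])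
      (by simp [fieldOf]) fun M => by simp [fieldOf])⟩
  have hc₂ : CompactlySupported ε U (fieldOf (fun _ => 0) (fun _ => 0) (fun _ => 0) b fun _ => 0) :=
    ⟨_, hbc, hbU, fun x _ hx => funext (index_cases (by simp [fieldOf])
      (by simp [fieldOf, hz _ hx]) fun M => by simp [fieldOf])⟩
  refine ⟨_, ⟨_, _, _, _, _, h₁, hdiv⟩, _, ⟨_, _, _, _, _, h₂, hdiv⟩, hc₁, hc₂, _, ?_,
    fun t => hasBracket hg hU hε hκ GN h₁ hdiv h₂ hdiv hc₁ t⟩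
  set u : (Fin n → ℝ) → ℝ := fun σ => Real.sqrt (metricDet q σ) / κ *
    bracketDensity U f b (fun _ => 0) (fun _ => 0) b (fun _ => 0) (fun _ => 0) σ with hu
  have ue : u = fun σ => Real.sqrt (metricDet q σ) / κ * ((1 / 2) * (b σ * b σ)) := by
    ext σ; simp [hu, bracketDensity]
  have su : ContinuousOn u U := by
    rw [ue]
    exact ((hq.smooth_sqrt_det.div_const κ).mul
      (contDiffOn_const.mul (hb.contDiffOn.mul hb.contDiffOn))).continuousOn
  have u0 : ∀ σ, 0 ≤ u σ := fun σ => by rw [ue]; have := b0 σ; positivity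
  have iu : IntegrableOn u U := by
    refine ((su.mono hbU).integrableOn_compact hbc.isCompact).of_forall_sdiff_eq_zero hU.measurableSet
      fun σ hσ => ?_
    rw [ue]; simp [hz σ hσ.2]
  have pos : 0 < ∫ σ in U, u σ := by
    rw [setIntegral_pos_iff_support_of_nonneg_ae (Eventually.of_forall u0) iu]
    have ho : IsOpen (U ∩ u ⁻¹' {0}ᶜ) := su.isOpen_inter_preimage hU isOpen_compl_singleton
    have hne : (U ∩ u ⁻¹' {0}ᶜ).Nonempty := by
      refine ⟨τ, hτ, ?_⟩
      have h1 : Real.sqrt (metricDet q τ) ≠ 0 := (Real.sqrt_pos.2 (hq.pos τ hτ)).ne'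
      have h2 := hκ.ne'
      simp [ue, hbτ, h1, h2]
    refine (ho.measure_pos volume hne).trans_le (measure_mono fun σ hσ => ⟨hσ.2, hσ.1⟩)
  exact mul_ne_zero (by positivity) pos.ne'

end CompactSupport

end KillingHorizon

end

/-! ### Assembly of the theorem -/

theorem mainTheorem2 (n : ℕ) (hn : 1 ≤ n) (ε κ cosm GN : ℝ) (hε : 0 < ε) (hκ : 0 < κ)
    (hGN : 0 < GN) (U : Set (Fin n → ℝ)) (hU : IsOpen U) (hUne : U.Nonempty)
    (f : Fin n → (Fin n → ℝ) → ℝ) (q : Fin n → Fin n → (Fin n → ℝ) → ℝ)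
    (gbar : Fin (n + 2) → Fin (n + 2) → (Fin (n + 2) → ℝ) → ℝ)
    (hbg : IsHorizonBackground ε U κ f q gbar)
    (hEinstein : ∀ x ∈ region ε U, 0 < x 1 → ∀ μ ν, einstein (region ε U) cosm gbar μ ν x = 0) :
    -- both sets of vector fields are closed Lie algebras
    IsLieClosed (region ε U) (algA' ε U) ∧
    IsLieClosed (region ε U) (algA ε U q) ∧
    -- the larger algebra has a bounded current, but fails the condition that its `ρ`-component
    -- be `O(ρ)`
    (∀ η ∈ algA' ε U, ∀ ξ ∈ algA' ε U, ∀ μ, BigO U 0 (bgCurrent GN ε U gbar η ξ μ)) ∧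
    (∃ η ∈ algA' ε U, ∃ ξ ∈ algA' ε U, ¬ BigO U 1 (bgCurrent GN ε U gbar η ξ 1)) ∧
    -- for the divergence-free algebra the `t`-, `ρ`- and `M`-components of the current are
    -- `O(1)`, `O(ρ)` and `O(1)`
    (∀ η ∈ algA ε U q, ∀ ξ ∈ algA ε U q,
      BigO U 0 (bgCurrent GN ε U gbar η ξ 0) ∧ BigO U 1 (bgCurrent GN ε U gbar η ξ 1) ∧
      ∀ M : Fin n, BigO U 0 (bgCurrent GN ε U gbar η ξ M.succ.succ)) ∧
    -- its charges are integrable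
    IntegrableCharges GN ε U gbar (algA ε U q) ∧
    -- the bracket of its charges at the background
    (∀ (F₁ G₁ H₁ J₁ F₂ G₂ H₂ J₂ : (Fin n → ℝ) → ℝ) (K₁ K₂ : (Fin n → ℝ) → (Fin n → ℝ))
        (ξ η : (Fin (n + 2) → ℝ) → (Fin (n + 2) → ℝ)),
      HasForm ε U F₁ G₁ H₁ J₁ K₁ ξ → (∀ σ ∈ U, divergence U q K₁ σ = 0) →
      HasForm ε U F₂ G₂ H₂ J₂ K₂ η → (∀ σ ∈ U, divergence U q K₂ σ = 0) →
      CompactlySupported ε U ξ → CompactlySupported ε U η →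
      ∀ t : ℝ, HasBracket GN ε U gbar t ξ η
        (1 / (8 * Real.pi * GN) * ∫ σ in U, Real.sqrt (metricDet q σ) / κ *
          ((1 / 2) * (G₁ σ * J₂ σ - J₁ σ * G₂ σ) +
            ∑ M, ∑ N, (pd U M (f N) σ - pd U N (f M) σ) * K₁ σ M * K₂ σ N))) ∧
    -- the charges are non-trivial
    (∃ ξ ∈ algA ε U q, ∃ η ∈ algA ε U q,
      CompactlySupported ε U ξ ∧ CompactlySupported ε U η ∧
      ∃ L : ℝ, L ≠ 0 ∧ ∀ t : ℝ, HasBracket GN ε U gbar t ξ η L) := by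
  have hq := hbg.isCrossMetric hU
  refine ⟨isLieClosed_algA' hU, isLieClosed_algA hq,
    fun η hη ξ hξ μ => bgCurrent_bigO hbg hU hε hκ hη hξ μ,
    exists_not_bigO hn hbg hU hUne hε hκ hGN, fun η hη ξ hξ => ?_, integrableCharges hbg hU hκ,
    fun F₁ G₁ H₁ J₁ F₂ G₂ H₂ J₂ K₁ K₂ ξ η h₁ hd₁ h₂ hd₂ hc₁ _ t =>
      hasBracket hbg hU hε hκ GN h₁ hd₁ h₂ hd₂ hc₁ t,
    exists_bracket_ne_zero hbg hU hUne hε hκ hGN⟩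
  have hη' := algA_subset hη
  have hξ' := algA_subset hξ
  exact ⟨bgCurrent_bigO hbg hU hε hκ hη' hξ' 0, bgCurrent_bigO_one hbg hU hε hκ hη hξ,
    fun M => bgCurrent_bigO hbg hU hε hκ hη' hξ' M.succ.succ⟩
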